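/- Let $\Bbbk$ be an algebraically closed field of characteristic zero, $q\in\Bbbk$ a primitive $7$th root of unity, and $$\mathfrak q_d=(q_{ij})_{i,j\in\{1,2\}}=\begin{pmatrix} q&q^3\\ q&q^3\end{pmatrix}.$$ Let $H$ be a cosemisimple Hopf algebra over $\Bbbk$ with a principal realization of the braided vector space $V=\langle x_1,x_2\rangle$ with braiding matrix $\mathfrak q_d$: group-likes $g_1,g_2$, central in the group $G(H)$, and algebra maps $\chi_1,\chi_2:H\to\Bbbk$ with $\chi_j(g_i)=q_{ij}$ and $h_{(1)}\chi_i(h_{(2)})\,g_i=g_i\,\chi_i(h_{(1)})h_{(2)}$ for $h\in H$, so that $V\in{}^H_H\mathcal{YD}$ with $h\cdot x_i=\chi_i(h)x_i$ and coaction $x_i\mapsto g_i\otimes x_i$. For $\alpha=a\alpha_1+b\alpha_2$ put $g_\alpha=g_1^ag_2^b$, $\chi_\alpha=\chi_1^a\chi_2^b$ (convolution), and $[u,v]_c=uv-q_{\alpha\beta}\,vu$ for $u,v$ of degrees $\alpha,\beta$, where $(\alpha,\beta)\mapsto q_{\alpha\beta}$ is the bicharacter extending $(q_{ij})$. For letters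 $z_1,z_2$ of degrees $\alpha_1,\alpha_2$ put $$z_{12}=[z_1,z_2]_c,\quad z_{112}=[z_1,z_{12}]_c,\quad z_{1112}=[z_1,z_{112}]_c,\quad z_{11112}=[z_1,z_{1112}]_c,\quad z_\beta=[z_{112},z_{12}]_c .$$ Let $\Delta_+=\{1,1112,112,\beta,12,2\}$ be the positive roots of type $G_2$, of degrees $\alpha_1,\ 3\alpha_1+\alpha_2,\ 2\alpha_1+\alpha_2,\ 3\alpha_1+2\alpha_2,\ \alpha_1+\alpha_2,\ \alpha_2$. Let $\lambda=(\lambda_1,\lambda_2)\in\Bbbk^2$ satisfy: $\lambda_1=0$ if $g_1^4g_2=1$ or $\chi_1^4\chi_2\ne\varepsilon$; $\lambda_2=0$ if $g_1g_2^2=1$ or $\chi_1\chi_2^2\neq\varepsilon$. Set $$\mathcal E(\lambda)=\Bbbk\langle y_1,y_2\mid y_{11112}=\lambda_1,\ [y_{12},y_2]_c=\lambda_2\rangle,\qquad \mathcal A(\lambda)=\mathcal E(\lambda)\# H,$$ where $h\cdot y_i=\chi_i(h)y_i$, and let $\mathcal H'=\mathcal E(0,0)\#H$, whose generators are written $x_1,x_2$,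 with its Hopf algebra structure $\Delta(x_i)=x_i\otimes1+g_i\otimes x_i$, $\Delta|_H=\Delta_H$. Let $\rho:\mathcal A(\lambda)\to\mathcal A(\lambda)\otimes\mathcal H'$ be the algebra map with $\rho(y_i)=y_i\otimes 1+g_i\otimes x_i$ and $\rho|_H=\Delta_H$. A *section* is a unital, $H$-bilinear, right $\mathcal H'$-colinear, convolution-invertible linear map $\gamma:\mathcal H'\to\mathcal A(\lambda)$ such that $\gamma(x_\alpha^7)\in\mathcal E(\lambda)$ for all $\alpha\in\Delta_+$. Let $\mathcal R$ be the set of all $\mu=(\mu_\alpha)_{\alpha\in\Delta_+}$ in $\Bbbk^{\Delta_+}$ with $\mu_\alpha=0$ whenever $g_\alpha^7=1$ or $\chi_\alpha^7\neq\varepsilon$. Given a section $\gamma$ and $\mu\in\mathcal R$, set $$\mathcal E(\lambda,\mu)=\mathcal E(\lambda)/\langle\gamma(x_\alpha^7)-\mu_\alpha:\alpha\in\Delta_+\rangle,\qquad \mathcal A(\lambda,\mu)=\mathcal E(\lambda,\mu)\#H .$$ **Proposition.** For every such $\lambda$ there is a section $\gamma:\mathcal H'\to\mathcal A(\lambda)$,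 depending only on $\lambda$, such that for every $\mu\in\mathcal R$ the $H$-action on $\mathcal E(\lambda)$ descends to $\mathcal E(\lambda,\mu)$ and $\mathcal A(\lambda,\mu)$ is isomorphic, by an algebra isomorphism which is compatible with $y_1,y_2$ and with the maps from $H$, to the quotient of $T(V)\#H$ (the generators of $T(V)$ being written $y_1,y_2$) by the two-sided ideal generated by the relations \begin{align*} &y_{11112}=\lambda_1;\qquad [y_{12},y_2]_c=\lambda_2;\qquad y_1^7=\mu_1;\qquad y_2^7=\mu_2;\qquad y_{12}^7=\mu_{12};\qquad y_{1112}^7=\mu_{1112};\\ &y_{112}^7=\mu_{112}-(8q+9q^2+3q^3+4q^4+5q^5-q^6)\lambda_1^2\,y_{12}^3y_\beta-(5q+8q^2+9q^3+8q^4+5q^5)\lambda_1^2\,y_2y_\beta^2\\ &\qquad\quad+7q^3(1+2q+q^2)\lambda_1^3\,y_2^2y_{12}^2-(2q+4q^2+13q^3+22q^4+17q^5+5q^6)\lambda_2\lambda_1^3\,y_2y_{12};\\ &y_\beta^7=\mu_\beta+(210q+224q^2+238q^3+105q^4+462q^5+231q^6)\lambda_2^2\lambda_1^3\,y_{12}^7\\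 &\qquad\quad+(833q+1911q^2+2352q^3+1911q^4+833q^5)\lambda_2\lambda_1^5\,y_2^7 . \end{align*} -/

import Mathlib

open scoped TensorProduct
open Coalgebra

noncomputable section
namespace CleftG2

/-- A left `H`-module algebra structure on `E`: `h · 1 = ε(h) 1`, `h · (ab) = (h₍₁₎ · a)(h₍₂₎ · b)`. -/
structure HModuleAlgebra (k H E : Type*) [Field k] [Ring H] [HopfAlgebra k H]
    [Ring E] [Algebra k E] where
  act : H →ₐ[k] Module.End k E
  act_one : ∀ h : H, act h 1 = algebraMap k E (counit (R := k) h)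
  act_mul : ∀ (h : H) (a b : E), act h (a * b) =
    LinearMap.mul' k E (TensorProduct.map (act.toLinearMap.flip a) (act.toLinearMap.flip b)
      (comul (R := k) h))

section Smash
variable {k H E B : Type*} [Field k] [Ring H] [HopfAlgebra k H] [Ring E] [Algebra k E]
  [Ring B] [Algebra k B]

/-- The underlying space `E ⊗ H` of the smash product `E # H`. -/
def HModuleAlgebra.Smash (_S : HModuleAlgebra k H E) : Type _ := E ⊗[k] H

namespace HModuleAlgebra
variable (S : HModuleAlgebra k H E)

instance instAddCommGroupSmash : AddCommGroup S.Smash := inferInstanceAs (AddCommGroup (E ⊗[k] H))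
instance : Module k S.Smash := inferInstanceAs (Module k (E ⊗[k] H))

/-- `h ↦ (c ⊗ h' ↦ h₍₁₎ · c ⊗ h₍₂₎ h')`. -/
def diagAct : H →ₐ[k] Module.End k (E ⊗[k] H) :=
  (Module.endTensorEndAlgHom (R := k) (S := k) (A := k) (M := E) (N := H)).comp
    ((Algebra.TensorProduct.map S.act (Algebra.lmul k H)).comp (Bialgebra.comulAlgHom k H))

/-- `a ↦ (c ⊗ h' ↦ a c ⊗ h')`. -/
def leftAct : E →ₐ[k] Module.End k (E ⊗[k] H) where
  toFun a := LinearMap.rTensor H (LinearMap.mulLeft k a)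
  map_one' := by ext; simp
  map_mul' a b := by ext; simp
  map_zero' := by ext; simp
  map_add' a b := by ext; simp [add_mul, TensorProduct.add_tmul]
  commutes' r := by ext; simp [Algebra.smul_def]

/-- `a ⊗ h ↦ (b ⊗ h' ↦ a (h₍₁₎ · b) ⊗ h₍₂₎ h')`. -/
def mulAct : (E ⊗[k] H) →ₗ[k] Module.End k (E ⊗[k] H) :=
  TensorProduct.lift ((LinearMap.mul k (Module.End k (E ⊗[k] H))).compl₁₂
    (leftAct (k := k) (H := H) (E := E)).toLinearMap S.diagAct.toLinearMap)

lemma mulAct_tmul (a : E) (h : H) :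
    S.mulAct (a ⊗ₜ h) = leftAct a * S.diagAct h := rfl

lemma leftAct_tmul (a b : E) (h : H) :
    leftAct (k := k) a (b ⊗ₜ[k] h) = (a * b) ⊗ₜ h := rfl

lemma diagAct_tmul (h h' : H) (c : E) :
    S.diagAct h (c ⊗ₜ h') =
      TensorProduct.map (S.act.toLinearMap.flip c) (LinearMap.mulRight k h') (comul (R := k) h) := by
  simp only [diagAct, AlgHom.comp_apply, Bialgebra.comulAlgHom_apply]
  induction comul (R := k) h using TensorProduct.induction_on with
  | zero => simp
  | tmul x y => simp [Module.endTensorEndAlgHom_apply]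
  | add x y hx hy => simp only [map_add, LinearMap.add_apply, hx, hy]

lemma diagAct_tmul_one (h h' : H) (c : E) :
    S.diagAct h (c ⊗ₜ h') = TensorProduct.map LinearMap.id (LinearMap.mulRight k h')
      (S.diagAct h (c ⊗ₜ 1)) := by
  rw [diagAct_tmul, diagAct_tmul]
  induction comul (R := k) h using TensorProduct.induction_on with
  | zero => simp
  | tmul x y => simp
  | add x y hx hy => simp only [map_add, hx, hy]

lemma mulAct_leftAct (a : E) (z : E ⊗[k] H) :
    S.mulAct (leftAct a z) = leftAct a * S.mulAct z := by
  induction z using TensorProduct.induction_on with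
  | zero => simp
  | tmul x y => simp [leftAct_tmul, mulAct_tmul, mul_assoc]
  | add x y hx hy => simp only [map_add, hx, hy, mul_add]

lemma mulAct_mulRight (h' : H) (z : E ⊗[k] H) :
    S.mulAct (TensorProduct.map LinearMap.id (LinearMap.mulRight k h') z) =
      S.mulAct z * S.diagAct h' := by
  induction z using TensorProduct.induction_on with
  | zero => simp
  | tmul x y => simp [mulAct_tmul, mul_assoc]
  | add x y hx hy => simp only [map_add, hx, hy, add_mul]

lemma diagAct_mul_leftAct (h : H) (b : E) :
    S.diagAct h * leftAct b = S.mulAct (S.diagAct h (b ⊗ₜ 1)) := by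
  apply TensorProduct.ext'
  intro c h'
  rw [Module.End.mul_apply, leftAct_tmul]
  set 𝓡 := Coalgebra.Repr.arbitrary k h
  have hL := diagAct_tmul S h h' (b * c)
  have hR : S.diagAct h (b ⊗ₜ 1) = ∑ i ∈ 𝓡.index, S.act (𝓡.left i) b ⊗ₜ 𝓡.right i := by
    rw [diagAct_tmul, ← 𝓡.eq]; simp
  rw [hL, hR, ← 𝓡.eq]
  simp only [map_sum, TensorProduct.map_tmul, LinearMap.flip_apply, AlgHom.toLinearMap_apply,
    act_mul, LinearMap.mulRight_apply, LinearMap.sum_apply, mulAct_tmul, Module.End.mul_apply,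
    diagAct_tmul]
  have key := Coalgebra.sum_tmul_tmul_eq 𝓡 (fun i => Coalgebra.Repr.arbitrary k (𝓡.left i))
    (fun i => Coalgebra.Repr.arbitrary k (𝓡.right i))
  have key2 := congrArg (TensorProduct.map (LinearMap.mul' k E) (LinearMap.mulRight k h') ∘ₗ
    (TensorProduct.assoc k E E H).symm.toLinearMap ∘ₗ
    TensorProduct.map (S.act.toLinearMap.flip b)
      (TensorProduct.map (S.act.toLinearMap.flip c) LinearMap.id)) key
  simp only [map_sum, LinearMap.comp_apply, TensorProduct.map_tmul, LinearMap.flip_apply,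
    AlgHom.toLinearMap_apply, LinearMap.id_apply, LinearEquiv.coe_coe,
    TensorProduct.assoc_symm_tmul, LinearMap.mul'_apply, LinearMap.mulRight_apply] at key2
  refine Eq.trans ?_ (key2.trans ?_)
  · refine Finset.sum_congr rfl fun i _ => ?_
    rw [← (Coalgebra.Repr.arbitrary k (𝓡.left i)).eq]
    simp [TensorProduct.sum_tmul]
  · refine Finset.sum_congr rfl fun i _ => ?_
    rw [← (Coalgebra.Repr.arbitrary k (𝓡.right i)).eq]
    simp [leftAct_tmul]

lemma mulAct_mulAct (x y : E ⊗[k] H) :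
    S.mulAct (S.mulAct x y) = S.mulAct x * S.mulAct y := by
  induction x using TensorProduct.induction_on with
  | zero => simp
  | add x x' hx hx' => simp only [map_add, LinearMap.add_apply, hx, hx', add_mul]
  | tmul a h =>
    induction y using TensorProduct.induction_on with
    | zero => simp
    | add y y' hy hy' => simp only [map_add, hy, hy', mul_add]
    | tmul b h' =>
      rw [mulAct_tmul, mulAct_tmul, Module.End.mul_apply, mulAct_leftAct, diagAct_tmul_one,
        mulAct_mulRight, ← diagAct_mul_leftAct]
      simp only [mul_assoc]

lemma mulAct_one (x : E ⊗[k] H) : S.mulAct x ((1 : E) ⊗ₜ[k] (1 : H)) = x := by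
  induction x using TensorProduct.induction_on with
  | zero => simp
  | add x y hx hy => rw [map_add, LinearMap.add_apply, hx, hy]
  | tmul a h =>
    rw [mulAct_tmul, Module.End.mul_apply, diagAct_tmul]
    have : TensorProduct.map (S.act.toLinearMap.flip 1) (LinearMap.mulRight k (1 : H)) =
        TensorProduct.map (Algebra.linearMap k E) LinearMap.id ∘ₗ
          LinearMap.rTensor H (counit (R := k) (A := H)) := by
      apply TensorProduct.ext'
      intro x y
      simp [S.act_one]
    rw [this, LinearMap.comp_apply, Coalgebra.rTensor_counit_comul]
    simp [leftAct_tmul]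

lemma one_mulAct : S.mulAct ((1 : E) ⊗ₜ[k] (1 : H)) = 1 := by
  rw [mulAct_tmul, map_one, map_one, one_mul]

/-- The smash product algebra: `(a ⊗ h) (b ⊗ h') = a (h₍₁₎ · b) ⊗ h₍₂₎ h'`. -/
instance instRingSmash : Ring S.Smash where
  __ := instAddCommGroupSmash S
  mul x y := S.mulAct x y
  one := ((1 : E) ⊗ₜ[k] (1 : H) : E ⊗[k] H)
  left_distrib x y z := map_add (S.mulAct x) y z
  right_distrib x y z := LinearMap.congr_fun (map_add S.mulAct x y) z
  zero_mul x := LinearMap.congr_fun (map_zero S.mulAct) x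
  mul_zero x := map_zero (S.mulAct x)
  mul_assoc x y z := LinearMap.congr_fun (S.mulAct_mulAct x y) z
  one_mul x := LinearMap.congr_fun S.one_mulAct x
  mul_one x := S.mulAct_one x

instance instAlgebraSmash : Algebra k S.Smash := Algebra.ofModule
  (fun r x y => LinearMap.congr_fun (map_smul S.mulAct r x) y)
  (fun r x y => map_smul (S.mulAct x) r y)

/-- The element `a # h`. -/
def tm (a : E) (h : H) : S.Smash := (a ⊗ₜ[k] h : E ⊗[k] H)

theorem tm_mul_tm (a b : E) (h h' : H) :
    S.tm a h * S.tm b h' = leftAct a (TensorProduct.map (S.act.toLinearMap.flip b)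
      (LinearMap.mulRight k h') (comul (R := k) h)) := by
  rw [← diagAct_tmul]; rfl

/-- The embedding `E → E # H`. -/
def inl : E →ₐ[k] S.Smash := AlgHom.ofLinearMap
  ((TensorProduct.mk k E H).flip 1) rfl (fun a b => by
    change S.tm (a * b) 1 = S.tm a 1 * S.tm b 1
    rw [tm_mul_tm, ← diagAct_tmul, map_one]
    rfl)

/-- The embedding `H → E # H`. -/
def inr : H →ₐ[k] S.Smash := AlgHom.ofLinearMap
  (TensorProduct.mk k E H 1) rfl (fun a b => by
    change S.tm 1 (a * b) = S.tm 1 a * S.tm 1 b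
    have := congrArg (fun f : Module.End k (E ⊗[k] H) => f (1 ⊗ₜ 1)) (map_mul S.diagAct a b)
    have h1 : ∀ c h', S.diagAct c ((1 : E) ⊗ₜ h') = 1 ⊗ₜ (c * h') := by
      intro c h'
      rw [diagAct_tmul]
      have : TensorProduct.map (S.act.toLinearMap.flip 1) (LinearMap.mulRight k h') =
          TensorProduct.map (Algebra.linearMap k E) (LinearMap.mulRight k h') ∘ₗ
            LinearMap.rTensor H (counit (R := k) (A := H)) := by
        apply TensorProduct.ext'
        intro x y
        simp [S.act_one]
      rw [this, LinearMap.comp_apply, Coalgebra.rTensor_counit_comul]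
      simp
    rw [tm_mul_tm, ← diagAct_tmul, h1, leftAct_tmul, one_mul]
    rfl)

lemma tm_eq (a : E) (h : H) : S.tm a h = S.inl a * S.inr h := by
  change _ = S.tm a 1 * S.tm 1 h
  rw [tm_mul_tm, ← diagAct_tmul, map_one, Module.End.one_apply, leftAct_tmul, mul_one]
  rfl

lemma inr_mul_inl (h : H) (a : E) : S.inr h * S.inl a = S.diagAct h (a ⊗ₜ 1) := by
  change S.tm 1 h * S.tm a 1 = _
  rw [tm_mul_tm, ← diagAct_tmul, map_one, Module.End.one_apply]

/-- `a ⊗ h ↦ f(a) g(h)`. -/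
def pairLin (f : E →ₐ[k] B) (g : H →ₐ[k] B) : (E ⊗[k] H) →ₗ[k] B :=
  LinearMap.mul' k B ∘ₗ TensorProduct.map f.toLinearMap g.toLinearMap

/-- `g(h) f(a) = f(h₍₁₎ · a) g(h₍₂₎)`. -/
def Compat (f : E →ₐ[k] B) (g : H →ₐ[k] B) (a : E) : Prop :=
  ∀ h : H, g h * f a = pairLin f g (S.diagAct h (a ⊗ₜ 1))

lemma pairLin_mulAct (f : E →ₐ[k] B) (g : H →ₐ[k] B) {b : E} (hb : S.Compat f g b) (h' : H)
    (x : E ⊗[k] H) : pairLin f g (S.mulAct x (b ⊗ₜ h')) =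
      pairLin f g x * (f b * g h') := by
  induction x using TensorProduct.induction_on with
  | zero => simp
  | add x y hx hy => simp only [map_add, LinearMap.add_apply, hx, hy, add_mul]
  | tmul a h =>
    have e1 : ∀ z : E ⊗[k] H, pairLin f g (leftAct a z) = f a * pairLin f g z := by
      intro z
      induction z using TensorProduct.induction_on with
      | zero => simp
      | add x y hx hy => simp only [map_add, hx, hy, mul_add]
      | tmul c d => simp [leftAct_tmul, pairLin, mul_assoc]
    have e2 : ∀ z : E ⊗[k] H, pairLin f g
        (TensorProduct.map LinearMap.id (LinearMap.mulRight k h') z) = pairLin f g z * g h' := by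
      intro z
      induction z using TensorProduct.induction_on with
      | zero => simp
      | add x y hx hy => simp only [map_add, hx, hy, add_mul]
      | tmul c d => simp [pairLin, mul_assoc]
    rw [mulAct_tmul, Module.End.mul_apply, e1, diagAct_tmul_one, e2, ← hb h]
    simp [pairLin, mul_assoc]

lemma pairLin_mulAct' (f : E →ₐ[k] B) (g : H →ₐ[k] B) (hfg : ∀ b, S.Compat f g b)
    (x y : E ⊗[k] H) : pairLin f g (S.mulAct x y) = pairLin f g x * pairLin f g y := by
  induction y using TensorProduct.induction_on with
  | zero => simp
  | add y z hy hz => simp only [map_add, hy, hz, mul_add]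
  | tmul b h' => rw [S.pairLin_mulAct f g (hfg b)]; simp [pairLin]

lemma Compat.mul {f : E →ₐ[k] B} {g : H →ₐ[k] B} {a b : E} (ha : S.Compat f g a)
    (hb : S.Compat f g b) : S.Compat f g (a * b) := by
  intro h
  have : S.diagAct h ((a * b) ⊗ₜ 1) = S.mulAct (S.diagAct h (a ⊗ₜ 1)) (b ⊗ₜ 1) := by
    rw [← diagAct_mul_leftAct, Module.End.mul_apply, leftAct_tmul]
  rw [this, S.pairLin_mulAct f g hb, ← ha h, map_mul, map_one, mul_one, mul_assoc]

lemma Compat.add {f : E →ₐ[k] B} {g : H →ₐ[k] B} {a b : E} (ha : S.Compat f g a)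
    (hb : S.Compat f g b) : S.Compat f g (a + b) := by
  intro h
  rw [map_add, mul_add, ha h, hb h, TensorProduct.add_tmul, map_add, map_add]

lemma Compat.algebraMap {f : E →ₐ[k] B} {g : H →ₐ[k] B} (r : k) :
    S.Compat f g (algebraMap k E r) := by
  intro h
  rw [← S.inr_mul_inl]
  rw [AlgHom.commutes, AlgHom.commutes, ← Algebra.commutes, ← Algebra.commutes,
    ← Algebra.smul_def, ← Algebra.smul_def]
  change _ = pairLin f g (r • ((1 : E) ⊗ₜ[k] h))
  simp [pairLin]

/-- The algebra map `E # H → B` given by a compatible pair of algebra maps. -/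
def lift (f : E →ₐ[k] B) (g : H →ₐ[k] B) (hfg : ∀ a, S.Compat f g a) : S.Smash →ₐ[k] B :=
  AlgHom.ofLinearMap (pairLin f g)
    (by change pairLin f g ((1 : E) ⊗ₜ[k] (1 : H)) = 1; simp [pairLin])
    (fun x y => S.pairLin_mulAct' f g hfg x y)

end HModuleAlgebra
end Smash

section Roots
variable {k A : Type*} [Field k] [Ring A] [Algebra k A]

/-- The braiding matrix `q_d`. -/
def qMatrix (q : k) : Matrix (Fin 2) (Fin 2) k := !![q, q ^ 3; q, q ^ 3]

/-- The bicharacter on `ℕ²` with value `q_ij` on the simple roots `α_i, α_j`. -/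
def bichar (q : k) (a b : Fin 2 → ℕ) : k := ∏ i, ∏ j, qMatrix q i j ^ (a i * b j)

/-- The braided commutator `[u, v]_c` of elements `u, v` of degree `a, b`. -/
def brBracket (q : k) (a b : Fin 2 → ℕ) (u v : A) : A := u * v - bichar q a b • (v * u)

/-! Iterated braided commutators of `y 0 = y_1`, `y 1 = y_2`; `y122` is `[y_12, y_2]_c`. -/

def y12 (q : k) (y : Fin 2 → A) : A := brBracket q ![1, 0] ![0, 1] (y 0) (y 1)
def y112 (q : k) (y : Fin 2 → A) : A := brBracket q ![1, 0] ![1, 1] (y 0) (y12 q y)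
def y1112 (q : k) (y : Fin 2 → A) : A := brBracket q ![1, 0] ![2, 1] (y 0) (y112 q y)
def y11112 (q : k) (y : Fin 2 → A) : A := brBracket q ![1, 0] ![3, 1] (y 0) (y1112 q y)
def yBeta (q : k) (y : Fin 2 → A) : A := brBracket q ![2, 1] ![1, 1] (y112 q y) (y12 q y)
def y122 (q : k) (y : Fin 2 → A) : A := brBracket q ![1, 1] ![0, 1] (y12 q y) (y 1)

lemma y122_add {q : k} (h7 : q ^ 7 = 1) (u v : Fin 2 → A)
    (h : ∀ i j, v i * u j = qMatrix q i j • (u j * v i)) :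
    y122 q (fun i => u i + v i) = y122 q u + y122 q v := by
  have h00 := h 0 0
  have h01 := h 0 1
  have h10 := h 1 0
  have h11 := h 1 1
  simp only [qMatrix, Matrix.of_apply, Matrix.cons_val', Matrix.cons_val_zero,
    Matrix.cons_val_one, Matrix.cons_val_fin_one] at h00 h01 h10 h11
  have e1 : y12 q (fun i => u i + v i) = y12 q u + y12 q v + (1 - q ^ 4) • (u 0 * v 1) := by
    simp [y12, brBracket, bichar, Fin.prod_univ_two, qMatrix, mul_add, add_mul, h01, h10, smul_smul]
    module
  have f1 : v 1 * y12 q u = q ^ 4 • (y12 q u * v 1) := by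
    have := congrArg (u 0 * ·) h11
    simp only [y12, brBracket, mul_sub, sub_mul, ← mul_assoc, h10, h11, mul_smul_comm,
      smul_mul_assoc] at this ⊢
    simp only [mul_assoc, h10, h11, mul_smul_comm]
    module
  have f2 : y12 q v * u 1 = q ^ 6 • (u 1 * y12 q v) := by
    simp only [y12, brBracket, mul_sub, sub_mul, mul_assoc, h01, h11, mul_smul_comm,
      smul_mul_assoc]
    simp only [← mul_assoc, h01, h11, smul_mul_assoc]
    module
  have e2 : bichar q ![1, 1] ![0, 1] = q ^ 6 := by
    simp [bichar, Fin.prod_univ_two, qMatrix]; ring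
  have e3 : bichar q ![1, 0] ![0, 1] = q ^ 3 := by
    simp [bichar, Fin.prod_univ_two, qMatrix]
  simp only [y122]
  rw [e1]
  simp only [brBracket, e2, mul_add, add_mul, f1, f2, mul_smul_comm, smul_mul_assoc]
  simp only [y12, brBracket, e3, mul_sub, sub_mul, mul_smul_comm, smul_mul_assoc, mul_assoc, h11]
  simp only [← mul_assoc, h10, smul_mul_assoc]
  simp only [mul_assoc]
  match_scalars <;>
    first
    | ring1
    | linear_combination (-1 - q ^ 3) * h7
    | linear_combination (q ^ 3 + q ^ 6) * h7
    | linear_combination (q ^ 4 - 1) * h7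

lemma y11112_add {q : k} (h7 : q ^ 7 = 1) (u v : Fin 2 → A)
    (h : ∀ i j, v i * u j = qMatrix q i j • (u j * v i)) :
    y11112 q (fun i => u i + v i) = y11112 q u + y11112 q v := by
  have h00 := h 0 0
  have h01 := h 0 1
  have h10 := h 1 0
  simp only [qMatrix, Matrix.of_apply, Matrix.cons_val', Matrix.cons_val_zero,
    Matrix.cons_val_one, Matrix.cons_val_fin_one] at h00 h01 h10
  have b3 : bichar q ![1, 0] ![0, 1] = q ^ 3 := by
    simp [bichar, Fin.prod_univ_two, qMatrix]
  have b4 : bichar q ![1, 0] ![1, 1] = q ^ 4 := by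
    simp [bichar, Fin.prod_univ_two, qMatrix]; ring
  have b5 : bichar q ![1, 0] ![2, 1] = q ^ 5 := by
    simp [bichar, Fin.prod_univ_two, qMatrix]; ring
  have b6 : bichar q ![1, 0] ![3, 1] = q ^ 6 := by
    simp [bichar, Fin.prod_univ_two, qMatrix]; ring
  -- a general commutation rule for brackets with `u 0` and `v 0`
  have L : ∀ (w : A) (c d : k), v 0 * w = c • (w * v 0) →
      v 0 * (u 0 * w - d • (w * u 0)) = (q * c) • ((u 0 * w - d • (w * u 0)) * v 0) := by
    intro w c d hw
    have e1 : v 0 * (u 0 * w) = (q * c) • (u 0 * w * v 0) := by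
      rw [← mul_assoc, h00, smul_mul_assoc, mul_assoc, hw, mul_smul_comm, smul_smul, mul_assoc]
    have e2 : v 0 * (w * u 0) = (q * c) • (w * u 0 * v 0) := by
      rw [← mul_assoc, hw, smul_mul_assoc, mul_assoc, h00, mul_smul_comm, smul_smul, mul_comm c,
        mul_assoc]
    rw [mul_sub, mul_smul_comm, e1, e2, sub_mul, smul_mul_assoc]
    module
  have R : ∀ (w : A) (c d : k), w * u 0 = c • (u 0 * w) →
      (v 0 * w - d • (w * v 0)) * u 0 = (q * c) • (u 0 * (v 0 * w - d • (w * v 0))) := by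
    intro w c d hw
    have e1 : v 0 * w * u 0 = (q * c) • (u 0 * (v 0 * w)) := by
      rw [mul_assoc, hw, mul_smul_comm, ← mul_assoc, h00, smul_mul_assoc, smul_smul, mul_comm c,
        mul_assoc]
    have e2 : w * v 0 * u 0 = (q * c) • (u 0 * (w * v 0)) := by
      rw [mul_assoc, h00, mul_smul_comm, ← mul_assoc, hw, smul_mul_assoc, smul_smul, mul_assoc]
    rw [sub_mul, smul_mul_assoc, e1, e2, mul_sub, mul_smul_comm]
    module
  have lu12 : v 0 * y12 q u = (q * q ^ 3) • (y12 q u * v 0) := L _ _ _ h01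
  have lu112 : v 0 * y112 q u = (q * (q * q ^ 3)) • (y112 q u * v 0) := L _ _ _ lu12
  have lu1112 : v 0 * y1112 q u = (q * (q * (q * q ^ 3))) • (y1112 q u * v 0) := L _ _ _ lu112
  have rv12 : y12 q v * u 0 = (q * q) • (u 0 * y12 q v) := R _ _ _ h10
  have rv112 : y112 q v * u 0 = (q * (q * q)) • (u 0 * y112 q v) := R _ _ _ rv12
  have rv1112 : y1112 q v * u 0 = (q * (q * (q * q))) • (u 0 * y1112 q v) := R _ _ _ rv112
  have sv12 : v 0 * v 1 = y12 q v + q ^ 3 • (v 1 * v 0) := by simp [y12, brBracket, b3]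
  have sv112 : v 0 * y12 q v = y112 q v + q ^ 4 • (y12 q v * v 0) := by
    simp [y112, brBracket, b4]
  have sv1112 : v 0 * y112 q v = y1112 q v + q ^ 5 • (y112 q v * v 0) := by
    simp [y1112, brBracket, b5]
  have a00 : ∀ z, v 0 * (u 0 * z) = q • (u 0 * (v 0 * z)) := fun z => by
    rw [← mul_assoc, h00, smul_mul_assoc, mul_assoc]
  have e1 : y12 q (fun i => u i + v i) = y12 q u + y12 q v + (1 - q ^ 4) • (u 0 * v 1) := by
    simp only [y12, brBracket, b3, mul_add, add_mul, h01, h10]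
    module
  have e2 : y112 q (fun i => u i + v i) = y112 q u + y112 q v +
      ((1 - q ^ 4) * (1 - q ^ 5)) • (u 0 * (u 0 * v 1)) +
      (1 + q - q ^ 5 - q ^ 6) • (u 0 * y12 q v) := by
    simp only [y112, brBracket, b4, e1, mul_add, add_mul, lu12, rv12, mul_smul_comm,
      smul_mul_assoc, a00, sv12, mul_assoc, h10]
    module
  have e3 : y1112 q (fun i => u i + v i) = y1112 q u + y1112 q v +
      ((1 - q ^ 4) * (1 - q ^ 5) * (1 - q ^ 6)) • (u 0 * (u 0 * (u 0 * v 1))) +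
      ((1 - q ^ 4) * (1 - q ^ 5) * q ^ 2 + (1 + q - q ^ 5 - q ^ 6) * (1 - q ^ 7)) •
        (u 0 * (u 0 * y12 q v)) +
      (1 - q ^ 8 + q * (1 + q - q ^ 5 - q ^ 6)) • (u 0 * y112 q v) := by
    simp only [y1112, brBracket, b5, e2, mul_add, add_mul, lu112, rv112, rv12, mul_smul_comm,
      smul_mul_assoc, a00, sv12, sv112, mul_assoc, h10]
    module
  simp only [y11112, brBracket, b6, e3, mul_add, add_mul, lu1112, rv1112, rv112, rv12,
    mul_smul_comm, smul_mul_assoc, a00, sv12, sv112, sv1112, mul_assoc, h10]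
  match_scalars <;>
    first
    | ring1
    | linear_combination ((-1) * q ^ 0 + (-1) * q ^ 1 + (-1) * q ^ 2 + (-1) * q ^ 3) * h7
    | linear_combination ((-1) * q ^ 0 + (1) * q ^ 4 + (1) * q ^ 5 + (1) * q ^ 6 + (-1) * q ^ 9 + (-1) * q ^ 10 + (-1) * q ^ 11 + (1) * q ^ 15) * h7
    | linear_combination ((-1) * q ^ 0 + (-1) * q ^ 1 + (-1) * q ^ 2 + (-1) * q ^ 3 + (1) * q ^ 5 + (2) * q ^ 6 + (2) * q ^ 7 + (2) * q ^ 8 + (1) * q ^ 9 + (-1) * q ^ 11 + (-1) * q ^ 12 + (-1) * q ^ 13 + (-1) * q ^ 14) * h7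
    | linear_combination ((-1) * q ^ 0 + (-1) * q ^ 1 + (-2) * q ^ 2 + (-1) * q ^ 3 + (-1) * q ^ 4 + (1) * q ^ 6 + (1) * q ^ 7 + (2) * q ^ 8 + (1) * q ^ 9 + (1) * q ^ 10) * h7
end Roots

section Weights
variable {k H E : Type*} [Field k] [Ring H] [HopfAlgebra k H] [Ring E] [Algebra k E]

open WithConv

/-- The linear map `h ↦ χ(h) a`, an element of the convolution algebra `Hom(H, E)`. -/
def wt (χ : WithConv (H →ₐ[k] k)) (a : E) : WithConv (H →ₗ[k] E) :=
  toConv (LinearMap.toSpanSingleton k E a ∘ₗ χ.ofConv.toLinearMap)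

lemma wt_apply (χ : WithConv (H →ₐ[k] k)) (a : E) (h : H) : (wt χ a).ofConv h = χ h • a := rfl

lemma wt_mul (χ ψ : WithConv (H →ₐ[k] k)) (a b : E) : wt χ a * wt ψ b = wt (χ * ψ) (a * b) := by
  apply WithConv.ext
  ext h
  rw [wt_apply]
  change LinearMap.mul' k E (TensorProduct.map (wt χ a).ofConv (wt ψ b).ofConv (comul h)) =
    LinearMap.mul' k k (TensorProduct.map χ.ofConv.toLinearMap ψ.ofConv.toLinearMap (comul h)) •
      (a * b)
  induction comul (R := k) h using TensorProduct.induction_on with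
  | zero => simp
  | add x y hx hy => simp only [map_add, hx, hy, add_smul]
  | tmul x y => simp [wt_apply, smul_smul, mul_comm]

lemma wt_sub (χ : WithConv (H →ₐ[k] k)) (a b : E) : wt χ (a - b) = wt χ a - wt χ b := by
  apply WithConv.ext
  ext h
  simp [wt_apply, smul_sub]

lemma wt_smul (χ : WithConv (H →ₐ[k] k)) (c : k) (a : E) : wt χ (c • a) = c • wt χ a := by
  apply WithConv.ext
  ext h
  exact smul_comm _ _ _

lemma wt_one_algebraMap (r : k) :
    wt (1 : WithConv (H →ₐ[k] k)) (algebraMap k E r) = algebraMap k _ r := by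
  apply WithConv.ext
  ext h
  rw [wt_apply]
  change (algebraMap k k (counit h)) • algebraMap k E r = r • algebraMap k E (counit h)
  rw [Algebra.algebraMap_self_apply, Algebra.algebraMap_eq_smul_one,
    Algebra.algebraMap_eq_smul_one (A := E) (counit h), smul_comm]

lemma wt_bracket (q : k) (a b : Fin 2 → ℕ) {χ ψ : WithConv (H →ₐ[k] k)} (h : χ * ψ = ψ * χ)
    (u v : E) :
    brBracket q a b (wt χ u) (wt ψ v) = wt (χ * ψ) (brBracket q a b u v) := by
  simp only [brBracket, wt_mul, wt_sub, wt_smul, h]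

/-- The `H`-module algebra structure on an algebra `E` generated by `y 0`, `y 1` for which
`h · y i = χ i (h) y i`; the algebra map `φ` encodes `a ↦ (h ↦ h · a)`. -/
def HModuleAlgebra.ofWeights (χ : Fin 2 → WithConv (H →ₐ[k] k)) (y : Fin 2 → E)
    (hy : Algebra.adjoin k (Set.range y) = ⊤) (φ : E →ₐ[k] WithConv (H →ₗ[k] E))
    (hφ : ∀ i, φ (y i) = wt (χ i) (y i)) : HModuleAlgebra k H E :=
  have mulf : ∀ (h : H) (a b : E), (φ (a * b)).ofConv h = LinearMap.mul' k E
      (TensorProduct.map (φ a).ofConv (φ b).ofConv (comul h)) := fun h a b => by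
    rw [map_mul]; rfl
  have algf : ∀ (h : H) (r : k), (φ (algebraMap k E r)).ofConv h =
      r • algebraMap k E (counit h) := fun h r => by
    rw [AlgHom.commutes]; rfl
  have addf : ∀ (h : H) (a b : E), (φ (a + b)).ofConv h = (φ a).ofConv h + (φ b).ofConv h :=
    fun h a b => by rw [map_add]; rfl
  have smulf : ∀ (h : H) (r : k) (a : E), (φ (r • a)).ofConv h = r • (φ a).ofConv h :=
    fun h r a => by rw [map_smul]; rfl
  have one' : ∀ a : E, (φ a).ofConv 1 = a := fun a => by
    have ha : a ∈ Algebra.adjoin k (Set.range y) := hy ▸ Algebra.mem_top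
    induction ha using Algebra.adjoin_induction with
    | mem x hx => obtain ⟨i, rfl⟩ := hx; rw [hφ, wt_apply]; simp
    | algebraMap r => rw [algf]; simp [Algebra.algebraMap_eq_smul_one]
    | add a b _ _ ha hb => rw [addf, ha, hb]
    | mul a b _ _ ha hb => rw [mulf]; simp [ha, hb, Algebra.TensorProduct.one_def]
  have mul' : ∀ (h h' : H) (a : E), (φ a).ofConv (h * h') = (φ ((φ a).ofConv h')).ofConv h := by
    intro h h' a
    have ha : a ∈ Algebra.adjoin k (Set.range y) := hy ▸ Algebra.mem_top
    induction ha using Algebra.adjoin_induction generalizing h h' with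
    | mem x hx =>
      obtain ⟨i, rfl⟩ := hx
      rw [hφ, wt_apply, wt_apply, smulf, hφ, wt_apply, smul_smul, map_mul, mul_comm]
    | algebraMap r =>
      rw [algf, algf, smulf, algf]
      simp [Algebra.algebraMap_eq_smul_one, smul_smul, mul_comm]
    | add a b _ _ ha hb => rw [addf, addf, addf, ha, hb]
    | mul a b _ _ ha hb =>
      rw [mulf, mulf, Bialgebra.comul_mul]
      induction comul (R := k) h' using TensorProduct.induction_on with
      | zero => simp
      | add z z' hz hz' => simp only [mul_add, map_add, hz, hz', WithConv.ofConv_add, LinearMap.add_apply]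
      | tmul x x' =>
        rw [TensorProduct.map_tmul, LinearMap.mul'_apply, mulf]
        induction comul (R := k) h using TensorProduct.induction_on with
        | zero => simp
        | add z z' hz hz' => simp only [add_mul, map_add, hz, hz']
        | tmul w w' => simp [ha, hb]
  { act := AlgHom.ofLinearMap
      { toFun := fun h =>
          { toFun := fun a => (φ a).ofConv h
            map_add' := fun a b => addf h a b
            map_smul' := fun r a => smulf h r a }
        map_add' := fun h h' => by ext a; simp
        map_smul' := fun r h => by ext a; simp }
      (by ext a; exact one' a)
      (fun h h' => by ext a; exact mul' h h' a)
    act_one := fun h => by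
      have := algf h 1
      rw [map_one, one_smul] at this
      exact this
    act_mul := fun h a b => mulf h a b }

lemma HModuleAlgebra.ofWeights_act (χ : Fin 2 → WithConv (H →ₐ[k] k)) (y : Fin 2 → E)
    (hy : Algebra.adjoin k (Set.range y) = ⊤) (φ : E →ₐ[k] WithConv (H →ₗ[k] E))
    (hφ : ∀ i, φ (y i) = wt (χ i) (y i)) (h : H) (i : Fin 2) :
    (HModuleAlgebra.ofWeights χ y hy φ hφ).act h (y i) = χ i h • y i := by
  change (φ (y i)).ofConv h = _
  rw [hφ, wt_apply]

/-- `h ↦ χ(h₍₁₎) h₍₂₎`. -/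
def hitL (χ : WithConv (H →ₐ[k] k)) : H →ₗ[k] H :=
  (TensorProduct.lid k H).toLinearMap ∘ₗ LinearMap.rTensor H χ.ofConv.toLinearMap ∘ₗ comul

/-- `h ↦ h₍₁₎ χ(h₍₂₎)`. -/
def hitR (χ : WithConv (H →ₐ[k] k)) : H →ₗ[k] H :=
  (TensorProduct.rid k H).toLinearMap ∘ₗ LinearMap.lTensor H χ.ofConv.toLinearMap ∘ₗ comul

lemma comul_hitL (χ : WithConv (H →ₐ[k] k)) (h : H) :
    comul (R := k) (hitL χ h) = LinearMap.rTensor H (hitL χ) (comul h) := by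
  have key := congrArg ((TensorProduct.lid k (H ⊗[k] H)).toLinearMap ∘ₗ
    LinearMap.rTensor (H ⊗[k] H) χ.ofConv.toLinearMap) (Coalgebra.coassoc_apply (R := k) h)
  have e1 : ((TensorProduct.lid k (H ⊗[k] H)).toLinearMap ∘ₗ
      LinearMap.rTensor (H ⊗[k] H) χ.ofConv.toLinearMap) ∘ₗ LinearMap.lTensor H comul =
      comul ∘ₗ (TensorProduct.lid k H).toLinearMap ∘ₗ LinearMap.rTensor H χ.ofConv.toLinearMap := by
    apply TensorProduct.ext'
    intro x y
    simp
  have e2 : ((TensorProduct.lid k (H ⊗[k] H)).toLinearMap ∘ₗ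
      LinearMap.rTensor (H ⊗[k] H) χ.ofConv.toLinearMap) ∘ₗ
        (TensorProduct.assoc k H H H).toLinearMap ∘ₗ LinearMap.rTensor H comul =
      LinearMap.rTensor H (hitL χ) := by
    apply TensorProduct.ext'
    intro x y
    simp only [hitL, LinearMap.comp_apply, LinearMap.rTensor_tmul, LinearEquiv.coe_coe]
    induction comul (R := k) x using TensorProduct.induction_on with
    | zero => simp
    | add z z' hz hz' => simp only [TensorProduct.add_tmul, map_add, hz, hz']
    | tmul z z' => simp [TensorProduct.smul_tmul']
  have h1 := LinearMap.congr_fun e1 (comul h)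
  have h2 := LinearMap.congr_fun e2 (comul h)
  simp only [LinearMap.comp_apply] at h1 h2 key
  exact h1.symm.trans (key.symm.trans h2)

lemma lTensor_hitL_comul (χ : WithConv (H →ₐ[k] k)) (h : H) :
    LinearMap.lTensor H (hitL χ) (comul (R := k) h) = LinearMap.rTensor H (hitR χ) (comul h) := by
  have key := congrArg (LinearMap.lTensor H ((TensorProduct.lid k H).toLinearMap ∘ₗ
    LinearMap.rTensor H χ.ofConv.toLinearMap)) (Coalgebra.coassoc_apply (R := k) h)
  have e1 : LinearMap.lTensor H ((TensorProduct.lid k H).toLinearMap ∘ₗ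
      LinearMap.rTensor H χ.ofConv.toLinearMap) ∘ₗ LinearMap.lTensor H comul =
      LinearMap.lTensor H (hitL χ) := by
    rw [← LinearMap.lTensor_comp]; rfl
  have e2 : LinearMap.lTensor H ((TensorProduct.lid k H).toLinearMap ∘ₗ
      LinearMap.rTensor H χ.ofConv.toLinearMap) ∘ₗ
        (TensorProduct.assoc k H H H).toLinearMap ∘ₗ LinearMap.rTensor H comul =
      LinearMap.rTensor H (hitR χ) := by
    apply TensorProduct.ext'
    intro x y
    simp only [hitR, LinearMap.comp_apply, LinearMap.rTensor_tmul, LinearEquiv.coe_coe]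
    induction comul (R := k) x using TensorProduct.induction_on with
    | zero => simp
    | add z z' hz hz' => simp only [TensorProduct.add_tmul, map_add, hz, hz']
    | tmul z z' => simp [TensorProduct.smul_tmul]
  have h1 := LinearMap.congr_fun e1 (comul h)
  have h2 := LinearMap.congr_fun e2 (comul h)
  simp only [LinearMap.comp_apply] at h1 h2 key
  exact h1.symm.trans (key.symm.trans h2)

lemma HModuleAlgebra.compat_iff {B : Type*} [Ring B] [Algebra k B] (S : HModuleAlgebra k H E)
    (f : E →ₐ[k] B) (G : H →ₐ[k] B) {χ : WithConv (H →ₐ[k] k)} {a : E}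
    (ha : ∀ h, S.act h a = χ h • a) :
    S.Compat f G a ↔ ∀ h, G h * f a = f a * G (hitL χ h) := by
  have : ∀ h, S.diagAct h (a ⊗ₜ 1) = a ⊗ₜ[k] hitL χ h := by
    intro h
    rw [diagAct_tmul]
    simp only [hitL, LinearMap.comp_apply]
    induction comul (R := k) h using TensorProduct.induction_on with
    | zero => simp
    | add z z' hz hz' => simp only [TensorProduct.tmul_add, map_add, hz, hz']
    | tmul z z' => simp [ha, TensorProduct.smul_tmul]
  simp only [HModuleAlgebra.Compat, this]
  simp [HModuleAlgebra.pairLin]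

lemma HModuleAlgebra.inr_mul_inl_of_weight (S : HModuleAlgebra k H E)
    {χ : WithConv (H →ₐ[k] k)} {a : E} (ha : ∀ h, S.act h a = χ h • a) (h : H) :
    S.inr h * S.inl a = S.inl a * S.inr (hitL χ h) := by
  refine (S.compat_iff S.inl S.inr ha).1 (fun h => ?_) h
  rw [S.inr_mul_inl]
  have : ∀ z : E ⊗[k] H, HModuleAlgebra.pairLin S.inl S.inr z = z := by
    intro z
    induction z using TensorProduct.induction_on with
    | zero => exact map_zero _
    | add z z' hz hz' => rw [map_add, hz, hz']; rfl
    | tmul z z' => exact (S.tm_eq z z').symm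
  exact (this _).symm

lemma HModuleAlgebra.compat_of_gen {B : Type*} [Ring B] [Algebra k B] (S : HModuleAlgebra k H E)
    (f : E →ₐ[k] B) (G : H →ₐ[k] B) (y : Fin 2 → E)
    (hy : Algebra.adjoin k (Set.range y) = ⊤) (h : ∀ i, S.Compat f G (y i)) (a : E) :
    S.Compat f G a := by
  have ha : a ∈ Algebra.adjoin k (Set.range y) := hy ▸ Algebra.mem_top
  induction ha using Algebra.adjoin_induction with
  | mem x hx => obtain ⟨i, rfl⟩ := hx; exact h i
  | algebraMap r => exact HModuleAlgebra.Compat.algebraMap S r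
  | add a b _ _ ha hb => exact ha.add S hb
  | mul a b _ _ ha hb => exact ha.mul S hb

end Weights
section Functoriality
variable {k A B : Type*} [Field k] [Ring A] [Algebra k A] [Ring B] [Algebra k B]

lemma map_brBracket (f : A →ₐ[k] B) (q : k) (a b : Fin 2 → ℕ) (u v : A) :
    f (brBracket q a b u v) = brBracket q a b (f u) (f v) := by
  simp [brBracket]

lemma map_y11112 (f : A →ₐ[k] B) (q : k) (y : Fin 2 → A) :
    f (y11112 q y) = y11112 q (fun i => f (y i)) := by
  simp only [y11112, y1112, y112, y12, map_brBracket]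

lemma map_y122 (f : A →ₐ[k] B) (q : k) (y : Fin 2 → A) :
    f (y122 q y) = y122 q (fun i => f (y i)) := by
  simp only [y122, y12, map_brBracket]

lemma brBracket_tmul (q : k) (a b : Fin 2 → ℕ) {g g' : A} (h : g * g' = g' * g) (x x' : B) :
    brBracket q a b (g ⊗ₜ[k] x) (g' ⊗ₜ[k] x') = (g * g') ⊗ₜ[k] brBracket q a b x x' := by
  simp [brBracket, h, TensorProduct.tmul_sub]

end Functoriality

/-- The deformed quantum Serre relations `y_11112 = l₁` and `[y_12, y_2]_c = l₂`. -/
inductive SerreRel {k : Type*} [Field k] (q l₁ l₂ : k) :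
    FreeAlgebra k (Fin 2) → FreeAlgebra k (Fin 2) → Prop
  | serre1 : SerreRel q l₁ l₂ (y11112 q (FreeAlgebra.ι k)) (algebraMap k _ l₁)
  | serre2 : SerreRel q l₁ l₂ (y122 q (FreeAlgebra.ι k)) (algebraMap k _ l₂)

/-- The algebra `𝓔(l₁, l₂)`; for `l₁ = l₂ = 0` it is the distinguished pre-Nichols algebra. -/
abbrev EAlg {k : Type*} [Field k] (q l₁ l₂ : k) : Type _ := RingQuot (SerreRel q l₁ l₂)

section EAlg
variable {k : Type*} [Field k] (q l₁ l₂ : k)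

/-- The generators of `𝓔(l₁, l₂)`. -/
def gen (i : Fin 2) : EAlg q l₁ l₂ := RingQuot.mkAlgHom k (SerreRel q l₁ l₂) (FreeAlgebra.ι k i)

lemma adjoin_gen : Algebra.adjoin k (Set.range (gen q l₁ l₂)) = ⊤ := by
  have : Set.range (gen q l₁ l₂) =
      (RingQuot.mkAlgHom k (SerreRel q l₁ l₂)) '' Set.range (FreeAlgebra.ι k) := by
    rw [← Set.range_comp]; rfl
  rw [this, ← AlgHom.map_adjoin, FreeAlgebra.adjoin_range_ι, Algebra.map_top,
    AlgHom.range_eq_top]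
  exact RingQuot.mkAlgHom_surjective k _

lemma gen_serre1 : y11112 q (gen q l₁ l₂) = algebraMap k _ l₁ := by
  have := RingQuot.mkAlgHom_rel k (SerreRel.serre1 (q := q) (l₁ := l₁) (l₂ := l₂))
  rwa [map_y11112, AlgHom.commutes] at this

lemma gen_serre2 : y122 q (gen q l₁ l₂) = algebraMap k _ l₂ := by
  have := RingQuot.mkAlgHom_rel k (SerreRel.serre2 (q := q) (l₁ := l₁) (l₂ := l₂))
  rwa [map_y122, AlgHom.commutes] at this

variable {q l₁ l₂}

/-- Algebra maps out of `𝓔(l₁, l₂)`. -/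
def EAlg.lift {B : Type*} [Ring B] [Algebra k B] (y : Fin 2 → B)
    (h1 : y11112 q y = algebraMap k B l₁) (h2 : y122 q y = algebraMap k B l₂) :
    EAlg q l₁ l₂ →ₐ[k] B :=
  RingQuot.liftAlgHom k ⟨FreeAlgebra.lift k y, fun a b hab => by
    cases hab with
    | serre1 => rw [map_y11112, AlgHom.commutes]; simpa using h1
    | serre2 => rw [map_y122, AlgHom.commutes]; simpa using h2⟩

lemma EAlg.lift_gen {B : Type*} [Ring B] [Algebra k B] (y : Fin 2 → B)
    (h1 : y11112 q y = algebraMap k B l₁) (h2 : y122 q y = algebraMap k B l₂) (i : Fin 2) :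
    EAlg.lift y h1 h2 (gen q l₁ l₂ i) = y i := by
  simp [EAlg.lift, gen, RingQuot.liftAlgHom_mkAlgHom_apply]

end EAlg

open WithConv

/-- A principal realization over `H` of the braided vector space with braiding matrix `q_d`, where
`q` is a primitive seventh root of unity: central group-likes `g i` and characters `χ i` with
`χ j (g i) = q_ij`, such that each `(χ i, g i)` is a Yetter-Drinfeld pair. -/
structure PrincipalRealization (k H : Type*) [Field k] [Ring H] [HopfAlgebra k H] (q : k) where
  q_primitive : IsPrimitiveRoot q 7
  g : Fin 2 → H
  χ : Fin 2 → WithConv (H →ₐ[k] k)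
  g_groupLike : ∀ i, IsGroupLikeElem k (g i)
  g_central : ∀ i h, IsGroupLikeElem k h → g i * h = h * g i
  χ_g : ∀ i j, χ j (g i) = qMatrix q i j
  yetterDrinfeld : ∀ i h, hitR (χ i) h * g i = g i * hitL (χ i) h

namespace PrincipalRealization
variable {k H : Type*} [Field k] [Ring H] [HopfAlgebra k H] {q : k}
  (R : PrincipalRealization k H q)

/-- The group-like element `g_α` for `α = d 0 • α₁ + d 1 • α₂`. -/
def gOf (d : Fin 2 → ℕ) : H := R.g 0 ^ d 0 * R.g 1 ^ d 1

/-- The character `χ_α` for `α = d 0 • α₁ + d 1 • α₂`. -/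
def χOf (d : Fin 2 → ℕ) : WithConv (H →ₐ[k] k) := R.χ 0 ^ d 0 * R.χ 1 ^ d 1

lemma q_pow (R : PrincipalRealization k H q) : q ^ 7 = 1 := R.q_primitive.pow_eq_one

lemma q_ne_zero (R : PrincipalRealization k H q) : q ≠ 0 := R.q_primitive.ne_zero (by norm_num)

lemma conv_apply (χ ψ : WithConv (H →ₐ[k] k)) (h : H) : (χ * ψ) h = χ (hitR ψ h) := by
  change LinearMap.mul' k k (TensorProduct.map χ.ofConv.toLinearMap ψ.ofConv.toLinearMap
    (comul h)) = _
  simp only [hitR, LinearMap.comp_apply]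
  induction comul (R := k) h using TensorProduct.induction_on with
  | zero => simp
  | add z z' hz hz' => simp only [map_add, hz, hz']
  | tmul z z' => simp [mul_comm]

lemma conv_apply' (χ ψ : WithConv (H →ₐ[k] k)) (h : H) : (χ * ψ) h = ψ (hitL χ h) := by
  change LinearMap.mul' k k (TensorProduct.map χ.ofConv.toLinearMap ψ.ofConv.toLinearMap
    (comul h)) = _
  simp only [hitL, LinearMap.comp_apply]
  induction comul (R := k) h using TensorProduct.induction_on with
  | zero => simp
  | add z z' hz hz' => simp only [map_add, hz, hz']
  | tmul z z' => simp

lemma χ_comm (i j : Fin 2) : R.χ i * R.χ j = R.χ j * R.χ i := by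
  apply WithConv.ext
  ext h
  have h1 := congrArg (R.χ j).ofConv (R.yetterDrinfeld i h)
  rw [map_mul, map_mul, mul_comm] at h1
  have hq : (R.χ j).ofConv (R.g i) ≠ 0 := by
    have := R.χ_g i j
    rw [this]
    have hq0 := R.q_ne_zero
    fin_cases i <;> fin_cases j <;> simp [qMatrix] <;> exact hq0
  have h2 := mul_left_cancel₀ hq h1
  exact (conv_apply' (R.χ i) (R.χ j) h).trans (h2.symm.trans (conv_apply (R.χ j) (R.χ i) h).symm)

lemma commute_χ : Commute (R.χ 0) (R.χ 1) := R.χ_comm 0 1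

lemma χOf_mul (a b : Fin 2 → ℕ) : R.χOf a * R.χOf b = R.χOf (a + b) := by
  simp only [χOf, Pi.add_apply, pow_add]
  have := (R.commute_χ.pow_pow (b 0) (a 1)).eq
  rw [mul_assoc, ← mul_assoc (R.χ 1 ^ a 1), ← this]
  simp only [mul_assoc]

lemma χOf_comm (a b : Fin 2 → ℕ) : R.χOf a * R.χOf b = R.χOf b * R.χOf a := by
  rw [χOf_mul, χOf_mul, add_comm]

lemma commute_g : Commute (R.g 0) (R.g 1) := R.g_central 0 _ (R.g_groupLike 1)

lemma gOf_mul (a b : Fin 2 → ℕ) : R.gOf a * R.gOf b = R.gOf (a + b) := by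
  simp only [gOf, Pi.add_apply, pow_add]
  have := (R.commute_g.pow_pow (b 0) (a 1)).eq
  rw [mul_assoc, ← mul_assoc (R.g 1 ^ a 1), ← this]
  simp only [mul_assoc]

lemma gOf_comm (a b : Fin 2 → ℕ) : R.gOf a * R.gOf b = R.gOf b * R.gOf a := by
  rw [gOf_mul, gOf_mul, add_comm]

lemma χOf_zero_one : R.χ 0 = R.χOf ![1, 0] ∧ R.χ 1 = R.χOf ![0, 1] := by simp [χOf]
lemma gOf_zero_one : R.g 0 = R.gOf ![1, 0] ∧ R.g 1 = R.gOf ![0, 1] := by simp [gOf]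

lemma bracket_wt {E : Type*} [Ring E] [Algebra k E] (a b c d e : Fin 2 → ℕ) (u v : E)
    (he : c + d = e) :
    brBracket q a b (wt (R.χOf c) u) (wt (R.χOf d) v) = wt (R.χOf e) (brBracket q a b u v) := by
  rw [wt_bracket q a b (R.χOf_comm c d), χOf_mul, he]

lemma y11112_wt {E : Type*} [Ring E] [Algebra k E] (y : Fin 2 → E) :
    y11112 q (fun i => wt (R.χ i) (y i)) = wt (R.χOf ![4, 1]) (y11112 q y) := by
  simp only [y11112, y1112, y112, y12]
  rw [R.χOf_zero_one.1, R.χOf_zero_one.2, R.bracket_wt (e := ![1, 1]) _ _ _ _ _ _ (by simp),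
    R.bracket_wt (e := ![2, 1]) _ _ _ _ _ _ (by simp),
    R.bracket_wt (e := ![3, 1]) _ _ _ _ _ _ (by simp),
    R.bracket_wt (e := ![4, 1]) _ _ _ _ _ _ (by simp)]

lemma y122_wt {E : Type*} [Ring E] [Algebra k E] (y : Fin 2 → E) :
    y122 q (fun i => wt (R.χ i) (y i)) = wt (R.χOf ![1, 2]) (y122 q y) := by
  simp only [y122, y12]
  rw [R.χOf_zero_one.1, R.χOf_zero_one.2, R.bracket_wt (e := ![1, 1]) _ _ _ _ _ _ (by simp),
    R.bracket_wt (e := ![1, 2]) _ _ _ _ _ _ (by simp)]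

/-- The `H`-action on `T(V)`. -/
def tensorAction : HModuleAlgebra k H (FreeAlgebra k (Fin 2)) :=
  HModuleAlgebra.ofWeights R.χ (FreeAlgebra.ι k) (FreeAlgebra.adjoin_range_ι _ _)
    (FreeAlgebra.lift k fun i => wt (R.χ i) (FreeAlgebra.ι k i)) (fun i => by simp)

/-- The conditions on the parameters `l₁, l₂`. -/
def SerreParam (l₁ l₂ : k) : Prop :=
  ((R.gOf ![4, 1] = 1 ∨ R.χOf ![4, 1] ≠ 1) → l₁ = 0) ∧
  ((R.gOf ![1, 2] = 1 ∨ R.χOf ![1, 2] ≠ 1) → l₂ = 0)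

lemma serreParam_zero : R.SerreParam 0 0 := ⟨fun _ => rfl, fun _ => rfl⟩

variable {l₁ l₂ : k} (hl : R.SerreParam l₁ l₂)

lemma wt_param {E : Type*} [Ring E] [Algebra k E] {χ : WithConv (H →ₐ[k] k)} {l : k}
    (h : χ ≠ 1 → l = 0) : wt χ (algebraMap k E l) = algebraMap k _ l := by
  by_cases hχ : χ = 1
  · rw [hχ, wt_one_algebraMap]
  · rw [h hχ, map_zero, map_zero]
    apply WithConv.ext
    ext x
    rw [wt_apply]
    simp

/-- The `H`-action on `𝓔(l₁, l₂)`. -/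
def action : HModuleAlgebra k H (EAlg q l₁ l₂) :=
  HModuleAlgebra.ofWeights R.χ (gen q l₁ l₂) (adjoin_gen q l₁ l₂)
    (EAlg.lift (fun i => wt (R.χ i) (gen q l₁ l₂ i))
      (by rw [R.y11112_wt, gen_serre1]; exact wt_param fun h => hl.1 (Or.inr h))
      (by rw [R.y122_wt, gen_serre2]; exact wt_param fun h => hl.2 (Or.inr h)))
    (fun i => EAlg.lift_gen _ _ _ i)

lemma action_gen (h : H) (i : Fin 2) :
    (R.action hl).act h (gen q l₁ l₂ i) = R.χ i h • gen q l₁ l₂ i :=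
  HModuleAlgebra.ofWeights_act _ _ _ _ _ _ _

/-- The algebra `T(V) # H`. -/
abbrev TH : Type _ := R.tensorAction.Smash

/-- The algebra `𝓐(l₁, l₂) = 𝓔(l₁, l₂) # H`. -/
abbrev AAlg : Type _ := (R.action hl).Smash

/-- The Hopf algebra `𝓗'`, the bosonization of the distinguished pre-Nichols algebra. -/
abbrev HPre : Type _ := R.AAlg R.serreParam_zero

/-- The elements `y 0`, `y 1` of `𝓐(l₁, l₂)`. -/
def y (i : Fin 2) : R.AAlg hl := (R.action hl).inl (gen q l₁ l₂ i)

/-- The elements `x 0`, `x 1` of `𝓗'`. -/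
def x (i : Fin 2) : R.HPre := R.y R.serreParam_zero i

lemma inr_mul_y (h : H) (i : Fin 2) :
    (R.action hl).inr h * R.y hl i = R.y hl i * (R.action hl).inr (hitL (R.χ i) h) :=
  HModuleAlgebra.inr_mul_inl_of_weight _ (fun h => R.action_gen hl h i) h

lemma hitL_g (i j : Fin 2) : hitL (R.χ j) (R.g i) = qMatrix q i j • R.g i := by
  simp only [hitL, LinearMap.comp_apply, (R.g_groupLike i).comul_eq_tmul_self]
  rw [LinearMap.rTensor_tmul]
  simp only [LinearEquiv.coe_coe, TensorProduct.lid_tmul]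
  exact congrArg (· • R.g i) (R.χ_g i j)

/-- The values `y i ⊗ 1 + g i ⊗ x i` of the coaction. -/
def coactGen (i : Fin 2) : R.AAlg hl ⊗[k] R.HPre :=
  R.y hl i ⊗ₜ 1 + (R.action hl).inr (R.g i) ⊗ₜ R.x i

lemma coact_comm (i j : Fin 2) :
    ((R.action hl).inr (R.g i) ⊗ₜ[k] R.x i) * (R.y hl j ⊗ₜ[k] (1 : R.HPre)) =
      qMatrix q i j • ((R.y hl j ⊗ₜ[k] (1 : R.HPre)) * ((R.action hl).inr (R.g i) ⊗ₜ[k] R.x i)) := by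
  rw [Algebra.TensorProduct.tmul_mul_tmul, Algebra.TensorProduct.tmul_mul_tmul, mul_one, one_mul,
    inr_mul_y, hitL_g, map_smul, mul_smul_comm, TensorProduct.smul_tmul']

lemma bracket_g (a b c d e : Fin 2 → ℕ) (u v : R.HPre) (he : c + d = e) :
    brBracket q a b ((R.action hl).inr (R.gOf c) ⊗ₜ[k] u) ((R.action hl).inr (R.gOf d) ⊗ₜ[k] v) =
      (R.action hl).inr (R.gOf e) ⊗ₜ[k] brBracket q a b u v := by
  rw [brBracket_tmul, ← map_mul, gOf_mul, he]
  rw [← map_mul, ← map_mul, gOf_comm]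

lemma coact_serre1 : y11112 q (R.coactGen hl) = algebraMap k _ l₁ := by
  have h1 : y11112 q (R.coactGen hl) = _ := y11112_add R.q_pow _ _ (R.coact_comm hl)
  rw [h1]
  have h2 : y11112 q (fun i => R.y hl i ⊗ₜ[k] (1 : R.HPre)) = algebraMap k _ l₁ := by
    have := map_y11112 ((Algebra.TensorProduct.includeLeft (R := k) (S := k) (A := R.AAlg hl)
      (B := R.HPre)).comp (R.action hl).inl) q (gen q l₁ l₂)
    rw [gen_serre1, AlgHom.commutes] at this
    exact this.symm
  have h3 : y11112 q (fun i => (R.action hl).inr (R.g i) ⊗ₜ[k] R.x i) = 0 := by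
    have h4 : y11112 q R.x = 0 := by
      have := map_y11112 (R.action R.serreParam_zero).inl q (gen q 0 0)
      rw [gen_serre1, map_zero, map_zero] at this
      exact this.symm
    have : y11112 q (fun i => (R.action hl).inr (R.g i) ⊗ₜ[k] R.x i) =
        (R.action hl).inr (R.gOf ![4, 1]) ⊗ₜ[k] y11112 q R.x := by
      simp only [y11112, y1112, y112, y12]
      rw [R.gOf_zero_one.1, R.gOf_zero_one.2, R.bracket_g hl (e := ![1, 1]) _ _ _ _ _ _ (by simp),
        R.bracket_g hl (e := ![2, 1]) _ _ _ _ _ _ (by simp),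
        R.bracket_g hl (e := ![3, 1]) _ _ _ _ _ _ (by simp),
        R.bracket_g hl (e := ![4, 1]) _ _ _ _ _ _ (by simp)]
    rw [this, h4, TensorProduct.tmul_zero]
  rw [h2, h3, add_zero]

lemma coact_serre2 : y122 q (R.coactGen hl) = algebraMap k _ l₂ := by
  have h1 : y122 q (R.coactGen hl) = _ := y122_add R.q_pow _ _ (R.coact_comm hl)
  rw [h1]
  have h2 : y122 q (fun i => R.y hl i ⊗ₜ[k] (1 : R.HPre)) = algebraMap k _ l₂ := by
    have := map_y122 ((Algebra.TensorProduct.includeLeft (R := k) (S := k) (A := R.AAlg hl)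
      (B := R.HPre)).comp (R.action hl).inl) q (gen q l₁ l₂)
    rw [gen_serre2, AlgHom.commutes] at this
    exact this.symm
  have h3 : y122 q (fun i => (R.action hl).inr (R.g i) ⊗ₜ[k] R.x i) = 0 := by
    have h4 : y122 q R.x = 0 := by
      have := map_y122 (R.action R.serreParam_zero).inl q (gen q 0 0)
      rw [gen_serre2, map_zero, map_zero] at this
      exact this.symm
    have : y122 q (fun i => (R.action hl).inr (R.g i) ⊗ₜ[k] R.x i) =
        (R.action hl).inr (R.gOf ![1, 2]) ⊗ₜ[k] y122 q R.x := by
      simp only [y122, y12]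
      rw [R.gOf_zero_one.1, R.gOf_zero_one.2, R.bracket_g hl (e := ![1, 1]) _ _ _ _ _ _ (by simp),
        R.bracket_g hl (e := ![1, 2]) _ _ _ _ _ _ (by simp)]
    rw [this, h4, TensorProduct.tmul_zero]
  rw [h2, h3, add_zero]

/-- The restriction of the coaction to `H`, namely the comultiplication of `H`. -/
def coactH : H →ₐ[k] R.AAlg hl ⊗[k] R.HPre :=
  (Algebra.TensorProduct.map (R.action hl).inr (R.action R.serreParam_zero).inr).comp
    (Bialgebra.comulAlgHom k H)

lemma coact_compat (i : Fin 2) : (R.action hl).Compat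
    (EAlg.lift (R.coactGen hl) (R.coact_serre1 hl) (R.coact_serre2 hl)) (R.coactH hl)
    (gen q l₁ l₂ i) := by
  rw [HModuleAlgebra.compat_iff _ _ _ (fun h => R.action_gen hl h i)]
  intro h
  rw [EAlg.lift_gen]
  simp only [coactH, AlgHom.comp_apply, Bialgebra.comulAlgHom_apply, coactGen, mul_add, add_mul]
  congr 1
  · rw [comul_hitL]
    induction comul (R := k) h using TensorProduct.induction_on with
    | zero => simp
    | add z z' hz hz' => simp only [map_add, add_mul, mul_add, hz, hz']
    | tmul z z' => simp [inr_mul_y]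
  · have e1 : ∀ z : H ⊗[k] H,
        Algebra.TensorProduct.map (R.action hl).inr (R.action R.serreParam_zero).inr z *
          ((R.action hl).inr (R.g i) ⊗ₜ[k] R.x i) =
        TensorProduct.map ((R.action hl).inr.toLinearMap ∘ₗ LinearMap.mulRight k (R.g i))
          (LinearMap.mulLeft k (R.x i) ∘ₗ (R.action R.serreParam_zero).inr.toLinearMap)
          (LinearMap.lTensor H (hitL (R.χ i)) z) := by
      intro z
      induction z using TensorProduct.induction_on with
      | zero => simp
      | add z z' hz hz' => simp only [map_add, add_mul, hz, hz']
      | tmul z z' => simp [x, inr_mul_y]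
    have e2 : ∀ z : H ⊗[k] H,
        TensorProduct.map ((R.action hl).inr.toLinearMap ∘ₗ LinearMap.mulRight k (R.g i))
          (LinearMap.mulLeft k (R.x i) ∘ₗ (R.action R.serreParam_zero).inr.toLinearMap)
          (LinearMap.rTensor H (hitR (R.χ i)) z) =
        ((R.action hl).inr (R.g i) ⊗ₜ[k] R.x i) *
          Algebra.TensorProduct.map (R.action hl).inr (R.action R.serreParam_zero).inr
            (LinearMap.rTensor H (hitL (R.χ i)) z) := by
      intro z
      induction z using TensorProduct.induction_on with
      | zero => simp
      | add z z' hz hz' => simp only [map_add, mul_add, hz, hz']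
      | tmul z z' =>
        simp only [LinearMap.rTensor_tmul, TensorProduct.map_tmul, LinearMap.comp_apply,
          LinearMap.mulRight_apply, LinearMap.mulLeft_apply, R.yetterDrinfeld,
          Algebra.TensorProduct.map_tmul, Algebra.TensorProduct.tmul_mul_tmul,
          AlgHom.toLinearMap_apply, map_mul]
    rw [e1, lTensor_hitL_comul, e2, comul_hitL]

/-- The coaction `ρ : 𝓐(l₁, l₂) → 𝓐(l₁, l₂) ⊗ 𝓗'`: the algebra map with
`ρ(y i) = y i ⊗ 1 + g i ⊗ x i` and `ρ(h) = h₍₁₎ ⊗ h₍₂₎`. -/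
def coaction : R.AAlg hl →ₐ[k] R.AAlg hl ⊗[k] R.HPre :=
  (R.action hl).lift (EAlg.lift (R.coactGen hl) (R.coact_serre1 hl) (R.coact_serre2 hl))
    (R.coactH hl)
    (HModuleAlgebra.compat_of_gen _ _ _ _ (adjoin_gen q l₁ l₂) (R.coact_compat hl))

lemma coaction_y (i : Fin 2) : R.coaction hl (R.y hl i) =
    R.y hl i ⊗ₜ 1 + (R.action hl).inr (R.g i) ⊗ₜ R.x i := by
  change HModuleAlgebra.pairLin _ _ (gen q l₁ l₂ i ⊗ₜ[k] (1 : H)) = _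
  simp [HModuleAlgebra.pairLin, EAlg.lift_gen, coactGen]

lemma coaction_inr (h : H) : R.coaction hl ((R.action hl).inr h) =
    TensorProduct.map (R.action hl).inr.toLinearMap (R.action R.serreParam_zero).inr.toLinearMap
      (comul h) := by
  change HModuleAlgebra.pairLin _ _ ((1 : EAlg q l₁ l₂) ⊗ₜ[k] h) = _
  simp only [HModuleAlgebra.pairLin, LinearMap.comp_apply, TensorProduct.map_tmul,
    AlgHom.toLinearMap_apply, map_one, LinearMap.mul'_apply, one_mul]
  rfl

/-- The comultiplication of `𝓗'`. -/
def preComul : R.HPre →ₐ[k] R.HPre ⊗[k] R.HPre := R.coaction R.serreParam_zero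

/-- The counit of `𝓗'`: the algebra map with `x i ↦ 0` which extends the counit of `H`. -/
def preCounit : R.HPre →ₐ[k] k :=
  (R.action R.serreParam_zero).lift
    (EAlg.lift (fun _ => 0) (by simp [y11112, brBracket]) (by simp [y122, brBracket]))
    (Bialgebra.counitAlgHom k H)
    (HModuleAlgebra.compat_of_gen _ _ _ _ (adjoin_gen q 0 0) fun i => by
      rw [HModuleAlgebra.compat_iff _ _ _ (fun h => R.action_gen R.serreParam_zero h i)]
      intro h
      rw [EAlg.lift_gen]
      simp)

end PrincipalRealization

section Cosemisimple
variable (k : Type*) {H : Type*} [Field k] [Ring H] [HopfAlgebra k H]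

/-- `C` is a subcoalgebra: `Δ(C) ⊆ C ⊗ C`. -/
def IsSubcoalgebra (C : Submodule k H) : Prop :=
  ∀ c ∈ C, comul (R := k) c ∈ LinearMap.range (TensorProduct.map C.subtype C.subtype)

/-- `C` is a simple subcoalgebra. -/
def IsSimpleSubcoalgebra (C : Submodule k H) : Prop :=
  IsSubcoalgebra k C ∧ C ≠ ⊥ ∧ ∀ D : Submodule k H, IsSubcoalgebra k D → D ≤ C → D = ⊥ ∨ D = C

variable (H) in
/-- `H` is cosemisimple: it is the sum of its simple subcoalgebras. -/
def IsCosemisimple : Prop := sSup {C : Submodule k H | IsSimpleSubcoalgebra k C} = ⊤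

end Cosemisimple

/-- The positive roots of type `G₂`. -/
inductive PosRoot : Type
  | r1
  | r1112
  | r112
  | rBeta
  | r12
  | r2

/-- The coordinates of a root in the basis of simple roots. -/
def PosRoot.deg : PosRoot → Fin 2 → ℕ
  | .r1 => ![1, 0]
  | .r1112 => ![3, 1]
  | .r112 => ![2, 1]
  | .rBeta => ![3, 2]
  | .r12 => ![1, 1]
  | .r2 => ![0, 1]

/-- The root vector attached to a positive root. -/
def rootVec {k A : Type*} [Field k] [Ring A] [Algebra k A] (q : k) (y : Fin 2 → A) : PosRoot → A
  | .r1 => y 0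
  | .r1112 => y1112 q y
  | .r112 => y112 q y
  | .rBeta => yBeta q y
  | .r12 => y12 q y
  | .r2 => y 1

namespace PrincipalRealization
variable {k H : Type*} [Field k] [Ring H] [HopfAlgebra k H] {q : k}
  (R : PrincipalRealization k H q) {l₁ l₂ : k} (hl : R.SerreParam l₁ l₂)

/-- The set of deformation parameters `μ = (μ_α)`. -/
def PowerParam (μ : PosRoot → k) : Prop :=
  ∀ α : PosRoot, (R.gOf α.deg ^ 7 = 1 ∨ R.χOf α.deg ^ 7 ≠ 1) → μ α = 0

/-- The convolution product of linear maps `𝓗' → 𝓐(l₁, l₂)`. -/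
def convMul (γ γ' : R.HPre →ₗ[k] R.AAlg hl) : R.HPre →ₗ[k] R.AAlg hl :=
  LinearMap.mul' k (R.AAlg hl) ∘ₗ TensorProduct.map γ γ' ∘ₗ R.preComul.toLinearMap

/-- The unit `x ↦ ε(x) 1` for the convolution product. -/
def convOne : R.HPre →ₗ[k] R.AAlg hl :=
  Algebra.linearMap k (R.AAlg hl) ∘ₗ R.preCounit.toLinearMap

/-- `γ : 𝓗' → 𝓐(l₁, l₂)` is a section of the cleft object `𝓐(l₁, l₂)`: it is unital,
`H`-bilinear, `𝓗'`-colinear and invertible for the convolution product; it maps `r_α = x_α ^ 7`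
into `𝓔(l₁, l₂)` for each positive root `α`. -/
structure IsSection (γ : R.HPre →ₗ[k] R.AAlg hl) : Prop where
  map_one : γ 1 = 1
  map_inr_mul : ∀ (h : H) (z : R.HPre),
    γ ((R.action R.serreParam_zero).inr h * z) = (R.action hl).inr h * γ z
  map_mul_inr : ∀ (z : R.HPre) (h : H),
    γ (z * (R.action R.serreParam_zero).inr h) = γ z * (R.action hl).inr h
  colinear : (R.coaction hl).toLinearMap ∘ₗ γ =
    TensorProduct.map γ LinearMap.id ∘ₗ R.preComul.toLinearMap
  convInvertible : ∃ γ' : R.HPre →ₗ[k] R.AAlg hl,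
    R.convMul hl γ γ' = R.convOne hl ∧ R.convMul hl γ' γ = R.convOne hl
  map_power_mem : ∀ α : PosRoot, γ (rootVec q R.x α ^ 7) ∈ (R.action hl).inl.range

/-- The relations `γ(r_α) = μ_α` in `𝓔(l₁, l₂)`, where `r_α = x_α ^ 7`. -/
inductive PowerRel (γ : R.HPre →ₗ[k] R.AAlg hl) (μ : PosRoot → k) :
    EAlg q l₁ l₂ → EAlg q l₁ l₂ → Prop
  | power (α : PosRoot) (a : EAlg q l₁ l₂)
      (ha : (R.action hl).inl a = γ (rootVec q R.x α ^ 7)) :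
      PowerRel γ μ a (algebraMap k _ (μ α))

/-- The algebra `𝓔(λ, μ) = 𝓔(λ) / ⟨γ(r_α) - μ_α⟩`. -/
abbrev EPow (γ : R.HPre →ₗ[k] R.AAlg hl) (μ : PosRoot → k) : Type _ :=
  RingQuot (R.PowerRel hl γ μ)

/-- The generators `y 0 = y_1`, `y 1 = y_2` of `T(V) # H`. -/
def yT (i : Fin 2) : R.TH := R.tensorAction.inl (FreeAlgebra.ι k i)

/-- The explicit relations in `T(V) # H`. -/
inductive CleftRel (l₁ l₂ : k) (μ : PosRoot → k) : R.TH → R.TH → Prop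
  | serre1 : CleftRel l₁ l₂ μ (y11112 q R.yT) (algebraMap k _ l₁)
  | serre2 : CleftRel l₁ l₂ μ (y122 q R.yT) (algebraMap k _ l₂)
  | pow1 : CleftRel l₁ l₂ μ (R.yT 0 ^ 7) (algebraMap k _ (μ .r1))
  | pow2 : CleftRel l₁ l₂ μ (R.yT 1 ^ 7) (algebraMap k _ (μ .r2))
  | pow12 : CleftRel l₁ l₂ μ (y12 q R.yT ^ 7) (algebraMap k _ (μ .r12))
  | pow1112 : CleftRel l₁ l₂ μ (y1112 q R.yT ^ 7) (algebraMap k _ (μ .r1112))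
  | pow112 : CleftRel l₁ l₂ μ (y112 q R.yT ^ 7)
      (algebraMap k _ (μ .r112)
        - ((8 * q + 9 * q ^ 2 + 3 * q ^ 3 + 4 * q ^ 4 + 5 * q ^ 5 - q ^ 6) * l₁ ^ 2) •
          (y12 q R.yT ^ 3 * yBeta q R.yT)
        - ((5 * q + 8 * q ^ 2 + 9 * q ^ 3 + 8 * q ^ 4 + 5 * q ^ 5) * l₁ ^ 2) •
          (R.yT 1 * yBeta q R.yT ^ 2)
        + (7 * q ^ 3 * (1 + 2 * q + q ^ 2) * l₁ ^ 3) • (R.yT 1 ^ 2 * y12 q R.yT ^ 2)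
        - ((2 * q + 4 * q ^ 2 + 13 * q ^ 3 + 22 * q ^ 4 + 17 * q ^ 5 + 5 * q ^ 6) * l₂ * l₁ ^ 3) •
          (R.yT 1 * y12 q R.yT))
  | powBeta : CleftRel l₁ l₂ μ (yBeta q R.yT ^ 7)
      (algebraMap k _ (μ .rBeta)
        + ((210 * q + 224 * q ^ 2 + 238 * q ^ 3 + 105 * q ^ 4 + 462 * q ^ 5 + 231 * q ^ 6) *
            l₂ ^ 2 * l₁ ^ 3) • y12 q R.yT ^ 7
        + ((833 * q + 1911 * q ^ 2 + 2352 * q ^ 3 + 1911 * q ^ 4 + 833 * q ^ 5) * l₂ * l₁ ^ 5) •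
          R.yT 1 ^ 7)

end PrincipalRealization

end CleftG2
end

/-!
The proof exhibits one section `γ` which takes the value `relVec q l₁ l₂ y α`, the seventh power of
the root vector `y_α` together with its deforming terms, at `x_α ^ 7`. These values have weight
`χ_α ^ 7` (`relVec_wt`), so the action descends to `𝓔(λ, μ)`, whose relations
`relVec q l₁ l₂ y α = μ_α` are the ones to be proved; the rest is formal
(`exists_equiv_presented`).

The section is constructed through its inverse. A linear form `φ` on `𝓐(λ)` which is unital and
compatible with the counit of `H` on both sides (`IsAugmentation`) gives an `H`-bilinear colinear
map `Φ a = φ(a₍₀₎) a₍₁₎` from `𝓐(λ)` to `𝓗'` (`cleave`), which sends `y_i a` to `x_i Φ(a)` up to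
terms of lower degree in the generators. As a polynomial which vanishes in `𝓔(0, 0)` has lower
degree in `𝓔(λ)`, by a Rees algebra argument, such a `Φ` is bijective (`bijective_of_unipotent`).
Its inverse `γ` is invertible for convolution because its restriction to `H` is an algebra map
(`isUnit_of_inr_algHom`). It remains to find a form `φ` with `Φ(relVec α) = x_α ^ 7` for all `α`
(`exists_augmentation`).

The form `φ` is a matrix coefficient `a ↦ ψ(a vac)` of an explicit `𝓐(λ)`-module `N`. Then `Φ(a)`
is obtained by letting `a` act on the vector `vac ⊗ 1` of `N ⊗ 𝓗'`, where `y_i` acts by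
`y_i ⊗ 1 + g_i ⊗ x_i`, and applying `ψ` to the first factor. For `l₁ = 0` one takes
`y_1 = κ X ^ 2`, `y_2 = d` on the polynomials in `d`, where `X` is a `q ^ 3`-derivative; here the
root vectors of `N` other than `y_2` vanish on the kernel of `X`
(`exists_augmentation_of_lower`).

For `l₁ ≠ 0` the operators are `y_1 = X + X'` and `y_2 = κ d ^ 4 + τ ^ 3 g`, where `X`, `X'` are
`q`-derivatives with respect to `d`, `τ`, the operator `d ^ 7` is a scalar, and the parameters
`κ`, `θ = d ^ 7` match `l₁`, `l₂` (`LoweringData`). The action on `N ⊗ 𝓗'` is thus obtained from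
the pair `g_i ⊗ x_i`, which satisfies the undeformed relations, by adding twice a pair of the form
`X, d ^ m g` (`Step`). The seventh powers of the root vectors of such a sum, on a vector killed by
`X`, are `Step.powers_scalar` and `Step.powers_braided`; the constants which they produce are
cancelled by the choice of `ψ` on the vectors `τ ^ a g ^ b vac`
(`exists_augmentation_of_loweringData`).

The seventh powers are computed by evaluation in the kernel. An operator is an expression (`Expr`),
which acts on normal forms of vectors: polynomials in `d` whose coefficients are linear combinations
of ordered monomials in the root vectors (`DState`, `Tree`), with coefficients in `ℕ[q]`. A
coefficient `p(q)` is stored as the number `p(B)` modulo `B ^ 7 - 1` for a large base `B`, together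
with a bound for its digits (`Packed`). The evaluation is sound because the reordering rules follow
from the Serre relations (`root_vector_relations`, `root_vectors_serre`), and an identity is
certified by the test `Expr.kills`.
-/

noncomputable section
namespace CleftG2

/-! ### Packed coefficients -/

/-- The width in bits of a digit of a packed coefficient. -/
def width : ℕ := 128

/-- The modulus `B ^ 7 - 1` of packed coefficients, where `B = 2 ^ width`. -/
def packMod : ℕ := 2 ^ (7 * width) - 1

/-- A packed coefficient, standing for `p(q)` with `p` a polynomial with coefficients in `ℕ`:
`c` is congruent to `p(2 ^ width)` modulo `packMod`, and `n = p(1)`. -/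
structure Packed where
  c : ℕ
  n : ℕ

/-- The packed coefficient of the polynomial with the given list of coefficients. -/
def Packed.ofList (l : List ℕ) : Packed :=
  ⟨l.foldr (fun a r => a + 2 ^ width * r) 0, l.foldr (fun a r => a + r) 0⟩

/-- The product; `c` is reduced so that it stays small. -/
def Packed.mul (a b : Packed) : Packed := ⟨a.c * b.c % packMod, a.n * b.n⟩

/-- The sum. -/
def Packed.add (a b : Packed) : Packed := ⟨a.c + b.c, a.n + b.n⟩

/-- A test which succeeds only on packed coefficients of `0`, see `Packed.Rep.eq_zero`. -/
def Packed.isZero (a : Packed) : Bool :=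
  Nat.beq (a.c * (2 ^ width - 1) % packMod) 0 && Nat.blt a.n (2 ^ width)

section Rep
variable {k : Type*} [Field k]

/-- The packed coefficient `a` represents the scalar `s`. -/
def Packed.Rep (q : k) (a : Packed) (s : k) : Prop :=
  ∃ p : Polynomial ℕ, p.eval (2 ^ width) ≡ a.c [MOD packMod] ∧ p.eval 1 = a.n ∧
    p.eval₂ (Nat.castRingHom k) q = s

/-- The value at `q` of the polynomial with the given list of coefficients. -/
def listVal (q : k) (l : List ℕ) : k := l.foldr (fun (a : ℕ) r => (a : k) + q * r) 0

lemma Packed.rep_ofList (q : k) (l : List ℕ) : (Packed.ofList l).Rep q (listVal q l) := by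
  induction l with
  | nil => exact ⟨0, by simp [ofList, listVal, Nat.ModEq]⟩
  | cons a l ih =>
    obtain ⟨p, h1, h2, h3⟩ := ih
    refine ⟨Polynomial.C a + Polynomial.X * p, ?_, ?_, ?_⟩
    · simp only [Polynomial.eval_add, Polynomial.eval_C, Polynomial.eval_mul, Polynomial.eval_X]
      exact (h1.mul_left _).add_left _
    · simp only [Polynomial.eval_add, Polynomial.eval_C, Polynomial.eval_mul, Polynomial.eval_X,
        h2, one_mul]
      rfl
    · simp only [Polynomial.eval₂_add, Polynomial.eval₂_C, Polynomial.eval₂_mul,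
        Polynomial.eval₂_X, h3]
      rfl

lemma Packed.Rep.mul {q : k} {a b : Packed} {s t : k} (ha : a.Rep q s) (hb : b.Rep q t) :
    (a.mul b).Rep q (s * t) := by
  obtain ⟨p, h1, h2, h3⟩ := ha
  obtain ⟨p', h1', h2', h3'⟩ := hb
  refine ⟨p * p', ?_, ?_, ?_⟩
  · rw [Polynomial.eval_mul]
    exact (h1.mul h1').trans (Nat.mod_modEq _ _).symm
  · rw [Polynomial.eval_mul, h2, h2']; rfl
  · rw [Polynomial.eval₂_mul, h3, h3']

lemma Packed.Rep.add {q : k} {a b : Packed} {s t : k} (ha : a.Rep q s) (hb : b.Rep q t) :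
    (a.add b).Rep q (s + t) := by
  obtain ⟨p, h1, h2, h3⟩ := ha
  obtain ⟨p', h1', h2', h3'⟩ := hb
  refine ⟨p + p', ?_, ?_, ?_⟩
  · rw [Polynomial.eval_add]; exact h1.add h1'
  · rw [Polynomial.eval_add, h2, h2']; rfl
  · rw [Polynomial.eval₂_add, h3, h3']

lemma Packed.rep_one (q : k) : (⟨1, 1⟩ : Packed).Rep q 1 :=
  ⟨1, by simp [Nat.ModEq]⟩

/-- If the base-`B` number with digits `b i` is divisible by `1 + B + ⋯ + B ^ 6` and the digits sum
up to less than `B`, then the digits agree. -/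
lemma digits_eq_of_dvd {B : ℕ} (b : ℕ → ℕ) (hb : ∑ i ∈ Finset.range 7, b i < B)
    (h : ∑ i ∈ Finset.range 7, B ^ i ∣ ∑ i ∈ Finset.range 7, b i * B ^ i) :
    ∀ i < 7, b i = b 0 := by
  obtain ⟨t, ht⟩ := h
  have key : ∀ (n : ℕ) (a c : ℕ → ℕ), (∀ i < n, a i < B) → (∀ i < n, c i < B) →
      ∑ i ∈ Finset.range n, a i * B ^ i = ∑ i ∈ Finset.range n, c i * B ^ i →
      ∀ i < n, a i = c i := by
    intro n
    induction n with
    | zero => intro _ _ _ _ _ i hi; omega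
    | succ n ih =>
      intro a c ha hc e
      rw [Finset.sum_range_succ', Finset.sum_range_succ'] at e
      simp only [pow_succ, ← mul_assoc, ← Finset.sum_mul, pow_zero, mul_one] at e
      have hB : 0 < B := lt_of_le_of_lt (Nat.zero_le _) (ha 0 (by omega))
      have e0 : a 0 = c 0 := by
        have := congrArg (· % B) e
        simpa [Nat.add_mod, Nat.mod_eq_of_lt (ha 0 (by omega)),
          Nat.mod_eq_of_lt (hc 0 (by omega))] using this
      rw [e0] at e
      have e1 := Nat.eq_of_mul_eq_mul_right hB (Nat.add_right_cancel e)
      intro i hi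
      cases i with
      | zero => exact e0
      | succ i =>
        exact ih (fun i => a (i + 1)) (fun i => c (i + 1)) (fun i hi => ha _ (by omega))
          (fun i hi => hc _ (by omega)) e1 i (by omega)
  have hbi : ∀ i < 7, b i < B := fun i hi => lt_of_le_of_lt
    (Finset.single_le_sum (f := b) (fun _ _ => Nat.zero_le _) (Finset.mem_range.2 hi)) hb
  have hB : 0 < B := lt_of_le_of_lt (Nat.zero_le _) hb
  -- so `b` and the constant digit `t` give the same number
  have htB : t < B := by
    by_contra hge
    push Not at hge
    have h1 : ∑ i ∈ Finset.range 7, b i * B ^ i < B * ∑ i ∈ Finset.range 7, B ^ i := by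
      rw [Finset.mul_sum]
      apply Finset.sum_lt_sum_of_nonempty (by simp)
      intro i hi
      exact Nat.mul_lt_mul_of_pos_right (hbi i (Finset.mem_range.1 hi)) (pow_pos hB i)
    rw [ht, mul_comm] at h1
    exact absurd (Nat.mul_le_mul_right (∑ i ∈ Finset.range 7, B ^ i) hge) (by omega)
  have e := key 7 b (fun _ => t) hbi (fun _ _ => htB) (by rw [ht, ← Finset.mul_sum, mul_comm])
  intro i hi
  rw [e i hi, e 0 (by omega)]

lemma sum_coeff_mod_seven {S : Type*} [CommSemiring S] (p : Polynomial ℕ) (f : ℕ → S) :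
    ∑ m ∈ p.support, (p.coeff m : S) * f (m % 7) =
      ∑ i ∈ Finset.range 7, ((∑ m ∈ p.support with m % 7 = i, p.coeff m : ℕ) : S) * f i := by
  rw [← Finset.sum_fiberwise_of_maps_to (s := p.support) (t := Finset.range 7)
    (g := fun m => m % 7) (fun m _ => Finset.mem_range.2 (Nat.mod_lt _ (by norm_num)))]
  refine Finset.sum_congr rfl fun i _ => ?_
  rw [Nat.cast_sum, Finset.sum_mul]
  refine Finset.sum_congr rfl fun m hm => ?_
  rw [(Finset.mem_filter.1 hm).2]

/-- If `(B - 1) c` is divisible by `B ^ 7 - 1`, then `p(B)` is divisible by `1 + B + ⋯ + B ^ 6`; as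
`p(1) < B`, the coefficients of `p` modulo `T ^ 7 - 1` all agree, and `p` is a multiple of
`1 + T + ⋯ + T ^ 6`, which vanishes at `q`. -/
lemma Packed.Rep.eq_zero {q : k} (hq : IsPrimitiveRoot q 7) {a : Packed} {s : k}
    (h : a.Rep q s) (h0 : a.isZero = true) : s = 0 := by
  obtain ⟨p, h1, h2, rfl⟩ := h
  rw [isZero, Bool.and_eq_true] at h0
  have z1 : a.c * (2 ^ width - 1) % packMod = 0 := Nat.eq_of_beq_eq_true h0.1
  have z2 : a.n < 2 ^ width := by simpa [Nat.blt_eq] using h0.2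
  obtain ⟨B, hB⟩ : ∃ B, B = 2 ^ width := ⟨_, rfl⟩
  have hM : packMod = B ^ 7 - 1 := by rw [packMod, hB, ← pow_mul, mul_comm]
  have hB2 : 2 ≤ B := by rw [hB]; exact Nat.le_self_pow (by norm_num [width]) 2
  rw [← hB] at h1 z1 z2
  rw [hM] at h1 z1
  -- collect the coefficients of `p` according to the exponent modulo `7`
  set b : ℕ → ℕ := fun i => ∑ m ∈ p.support with m % 7 = i, p.coeff m with hb
  have hs : ∑ i ∈ Finset.range 7, b i < B := by
    have := sum_coeff_mod_seven p (fun _ => (1 : ℕ))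
    simp only [mul_one, Nat.cast_id] at this
    rw [← this]
    rw [Polynomial.eval_eq_sum, Polynomial.sum] at h2
    simp only [one_pow, mul_one] at h2
    omega
  have hdvd : ∑ i ∈ Finset.range 7, B ^ i ∣ ∑ i ∈ Finset.range 7, b i * B ^ i := by
    have hB7 : 1 ≤ B ^ 7 := Nat.one_le_pow _ _ (by omega)
    have c1 : ∑ i ∈ Finset.range 7, b i * B ^ i ≡ a.c [MOD B ^ 7 - 1] := by
      have := sum_coeff_mod_seven p (fun i => B ^ i)
      simp only [Nat.cast_id] at this
      rw [← this]
      rw [Polynomial.eval_eq_sum, Polynomial.sum] at h1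
      refine Nat.ModEq.trans ?_ h1
      have hp : ∀ m, B ^ (m % 7) ≡ B ^ m [MOD B ^ 7 - 1] := by
        intro m
        conv_rhs => rw [← Nat.mod_add_div m 7, pow_add, pow_mul]
        have : B ^ 7 ≡ 1 [MOD B ^ 7 - 1] := by
          conv_lhs => rw [← Nat.sub_add_cancel hB7]
          exact Nat.add_modEq_left
        simpa using ((this.pow (m / 7)).mul_left (B ^ (m % 7))).symm
      have : ∀ s : Finset ℕ, ∑ m ∈ s, p.coeff m * B ^ (m % 7) ≡
          ∑ m ∈ s, p.coeff m * B ^ m [MOD B ^ 7 - 1] := by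
        intro s
        induction s using Finset.induction_on with
        | empty => rfl
        | insert x s hx ih =>
          rw [Finset.sum_insert hx, Finset.sum_insert hx]
          exact ((hp x).mul_left _).add ih
      exact this _
    have c2 : B ^ 7 - 1 ∣ (∑ i ∈ Finset.range 7, b i * B ^ i) * (B - 1) :=
      (Nat.modEq_zero_iff_dvd).1 ((c1.mul_right _).trans z1)
    have c3 : B ^ 7 - 1 = (∑ i ∈ Finset.range 7, B ^ i) * (B - 1) := by
      have := Nat.geomSum_eq hB2 7
      rw [this, Nat.div_mul_cancel]
      simpa using Nat.sub_dvd_pow_sub_pow B 1 7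
    rw [c3] at c2
    exact Nat.dvd_of_mul_dvd_mul_right (by omega) c2
  have hall := digits_eq_of_dvd b hs hdvd
  have hgeom : ∑ i ∈ Finset.range 7, q ^ i = 0 := hq.geom_sum_eq_zero (by norm_num)
  have := sum_coeff_mod_seven p (fun i => q ^ i)
  rw [Polynomial.eval₂_eq_sum, Polynomial.sum]
  calc ∑ m ∈ p.support, (Nat.castRingHom k) (p.coeff m) * q ^ m
      = ∑ m ∈ p.support, (p.coeff m : k) * q ^ (m % 7) := by
        refine Finset.sum_congr rfl fun m _ => ?_
        rw [← pow_mod_orderOf q m, ← hq.eq_orderOf]; rfl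
    _ = ∑ i ∈ Finset.range 7, (b i : k) * q ^ i := this
    _ = ∑ i ∈ Finset.range 7, (b 0 : k) * q ^ i :=
        Finset.sum_congr rfl fun i hi => by rw [hall i (Finset.mem_range.1 hi)]
    _ = 0 := by rw [← Finset.mul_sum, hgeom, mul_zero]

end Rep

/-! ### Normal forms of vectors -/

/-- A tree encodes a linear combination of ordered monomials in letters `L 0, L 1, …` applied to a
fixed vector `ξ`: `leaf a` is a multiple of `ξ`, and `node i t r` is `t + L i r`. -/
inductive Tree
  | nil
  | leaf (a : Packed)
  | node (i : ℕ) (t r : Tree)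

namespace Tree

/-- The tree of `a t`. -/
def smul (a : Packed) : Tree → Tree :=
  Tree.rec .nil (fun b => .leaf (a.mul b)) (fun i _ _ t r => .node i t r)

/-- The sum of two trees. -/
def add (t : Tree) : Tree → Tree :=
  Tree.rec (motive := fun _ => Tree → Tree) (fun u => u)
    (fun a u => Tree.rec (motive := fun _ => Tree) (.leaf a) (fun b => .leaf (a.add b))
      (fun j _ r ih _ => .node j ih r) u)
    (fun i t r iht ihr u => Tree.rec (motive := fun _ => Tree) (.node i t r)
      (fun a => .node i (iht (.leaf a)) r)
      (fun j t' r' ih _ => bif Nat.blt j i then .node j ih r' else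
        bif Nat.beq i j then .node i (iht t') (ihr r') else .node i (iht (.node j t' r')) r) u) t

/-- The test that all coefficients are `0`. -/
def isZero : Tree → Bool :=
  Tree.rec true (fun a => a.isZero) (fun _ _ _ t r => t && r)

/-- The entry number `n` of a list. -/
def nth {α : Type} (d : α) : List α → ℕ → α :=
  List.rec (fun _ => d) (fun a _ ih n => Nat.rec a (fun m _ => ih m) n)

/-- A linear combination of words; a coefficient is the list of the coefficients of a polynomial
in `q`. -/
abbrev Comb := List (List ℕ × List ℕ)

/-- The word `w` times the tree `t` of a vector, times `a`, where `lm` multiplies by a letter. -/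
def word (lm : Packed → ℕ → Tree → Tree) (a : Packed) : List ℕ → Tree → Tree
  | [], t => t.smul a
  | [g], t => lm a g t
  | g :: w, t => lm ⟨1, 1⟩ g (word lm a w t)

/-- The linear combination `es` times the tree `t`, times `a`. -/
def comb (lm : Packed → ℕ → Tree → Tree) (a : Packed) (t : Tree) : Comb → Tree :=
  List.rec .nil (fun e _ ih => add (word lm (a.mul (Packed.ofList e.1)) e.2 t) ih)

/-- The letter `g` times a tree, times `a`. The entry `(j, i)` of `tb` is the normal form of
`L j * L i` for `i < j`. The recursion depth is bounded by the first argument; when it is exhausted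
the product is left unordered, so that the result represents the right vector in any case. -/
def lmul (tb : List (List Comb)) : ℕ → Packed → ℕ → Tree → Tree
  | 0, a, g, t => .node g .nil (t.smul a)
  | f + 1, a, g, t => Tree.rec (motive := fun _ => Tree) .nil
      (fun b => .node g .nil (.leaf (a.mul b)))
      (fun i t r _ _ => bif Nat.ble g i then .node g .nil ((Tree.node i t r).smul a) else
        add (lmul tb f a g t) (comb (lmul tb f) a r (nth [] (nth [] tb g) i))) t

end Tree

section Semantics
variable {k M : Type*} [Field k] [AddCommGroup M] [Module k M]

/-- The operator given by a word in the letters `L`. -/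
def wordOp (L : ℕ → Module.End k M) (w : List ℕ) : Module.End k M := (w.map L).prod

/-- The operator given by a linear combination of words. -/
def combOp (q : k) (L : ℕ → Module.End k M) (es : Tree.Comb) : Module.End k M :=
  (es.map fun e => listVal q e.1 • wordOp L e.2).sum

namespace Tree

/-- The tree `t` represents the vector `m`. -/
inductive Rep (q : k) (L : ℕ → Module.End k M) (ξ : M) : Tree → M → Prop
  | nil : Rep q L ξ .nil 0
  | leaf {a : Packed} {s : k} (h : a.Rep q s) : Rep q L ξ (.leaf a) (s • ξ)
  | node {i : ℕ} {t r : Tree} {m m' : M} (ht : Rep q L ξ t m) (hr : Rep q L ξ r m') :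
      Rep q L ξ (.node i t r) (m + L i m')

variable {q : k} {L : ℕ → Module.End k M} {ξ : M}

lemma Rep.smul {t : Tree} {m : M} (h : Rep q L ξ t m) {a : Packed} {s : k} (ha : a.Rep q s) :
    Rep q L ξ (t.smul a) (s • m) := by
  induction h with
  | nil => rw [smul_zero]; exact .nil
  | leaf h => rw [smul_smul]; exact .leaf (ha.mul h)
  | node _ _ iht ihr => rw [smul_add, ← map_smul]; exact .node iht ihr

lemma Rep.add {t u : Tree} {m m' : M} (h : Rep q L ξ t m) (h' : Rep q L ξ u m') :
    Rep q L ξ (t.add u) (m + m') := by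
  induction h generalizing u m' with
  | nil => rw [zero_add]; exact h'
  | leaf h =>
    induction h' with
    | nil => rw [add_zero]; exact .leaf h
    | leaf h' => rw [← add_smul]; exact .leaf (h.add h')
    | node ht hr iht _ => rw [← add_assoc]; exact .node iht hr
  | @node i t r m₁ m₂ ht hr iht ihr =>
    induction h' with
    | nil => rw [add_zero]; exact .node ht hr
    | leaf h' => rw [add_right_comm]; exact .node (iht (.leaf h')) hr
    | @node j t' r' m₃ m₄ ht' hr' iht' _ =>
      change Rep q L ξ (bif Nat.blt j i then _ else bif Nat.beq i j then _ else _) _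
      cases e : Nat.blt j i with
      | true => rw [← add_assoc]; exact .node iht' hr'
      | false =>
        cases e' : Nat.beq i j with
        | true =>
          obtain rfl := Nat.eq_of_beq_eq_true e'
          have := Rep.node (i := i) (iht ht') (ihr hr')
          rw [map_add, add_add_add_comm] at this
          exact this
        | false =>
          rw [add_right_comm]
          exact .node (iht (.node ht' hr')) hr

lemma Rep.eq_zero (hq : IsPrimitiveRoot q 7) {t : Tree} {m : M} (h : Rep q L ξ t m)
    (h0 : t.isZero = true) : m = 0 := by
  induction h with
  | nil => rfl
  | leaf h => rw [h.eq_zero hq h0, zero_smul]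
  | node _ _ iht ihr =>
    have := (Bool.and_eq_true _ _).mp h0
    rw [iht this.1, ihr this.2, map_zero, add_zero]

lemma Rep.word {lm : Packed → ℕ → Tree → Tree}
    (hlm : ∀ {a : Packed} {s : k} (g : ℕ) {t : Tree} {m : M}, a.Rep q s → Rep q L ξ t m →
      Rep q L ξ (lm a g t) (s • L g m))
    {a : Packed} {s : k} (ha : a.Rep q s) (w : List ℕ) {t : Tree} {m : M} (h : Rep q L ξ t m) :
    Rep q L ξ (word lm a w t) (s • wordOp L w m) := by
  induction w with
  | nil => exact h.smul ha
  | cons g w ih =>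
    cases w with
    | nil =>
      have : wordOp L [g] = L g := by simp [wordOp]
      rw [this]; exact hlm g ha h
    | cons g' w =>
      have := hlm g (Packed.rep_one q) ih
      rw [one_smul, map_smul] at this
      exact this

lemma Rep.comb {lm : Packed → ℕ → Tree → Tree}
    (hlm : ∀ {a : Packed} {s : k} (g : ℕ) {t : Tree} {m : M}, a.Rep q s → Rep q L ξ t m →
      Rep q L ξ (lm a g t) (s • L g m))
    {a : Packed} {s : k} (ha : a.Rep q s) (es : Comb) {t : Tree} {m : M} (h : Rep q L ξ t m) :
    Rep q L ξ (comb lm a t es) (s • combOp q L es m) := by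
  induction es with
  | nil => simp only [combOp, List.map_nil, List.sum_nil, LinearMap.zero_apply, smul_zero]
           exact .nil
  | cons e es ih =>
    have : combOp q L (e :: es) = listVal q e.1 • wordOp L e.2 + combOp q L es := by
      simp [combOp]
    rw [this, LinearMap.add_apply, smul_add, LinearMap.smul_apply, smul_smul]
    exact (Rep.word hlm (ha.mul (Packed.rep_ofList q e.1)) e.2 h).add ih

lemma Rep.lmul {tb : List (List Comb)}
    (htb : ∀ i j, i < j → L j * L i = combOp q L (nth [] (nth [] tb j) i)) (f : ℕ) :
    ∀ {a : Packed} {s : k} (g : ℕ) {t : Tree} {m : M}, a.Rep q s → Rep q L ξ t m →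
      Rep q L ξ (lmul tb f a g t) (s • L g m) := by
  induction f with
  | zero =>
    intro a s g t m ha h
    have := Rep.node (i := g) Rep.nil (h.smul ha)
    rwa [zero_add, map_smul] at this
  | succ f ih =>
    intro a s g t m ha h
    induction h with
    | nil => rw [map_zero, smul_zero]; exact .nil
    | @leaf b s' h =>
      have := Rep.node (L := L) (ξ := ξ) (i := g) Rep.nil (.leaf (ha.mul h))
      rwa [zero_add, mul_smul, map_smul] at this
    | @node i t r m₁ m₂ ht hr _ _ =>
      change Rep q L ξ (bif Nat.ble g i then _ else _) _
      cases e : Nat.ble g i with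
      | true =>
        have := Rep.node (i := g) Rep.nil ((Rep.node (i := i) ht hr).smul ha)
        rwa [zero_add, map_smul] at this
      | false =>
        have hgi : i < g := by
          by_contra hh
          push Not at hh
          rw [Nat.ble_eq_true_of_le hh] at e
          exact absurd e (by simp)
        have := (ih g ha ht).add (Rep.comb ih ha (nth [] (nth [] tb g) i) hr)
        rw [← htb i g hgi] at this
        rw [map_add, smul_add]
        exact this

end Tree

/-! ### Truncated states: polynomials in a further letter `d` -/

/-- A list of trees `t₀, t₁, …` encodes the vector `t₀ + d t₁ + d² t₂ + ⋯`. -/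
abbrev DState := List Tree

namespace DState

/-- The state `D` represents the vector `m`. -/
inductive Rep (q : k) (L : ℕ → Module.End k M) (ξ : M) (d : Module.End k M) : DState → M → Prop
  | nil : Rep q L ξ d [] 0
  | cons {t : Tree} {D : DState} {m m' : M} (ht : t.Rep q L ξ m) (hD : Rep q L ξ d D m') :
      Rep q L ξ d (t :: D) (m + d m')

/-- The state of `d ^ n m`. -/
def shift : ℕ → DState → DState
  | 0, D => D
  | n + 1, D => .nil :: shift n D

/-- The state of `a m`. -/
def smul (a : Packed) : DState → DState :=
  List.rec [] (fun t _ ih => t.smul a :: ih)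

/-- The sum of two states. -/
def add (D : DState) : DState → DState :=
  List.rec (motive := fun _ => DState → DState) (fun D' => D')
    (fun t D ih D' => List.rec (motive := fun _ => DState) (t :: D)
      (fun t' D' _ => t.add t' :: ih D') D') D

/-- The test that all coefficients are `0`. -/
def isZero : DState → Bool := List.rec true (fun t _ ih => t.isZero && ih)

/-- The letter number `g` times a state, for a letter with `L g d = ε d (L g)`. The first argument
is the multiplication of trees by `L g`, and `a` is a scalar. -/
def letter (lm : Packed → Tree → Tree) (ε : Packed) (a : Packed) (D : DState) : DState :=
  List.rec (motive := fun _ => Packed → DState) (fun _ => [])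
    (fun t _ ih a => lm a t :: ih (a.mul ε)) D a

/-- The list of coefficients of `1 - q ^ (-n)`, for `0 < n < 7`. -/
def lowerList : List (List ℕ) :=
  [[], [2, 1, 1, 1, 1, 1], [2, 1, 1, 1, 1, 0, 1], [2, 1, 1, 1, 0, 1, 1], [2, 1, 1, 0, 1, 1, 1],
    [2, 1, 0, 1, 1, 1, 1], [2, 0, 1, 1, 1, 1, 1]]

/-- The tree number `i` is multiplied by `1 - q ^ (-(n + i))`. -/
def lowerScale (n : ℕ) (D : DState) : DState :=
  List.rec (motive := fun _ => ℕ → DState) (fun _ => [])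
    (fun t _ ih n => (bif Nat.beq (n % 7) 0 then .nil else
      t.smul (Packed.ofList (Tree.nth [] lowerList (n % 7)))) :: ih (n + 1)) D n

/-- The action of the lowering operator `X`, a `q`-derivative with respect to `d`. -/
def lower (D : DState) : DState := List.rec [] (fun _ D _ => lowerScale 1 D) D

variable {q : k} {L : ℕ → Module.End k M} {ξ : M} {d : Module.End k M}

lemma Rep.shift {D : DState} {m : M} (h : Rep q L ξ d D m) (n : ℕ) :
    Rep q L ξ d (DState.shift n D) ((d ^ n) m) := by
  induction n with
  | zero => exact h
  | succ n ih =>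
    have := Rep.cons Tree.Rep.nil ih
    rwa [zero_add, ← Module.End.mul_apply, ← pow_succ'] at this

lemma Rep.smul {D : DState} {m : M} (h : Rep q L ξ d D m) {a : Packed} {s : k} (ha : a.Rep q s) :
    Rep q L ξ d (D.smul a) (s • m) := by
  induction h with
  | nil => rw [smul_zero]; exact .nil
  | cons ht _ ih => rw [smul_add, ← map_smul]; exact .cons (ht.smul ha) ih

lemma Rep.add {D D' : DState} {m m' : M} (h : Rep q L ξ d D m) (h' : Rep q L ξ d D' m') :
    Rep q L ξ d (DState.add D D') (m + m') := by
  induction h generalizing D' m' with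
  | nil => rw [zero_add]; exact h'
  | cons ht hD ih =>
    cases h' with
    | nil => rw [add_zero]; exact .cons ht hD
    | cons ht' hD' =>
      have := Rep.cons (ht.add ht') (ih hD')
      rw [map_add, add_add_add_comm] at this
      exact this

lemma Rep.eq_zero (hq : IsPrimitiveRoot q 7) {D : DState} {m : M} (h : Rep q L ξ d D m)
    (h0 : D.isZero = true) : m = 0 := by
  induction h with
  | nil => rfl
  | cons ht _ ih =>
    have := (Bool.and_eq_true _ _).mp h0
    rw [ht.eq_zero hq this.1, ih this.2, map_zero, add_zero]

lemma Rep.letter {g : ℕ} {lm : Packed → Tree → Tree}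
    (hlm : ∀ {a : Packed} {s : k} {t : Tree} {m : M}, a.Rep q s → t.Rep q L ξ m →
      (lm a t).Rep q L ξ (s • L g m))
    {ε : Packed} {e : k} (hε : ε.Rep q e) (hd : L g * d = e • (d * L g))
    {a : Packed} {s : k} (ha : a.Rep q s) {D : DState} {m : M} (h : Rep q L ξ d D m) :
    Rep q L ξ d (DState.letter lm ε a D) (s • L g m) := by
  induction h generalizing a s with
  | nil => rw [map_zero, smul_zero]; exact .nil
  | @cons t D m m' ht hD ih =>
    have := Rep.cons (hlm ha ht) (ih (ha.mul hε))
    have e1 : L g (d m') = e • d (L g m') := LinearMap.congr_fun hd m'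
    rw [map_add, smul_add, e1, ← map_smul d e, ← map_smul d s, smul_smul]
    exact this

lemma listVal_lowerList (hq : IsPrimitiveRoot q 7) (n : ℕ) (hn : n % 7 ≠ 0) :
    listVal q (Tree.nth [] lowerList (n % 7)) = 1 - q ^ (6 * n) := by
  have h7 := hq.pow_eq_one
  have hΦ : ∑ i ∈ Finset.range 7, q ^ i = 0 := hq.geom_sum_eq_zero (by norm_num)
  simp only [Finset.sum_range_succ, Finset.sum_range_zero, zero_add, pow_zero, pow_one] at hΦ
  have e : q ^ (6 * n) = q ^ (6 * (n % 7)) := by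
    conv_lhs => rw [← Nat.mod_add_div n 7, mul_add, pow_add, mul_left_comm, pow_mul q 7, h7,
      one_pow, mul_one]
  rw [e]
  have hlt := Nat.mod_lt n (show 7 > 0 by norm_num)
  generalize n % 7 = j at *
  interval_cases j
  · exact absurd rfl hn
  all_goals
    simp only [lowerList, Tree.nth, listVal, List.foldr]
    push_cast
    grind

/-- `m ↦ (1 - q^{-n}) m + q^{-n} d X m` multiplies the component `d^i m_i` by `1 - q^{-(n+i)}`. -/
lemma Rep.lowerScale (hq : IsPrimitiveRoot q 7) {X : Module.End k M}
    (hXd : X * d = q ^ 6 • (d * X) + (1 - q ^ 6) • 1)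
    (hX : ∀ {t : Tree} {m : M}, t.Rep q L ξ m → X m = 0) (n : ℕ) {D : DState} {m : M}
    (h : Rep q L ξ d D m) :
    Rep q L ξ d (lowerScale n D) ((1 - q ^ (6 * n)) • m + q ^ (6 * n) • d (X m)) := by
  induction h generalizing n with
  | nil => simp only [map_zero, smul_zero, add_zero]; exact .nil
  | @cons t D m m' ht hD ih =>
    have e1 : X (d m') = q ^ 6 • d (X m') + (1 - q ^ 6) • m' := LinearMap.congr_fun hXd m'
    have e2 : (1 - q ^ (6 * n)) • (m + d m') + q ^ (6 * n) • d (X (m + d m')) =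
        (1 - q ^ (6 * n)) • m +
          d ((1 - q ^ (6 * (n + 1))) • m' + q ^ (6 * (n + 1)) • d (X m')) := by
      rw [map_add, hX ht, e1]
      simp only [map_add, map_smul, zero_add, smul_add, smul_smul]
      rw [mul_add 6, pow_add]
      module
    rw [e2]
    refine .cons ?_ (ih (n + 1))
    cases e : Nat.beq (n % 7) 0 with
    | true =>
      have hn : n % 7 = 0 := Nat.eq_of_beq_eq_true e
      have : q ^ (6 * n) = 1 := by
        obtain ⟨c, rfl⟩ := Nat.dvd_of_mod_eq_zero hn
        rw [mul_left_comm, pow_mul, hq.pow_eq_one, one_pow]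
      rw [this, sub_self, zero_smul]
      exact .nil
    | false =>
      have hn : n % 7 ≠ 0 := Nat.ne_of_beq_eq_false e
      exact ht.smul (listVal_lowerList hq n hn ▸ Packed.rep_ofList q _)

lemma Rep.lower (hq : IsPrimitiveRoot q 7) {X : Module.End k M}
    (hXd : X * d = q ^ 6 • (d * X) + (1 - q ^ 6) • 1)
    (hX : ∀ {t : Tree} {m : M}, t.Rep q L ξ m → X m = 0) {D : DState} {m : M}
    (h : Rep q L ξ d D m) : Rep q L ξ d (DState.lower D) (X m) := by
  cases h with
  | nil => rw [map_zero]; exact .nil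
  | @cons t D m m' ht hD =>
    have e1 : X (d m') = q ^ 6 • d (X m') + (1 - q ^ 6) • m' := LinearMap.congr_fun hXd m'
    rw [map_add, hX ht, zero_add, e1, add_comm]
    exact Rep.lowerScale hq hXd hX 1 hD

end DState

/-! ### Operator expressions -/

/-- Expressions for operators built from letters `L i`, the lowering operator `X` and the raising
operator `d`; each constructor acts after the operator it is applied to. -/
inductive Expr
  | one
  | letter (i : ℕ) (e : Expr)
  | lower (e : Expr)
  | shift (n : ℕ) (e : Expr)
  | smul (l : List ℕ) (e : Expr)
  | add (e e' : Expr)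
  | comp (e e' : Expr)

namespace Expr

/-- The operator of an expression. -/
def op (q : k) (L : ℕ → Module.End k M) (d X : Module.End k M) : Expr → Module.End k M
  | .one => 1
  | .letter i e => L i * op q L d X e
  | .lower e => X * op q L d X e
  | .shift n e => d ^ n * op q L d X e
  | .smul l e => listVal q l • op q L d X e
  | .add e e' => op q L d X e + op q L d X e'
  | .comp e e' => op q L d X e * op q L d X e'

/-- The action of an expression on states. The entry number `i` of `εs` is the scalar by which the
letters `L i` and `d` commute. The number `200` bounds the recursion depth of `Tree.lmul`. -/
def run (tb : List (List Tree.Comb)) (εs : List (List ℕ)) : Expr → DState → DState :=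
  Expr.rec (fun D => D)
    (fun i _ ih D => DState.letter (fun a t => Tree.lmul tb 200 a i t)
      (Packed.ofList (Tree.nth [] εs i)) ⟨1, 1⟩ (ih D))
    (fun _ ih D => DState.lower (ih D))
    (fun n _ ih D => DState.shift n (ih D))
    (fun l _ ih D => DState.smul (Packed.ofList l) (ih D))
    (fun _ _ ih ih' D => DState.add (ih D) (ih' D))
    (fun _ _ ih ih' D => ih (ih' D))

/-- The expression of a power. -/
def pow (e : Expr) (n : ℕ) : Expr := Nat.rec .one (fun _ r => .comp e r) n

lemma op_pow (q : k) (L : ℕ → Module.End k M) (d X : Module.End k M) (e : Expr) (n : ℕ) :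
    (pow e n).op q L d X = e.op q L d X ^ n := by
  induction n with
  | zero => rfl
  | succ n ih => rw [pow_succ', ← ih]; rfl

lemma rep_run {q : k} (hq : IsPrimitiveRoot q 7) {L : ℕ → Module.End k M} {ξ : M}
    {d X : Module.End k M} {tb : List (List Tree.Comb)} {εs : List (List ℕ)} {c : ℕ → k}
    (htb : ∀ i j, i < j → L j * L i = combOp q L (Tree.nth [] (Tree.nth [] tb j) i))
    (hd : ∀ i, L i * d = listVal q (Tree.nth [] εs i) • (d * L i))
    (hXd : X * d = q ^ 6 • (d * X) + (1 - q ^ 6) • 1)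
    (hXL : ∀ i, X * L i = c i • (L i * X)) (hξ : X ξ = 0) (e : Expr) {D : DState} {m : M}
    (h : D.Rep q L ξ d m) : (e.run tb εs D).Rep q L ξ d (e.op q L d X m) := by
  have hX : ∀ {t : Tree} {m : M}, t.Rep q L ξ m → X m = 0 := by
    intro t m ht
    induction ht with
    | nil => exact map_zero _
    | leaf _ => rw [map_smul, hξ, smul_zero]
    | @node i _ _ m m' _ _ ih ih' =>
      have := LinearMap.congr_fun (hXL i) m'
      simp only [Module.End.mul_apply, LinearMap.smul_apply] at this
      rw [map_add, ih, this, ih', map_zero, smul_zero, add_zero]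
  induction e generalizing D m with
  | one => exact h
  | letter i e ih =>
    have := (ih h).letter (g := i) (lm := fun a t => Tree.lmul tb 200 a i t)
      (fun ha ht => Tree.Rep.lmul htb 200 i ha ht)
      (Packed.rep_ofList q (Tree.nth [] εs i)) (hd i) (Packed.rep_one q)
    rwa [one_smul] at this
  | lower e ih => exact (ih h).lower hq hXd hX
  | shift n e ih => exact (ih h).shift n
  | smul l e ih => exact (ih h).smul (Packed.rep_ofList q l)
  | add e e' ih ih' => exact (ih h).add (ih' h)
  | comp e e' ih ih' => exact ih (ih' h)

/-- The test which shows that the operator of an expression kills a vector `ξ` with `X ξ = 0`. -/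
def kills (tb : List (List Tree.Comb)) (εs : List (List ℕ)) (e : Expr) : Bool :=
  (e.run tb εs [.leaf ⟨1, 1⟩]).isZero

lemma op_apply_eq_zero {q : k} (hq : IsPrimitiveRoot q 7) {L : ℕ → Module.End k M} {ξ : M}
    {d X : Module.End k M} {tb : List (List Tree.Comb)} {εs : List (List ℕ)} {c : ℕ → k}
    (htb : ∀ i j, i < j → L j * L i = combOp q L (Tree.nth [] (Tree.nth [] tb j) i))
    (hd : ∀ i, L i * d = listVal q (Tree.nth [] εs i) • (d * L i))
    (hXd : X * d = q ^ 6 • (d * X) + (1 - q ^ 6) • 1)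
    (hXL : ∀ i, X * L i = c i • (L i * X)) (hξ : X ξ = 0) {e : Expr}
    (he : e.kills tb εs = true) : e.op q L d X ξ = 0 := by
  have h : DState.Rep q L ξ d [.leaf ⟨1, 1⟩] ξ := by
    have := DState.Rep.cons (d := d) (Tree.Rep.leaf (L := L) (ξ := ξ) (Packed.rep_one q)) .nil
    simpa using this
  exact (rep_run hq htb hd hXd hXL hξ e h).eq_zero hq he

end Expr

end Semantics

/-! ### The two reduction steps as expressions -/

/-- The normal forms of the products of the letters `g, z₀, z₁, b, z₂, z₃`, where `g` is a scalar
operator and `z₀, z₁, z₂, z₃, b` are the root vectors of degrees `α₂, α₁ + α₂, 2α₁ + α₂, 3α₁ + α₂,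
3α₁ + 2α₂` of a pair with the undeformed Serre relations. -/
def tableScalar : List (List Tree.Comb) :=
  [[],
    [[([1], [0, 1])]],
    [[([1], [0, 2])], [([0, 0, 0, 0, 0, 0, 1], [1, 2])]],
    [[([1], [0, 3])], [([0, 1], [1, 3]), ([1, 1, 2, 0, 0, 2, 1], [2, 2, 2])],
        [([0, 0, 0, 0, 0, 0, 1], [2, 3])]],
    [[([1], [0, 4])], [([0, 0, 1], [1, 4]), ([1, 1, 1, 1, 0, 1, 2], [2, 2])], [([0, 0, 0, 0, 0, 1],
        [2, 4]), ([1], [3])], [([0, 0, 0, 0, 0, 0, 1], [3, 4])]],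
    [[([1], [0, 5])], [([1, 0, 1, 1, 2, 1, 1], [2, 4]), ([0, 0, 0, 0, 0, 1], [1, 5]),
        ([1, 1, 1, 1, 0, 0, 2], [3])], [([2, 0, 2, 0, 1, 1, 1], [4, 4]), ([0, 0, 1], [2, 5])],
        [([0, 1], [3, 5]), ([0, 4, 1, 2, 2, 1, 4], [4, 4, 4])], [([0, 0, 0, 0, 0, 0, 1], [4, 5])]]]

/-- The normal forms of the products of the letters `g, z₀, z₁, b, z₂, z₃`, where `g` has degree
`3α₁ + α₂`. -/
def tableBraided : List (List Tree.Comb) :=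
  [[],
    [[([0, 0, 0, 0, 0, 0, 1], [0, 1])]],
    [[([0, 0, 0, 0, 0, 1], [0, 2])], [([0, 0, 0, 0, 0, 0, 1], [1, 2])]],
    [[([0, 0, 1], [0, 3])], [([0, 1], [1, 3]), ([1, 1, 2, 0, 0, 2, 1], [2, 2, 2])],
        [([0, 0, 0, 0, 0, 0, 1], [2, 3])]],
    [[([0, 0, 0, 0, 1], [0, 4])], [([0, 0, 1], [1, 4]), ([1, 1, 1, 1, 0, 1, 2], [2, 2])],
        [([0, 0, 0, 0, 0, 1], [2, 4]), ([1], [3])], [([0, 0, 0, 0, 0, 0, 1], [3, 4])]],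
    [[([0, 0, 0, 1], [0, 5])], [([1, 0, 1, 1, 2, 1, 1], [2, 4]), ([0, 0, 0, 0, 0, 1], [1, 5]),
        ([1, 1, 1, 1, 0, 0, 2], [3])], [([2, 0, 2, 0, 1, 1, 1], [4, 4]), ([0, 0, 1], [2, 5])],
        [([0, 1], [3, 5]), ([0, 4, 1, 2, 2, 1, 4], [4, 4, 4])], [([0, 0, 0, 0, 0, 0, 1], [4, 5])]]]

namespace Expr

/-- The constants in the root vectors `z_j = c_j d^(m - j) g` and `b = c d^(2m - 3) g^2` for the
pair `X, d^m g`. -/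
abbrev Consts := List (List ℕ)

/-- The letter `g` after `e`. -/
def g (e : Expr) : Expr := .letter 0 e

/-- `z_j` for the pair `X, d^m g`. -/
def zu (m : ℕ) (cs : Consts) (j : ℕ) (e : Expr) : Expr :=
  .shift (m - j) (.smul (Tree.nth [] cs j) (.g e))

/-- `b` for the pair `X, d^m g`. -/
def bu (m : ℕ) (cs : Consts) (e : Expr) : Expr :=
  .shift (2 * m - 3) (.smul (Tree.nth [] cs 4) (.g (.g e)))

/-- The letter number `i` among `z₀, z₁, b, z₂, z₃`, after `e`. -/
def v (i : ℕ) (e : Expr) : Expr := .letter (i + 1) e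

/-! The root vectors `z₀, z₁, z₂, z₃, b` of the sum of the pair `X, d^m g` and a pair with root
vectors `v 0, v 1, v 3, v 4, v 2`. -/

/-- The root vector `z₀`, of degree `α₂`. -/
def z0 (m : ℕ) (cs : Consts) : Expr := .add (zu m cs 0 .one) (v 0 .one)

/-- The root vector `z₁`, of degree `α₁ + α₂`. -/
def z1 (m : ℕ) (cs : Consts) : Expr :=
  .add (zu m cs 1 .one) (.add (.lower (.smul [2, 1, 1, 1, 0, 1, 1] (v 0 .one))) (v 1 .one))

/-- The root vector `z₂`, of degree `2α₁ + α₂`. -/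
def z2 (m : ℕ) (cs : Consts) : Expr :=
  .add (zu m cs 2 .one) (.add (.lower (.add (.lower (.smul [2, 1, 2, 1, 0, 0, 1] (v 0 .one)))
    (.smul [2, 2, 1, 1, 1] (v 1 .one)))) (v 3 .one))

/-- The root vector `z₃`, of degree `3α₁ + α₂`. -/
def z3 (m : ℕ) (cs : Consts) : Expr :=
  .add (zu m cs 3 .one) (.add (.lower (.add (.lower (.add (.lower (.smul [2, 0, 2, 2, 1] (v 0
      .one)))
    (.smul [0, 1, 2, 1, 2, 1] (v 1 .one)))) (.smul [1, 1, 2, 1, 1, 1] (v 3 .one)))) (v 4 .one))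

/-- The root vector `b`, of degree `3α₁ + 2α₂`. -/
def b (m : ℕ) (cs : Consts) : Expr :=
  .add (bu m cs .one) (.add (zu m cs 2 (.add (.lower (.smul [2, 2, 3, 3, 2, 2] (v 0 .one)))
    (.smul [1, 1, 2, 1, 1, 1] (v 1 .one)))) (.add (zu m cs 3 (.smul [2, 0, 0, 0, 2, 1, 2] (v 0
        .one)))
    (.add (.lower (.add (.lower (.add (.lower (.smul [0, 2, 1, 4, 4, 1, 2] (v 0 (v 0 .one))))
      (.smul [1, 1, 3, 3, 4, 2] (v 0 (v 1 .one))))) (.smul [0, 1, 2, 1, 2, 1] (v 1 (v 1 .one))))) (v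
          2 .one))))

/-- The negative of `e`, as `(q + ⋯ + q ^ 6) e`. -/
def neg (e : Expr) : Expr := .smul [0, 1, 1, 1, 1, 1, 1] e

/-- `a d^n g^s e`. -/
def term (a : List ℕ) (n s : ℕ) (e : Expr) : Expr := .smul a (.shift n (.comp (pow (.g .one) s) e))

/-- The seventh power of the letter `v i`. -/
def vpow (i : ℕ) : Expr := pow (v i .one) 7

end Expr

/-! ### Certified identities for seventh powers -/

namespace Expr

/-- The constants for `m = 4` and a scalar `g`. -/
def constsScalar : Consts := [[1], [2, 1, 1, 0, 1, 1, 1], [3, 1, 1, 0, 0, 1, 1],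
    [4, 3, 3, 1, 1, 0, 2], [6, 6, 4, 0, 1, 0, 4]]

/-- The constants for `m = 3` and a twist `g` with `g d = q⁻¹ d g`. -/
def constsBraided : Consts := [[1], [2, 1, 1, 1, 0, 1, 1], [2, 1, 2, 1, 0, 0, 1], [2, 0, 2, 2, 1],
    [4, 4, 1, 2, 0, 2, 1]]

/-- The scalars by which the letters commute with `d`, for a scalar `g`. -/
def twistScalar : List (List ℕ) := [[1], [0, 0, 0, 0, 0, 0, 1], [0, 0, 0, 0, 0, 1], [0, 0, 1],
    [0, 0, 0, 0, 1], [0, 0, 0, 1]]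

/-- The scalars by which the letters commute with `d`, if `g d = q⁻¹ d g`. -/
def twistBraided : List (List ℕ) := [[0, 0, 0, 0, 0, 0, 1], [0, 0, 0, 0, 0, 0, 1],
    [0, 0, 0, 0, 0, 1], [0, 0, 1], [0, 0, 0, 0, 1], [0, 0, 0, 1]]

/-! Each of the lemmas says that, on every vector killed by `X`, the seventh power of a root vector
of the sum of the pair `X, d^m g` and the pair `v`, together with its deforming terms, agrees with
the seventh power of the root vector of `v` up to a multiple of `d^n g^s` and, for `b`, multiples of
the seventh powers of `v 0` and `v 1`. -/

lemma z0_scalar : kills tableScalar twistScalar (.add (pow (z0 4 constsScalar) 7)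
    (neg (.add (vpow 0) (term [1] 28 7 .one)))) = true := by
  decide +kernel

lemma z1_scalar : kills tableScalar twistScalar (.add (pow (z1 4 constsScalar) 7)
    (neg (.add (vpow 1) (term [35, 14, 0, 28, 42, 70, 56] 21 7 .one)))) = true := by
  decide +kernel

lemma z2_scalar : kills tableScalar twistScalar (.add (pow (z2 4 constsScalar) 7)
    (.add (term [147, 98, 49, 0, 49, 147, 196] 0 2 (.comp (pow (z1 4 constsScalar) 3)
        (b 4 constsScalar)))
    (.add (term [245, 196, 98, 0, 0, 98, 196] 0 2 (.comp (z0 4 constsScalar)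
        (pow (b 4 constsScalar) 2)))
    (.add (term [1715, 1029, 343, 0, 343, 1029, 1715] 0 3 (.comp (pow (z0 4 constsScalar) 2)
        (pow (z1 4 constsScalar) 2)))
    (.add (term [343, 0, 1715, 3773, 4802, 4116, 2058] 7 5 (.comp (z0 4 constsScalar)
        (z1 4 constsScalar)))
    (neg (.add (vpow 3) (term [32487, 28567, 15729, 2744, 0, 9212, 23422] 14 7 .one)))))))) = true
        := by
  decide +kernel

lemma z3_scalar : kills tableScalar twistScalar (.add (pow (z3 4 constsScalar) 7)
    (neg (.add (vpow 4) (term [73059, 14406, 0, 40474, 105644, 146118, 131712] 7 7 .one)))) = true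
        := by
  decide +kernel

lemma z0_braided : kills tableBraided twistBraided (.add (pow (z0 3 constsBraided) 7)
    (neg (.add (vpow 0) (term [1] 21 7 .one)))) = true := by
  decide +kernel

lemma z1_braided : kills tableBraided twistBraided (.add (pow (z1 3 constsBraided) 7)
    (neg (.add (vpow 1) (term [35, 56, 70, 42, 28, 0, 14] 14 7 .one)))) = true := by
  decide +kernel

lemma z2_braided : kills tableBraided twistBraided (.add (pow (z2 3 constsBraided) 7)
    (neg (.add (vpow 3) (term [1323, 1078, 490, 0, 0, 490, 1078] 7 7 .one)))) = true := by
  decide +kernel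

lemma z3_braided : kills tableBraided twistBraided (.add (pow (z3 3 constsBraided) 7)
    (neg (.add (vpow 4) (term [343, 686, 686, 0, 686] 0 7 .one)))) = true := by
  decide +kernel

lemma b_scalar : kills tableScalar twistScalar (.add (pow (b 4 constsScalar) 7)
    (neg (.add (vpow 2) (.add (term [0, 14406, 376957, 549829, 549829, 376957, 14406] 7 7 (vpow 0))
        (.add (term [9947, 0, 0, 3087, 16807, 19894, 19894] 14 7 (vpow 1))
      (term [0, 3022859, 9822491, 15272761, 15272761, 9822491, 3022859] 35 14 .one)))))) = true :=
          by
  decide +kernel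

lemma b_braided : kills tableBraided twistBraided (.add (pow (b 3 constsBraided) 7)
    (neg (.add (vpow 2) (.add (term [60025, 38416, 24010, 0, 0, 24010, 38416] 0 7 (vpow 0))
        (.add (term [1029, 2058, 2058, 0, 2058] 7 7 (vpow 1))
      (term [0, 21609, 36015, 60025, 60025, 36015, 21609] 21 14 .one)))))) = true := by
  decide +kernel

end Expr

/-! ### Commutation relations of the root vectors -/

set_option linter.unusedSimpArgs false
section VTable
variable {k A : Type*} [Field k] [Ring A] [Algebra k A]

lemma mul_mul_of_eq {x a a' : A} {c : k} (h : x * a = a' + c • (a * x)) (w : A) :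
    x * (a * w) = a' * w + c • (a * (x * w)) := by
  rw [← mul_assoc, h, add_mul, smul_mul_assoc, mul_assoc]

lemma mul_mul_of_eq' {x a a' : A} (h : x * a = a') (w : A) : x * (a * w) = a' * w := by
  rw [← mul_assoc, h]

set_option maxHeartbeats 1000000 in
/-- The commutation relations of the root vectors `z₀, z₁, z₂, z₃, b` follow from the Serre
relations: each of them is obtained by applying the braided derivation `[y, ·]_c` to a previous
one. -/
theorem root_vector_relations {q : k} (hq : IsPrimitiveRoot q 7) {y z0 z1 z2 z3 b : A}
    (hy0 : y * z0 = z1 + q ^ 3 • (z0 * y)) (hy1 : y * z1 = z2 + q ^ 4 • (z1 * y))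
    (hy2 : y * z2 = z3 + q ^ 5 • (z2 * y)) (hy3 : y * z3 = q ^ 6 • (z3 * y))
    (h10 : z1 * z0 = q ^ 6 • (z0 * z1)) (h21 : z2 * z1 = q ^ 5 • (z1 * z2) + b) :
    (z2 * z0 = q ^ 2 • (z0 * z2) + (q ^ 6 - q ^ 4) • (z1 * z1) ∧
    z3 * z0 = q ^ 5 • (z0 * z3) + (q ^ 4 - q) • (z1 * z2) +
      (-1 - q - q ^ 2 - q ^ 3 - 2 * q ^ 4 - 2 * q ^ 5) • b ∧
    z3 * z1 = q ^ 2 • (z1 * z3) + (1 - q + q ^ 2 - q ^ 3) • (z2 * z2) ∧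
    z3 * z2 = q ^ 6 • (z2 * z3)) ∧
    b * z0 = q • (z0 * b) + ((q ^ 6 - q ^ 4) * (q ^ 6 - q ^ 5)) • (z1 * (z1 * z1)) ∧
    b * z1 = q ^ 6 • (z1 * b) ∧ z2 * b = q ^ 6 • (b * z2) ∧
    z3 * b = q • (b * z3) + ((q ^ 6 - q ^ 5) * (1 - q + q ^ 2 - q ^ 3)) • (z2 * (z2 * z2)) := by
  have hΦ : ∑ i ∈ Finset.range 7, q ^ i = 0 := hq.geom_sum_eq_zero (by norm_num)
  simp only [Finset.sum_range_succ, Finset.sum_range_zero, zero_add, pow_zero, pow_one] at hΦ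
  have my0 := mul_mul_of_eq hy0
  have my1 := mul_mul_of_eq hy1
  have my2 := mul_mul_of_eq hy2
  have my3 := mul_mul_of_eq' hy3
  have m10 := mul_mul_of_eq' h10
  have m21 := mul_mul_of_eq' h21
  have h20 : z2 * z0 = q ^ 2 • (z0 * z2) + (q ^ 6 - q ^ 4) • (z1 * z1) := by
    have := congrArg (y * ·) h10
    simp only [my0, my1, mul_smul_comm, smul_mul_assoc, hy0, hy1, mul_add, m10, mul_assoc] at this
    linear_combination (norm := (match_scalars <;> clear * - hΦ <;> grind)) this
  have m20 := mul_mul_of_eq' h20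
  have h30 : z3 * z0 = q ^ 5 • (z0 * z3) + (q ^ 4 - q) • (z1 * z2) +
      (-1 - q - q ^ 2 - q ^ 3 - 2 * q ^ 4 - 2 * q ^ 5) • b := by
    have := congrArg (y * ·) h20
    simp only [my0, my1, my2, mul_smul_comm, smul_mul_assoc, hy0, hy1, hy2, mul_add, add_mul, m20,
      h21, mul_assoc] at this
    linear_combination (norm := (match_scalars <;> clear * - hΦ <;> grind)) this
  have hyb' : y * b = (z3 * z1 - q ^ 2 • (z1 * z3)) + q ^ 2 • (b * y) := by
    have e : b = z2 * z1 - q ^ 5 • (z1 * z2) := by rw [h21]; abel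
    rw [e]
    simp only [my1, my2, mul_smul_comm, smul_mul_assoc, hy1, hy2, mul_add, mul_sub, sub_mul,
      mul_assoc]
    match_scalars <;> clear * - hΦ <;> grind
  have m30 := mul_mul_of_eq' h30
  have h31 : z3 * z1 = q ^ 2 • (z1 * z3) + (1 - q + q ^ 2 - q ^ 3) • (z2 * z2) := by
    have := congrArg (y * ·) h30
    simp only [my0, my1, my2, my3, mul_smul_comm, smul_mul_assoc, hy0, hy1, hy2, hy3, hyb',
      mul_add, add_mul, mul_sub, sub_mul, m30, h21, mul_assoc] at this
    linear_combination (norm := (match_scalars <;> clear * - hΦ <;> grind))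
      (1 + q ^ 2 + q ^ 3 + q ^ 5) • this
  have m31 := mul_mul_of_eq' h31
  have hyb : y * b = (1 - q + q ^ 2 - q ^ 3) • (z2 * z2) + q ^ 2 • (b * y) := by
    rw [hyb', h31]; abel
  have myb := mul_mul_of_eq hyb
  have h32 : z3 * z2 = q ^ 6 • (z2 * z3) := by
    have := congrArg (y * ·) h31
    simp only [my0, my1, my2, my3, mul_smul_comm, smul_mul_assoc, hy0, hy1, hy2, hy3, hyb',
      mul_add, add_mul, mul_sub, sub_mul, m31, h21, mul_assoc] at this
    linear_combination (norm := (match_scalars <;> clear * - hΦ <;> grind))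
      (1 + 2 * q + q ^ 2 + q ^ 3 + 2 * q ^ 4 + q ^ 5) • this
  have hb0 : b * z0 = q • (z0 * b) +
      ((q ^ 6 - q ^ 4) * (q ^ 6 - q ^ 5)) • (z1 * (z1 * z1)) := by
    have e : b = z2 * z1 - q ^ 5 • (z1 * z2) := by rw [h21]; abel
    rw [e]
    simp only [mul_smul_comm, smul_mul_assoc, mul_sub, sub_mul, mul_add, add_mul, mul_assoc, h10,
      h20, m10, m20]
    match_scalars <;> clear * - hΦ <;> grind
  have mb0 := mul_mul_of_eq' hb0
  have hb1 : b * z1 = q ^ 6 • (z1 * b) := by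
    have := congrArg (y * ·) hb0
    simp only [my0, my1, my2, my3, myb, mul_smul_comm, smul_mul_assoc, hy0, hy1, hy2, hy3, hyb,
      mul_add, add_mul, mb0, m21, h21, h20, m20, mul_assoc] at this
    linear_combination (norm := (match_scalars <;> clear * - hΦ <;> grind))
      (-1 - 2 * q - 2 * q ^ 2 - q ^ 3) • this
  have mb1 := mul_mul_of_eq' hb1
  have h2b : z2 * b = q ^ 6 • (b * z2) := by
    have := congrArg (y * ·) hb1
    simp only [my0, my1, my2, my3, myb, mul_smul_comm, smul_mul_assoc, hy0, hy1, hy2, hy3, hyb,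
      mul_add, add_mul, mb1, m21, h21, h20, m20, mul_assoc] at this
    linear_combination (norm := (match_scalars <;> clear * - hΦ <;> grind))
      (-1 - 2 * q - q ^ 2 - q ^ 3 - 2 * q ^ 4 - q ^ 5) • this
  have m2b := mul_mul_of_eq' h2b
  have h3b : z3 * b = q • (b * z3) +
      ((q ^ 6 - q ^ 5) * (1 - q + q ^ 2 - q ^ 3)) • (z2 * (z2 * z2)) := by
    have := congrArg (y * ·) h2b
    simp only [my0, my1, my2, my3, myb, mul_smul_comm, smul_mul_assoc, hy0, hy1, hy2, hy3, hyb,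
      mul_add, add_mul, m2b, mul_assoc] at this
    linear_combination (norm := (match_scalars <;> clear * - hΦ <;> grind)) this
  exact ⟨⟨h20, h30, h31, h32⟩, hb0, hb1, h2b, h3b⟩

/-- The bicharacter `q ^ ((a₀ + a₁) (b₀ + 3 b₁))`. -/
lemma bichar_eq (q : k) (a b : Fin 2 → ℕ) : bichar q a b = q ^ ((a 0 + a 1) * (b 0 + 3 * b 1)) := by
  simp only [bichar, Fin.prod_univ_two, qMatrix, Matrix.of_apply, Matrix.cons_val',
      Matrix.cons_val_zero,
    Matrix.cons_val_one, Matrix.cons_val_fin_one, ← pow_mul, ← pow_add]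
  congr 1
  ring

lemma mul_root_vectors {q : k} (y : Fin 2 → A) :
    y 0 * y 1 = y12 q y + q ^ 3 • (y 1 * y 0) ∧
    y 0 * y12 q y = y112 q y + q ^ 4 • (y12 q y * y 0) ∧
    y 0 * y112 q y = y1112 q y + q ^ 5 • (y112 q y * y 0) ∧
    y 0 * y1112 q y = y11112 q y + q ^ 6 • (y1112 q y * y 0) ∧
    y12 q y * y 1 = y122 q y + q ^ 6 • (y 1 * y12 q y) ∧
    y112 q y * y12 q y = q ^ 12 • (y12 q y * y112 q y) + yBeta q y := by
  refine ⟨?_, ?_, ?_, ?_, ?_, ?_⟩ <;>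
    simp [y12, y112, y1112, y11112, y122, yBeta, brBracket, bichar_eq, pow_succ, mul_assoc]

end VTable

section VTable
variable {k A : Type*} [Field k] [Ring A] [Algebra k A]

/-- The commutation relations, in terms of the normal forms in `tableScalar`. -/
theorem root_vectors_serre {q : k} (hq : IsPrimitiveRoot q 7) {v : Fin 2 → A}
    (h1 : y11112 q v = 0) (h2 : y122 q v = 0) :
    (y12 q v * v 1 = q ^ 6 • (v 1 * y12 q v) ∧
    y112 q v * y12 q v = q ^ 5 • (y12 q v * y112 q v) + yBeta q v) ∧
    (y112 q v * v 1 = q ^ 2 • (v 1 * y112 q v) + (q ^ 6 - q ^ 4) • (y12 q v * y12 q v) ∧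
    y1112 q v * v 1 = q ^ 5 • (v 1 * y1112 q v) + (q ^ 4 - q) • (y12 q v * y112 q v) +
      (-1 - q - q ^ 2 - q ^ 3 - 2 * q ^ 4 - 2 * q ^ 5) • yBeta q v ∧
    y1112 q v * y12 q v = q ^ 2 • (y12 q v * y1112 q v) +
      (1 - q + q ^ 2 - q ^ 3) • (y112 q v * y112 q v) ∧
    y1112 q v * y112 q v = q ^ 6 • (y112 q v * y1112 q v)) ∧
    yBeta q v * v 1 = q • (v 1 * yBeta q v) +
      ((q ^ 6 - q ^ 4) * (q ^ 6 - q ^ 5)) • (y12 q v * (y12 q v * y12 q v)) ∧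
    yBeta q v * y12 q v = q ^ 6 • (y12 q v * yBeta q v) ∧
    y112 q v * yBeta q v = q ^ 6 • (yBeta q v * y112 q v) ∧
    y1112 q v * yBeta q v = q • (yBeta q v * y1112 q v) +
      ((q ^ 6 - q ^ 5) * (1 - q + q ^ 2 - q ^ 3)) • (y112 q v * (y112 q v * y112 q v)) := by
  obtain ⟨e0, e1, e2, e3, e4, e5⟩ := mul_root_vectors (q := q) v
  rw [h1, zero_add] at e3
  rw [h2, zero_add] at e4
  have e12 : q ^ 12 = q ^ 5 := by
    rw [show 12 = 7 + 5 from rfl, pow_add, hq.pow_eq_one, one_mul]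
  rw [e12] at e5
  exact ⟨⟨e4, e5⟩, root_vector_relations hq e0 e1 e2 e3 e4 e5⟩

set_option maxHeartbeats 1000000 in
/-- The root vectors of the sum of two pairs `u`, `v` with `v i u j = q_ij u j v i`. -/
theorem root_vectors_add {q : k} (hq : IsPrimitiveRoot q 7) (u v : Fin 2 → A)
    (h : ∀ i j, v i * u j = qMatrix q i j • (u j * v i))
    (h1 : y11112 q v = 0) (h2 : y122 q v = 0) :
    y12 q (fun i => u i + v i) = y12 q u + (u 0 * (listVal q [2, 1, 1, 1, 0, 1, 1] • v 1) +
      y12 q v) ∧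
    y112 q (fun i => u i + v i) = y112 q u + (u 0 * (u 0 * (listVal q [2, 1, 2, 1, 0, 0, 1] • v 1) +
      listVal q [2, 2, 1, 1, 1] • y12 q v) + y112 q v) ∧
    y1112 q (fun i => u i + v i) = y1112 q u + (u 0 * (u 0 *
      (u 0 * (listVal q [2, 0, 2, 2, 1] • v 1) + listVal q [0, 1, 2, 1, 2, 1] • y12 q v) +
      listVal q [1, 1, 2, 1, 1, 1] • y112 q v) + y1112 q v) ∧
    yBeta q (fun i => u i + v i) = yBeta q u + (y112 q u *
      (u 0 * (listVal q [2, 2, 3, 3, 2, 2] • v 1) + listVal q [1, 1, 2, 1, 1, 1] • y12 q v) +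
      (y1112 q u * (listVal q [2, 0, 0, 0, 2, 1, 2] • v 1) +
      (u 0 * (u 0 * (u 0 * (listVal q [0, 2, 1, 4, 4, 1, 2] • (v 1 * v 1)) +
        listVal q [1, 1, 3, 3, 4, 2] • (v 1 * y12 q v)) +
        listVal q [0, 1, 2, 1, 2, 1] • (y12 q v * y12 q v)) + yBeta q v))) := by
  have hΦ : ∑ i ∈ Finset.range 7, q ^ i = 0 := hq.geom_sum_eq_zero (by norm_num)
  simp only [Finset.sum_range_succ, Finset.sum_range_zero, zero_add, pow_zero, pow_one] at hΦ
  obtain ⟨⟨t10, t21⟩, ⟨t20, -, -, -⟩, -⟩ := root_vectors_serre hq h1 h2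
  have h00 := h 0 0
  have h01 := h 0 1
  have h10 := h 1 0
  have h11 := h 1 1
  simp only [qMatrix, Matrix.of_apply, Matrix.cons_val', Matrix.cons_val_zero,
    Matrix.cons_val_one, Matrix.cons_val_fin_one] at h00 h01 h10 h11
  obtain ⟨u0, u1, u2, u3, u4, ub⟩ := mul_root_vectors (q := q) u
  obtain ⟨w0, w1, w2, w3, w4, wb⟩ := mul_root_vectors (q := q) v
  obtain ⟨Y0, Y1, Y2, -, -, Yb⟩ := mul_root_vectors (q := q) (fun i => u i + v i)
  -- the letters of `v` move to the right of those of `u`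
  have L : ∀ (w x y : A) (c c' d : k), w * x = c • (x * w) → w * y = c' • (y * w) →
      w * (x * y - d • (y * x)) = (c * c') • ((x * y - d • (y * x)) * w) := by
    intro w x y c c' d hx hy
    rw [mul_sub, mul_smul_comm, ← mul_assoc, hx, ← mul_assoc, hy, sub_mul]
    simp only [smul_mul_assoc, mul_assoc, hx, hy, mul_smul_comm]
    module
  have R : ∀ (w x y : A) (c c' d : k), x * w = c • (w * x) → y * w = c' • (w * y) →
      (x * y - d • (y * x)) * w = (c * c') • (w * (x * y - d • (y * x))) := by
    intro w x y c c' d hx hy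
    rw [mul_sub, mul_smul_comm, ← mul_assoc w, ← mul_assoc w, sub_mul]
    simp only [smul_mul_assoc, mul_assoc, hx, hy, mul_smul_comm]
    simp only [← mul_assoc, hx, hy, smul_mul_assoc]
    module
  have p10 : v 0 * y12 q u = (q * q ^ 3) • (y12 q u * v 0) := L _ _ _ _ _ _ h00 h01
  have p11 : v 1 * y12 q u = (q * q ^ 3) • (y12 q u * v 1) := L _ _ _ _ _ _ h10 h11
  have p20 : v 0 * y112 q u = (q * (q * q ^ 3)) • (y112 q u * v 0) := L _ _ _ _ _ _ h00 p10
  have p21 : v 1 * y112 q u = (q * (q * q ^ 3)) • (y112 q u * v 1) := L _ _ _ _ _ _ h10 p11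
  have p31 : v 1 * y1112 q u = (q * (q * (q * q ^ 3))) • (y1112 q u * v 1) := L _ _ _ _ _ _ h10 p21
  have r1 : y12 q v * u 0 = (q * q) • (u 0 * y12 q v) := R _ _ _ _ _ _ h00 h10
  have r11 : y12 q v * y12 q u = ((q * q ^ 3) * (q * q ^ 3)) • (y12 q u * y12 q v) :=
    R _ _ _ _ _ _ p10 p11
  have r12 : y12 q v * y112 q u = ((q * (q * q ^ 3)) * (q * (q * q ^ 3))) • (y112 q u * y12 q v) :=
    R _ _ _ _ _ _ p20 p21
  have r2 : y112 q v * u 0 = (q * (q * q)) • (u 0 * y112 q v) := R _ _ _ _ _ _ h00 r1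
  have r21 : y112 q v * y12 q u =
      ((q * q ^ 3) * ((q * q ^ 3) * (q * q ^ 3))) • (y12 q u * y112 q v) :=
    R _ _ _ _ _ _ p10 r11
  have a00 := mul_mul_of_eq' h00
  have a10 := mul_mul_of_eq' h10
  have a1 := mul_mul_of_eq' r1
  have a2 := mul_mul_of_eq' r2
  have a11 := mul_mul_of_eq' p11
  have a21 := mul_mul_of_eq' p21
  have a31 := mul_mul_of_eq' p31
  have au1 := mul_mul_of_eq u1
  have au2 := mul_mul_of_eq u2
  have e1 : y12 q (fun i => u i + v i) = y12 q u + y12 q v + (1 - q ^ 4) • (u 0 * v 1) := by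
    rw [← sub_eq_iff_eq_add] at Y0
    rw [← Y0]
    simp only [mul_add, add_mul, h01, h10, u0, w0]
    match_scalars <;> clear * - hΦ <;> grind
  have e2 : y112 q (fun i => u i + v i) = y112 q u + y112 q v +
      ((1 - q ^ 4) * (1 - q ^ 5)) • (u 0 * (u 0 * v 1)) +
      (1 + q - q ^ 5 - q ^ 6) • (u 0 * y12 q v) := by
    rw [← sub_eq_iff_eq_add] at Y1
    rw [← Y1]
    simp only [e1, mul_add, add_mul, p10, r1, mul_smul_comm, smul_mul_assoc, a00, w0, w1, u1,
      mul_assoc, h10]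
    match_scalars <;> clear * - hΦ <;> grind
  have e3 : y1112 q (fun i => u i + v i) = y1112 q u + y1112 q v +
      ((1 - q ^ 4) * (1 - q ^ 5) * (1 - q ^ 6)) • (u 0 * (u 0 * (u 0 * v 1))) +
      ((1 - q ^ 4) * (1 - q ^ 5) * q ^ 2 + (1 + q - q ^ 5 - q ^ 6) * (1 - q ^ 7)) •
        (u 0 * (u 0 * y12 q v)) +
      (1 - q ^ 8 + q * (1 + q - q ^ 5 - q ^ 6)) • (u 0 * y112 q v) := by
    rw [← sub_eq_iff_eq_add] at Y2
    rw [← Y2]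
    simp only [e2, mul_add, add_mul, p20, r1, r2, mul_smul_comm, smul_mul_assoc, a00, w0, w1, w2,
      u2, mul_assoc, h10]
    match_scalars <;> clear * - hΦ <;> grind
  refine ⟨?_, ?_, ?_, ?_⟩
  · rw [e1]
    simp only [listVal, List.foldr, mul_add, mul_smul_comm]
    push_cast
    match_scalars <;> clear * - hΦ <;> grind
  · rw [e2]
    simp only [listVal, List.foldr, mul_add, mul_smul_comm]
    push_cast
    match_scalars <;> clear * - hΦ <;> grind
  · rw [e3]
    simp only [listVal, List.foldr, mul_add, mul_smul_comm]
    push_cast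
    match_scalars <;> clear * - hΦ <;> grind
  · rw [← sub_eq_iff_eq_add'] at Yb
    rw [← Yb]
    simp only [e1, e2, mul_add, add_mul, mul_smul_comm, smul_mul_assoc, mul_assoc, h10, a10, a1, a2,
      r1, r2, r11, r12, r21, p11, p21, a11, a21, u1, u2, au1, au2, ub, t10, t20, t21,
      mul_mul_of_eq' t10]
    simp only [listVal, List.foldr, mul_add, mul_smul_comm]
    push_cast
    match_scalars <;> clear * - hΦ <;> grind

end VTable

/-! ### Reduction steps -/

section Steps
variable {k M : Type*} [Field k] [AddCommGroup M] [Module k M]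

lemma brBracket_mul_of_comm {A : Type*} [Ring A] [Algebra k A] (q : k) (a b : Fin 2 → ℕ)
    {x y w : A} {c c' : k} (hx : x * w = c • (w * x)) (hy : y * w = c' • (w * y)) :
    brBracket q a b x y * w = (c * c') • (w * brBracket q a b x y) := by
  simp only [brBracket]
  rw [mul_sub, mul_smul_comm, ← mul_assoc w, ← mul_assoc w, sub_mul]
  simp only [smul_mul_assoc, mul_assoc, hx, hy, mul_smul_comm]
  simp only [← mul_assoc, hx, hy, smul_mul_assoc]
  module

lemma mul_brBracket_of_comm {A : Type*} [Ring A] [Algebra k A] (q : k) (a b : Fin 2 → ℕ)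
    {x y w : A} {c c' : k} (hx : w * x = c • (x * w)) (hy : w * y = c' • (y * w)) :
    w * brBracket q a b x y = (c * c') • (brBracket q a b x y * w) := by
  simp only [brBracket]
  rw [mul_sub, mul_smul_comm, ← mul_assoc, hx, ← mul_assoc, hy, sub_mul]
  simp only [smul_mul_assoc, mul_assoc, hx, hy, mul_smul_comm]
  module

/-- The letters `g, z₀, z₁, b, z₂, z₃`. -/
def letters (q : k) (g : Module.End k M) (v : Fin 2 → Module.End k M) : ℕ → Module.End k M
  | 0 => g
  | 1 => v 1
  | 2 => y12 q v
  | 3 => yBeta q v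
  | 4 => y112 q v
  | 5 => y1112 q v
  | _ => 0

/-- The exponents of the scalars by which the letters `z₀, z₁, b, z₂, z₃` commute with an operator
which commutes with the two generators up to the same scalar. -/
def height : ℕ → ℕ
  | 1 => 1
  | 2 => 2
  | 3 => 5
  | 4 => 3
  | 5 => 4
  | _ => 0

lemma letters_mul_of_comm (q : k) {g w : Module.End k M} {v : Fin 2 → Module.End k M} {c : k}
    (h : ∀ i, v i * w = c • (w * v i)) (n : ℕ) (hn : n ≠ 0) :
    letters q g v n * w = c ^ height n • (w * letters q g v n) := by
  have h1 : y12 q v * w = (c * c) • (w * y12 q v) := brBracket_mul_of_comm _ _ _ (h 0) (h 1)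
  have h2 : y112 q v * w = (c * (c * c)) • (w * y112 q v) := brBracket_mul_of_comm _ _ _ (h 0) h1
  have h3 : y1112 q v * w = (c * (c * (c * c))) • (w * y1112 q v) :=
    brBracket_mul_of_comm _ _ _ (h 0) h2
  have hb : yBeta q v * w = (c * (c * c) * (c * c)) • (w * yBeta q v) :=
    brBracket_mul_of_comm _ _ _ h2 h1
  match n, hn with
  | 1, _ => simpa [letters, height] using h 1
  | 2, _ => simpa [letters, height, pow_succ, mul_assoc] using h1
  | 3, _ => simpa [letters, height, pow_succ, mul_assoc] using hb
  | 4, _ => simpa [letters, height, pow_succ, mul_assoc] using h2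
  | 5, _ => simpa [letters, height, pow_succ, mul_assoc] using h3
  | n + 6, _ => simp [letters]

lemma mul_letters_of_comm (q : k) {g w : Module.End k M} {v : Fin 2 → Module.End k M} {c : k}
    (h : ∀ i, w * v i = c • (v i * w)) (n : ℕ) (hn : n ≠ 0) :
    w * letters q g v n = c ^ height n • (letters q g v n * w) := by
  have h1 : w * y12 q v = (c * c) • (y12 q v * w) := mul_brBracket_of_comm _ _ _ (h 0) (h 1)
  have h2 : w * y112 q v = (c * (c * c)) • (y112 q v * w) := mul_brBracket_of_comm _ _ _ (h 0) h1
  have h3 : w * y1112 q v = (c * (c * (c * c))) • (y1112 q v * w) :=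
    mul_brBracket_of_comm _ _ _ (h 0) h2
  have hb : w * yBeta q v = (c * (c * c) * (c * c)) • (yBeta q v * w) :=
    mul_brBracket_of_comm _ _ _ h2 h1
  match n, hn with
  | 1, _ => simpa [letters, height] using h 1
  | 2, _ => simpa [letters, height, pow_succ, mul_assoc] using h1
  | 3, _ => simpa [letters, height, pow_succ, mul_assoc] using hb
  | 4, _ => simpa [letters, height, pow_succ, mul_assoc] using h2
  | 5, _ => simpa [letters, height, pow_succ, mul_assoc] using h3
  | n + 6, _ => simp [letters]

set_option maxHeartbeats 1000000 in
/-- The part of the tables `tableScalar` and `tableBraided` which concerns the root vectors. -/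
lemma letters_table {q : k} (hq : IsPrimitiveRoot q 7) (g : Module.End k M)
    {v : Fin 2 → Module.End k M} (h1 : y11112 q v = 0) (h2 : y122 q v = 0) (i j : ℕ)
    (hij : i < j) (hi : i ≠ 0) : letters q g v j * letters q g v i =
      combOp q (letters q g v) (Tree.nth [] (Tree.nth [] tableScalar j) i) ∧
    Tree.nth [] (Tree.nth [] tableBraided j) i = Tree.nth [] (Tree.nth [] tableScalar j) i := by
  have hΦ : ∑ i ∈ Finset.range 7, q ^ i = 0 := hq.geom_sum_eq_zero (by norm_num)
  simp only [Finset.sum_range_succ, Finset.sum_range_zero, zero_add, pow_zero, pow_one] at hΦ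
  obtain ⟨⟨r10, r21⟩, ⟨r20, r30, r31, r32⟩, rb0, rb1, r2b, r3b⟩ := root_vectors_serre hq h1 h2
  match j, i, hij, hi with
  | 1, 0, _, hi => exact absurd rfl hi
  | 2, 1, _, _ =>
    refine ⟨?_, rfl⟩
    simp only [letters, combOp, wordOp, Tree.nth, tableScalar, listVal, List.map, List.sum_cons,
      List.sum_nil, List.prod_cons, List.prod_nil, List.foldr, mul_one, add_zero]
    push_cast
    linear_combination (norm := (match_scalars <;> clear * - hΦ <;> grind)) r10
  | 3, 1, _, _ =>
    refine ⟨?_, rfl⟩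
    simp only [letters, combOp, wordOp, Tree.nth, tableScalar, listVal, List.map, List.sum_cons,
      List.sum_nil, List.prod_cons, List.prod_nil, List.foldr, mul_one, add_zero]
    push_cast
    linear_combination (norm := (match_scalars <;> clear * - hΦ <;> grind)) rb0
  | 3, 2, _, _ =>
    refine ⟨?_, rfl⟩
    simp only [letters, combOp, wordOp, Tree.nth, tableScalar, listVal, List.map, List.sum_cons,
      List.sum_nil, List.prod_cons, List.prod_nil, List.foldr, mul_one, add_zero]
    push_cast
    linear_combination (norm := (match_scalars <;> clear * - hΦ <;> grind)) rb1
  | 4, 1, _, _ =>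
    refine ⟨?_, rfl⟩
    simp only [letters, combOp, wordOp, Tree.nth, tableScalar, listVal, List.map, List.sum_cons,
      List.sum_nil, List.prod_cons, List.prod_nil, List.foldr, mul_one, add_zero]
    push_cast
    linear_combination (norm := (match_scalars <;> clear * - hΦ <;> grind)) r20
  | 4, 2, _, _ =>
    refine ⟨?_, rfl⟩
    simp only [letters, combOp, wordOp, Tree.nth, tableScalar, listVal, List.map, List.sum_cons,
      List.sum_nil, List.prod_cons, List.prod_nil, List.foldr, mul_one, add_zero]
    push_cast
    linear_combination (norm := (match_scalars <;> clear * - hΦ <;> grind)) r21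
  | 4, 3, _, _ =>
    refine ⟨?_, rfl⟩
    simp only [letters, combOp, wordOp, Tree.nth, tableScalar, listVal, List.map, List.sum_cons,
      List.sum_nil, List.prod_cons, List.prod_nil, List.foldr, mul_one, add_zero]
    push_cast
    linear_combination (norm := (match_scalars <;> clear * - hΦ <;> grind)) r2b
  | 5, 1, _, _ =>
    refine ⟨?_, rfl⟩
    simp only [letters, combOp, wordOp, Tree.nth, tableScalar, listVal, List.map, List.sum_cons,
      List.sum_nil, List.prod_cons, List.prod_nil, List.foldr, mul_one, add_zero]
    push_cast
    linear_combination (norm := (match_scalars <;> clear * - hΦ <;> grind)) r30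
  | 5, 2, _, _ =>
    refine ⟨?_, rfl⟩
    simp only [letters, combOp, wordOp, Tree.nth, tableScalar, listVal, List.map, List.sum_cons,
      List.sum_nil, List.prod_cons, List.prod_nil, List.foldr, mul_one, add_zero]
    push_cast
    linear_combination (norm := (match_scalars <;> clear * - hΦ <;> grind)) r31
  | 5, 3, _, _ =>
    refine ⟨?_, rfl⟩
    simp only [letters, combOp, wordOp, Tree.nth, tableScalar, listVal, List.map, List.sum_cons,
      List.sum_nil, List.prod_cons, List.prod_nil, List.foldr, mul_one, add_zero]
    push_cast
    linear_combination (norm := (match_scalars <;> clear * - hΦ <;> grind)) r3b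
  | 5, 4, _, _ =>
    refine ⟨?_, rfl⟩
    simp only [letters, combOp, wordOp, Tree.nth, tableScalar, listVal, List.map, List.sum_cons,
      List.sum_nil, List.prod_cons, List.prod_nil, List.foldr, mul_one, add_zero]
    push_cast
    linear_combination (norm := (match_scalars <;> clear * - hΦ <;> grind)) r32
  | n + 6, i, _, _ => exact ⟨by simp [letters, combOp, Tree.nth, tableScalar], rfl⟩

/-- `X d ^ n g` in terms of `d ^ n g X`. -/
lemma lower_mul_pow_mul {q : k} {d X g : Module.End k M} {e : ℕ}
    (hXd : X * d = q ^ 6 • (d * X) + (1 - q ^ 6) • 1) (hXg : X * g = q ^ e • (g * X)) (n : ℕ) :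
    X * (d ^ (n + 1) * g) = q ^ (6 * (n + 1) + e) • ((d ^ (n + 1) * g) * X) +
      (1 - q ^ (6 * (n + 1))) • (d ^ n * g) := by
  induction n with
  | zero =>
    simp only [zero_add, pow_one, pow_zero, one_mul, mul_one]
    rw [← mul_assoc, hXd, add_mul, smul_mul_assoc, mul_assoc d, hXg]
    simp only [mul_smul_comm, smul_mul_assoc, one_mul, mul_assoc, smul_smul, pow_add]
  | succ n ih =>
    rw [pow_succ', mul_assoc, ← mul_assoc X, hXd, add_mul, smul_mul_assoc, mul_assoc d, ih]
    simp only [mul_smul_comm, smul_mul_assoc, one_mul, mul_assoc, mul_add, pow_succ' d]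
    simp only [pow_add, pow_mul]
    match_scalars <;> ring

/-- The root vectors for the pair `X, d ^ m g`. -/
lemma root_vectors_lower {q : k} (h7 : q ^ 7 = 1) {d X g : Module.End k M} {e : ℕ}
    (hXd : X * d = q ^ 6 • (d * X) + (1 - q ^ 6) • 1) (hXg : X * g = q ^ e • (g * X)) (m : ℕ)
    (he : q ^ (6 * (m + 3) + e) = q ^ 3) :
    y12 q ![X, d ^ (m + 3) * g] = (1 - q ^ (6 * (m + 3))) • (d ^ (m + 2) * g) ∧
    y112 q ![X, d ^ (m + 3) * g] =
      ((1 - q ^ (6 * (m + 3))) * (1 - q ^ (6 * (m + 2)))) • (d ^ (m + 1) * g) ∧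
    y1112 q ![X, d ^ (m + 3) * g] = ((1 - q ^ (6 * (m + 3))) * (1 - q ^ (6 * (m + 2))) *
      (1 - q ^ (6 * (m + 1)))) • (d ^ m * g) := by
  have e1 : y12 q ![X, d ^ (m + 3) * g] = (1 - q ^ (6 * (m + 3))) • (d ^ (m + 2) * g) := by
    have := lower_mul_pow_mul hXd hXg (m + 2)
    simp only [y12, brBracket, bichar_eq, Matrix.cons_val_zero, Matrix.cons_val_one]
    rw [this, he]
    norm_num
  have e2 : y112 q ![X, d ^ (m + 3) * g] =
      ((1 - q ^ (6 * (m + 3))) * (1 - q ^ (6 * (m + 2)))) • (d ^ (m + 1) * g) := by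
    have := lower_mul_pow_mul hXd hXg (m + 1)
    have he' : q ^ (6 * (m + 2) + e) = q ^ 4 := by
      calc q ^ (6 * (m + 2) + e) = q ^ 7 * q ^ (6 * (m + 2) + e) := by rw [h7, one_mul]
        _ = q ^ (6 * (m + 3) + e) * q := by ring
        _ = q ^ 4 := by rw [he]; ring
    simp only [y112, brBracket, bichar_eq, e1, Matrix.cons_val_zero, Matrix.cons_val_one]
    rw [mul_smul_comm, this, he']
    norm_num
    module
  refine ⟨e1, e2, ?_⟩
  have := lower_mul_pow_mul hXd hXg m
  have he' : q ^ (6 * (m + 1) + e) = q ^ 5 := by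
    calc q ^ (6 * (m + 1) + e) = q ^ 7 * q ^ 7 * q ^ (6 * (m + 1) + e) := by rw [h7]; simp
      _ = q ^ (6 * (m + 3) + e) * q ^ 2 := by ring
      _ = q ^ 5 := by rw [he]; ring
  simp only [y1112, brBracket, bichar_eq, e2, Matrix.cons_val_zero, Matrix.cons_val_one]
  rw [mul_smul_comm, this, he']
  norm_num
  module

lemma mul_pow_of_comm {d g : Module.End k M} {c : k} (h : g * d = c • (d * g)) (n : ℕ) :
    g * d ^ n = c ^ n • (d ^ n * g) := by
  induction n with
  | zero => simp
  | succ n ih =>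
    rw [pow_succ, ← mul_assoc, ih, smul_mul_assoc, mul_assoc, h, mul_smul_comm, smul_smul,
      ← mul_assoc, pow_succ]

/-- The data of a reduction step: `X` is a lowering operator for `d`, and the pair `v` satisfies the
undeformed Serre relations and commutes with the pair `X, d ^ (m + 3) g` up to the entries of the
braiding matrix. The scalars are chosen so that `X, d ^ (m + 3) g` has the braiding of `x₁, x₂`,
which is the condition `exponent`. -/
structure Step (q : k) (m e : ℕ) (η : k) (d X g : Module.End k M) (v : Fin 2 → Module.End k M) :
    Prop where
  lower_d : X * d = q ^ 6 • (d * X) + (1 - q ^ 6) • 1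
  lower_g : X * g = q ^ e • (g * X)
  g_d : g * d = η • (d * g)
  v_d : ∀ i, v i * d = q ^ 6 • (d * v i)
  v_g : ∀ i, v i * g = q ^ e • (g * v i)
  v_lower : ∀ i, v i * X = q • (X * v i)
  lower_v : ∀ i, X * v i = q ^ 6 • (v i * X)
  serre1 : y11112 q v = 0
  serre2 : y122 q v = 0
  exponent : q ^ (6 * (m + 3) + e) = q ^ 3

namespace Step
variable {q : k} {m e : ℕ} {η : k} {d X g : Module.End k M} {v : Fin 2 → Module.End k M}

lemma comm (S : Step q m e η d X g v) (i j : Fin 2) : v i * ![X, d ^ (m + 3) * g] j =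
    qMatrix q i j • (![X, d ^ (m + 3) * g] j * v i) := by
  have h3 : v i * (d ^ (m + 3) * g) = q ^ 3 • (d ^ (m + 3) * g * v i) := by
    rw [← mul_assoc, mul_pow_of_comm (S.v_d i), smul_mul_assoc, mul_assoc, S.v_g i, mul_smul_comm,
      smul_smul, ← pow_mul, ← pow_add, S.exponent, mul_assoc]
  have h1 := S.v_lower i
  fin_cases j <;> fin_cases i <;> simpa [qMatrix] using ‹_›

/-- The constants `cs` are those of the root vectors for the pair `X, d ^ (m + 3) g`. -/
def ConstsEq (q : k) (m : ℕ) (η : k) (cs : Expr.Consts) : Prop :=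
  listVal q (Tree.nth [] cs 0) = 1 ∧ listVal q (Tree.nth [] cs 1) = 1 - q ^ (6 * (m + 3)) ∧
  listVal q (Tree.nth [] cs 2) = (1 - q ^ (6 * (m + 3))) * (1 - q ^ (6 * (m + 2))) ∧
  listVal q (Tree.nth [] cs 3) =
    (1 - q ^ (6 * (m + 3))) * (1 - q ^ (6 * (m + 2))) * (1 - q ^ (6 * (m + 1))) ∧
  listVal q (Tree.nth [] cs 4) = (1 - q ^ (6 * (m + 3))) * (1 - q ^ (6 * (m + 2))) *
    (1 - q ^ (6 * (m + 3))) * (η ^ (m + 2) - q ^ 12 * η ^ (m + 1))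

lemma root_vectors (hq : IsPrimitiveRoot q 7) (S : Step q m e η d X g v) {cs : Expr.Consts}
    (hcs : ConstsEq q m η cs) :
    let Y := fun i => ![X, d ^ (m + 3) * g] i + v i
    Y 1 = (Expr.z0 (m + 3) cs).op q (letters q g v) d X ∧
    y12 q Y = (Expr.z1 (m + 3) cs).op q (letters q g v) d X ∧
    y112 q Y = (Expr.z2 (m + 3) cs).op q (letters q g v) d X ∧
    y1112 q Y = (Expr.z3 (m + 3) cs).op q (letters q g v) d X ∧
    yBeta q Y = (Expr.b (m + 3) cs).op q (letters q g v) d X := by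
  obtain ⟨c0, c1, c2, c3, c4⟩ := hcs
  obtain ⟨e1, e2, e3⟩ := root_vectors_lower hq.pow_eq_one S.lower_d S.lower_g m S.exponent
  have eb : yBeta q ![X, d ^ (m + 3) * g] = ((1 - q ^ (6 * (m + 3))) * (1 - q ^ (6 * (m + 2))) *
      (1 - q ^ (6 * (m + 3))) * (η ^ (m + 2) - q ^ 12 * η ^ (m + 1))) •
        (d ^ (2 * (m + 3) - 3) * (g * g)) := by
    have p1 : ∀ i j, i + j = 2 * (m + 3) - 3 →
        d ^ i * g * (d ^ j * g) = η ^ j • (d ^ (2 * (m + 3) - 3) * (g * g)) := by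
      intro i j hij
      rw [mul_assoc, ← mul_assoc g, mul_pow_of_comm S.g_d, smul_mul_assoc, mul_smul_comm,
        ← mul_assoc, ← mul_assoc, ← pow_add, hij, mul_assoc]
    simp only [yBeta, brBracket, bichar_eq, e1, e2, smul_mul_assoc, mul_smul_comm]
    rw [p1 (m + 1) (m + 2) (by omega), p1 (m + 2) (m + 1) (by omega)]
    norm_num
    module
  obtain ⟨f1, f2, f3, fb⟩ := root_vectors_add hq _ v S.comm S.serre1 S.serre2
  have hz : ∀ j ≤ 3, m + 3 - j = m + (3 - j) := fun j hj => by omega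
  intro Y
  refine ⟨?_, f1.trans ?_, f2.trans ?_, f3.trans ?_, fb.trans ?_⟩
  · simp [Y, Expr.z0, Expr.zu, Expr.op, Expr.g, Expr.v, letters, c0]
  · rw [e1]
    simp [Expr.z1, Expr.zu, Expr.op, Expr.g, Expr.v, letters, c1]
  · rw [e2]
    simp [Expr.z2, Expr.zu, Expr.op, Expr.g, Expr.v, letters, c2, hz]
  · rw [e3]
    simp [Expr.z3, Expr.zu, Expr.op, Expr.g, Expr.v, letters, c3]
  · rw [eb, e2, e3]
    simp [Expr.b, Expr.bu, Expr.zu, Expr.op, Expr.g, Expr.v, letters, c2, c3, c4, hz, mul_assoc]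
    exact smul_comm _ _ _

/-- The criterion for an operator built from the letters of a step to kill a vector. -/
lemma op_apply_eq_zero (hq : IsPrimitiveRoot q 7) (S : Step q m e η d X g v) {ξ : M}
    (hξ : X ξ = 0) {tb : List (List Tree.Comb)} {εs : List (List ℕ)}
    (hg : listVal q (Tree.nth [] εs 0) = η)
    (hε : ∀ i, i ≠ 0 → letters q g v i = 0 ∨ listVal q (Tree.nth [] εs i) = (q ^ 6) ^ height i)
    (ht : ∀ i j, i < j → i ≠ 0 → Tree.nth [] (Tree.nth [] tb j) i = Tree.nth [] (Tree.nth []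
        tableScalar j) i)
    (ht0 : ∀ j, j ≠ 0 → letters q g v j * g = combOp q (letters q g v)
      (Tree.nth [] (Tree.nth [] tb j) 0)) {E : Expr} (hE : E.kills tb εs = true) :
    E.op q (letters q g v) d X ξ = 0 := by
  refine Expr.op_apply_eq_zero hq (c := fun i => if i = 0 then q ^ e else (q ^ 6) ^ height i)
    ?_ ?_ S.lower_d ?_ hξ hE
  · intro i j hij
    by_cases hi : i = 0
    · subst hi
      exact ht0 j (by omega)
    · rw [ht i j hij hi]
      exact (letters_table hq g S.serre1 S.serre2 i j hij hi).1
  · intro i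
    by_cases hi : i = 0
    · subst hi
      rw [hg]; exact S.g_d
    · rcases hε i hi with h | h
      · rw [h, zero_mul, mul_zero, smul_zero]
      · rw [h]
        exact letters_mul_of_comm q S.v_d i hi
  · intro i
    by_cases hi : i = 0
    · subst hi
      exact S.lower_g
    · simp only [if_neg hi]
      exact mul_letters_of_comm q S.lower_v i hi

end Step

end Steps

/-! ### Seventh powers in a reduction step -/

section Powers
variable {k M : Type*} [Field k] [AddCommGroup M] [Module k M] {q : k}

namespace Expr

lemma op_neg (hq : IsPrimitiveRoot q 7) (L : ℕ → Module.End k M) (d X : Module.End k M)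
    (e : Expr) : (neg e).op q L d X = -e.op q L d X := by
  have hΦ : ∑ i ∈ Finset.range 7, q ^ i = 0 := hq.geom_sum_eq_zero (by norm_num)
  simp only [Finset.sum_range_succ, Finset.sum_range_zero, zero_add, pow_zero, pow_one] at hΦ
  have : listVal q [0, 1, 1, 1, 1, 1, 1] = -1 := by
    simp only [listVal, List.foldr]
    push_cast
    linear_combination hΦ
  simp [neg, op, this]

lemma op_term (q : k) (L : ℕ → Module.End k M) (d X : Module.End k M) (a : List ℕ) (n s : ℕ)
    (e : Expr) : (term a n s e).op q L d X = listVal q a • (d ^ n * (L 0 ^ s * e.op q L d X)) := by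
  simp [term, op, op_pow, g]

lemma op_vpow (q : k) (L : ℕ → Module.End k M) (d X : Module.End k M) (i : ℕ) :
    (vpow i).op q L d X = L (i + 1) ^ 7 := by
  simp [vpow, op, op_pow, v]

/-- The form in which the certified identities are used. -/
lemma pow_seven_apply (hq : IsPrimitiveRoot q 7) {L : ℕ → Module.End k M} {d X : Module.End k M}
    {e f : Expr} {ξ : M} {y : Module.End k M}
    (h : (Expr.add (pow e 7) (neg f)).op q L d X ξ = 0) (hy : y = e.op q L d X) :
    (y ^ 7) ξ = f.op q L d X ξ := by
  rw [hy, ← op_pow, ← sub_eq_zero, sub_eq_add_neg]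
  rw [op, op_neg hq] at h
  exact h

lemma pow_seven_add_apply (hq : IsPrimitiveRoot q 7) {L : ℕ → Module.End k M}
    {d X : Module.End k M} {e f t₁ t₂ t₃ t₄ : Expr} {ξ : M} {y w₁ w₂ w₃ w₄ : Module.End k M}
    (h : (Expr.add (pow e 7) (.add t₁ (.add t₂ (.add t₃ (.add t₄ (neg f)))))).op q L d X ξ = 0)
    (hy : y = e.op q L d X) (h₁ : w₁ = t₁.op q L d X) (h₂ : w₂ = t₂.op q L d X)
    (h₃ : w₃ = t₃.op q L d X) (h₄ : w₄ = t₄.op q L d X) :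
    (y ^ 7 + (w₁ + (w₂ + (w₃ + w₄)))) ξ = f.op q L d X ξ := by
  rw [hy, ← op_pow, h₁, h₂, h₃, h₄, ← sub_eq_zero, ← h, op, op, op, op, op, op_neg hq]
  simp only [LinearMap.add_apply, LinearMap.neg_apply]
  abel

end Expr

lemma letters_eq (q : k) (g : Module.End k M) (v : Fin 2 → Module.End k M) :
    letters q g v 0 = g ∧ letters q g v (0 + 1) = v 1 ∧ letters q g v (1 + 1) = y12 q v ∧
    letters q g v (2 + 1) = yBeta q v ∧ letters q g v (3 + 1) = y112 q v ∧
    letters q g v (4 + 1) = y1112 q v :=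
  ⟨rfl, rfl, rfl, rfl, rfl, rfl⟩

namespace Step

lemma constsEq_scalar (hq : IsPrimitiveRoot q 7) : ConstsEq q 1 1 Expr.constsScalar := by
  have hΦ : ∑ i ∈ Finset.range 7, q ^ i = 0 := hq.geom_sum_eq_zero (by norm_num)
  simp only [Finset.sum_range_succ, Finset.sum_range_zero, zero_add, pow_zero, pow_one] at hΦ
  refine ⟨?_, ?_, ?_, ?_, ?_⟩ <;>
    simp only [Expr.constsScalar, Tree.nth, listVal, List.foldr] <;> push_cast <;>
      clear hq <;> grind

lemma constsEq_braided (hq : IsPrimitiveRoot q 7) : ConstsEq q 0 (q ^ 6) Expr.constsBraided := by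
  have hΦ : ∑ i ∈ Finset.range 7, q ^ i = 0 := hq.geom_sum_eq_zero (by norm_num)
  simp only [Finset.sum_range_succ, Finset.sum_range_zero, zero_add, pow_zero, pow_one] at hΦ
  refine ⟨?_, ?_, ?_, ?_, ?_⟩ <;>
    simp only [Expr.constsBraided, Tree.nth, listVal, List.foldr] <;> push_cast <;>
      clear hq <;> grind

variable {d X g : Module.End k M} {v : Fin 2 → Module.End k M}

lemma twist_height (hq : IsPrimitiveRoot q 7) (g : Module.End k M) (v : Fin 2 → Module.End k M)
    (i : ℕ) (hi : i ≠ 0) : letters q g v i = 0 ∨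
      (listVal q (Tree.nth [] Expr.twistScalar i) = (q ^ 6) ^ height i ∧
        listVal q (Tree.nth [] Expr.twistBraided i) = (q ^ 6) ^ height i) := by
  have h7 := hq.pow_eq_one
  match i, hi with
  | 1, _ | 2, _ | 3, _ | 4, _ | 5, _ =>
    right
    constructor <;> simp only [Expr.twistScalar, Expr.twistBraided, Tree.nth, height, listVal,
        List.foldr] <;>
      push_cast <;> grind
  | n + 6, _ => left; rfl

lemma op_eq_zero_scalar (hq : IsPrimitiveRoot q 7) {κ : k}
    (S : Step q 1 0 1 d X (κ • (1 : Module.End k M)) v) {ξ : M} (hξ : X ξ = 0) {E : Expr}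
    (hE : E.kills tableScalar Expr.twistScalar = true) :
    E.op q (letters q (κ • (1 : Module.End k M)) v) d X ξ = 0 := by
  refine S.op_apply_eq_zero hq hξ (by
      simp only [Expr.twistScalar, Tree.nth, listVal, List.foldr]; push_cast; ring)
    (fun i hi => (twist_height hq _ v i hi).imp_right And.left) (fun _ _ _ _ => rfl) ?_ hE
  intro j hj
  match j, hj with
  | 1, _ | 2, _ | 3, _ | 4, _ | 5, _ =>
    simp only [combOp, Tree.nth, tableScalar, listVal, wordOp, letters, List.map,
      List.sum_cons, List.sum_nil, List.prod_cons, List.prod_nil, List.foldr, mul_one, add_zero]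
    push_cast
    rw [mul_zero, add_zero, one_smul, mul_smul_comm, mul_one, smul_one_mul]
  | n + 6, _ => simp [combOp, Tree.nth, tableScalar, letters]

lemma op_eq_zero_braided (hq : IsPrimitiveRoot q 7) (S : Step q 0 6 (q ^ 6) d X g v) {ξ : M}
    (hξ : X ξ = 0) {E : Expr} (hE : E.kills tableBraided Expr.twistBraided = true) :
    E.op q (letters q g v) d X ξ = 0 := by
  have h7 := hq.pow_eq_one
  refine S.op_apply_eq_zero hq hξ
    (by simp only [Expr.twistBraided, Tree.nth, listVal, List.foldr]; push_cast; ring)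
    (fun i hi => (twist_height hq _ v i hi).imp_right And.right)
    (fun i j hij hi => (letters_table hq g S.serre1 S.serre2 i j hij hi).2) ?_ hE
  intro j hj
  rw [letters_mul_of_comm q S.v_g j hj]
  match j, hj with
  | 1, _ | 2, _ | 3, _ | 4, _ | 5, _ =>
    simp only [combOp, Tree.nth, tableBraided, listVal, wordOp, letters, height, List.map,
      List.sum_cons, List.sum_nil, List.prod_cons, List.prod_nil, List.foldr, mul_one, add_zero]
    push_cast
    congr 1
    grind
  | n + 6, _ => simp [combOp, Tree.nth, tableBraided, letters]

/-- The seventh powers of the root vectors in a reduction step with `m = 4` and a scalar `g`, on a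
vector killed by `X`. -/
theorem powers_scalar (hq : IsPrimitiveRoot q 7) {κ : k} (hg : g = κ • (1 : Module.End k M))
    (S : Step q 1 0 1 d X g v) {ξ : M} (hξ : X ξ = 0)
    {Y : Fin 2 → Module.End k M} (hY : ∀ i, Y i = ![X, d ^ 4 * g] i + v i) :
    ((Y 1 ^ 7) ξ =
      (v 1 ^ 7) ξ + listVal q [1] • (d ^ 28 * g ^ 7) ξ) ∧
    ((y12 q Y ^ 7) ξ =
      (y12 q v ^ 7) ξ + listVal q [35, 14, 0, 28, 42, 70, 56] • (d ^ 21 * g ^ 7) ξ) ∧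
    ((y112 q Y ^ 7 +
      (listVal q [147, 98, 49, 0, 49, 147, 196] • (g ^ 2 * (y12 q Y ^ 3 * yBeta q Y)) +
      (listVal q [245, 196, 98, 0, 0, 98, 196] • (g ^ 2 * (Y 1 * yBeta q Y ^ 2)) +
      (listVal q [1715, 1029, 343, 0, 343, 1029, 1715] • (g ^ 3 * (Y 1 ^ 2 * y12 q Y ^ 2)) +
      listVal q [343, 0, 1715, 3773, 4802, 4116, 2058] • (d ^ 7 * (g ^ 5 * (Y 1 * y12 q Y))))))) ξ =
      (y112 q v ^ 7) ξ + listVal q [32487, 28567, 15729, 2744, 0, 9212, 23422] • (d ^ 14 * g ^ 7) ξ)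
          ∧
    ((y1112 q Y ^ 7) ξ =
      (y1112 q v ^ 7) ξ + listVal q [73059, 14406, 0, 40474, 105644, 146118, 131712] • (d ^ 7 * g ^
          7) ξ) ∧
    ((yBeta q Y ^ 7) ξ = (yBeta q v ^ 7) ξ +
      (listVal q [0, 14406, 376957, 549829, 549829, 376957, 14406] • (d ^ 7 * (g ^ 7 * v 1 ^ 7)) ξ +
      (listVal q [9947, 0, 0, 3087, 16807, 19894, 19894] • (d ^ 14 * (g ^ 7 * y12 q v ^ 7)) ξ +
      listVal q [0, 3022859, 9822491, 15272761, 15272761, 9822491, 3022859] • (d ^ 35 * g ^ 14) ξ)))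
          := by
  subst hg
  obtain ⟨h0, h1, h2, h3, hb⟩ := S.root_vectors hq (constsEq_scalar hq)
  replace h0 : Y 1 = _ := (hY 1).trans h0
  rw [← funext hY] at h1 h2 h3 hb
  refine ⟨?_, ?_, ?_, ?_, ?_⟩
  · rw [Expr.pow_seven_apply hq (op_eq_zero_scalar hq S hξ Expr.z0_scalar) h0]
    simp only [Expr.op, Expr.op_term, Expr.op_vpow, LinearMap.add_apply, LinearMap.smul_apply,
      mul_one, letters_eq]
  · rw [Expr.pow_seven_apply hq (op_eq_zero_scalar hq S hξ Expr.z1_scalar) h1]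
    simp only [Expr.op, Expr.op_term, Expr.op_vpow, LinearMap.add_apply, LinearMap.smul_apply,
      mul_one, letters_eq]
  · rw [Expr.pow_seven_add_apply hq (op_eq_zero_scalar hq S hξ Expr.z2_scalar) h2
      (by rw [Expr.op_term, pow_zero, one_mul, Expr.op, Expr.op_pow, h1, hb, (letters_eq q _ v).1])
      (by rw [Expr.op_term, pow_zero, one_mul, Expr.op, Expr.op_pow, h0, hb, (letters_eq q _ v).1])
      (by rw [Expr.op_term, pow_zero, one_mul, Expr.op, Expr.op_pow, Expr.op_pow,
          h0, h1, (letters_eq q _ v).1])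
      (by rw [Expr.op_term, Expr.op, h0, h1, (letters_eq q _ v).1])]
    simp only [Expr.op, Expr.op_term, Expr.op_vpow, LinearMap.add_apply, LinearMap.smul_apply,
      mul_one, letters_eq]
  · rw [Expr.pow_seven_apply hq (op_eq_zero_scalar hq S hξ Expr.z3_scalar) h3]
    simp only [Expr.op, Expr.op_term, Expr.op_vpow, LinearMap.add_apply, LinearMap.smul_apply,
      mul_one, letters_eq]
  · rw [Expr.pow_seven_apply hq (op_eq_zero_scalar hq S hξ Expr.b_scalar) hb]
    simp only [Expr.op, Expr.op_term, Expr.op_vpow, LinearMap.add_apply, LinearMap.smul_apply,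
      mul_one, letters_eq]

/-- The seventh powers of the root vectors in a reduction step with `m = 3`, on a vector killed by
`X`. -/
theorem powers_braided (hq : IsPrimitiveRoot q 7)
    (S : Step q 0 6 (q ^ 6) d X g v) {ξ : M} (hξ : X ξ = 0)
    {Y : Fin 2 → Module.End k M} (hY : ∀ i, Y i = ![X, d ^ 3 * g] i + v i) :
    ((Y 1 ^ 7) ξ =
      (v 1 ^ 7) ξ + listVal q [1] • (d ^ 21 * g ^ 7) ξ) ∧
    ((y12 q Y ^ 7) ξ =
      (y12 q v ^ 7) ξ + listVal q [35, 56, 70, 42, 28, 0, 14] • (d ^ 14 * g ^ 7) ξ) ∧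
    ((y112 q Y ^ 7) ξ =
      (y112 q v ^ 7) ξ + listVal q [1323, 1078, 490, 0, 0, 490, 1078] • (d ^ 7 * g ^ 7) ξ) ∧
    ((y1112 q Y ^ 7) ξ =
      (y1112 q v ^ 7) ξ + listVal q [343, 686, 686, 0, 686] • (d ^ 0 * g ^ 7) ξ) ∧
    ((yBeta q Y ^ 7) ξ = (yBeta q v ^ 7) ξ +
      (listVal q [60025, 38416, 24010, 0, 0, 24010, 38416] • (d ^ 0 * (g ^ 7 * v 1 ^ 7)) ξ +
      (listVal q [1029, 2058, 2058, 0, 2058] • (d ^ 7 * (g ^ 7 * y12 q v ^ 7)) ξ +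
      listVal q [0, 21609, 36015, 60025, 60025, 36015, 21609] • (d ^ 21 * g ^ 14) ξ))) := by
  obtain ⟨h0, h1, h2, h3, hb⟩ := S.root_vectors hq (constsEq_braided hq)
  replace h0 : Y 1 = _ := (hY 1).trans h0
  rw [← funext hY] at h1 h2 h3 hb
  refine ⟨?_, ?_, ?_, ?_, ?_⟩
  · rw [Expr.pow_seven_apply hq (op_eq_zero_braided hq S hξ Expr.z0_braided) h0]
    simp only [Expr.op, Expr.op_term, Expr.op_vpow, LinearMap.add_apply, LinearMap.smul_apply,
      mul_one, letters_eq]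
  · rw [Expr.pow_seven_apply hq (op_eq_zero_braided hq S hξ Expr.z1_braided) h1]
    simp only [Expr.op, Expr.op_term, Expr.op_vpow, LinearMap.add_apply, LinearMap.smul_apply,
      mul_one, letters_eq]
  · rw [Expr.pow_seven_apply hq (op_eq_zero_braided hq S hξ Expr.z2_braided) h2]
    simp only [Expr.op, Expr.op_term, Expr.op_vpow, LinearMap.add_apply, LinearMap.smul_apply,
      mul_one, letters_eq]
  · rw [Expr.pow_seven_apply hq (op_eq_zero_braided hq S hξ Expr.z3_braided) h3]
    simp only [Expr.op, Expr.op_term, Expr.op_vpow, LinearMap.add_apply, LinearMap.smul_apply,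
      mul_one, letters_eq]
  · rw [Expr.pow_seven_apply hq (op_eq_zero_braided hq S hξ Expr.b_braided) hb]
    simp only [Expr.op, Expr.op_term, Expr.op_vpow, LinearMap.add_apply, LinearMap.smul_apply,
      mul_one, letters_eq]

end Step

end Powers

/-! ### Shift operators and colinear maps from linear forms -/

section Shift
variable {k ι : Type*} [Field k]

/-- The weighted shift operator `e_p ↦ c p • e_(f p)`. -/
def wshift (f : ι → ι) (c : ι → k) : Module.End k (ι →₀ k) :=
  Finsupp.linearCombination k fun p => Finsupp.single (f p) (c p)

lemma wshift_single (f : ι → ι) (c : ι → k) (p : ι) (a : k) :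
    wshift f c (Finsupp.single p a) = Finsupp.single (f p) (c p * a) := by
  simp [wshift, mul_comm]

lemma wshift_mul (f f' : ι → ι) (c c' : ι → k) :
    wshift f c * wshift f' c' = wshift (f ∘ f') (fun p => c (f' p) * c' p) := by
  refine Finsupp.lhom_ext fun p a => ?_
  rw [Module.End.mul_apply]
  simp only [wshift_single, Function.comp_apply, mul_assoc]

lemma end_ext {T T' : Module.End k (ι →₀ k)}
    (h : ∀ p, T (Finsupp.single p 1) = T' (Finsupp.single p 1)) : T = T' := by
  refine Finsupp.lhom_ext fun p a => ?_
  rw [← mul_one a, ← smul_eq_mul, ← Finsupp.smul_single, map_smul, map_smul, h]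

variable {H : Type*} [Ring H] [HopfAlgebra k H]

/-- The action of `H` for which `e_p` has weight `σ p`. -/
def diagHom (σ : ι → WithConv (H →ₐ[k] k)) : H →ₐ[k] Module.End k (ι →₀ k) :=
  AlgHom.ofLinearMap
    { toFun := fun h => wshift id fun p => σ p h
      map_add' := fun h h' => end_ext fun p => by simp [wshift_single]
      map_smul' := fun r h => end_ext fun p => by simp [wshift_single] }
    (end_ext fun p => by
      simp [wshift_single])
    (fun h h' => end_ext fun p => by
      simp [wshift_single])

lemma diagHom_apply (σ : ι → WithConv (H →ₐ[k] k)) (h : H) :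
    diagHom σ h = wshift id fun p => σ p h := rfl

lemma diagHom_mul_wshift {σ : ι → WithConv (H →ₐ[k] k)} {χ : WithConv (H →ₐ[k] k)} {f : ι → ι}
    {c : ι → k} (hc : ∀ p, c p ≠ 0 → σ (f p) = χ * σ p) (h : H) :
    diagHom σ h * wshift f c = wshift f c * diagHom σ (hitL χ h) := by
  refine end_ext fun p => ?_
  simp only [diagHom_apply, wshift_mul, wshift_single, Function.comp_apply, id]
  by_cases hp : c p = 0
  · simp [hp]
  · rw [hc p hp, PrincipalRealization.conv_apply', mul_comm (c p)]

end Shift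

section RelVec
variable {k A B : Type*} [Field k] [Ring A] [Algebra k A] [Ring B] [Algebra k B]

/-- The polynomials in the generators which take the constant values `μ_α` in the cleft object. -/
def relVec (q l₁ l₂ : k) (y : Fin 2 → A) : PosRoot → A
  | .r112 => y112 q y ^ 7
      + (((8 * q + 9 * q ^ 2 + 3 * q ^ 3 + 4 * q ^ 4 + 5 * q ^ 5 - q ^ 6) * l₁ ^ 2) •
          (y12 q y ^ 3 * yBeta q y)
      + (((5 * q + 8 * q ^ 2 + 9 * q ^ 3 + 8 * q ^ 4 + 5 * q ^ 5) * l₁ ^ 2) •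
          (y 1 * yBeta q y ^ 2)
      + ((-(7 * q ^ 3 * (1 + 2 * q + q ^ 2) * l₁ ^ 3)) • (y 1 ^ 2 * y12 q y ^ 2)
      + ((2 * q + 4 * q ^ 2 + 13 * q ^ 3 + 22 * q ^ 4 + 17 * q ^ 5 + 5 * q ^ 6) * l₂ * l₁ ^ 3) •
          (y 1 * y12 q y))))
  | .rBeta => yBeta q y ^ 7
      - (((210 * q + 224 * q ^ 2 + 238 * q ^ 3 + 105 * q ^ 4 + 462 * q ^ 5 + 231 * q ^ 6) *
            l₂ ^ 2 * l₁ ^ 3) • y12 q y ^ 7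
      + ((833 * q + 1911 * q ^ 2 + 2352 * q ^ 3 + 1911 * q ^ 4 + 833 * q ^ 5) * l₂ * l₁ ^ 5) •
          y 1 ^ 7)
  | .r1 => y 0 ^ 7
  | .r2 => y 1 ^ 7
  | .r12 => y12 q y ^ 7
  | .r1112 => y1112 q y ^ 7

lemma map_rootVec (f : A →ₐ[k] B) (q : k) (y : Fin 2 → A) (α : PosRoot) :
    f (rootVec q y α) = rootVec q (fun i => f (y i)) α := by
  cases α <;> simp only [rootVec, yBeta, y1112, y112, y12, map_brBracket]

lemma map_relVec (f : A →ₐ[k] B) (q l₁ l₂ : k) (y : Fin 2 → A) (α : PosRoot) :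
    f (relVec q l₁ l₂ y α) = relVec q l₁ l₂ (fun i => f (y i)) α := by
  have h12 := map_rootVec f q y .r12
  have h112 := map_rootVec f q y .r112
  have h1112 := map_rootVec f q y .r1112
  have hb := map_rootVec f q y .rBeta
  simp only [rootVec] at h12 h112 h1112 hb
  cases α <;> simp only [relVec, map_add, map_sub, map_smul, map_pow, map_mul, h12, h112, h1112, hb]

end RelVec

section Tensor
variable {k N B : Type*} [Field k] [AddCommGroup N] [Module k N] [Ring B] [Algebra k B]

/-- The action of `T ⊗ b` on `N ⊗ B`, where `b` acts by left multiplication. -/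
def tensorEnd : Module.End k N ⊗[k] B →ₐ[k] Module.End k (N ⊗[k] B) :=
  (Module.endTensorEndAlgHom (R := k) (S := k) (A := k) (M := N) (N := B)).comp
    (Algebra.TensorProduct.map (AlgHom.id k _) (Algebra.lmul k B))

lemma tensorEnd_tmul (T : Module.End k N) (b : B) (n : N) (c : B) :
    tensorEnd (T ⊗ₜ[k] b) (n ⊗ₜ c) = T n ⊗ₜ (b * c) := by
  simp [tensorEnd, Module.endTensorEndAlgHom_apply]

/-- The action of `T` on the first factor of `N ⊗ B`. -/
def leftEnd : Module.End k N →ₐ[k] Module.End k (N ⊗[k] B) :=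
  tensorEnd.comp Algebra.TensorProduct.includeLeft

lemma leftEnd_apply (T : Module.End k N) : leftEnd (B := B) T = tensorEnd (T ⊗ₜ[k] (1 : B)) := rfl

lemma tensorEnd_mul_leftEnd {G T : Module.End k N} {c : k} (h : G * T = c • (T * G)) (b : B) :
    tensorEnd (G ⊗ₜ[k] b) * leftEnd T = c • (leftEnd T * tensorEnd (G ⊗ₜ[k] b)) := by
  rw [leftEnd_apply, ← map_mul, ← map_mul, Algebra.TensorProduct.tmul_mul_tmul,
    Algebra.TensorProduct.tmul_mul_tmul, h, ← map_smul, mul_one, one_mul, TensorProduct.smul_tmul']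

lemma leftEnd_mul_tensorEnd {G T : Module.End k N} {c : k} (h : T * G = c • (G * T)) (b : B) :
    leftEnd T * tensorEnd (G ⊗ₜ[k] b) = c • (tensorEnd (G ⊗ₜ[k] b) * leftEnd T) := by
  rw [leftEnd_apply, ← map_mul, ← map_mul, Algebra.TensorProduct.tmul_mul_tmul,
    Algebra.TensorProduct.tmul_mul_tmul, h, ← map_smul, mul_one, one_mul, TensorProduct.smul_tmul']

/-- The slice map `n ⊗ b ↦ ψ(n) b`. -/
def slice (ψ : N →ₗ[k] k) : N ⊗[k] B →ₗ[k] B :=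
  (TensorProduct.lid k B).toLinearMap ∘ₗ LinearMap.rTensor B ψ

lemma slice_tmul (ψ : N →ₗ[k] k) (n : N) (b : B) : slice ψ (n ⊗ₜ[k] b) = ψ n • b := by
  simp [slice]

end Tensor

namespace PrincipalRealization
variable {k H : Type*} [Field k] [Ring H] [HopfAlgebra k H] {q : k}
  (R : PrincipalRealization k H q) {l₁ l₂ : k} (hl : R.SerreParam l₁ l₂)

/-- A linear form on `𝓐(λ)` which is unital and compatible with the counit of `H`. -/
structure IsAugmentation (φ : R.AAlg hl →ₗ[k] k) : Prop where
  map_one : φ 1 = 1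
  inr_mul : ∀ h a, φ ((R.action hl).inr h * a) = counit (R := k) h * φ a
  mul_inr : ∀ a h, φ (a * (R.action hl).inr h) = φ a * counit (R := k) h

/-- The colinear map `a ↦ φ(a₍₀₎) a₍₁₎` attached to a linear form. -/
def cleave (φ : R.AAlg hl →ₗ[k] k) : R.AAlg hl →ₗ[k] R.HPre :=
  slice φ ∘ₗ (R.coaction hl).toLinearMap

variable {N : Type*} [AddCommGroup N] [Module k N]

lemma rootVec_g_tmul (α : PosRoot) :
    rootVec q (fun i => (R.action hl).inr (R.g i) ⊗ₜ[k] R.x i) α =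
      (R.action hl).inr (R.gOf α.deg) ⊗ₜ[k] rootVec q R.x α := by
  cases α <;> simp only [rootVec, yBeta, y1112, y112, y12, PosRoot.deg]
  · rw [R.gOf_zero_one.1]
  · rw [R.gOf_zero_one.1, R.gOf_zero_one.2, R.bracket_g hl (e := ![1, 1]) _ _ _ _ _ _ (by simp),
      R.bracket_g hl (e := ![2, 1]) _ _ _ _ _ _ (by simp),
      R.bracket_g hl (e := ![3, 1]) _ _ _ _ _ _ (by simp)]
  · rw [R.gOf_zero_one.1, R.gOf_zero_one.2, R.bracket_g hl (e := ![1, 1]) _ _ _ _ _ _ (by simp),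
      R.bracket_g hl (e := ![2, 1]) _ _ _ _ _ _ (by simp)]
  · rw [R.gOf_zero_one.1, R.gOf_zero_one.2, R.bracket_g hl (e := ![1, 1]) _ _ _ _ _ _ (by simp),
      R.bracket_g hl (e := ![2, 1]) _ _ _ _ _ _ (by simp),
      R.bracket_g hl (e := ![3, 2]) _ _ _ _ _ _ (by simp)]
  · rw [R.gOf_zero_one.1, R.gOf_zero_one.2, R.bracket_g hl (e := ![1, 1]) _ _ _ _ _ _ (by simp)]
  · rw [R.gOf_zero_one.2]

lemma serre_x : y11112 q R.x = 0 ∧ y122 q R.x = 0 := by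
  constructor
  · have := map_y11112 (R.action R.serreParam_zero).inl q (gen q 0 0)
    rw [gen_serre1, map_zero, map_zero] at this
    exact this.symm
  · have := map_y122 (R.action R.serreParam_zero).inl q (gen q 0 0)
    rw [gen_serre2, map_zero, map_zero] at this
    exact this.symm

lemma serre_g_tmul : y11112 q (fun i => (R.action hl).inr (R.g i) ⊗ₜ[k] R.x i) = 0 ∧
    y122 q (fun i => (R.action hl).inr (R.g i) ⊗ₜ[k] R.x i) = 0 := by
  have h1 := R.rootVec_g_tmul hl .r1112
  have h2 := R.rootVec_g_tmul hl .r12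
  simp only [rootVec, PosRoot.deg] at h1 h2
  constructor
  · have := R.serre_x.1
    rw [y11112] at this ⊢
    rw [h1, R.gOf_zero_one.1, R.bracket_g hl (e := ![4, 1]) _ _ _ _ _ _ (by simp), this,
      TensorProduct.tmul_zero]
  · have := R.serre_x.2
    rw [y122] at this ⊢
    rw [h2, R.gOf_zero_one.2, R.bracket_g hl (e := ![1, 2]) _ _ _ _ _ _ (by simp), this,
      TensorProduct.tmul_zero]

/-- The operators `r(g_i) ⊗ x_i` on `N ⊗ 𝓗'`. -/
def gx (r : R.AAlg hl →ₐ[k] Module.End k N) (i : Fin 2) : Module.End k (N ⊗[k] R.HPre) :=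
  tensorEnd (r ((R.action hl).inr (R.g i)) ⊗ₜ R.x i)

lemma gx_eq (r : R.AAlg hl →ₐ[k] Module.End k N) :
    R.gx hl r = fun i => (tensorEnd.comp (Algebra.TensorProduct.map r (AlgHom.id k R.HPre)))
      ((R.action hl).inr (R.g i) ⊗ₜ[k] R.x i) := rfl

lemma gx_serre (r : R.AAlg hl →ₐ[k] Module.End k N) :
    y11112 q (R.gx hl r) = 0 ∧ y122 q (R.gx hl r) = 0 := by
  rw [gx_eq, ← map_y11112, ← map_y122, (R.serre_g_tmul hl).1, (R.serre_g_tmul hl).2]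
  simp

lemma counit_gOf (d : Fin 2 → ℕ) : counit (R := k) (R.gOf d) = 1 := by
  have h := fun i => (R.g_groupLike i).counit_eq_one
  rw [gOf, Bialgebra.counit_mul, Bialgebra.counit_pow, Bialgebra.counit_pow, h, h]
  simp

/-- The root vectors in the operators `r(g_i) ⊗ x_i`, on the vectors `v ⊗ z` with `v`
invariant. -/
lemma rootVec_gx_apply {r : R.AAlg hl →ₐ[k] Module.End k N} {vac : N}
    (hv : ∀ h, r ((R.action hl).inr h) vac = counit (R := k) h • vac) (α : PosRoot) (n : ℕ)
    (z : R.HPre) :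
    (rootVec q (R.gx hl r) α ^ n) (vac ⊗ₜ z) = vac ⊗ₜ (rootVec q R.x α ^ n * z) := by
  induction n generalizing z with
  | zero => simp
  | succ n ih =>
    rw [pow_succ, Module.End.mul_apply, pow_succ, mul_assoc, ← ih]
    congr 1
    rw [gx_eq, ← map_rootVec, R.rootVec_g_tmul]
    simp [tensorEnd_tmul, hv, counit_gOf]

/-- It suffices to evaluate the elements `relVec` on the vector `vac ⊗ 1` of `N ⊗ 𝓗'`, for a module
`N` over `𝓐(λ)` with an invariant vector and an invariant linear form. -/
theorem exists_augmentation_of_module (r : R.AAlg hl →ₐ[k] Module.End k N) {vac : N}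
    {ψ : N →ₗ[k] k} (hv : ∀ h, r ((R.action hl).inr h) vac = counit (R := k) h • vac)
    (hψ : ∀ h n, ψ (r ((R.action hl).inr h) n) = counit (R := k) h * ψ n) (hvac : ψ vac = 1)
    (hrel : ∀ α, slice ψ ((relVec q l₁ l₂
      (fun i => leftEnd (r (R.y hl i)) + R.gx hl r i) α : Module.End k (N ⊗[k] R.HPre))
        (vac ⊗ₜ[k] (1 : R.HPre))) = rootVec q R.x α ^ 7) :
    ∃ φ : R.AAlg hl →ₗ[k] k, R.IsAugmentation hl φ ∧
      ∀ α, R.cleave hl φ (relVec q l₁ l₂ (R.y hl) α) = rootVec q R.x α ^ 7 := by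
  let φ : R.AAlg hl →ₗ[k] k := ψ ∘ₗ LinearMap.applyₗ vac ∘ₗ r.toLinearMap
  have key : ∀ a, R.cleave hl φ a = slice ψ ((tensorEnd.comp
      (Algebra.TensorProduct.map r (AlgHom.id k R.HPre))) (R.coaction hl a) (vac ⊗ₜ 1)) := by
    intro a
    simp only [cleave, LinearMap.comp_apply, AlgHom.toLinearMap_apply]
    induction R.coaction hl a using TensorProduct.induction_on with
    | zero => simp
    | add x y hx hy => simp only [map_add, hx, hy, LinearMap.add_apply]
    | tmul a b => simp [tensorEnd_tmul, slice_tmul, φ]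
  refine ⟨φ, ⟨by simp [φ, hvac], fun h a => by simp [φ, hψ], fun a h => ?_⟩, fun α => ?_⟩
  · simp [φ, hv, mul_comm]
  · have e : (fun i => (tensorEnd.comp (Algebra.TensorProduct.map r (AlgHom.id k R.HPre)))
        (R.coaction hl (R.y hl i))) = fun i => leftEnd (r (R.y hl i)) + R.gx hl r i := by
      funext i
      rw [coaction_y, map_add]
      simp [gx, leftEnd]
    rw [key, map_relVec, map_relVec, e, hrel α]

variable {ι : Type*}

/-- The module over `𝓐(λ)` with a basis of weight vectors. -/
def rep (σ : ι → WithConv (H →ₐ[k] k)) (y : Fin 2 → Module.End k (ι →₀ k))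
    (h1 : y11112 q y = algebraMap k _ l₁) (h2 : y122 q y = algebraMap k _ l₂)
    (hy : ∀ i h, diagHom σ h * y i = y i * diagHom σ (hitL (R.χ i) h)) :
    R.AAlg hl →ₐ[k] Module.End k (ι →₀ k) :=
  (R.action hl).lift (EAlg.lift y h1 h2) (diagHom σ)
    (HModuleAlgebra.compat_of_gen _ _ _ _ (adjoin_gen q l₁ l₂) fun i => by
      rw [HModuleAlgebra.compat_iff _ _ _ (fun h => R.action_gen hl h i)]
      intro h
      rw [EAlg.lift_gen, hy])

lemma rep_y (σ : ι → WithConv (H →ₐ[k] k)) (y : Fin 2 → Module.End k (ι →₀ k))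
    (h1 : y11112 q y = algebraMap k _ l₁) (h2 : y122 q y = algebraMap k _ l₂)
    (hy : ∀ i h, diagHom σ h * y i = y i * diagHom σ (hitL (R.χ i) h))
    (i : Fin 2) : R.rep hl σ y h1 h2 hy (R.y hl i) = y i := by
  change HModuleAlgebra.pairLin (EAlg.lift y h1 h2) (diagHom σ) (gen q l₁ l₂ i ⊗ₜ[k] (1 : H)) = _
  simp [HModuleAlgebra.pairLin, EAlg.lift_gen]

lemma rep_inr (σ : ι → WithConv (H →ₐ[k] k)) (y : Fin 2 → Module.End k (ι →₀ k))
    (h1 : y11112 q y = algebraMap k _ l₁) (h2 : y122 q y = algebraMap k _ l₂)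
    (hy : ∀ i h, diagHom σ h * y i = y i * diagHom σ (hitL (R.χ i) h))
    (h : H) : R.rep hl σ y h1 h2 hy ((R.action hl).inr h) = diagHom σ h := by
  change HModuleAlgebra.pairLin (EAlg.lift y h1 h2) (diagHom σ) ((1 : EAlg q l₁ l₂) ⊗ₜ[k] h) = _
  simp [HModuleAlgebra.pairLin]

end PrincipalRealization

/-! ### The linear form for `l₁ = 0` -/

section Kernel
variable {k M : Type*} [Field k] [AddCommGroup M] [Module k M] {q : k}

lemma rootVec_mem {v : Fin 2 → Module.End k M} {K : Submodule k M}
    (hv : ∀ i, ∀ ζ ∈ K, v i ζ ∈ K) (α : PosRoot) : ∀ ζ ∈ K, rootVec q v α ζ ∈ K := by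
  have hb : ∀ (a b : Fin 2 → ℕ) (S T : Module.End k M), (∀ ζ ∈ K, S ζ ∈ K) → (∀ ζ ∈ K, T ζ ∈ K) →
      ∀ ζ ∈ K, brBracket q a b S T ζ ∈ K := fun a b S T hS hT ζ hζ =>
    K.sub_mem (hS _ (hT _ hζ)) (K.smul_mem _ (hT _ (hS _ hζ)))
  have h12 : ∀ ζ ∈ K, y12 q v ζ ∈ K := hb _ _ _ _ (hv 0) (hv 1)
  have h112 : ∀ ζ ∈ K, y112 q v ζ ∈ K := hb _ _ _ _ (hv 0) h12
  cases α with
  | r1 => exact hv 0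
  | r2 => exact hv 1
  | r12 => exact h12
  | r112 => exact h112
  | r1112 => exact hb _ _ _ _ (hv 0) h112
  | rBeta => exact hb _ _ _ _ h112 h12

/-- If the root vectors other than the last one of the pair `u` vanish on an invariant subspace,
then adding `u` does not change these root vectors on the subspace. -/
lemma rootVec_add_apply (hq : IsPrimitiveRoot q 7) {u v : Fin 2 → Module.End k M}
    (h : ∀ i j, v i * u j = qMatrix q i j • (u j * v i)) (hs : y11112 q v = 0 ∧ y122 q v = 0)
    {K : Submodule k M} (hv : ∀ i, ∀ ζ ∈ K, v i ζ ∈ K)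
    (hu : ∀ α, α ≠ .r2 → ∀ ζ ∈ K, rootVec q u α ζ = 0) {α : PosRoot} (hα : α ≠ .r2) (n : ℕ) :
    ∀ ζ ∈ K, (rootVec q (fun i => u i + v i) α ^ n) ζ = (rootVec q v α ^ n) ζ := by
  have m2 := hv 1
  have m12 : ∀ ζ ∈ K, y12 q v ζ ∈ K := rootVec_mem hv .r12
  have m112 : ∀ ζ ∈ K, y112 q v ζ ∈ K := rootVec_mem hv .r112
  have z1 : ∀ ζ ∈ K, u 0 ζ = 0 := hu .r1 (by simp)
  have z12 : ∀ ζ ∈ K, y12 q u ζ = 0 := hu .r12 (by simp)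
  have z112 : ∀ ζ ∈ K, y112 q u ζ = 0 := hu .r112 (by simp)
  have z1112 : ∀ ζ ∈ K, y1112 q u ζ = 0 := hu .r1112 (by simp)
  have zb : ∀ ζ ∈ K, yBeta q u ζ = 0 := hu .rBeta (by simp)
  have key : ∀ ζ ∈ K, rootVec q (fun i => u i + v i) α ζ = rootVec q v α ζ := by
    intro ζ hζ
    obtain ⟨e1, e2, e3, eb⟩ := root_vectors_add hq u v h hs.1 hs.2
    have w2 := z1 _ (m2 _ hζ)
    have w12 := z1 _ (m12 _ hζ)
    have w112 := z1 _ (m112 _ hζ)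
    cases α with
    | r2 => exact absurd rfl hα
    | r1 => simp [rootVec, z1 _ hζ]
    | r12 =>
      simp only [rootVec]
      rw [e1]
      simp [z12 _ hζ, w2]
    | r112 =>
      simp only [rootVec]
      rw [e2]
      simp [z112 _ hζ, w2, w12]
    | r1112 =>
      simp only [rootVec]
      rw [e3]
      simp [z1112 _ hζ, w2, w12, w112]
    | rBeta =>
      simp only [rootVec]
      rw [eb]
      simp [zb _ hζ, w2, z112 _ (m12 _ hζ), z1112 _ (m2 _ hζ), z1 _ (m2 _ (m2 _ hζ)),
        z1 _ (m2 _ (m12 _ hζ)), z1 _ (m12 _ (m12 _ hζ))]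
  induction n with
  | zero => simp
  | succ n ih =>
    intro ζ hζ
    rw [pow_succ, pow_succ, Module.End.mul_apply, Module.End.mul_apply, key ζ hζ,
      ih _ (rootVec_mem hv α ζ hζ)]

end Kernel

section Lowering
variable {k A : Type*} [Field k] [Ring A] [Algebra k A] {q : k}

lemma sq_mul_of_lower {d X : A} (h : X * d = q ^ 3 • (d * X) + (1 - q ^ 3) • 1) :
    X ^ 2 * d = q ^ 6 • (d * X ^ 2) + (1 - q ^ 6) • X := by
  rw [pow_two, mul_assoc, h, mul_add, mul_smul_comm, mul_smul_comm, ← mul_assoc, h, mul_one,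
    add_mul, smul_mul_assoc, smul_mul_assoc, one_mul, mul_assoc]
  module

lemma bracket_lower {d X : A} (h : X * d = q ^ 3 • (d * X) + (1 - q ^ 3) • 1) (κ a b : k)
    (α β : Fin 2 → ℕ) (m : ℕ) : ∃ a' b' : k,
      brBracket q α β (κ • X ^ 2) (a • (d * X ^ (m + 1)) + b • X ^ m) =
        a' • (d * X ^ (m + 3)) + b' • X ^ (m + 2) := by
  have e : X ^ 2 * (d * X ^ (m + 1)) = q ^ 6 • (d * X ^ (m + 3)) + (1 - q ^ 6) • X ^ (m + 2) := by
    rw [← mul_assoc, sq_mul_of_lower h, add_mul, smul_mul_assoc, smul_mul_assoc, mul_assoc,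
      ← pow_add, ← pow_succ', show 2 + (m + 1) = m + 3 by ring]
  have e' : X ^ 2 * X ^ m = X ^ (m + 2) := by rw [← pow_add, add_comm]
  have e'' : X ^ m * X ^ 2 = X ^ (m + 2) := by rw [← pow_add]
  have e3 : d * X ^ (m + 1) * X ^ 2 = d * X ^ (m + 3) := by rw [mul_assoc, ← pow_add]
  refine ⟨κ * (a * q ^ 6 - bichar q α β * a),
    κ * (a * (1 - q ^ 6) + b - bichar q α β * b), ?_⟩
  simp only [brBracket, mul_add, add_mul, smul_mul_assoc, mul_smul_comm, e, e', e'', e3]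
  module

/-- The pair `κ X ^ 2, d`, for a lowering operator `X` with `X ^ 7 = 0`, satisfies the Serre
relations deformed by the second parameter, and its root vectors lie in the left ideal of `X`. -/
lemma serre_sq_lower {d X : A}
    (h : X * d = q ^ 3 • (d * X) + (1 - q ^ 3) • 1) (hX : X ^ 7 = 0) (κ : k) :
    y11112 q ![κ • X ^ 2, d] = 0 ∧
    y122 q ![κ • X ^ 2, d] = algebraMap k A (κ * (1 - q ^ 3) * (1 - q ^ 6)) ∧
    ∀ α, α ≠ .r2 → ∃ B, rootVec q ![κ • X ^ 2, d] α = B * X := by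
  have hs := sq_mul_of_lower h
  have e12 : y12 q ![κ • X ^ 2, d] = (κ * (q ^ 6 - q ^ 3)) • (d * X ^ (1 + 1)) +
      (κ * (1 - q ^ 6)) • X ^ 1 := by
    simp only [y12, brBracket, bichar_eq, Matrix.cons_val_zero, Matrix.cons_val_one,
      smul_mul_assoc, mul_smul_comm, hs]
    norm_num
    module
  obtain ⟨a2, b2, e112⟩ := bracket_lower h κ (κ * (q ^ 6 - q ^ 3)) (κ * (1 - q ^ 6)) ![1, 0] ![1, 1]
      1
  obtain ⟨a3, b3, e1112⟩ := bracket_lower h κ a2 b2 ![1, 0] ![2, 1] 3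
  obtain ⟨a4, b4, e11112⟩ := bracket_lower h κ a3 b3 ![1, 0] ![3, 1] 5
  have f112 : y112 q ![κ • X ^ 2, d] = a2 • (d * X ^ (1 + 3)) + b2 • X ^ (1 + 2) := by
    rw [y112, e12]; exact e112
  have f1112 : y1112 q ![κ • X ^ 2, d] = a3 • (d * X ^ (3 + 3)) + b3 • X ^ (3 + 2) := by
    rw [y1112, f112]; exact e1112
  have g : ∀ (a b : k) (m : ℕ), ∃ B, a • (d * X ^ (m + 2)) + b • X ^ (m + 1) = B * X := by
    intro a b m
    refine ⟨a • (d * X ^ (m + 1)) + b • X ^ m, ?_⟩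
    rw [add_mul, smul_mul_assoc, smul_mul_assoc, mul_assoc, ← pow_succ, ← pow_succ]
  obtain ⟨B1, hB1⟩ := g (κ * (q ^ 6 - q ^ 3)) (κ * (1 - q ^ 6)) 0
  obtain ⟨B2, hB2⟩ := g a2 b2 2
  obtain ⟨B3, hB3⟩ := g a3 b3 4
  refine ⟨?_, ?_, ?_⟩
  · rw [y11112, f1112]
    refine e11112.trans ?_
    rw [show 5 + 3 = 7 + 1 from rfl, pow_add, hX]
    simp
  · rw [y122, e12]
    simp only [brBracket, bichar_eq, Matrix.cons_val_zero, Matrix.cons_val_one, add_mul, mul_add,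
      smul_mul_assoc, mul_smul_comm, pow_one, mul_assoc, h]
    rw [show 1 + 1 = 2 from rfl, hs, Algebra.algebraMap_eq_smul_one]
    simp only [mul_add, mul_smul_comm, ← mul_assoc, mul_one]
    match_scalars <;> ring
  · intro α hα
    cases α with
    | r2 => exact absurd rfl hα
    | r1 => exact ⟨κ • X, by simp [rootVec, pow_two]⟩
    | r12 => exact ⟨B1, by rw [rootVec, e12, hB1]⟩
    | r112 => exact ⟨B2, by rw [rootVec, f112, hB2]⟩
    | r1112 => exact ⟨B3, by rw [rootVec, f1112, hB3]⟩
    | rBeta =>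
      refine ⟨B2 * X * B1 - bichar q ![2, 1] ![1, 1] • (B1 * X * B2), ?_⟩
      simp only [rootVec, yBeta, brBracket]
      rw [e12, f112]
      rw [show 1 + 1 = 0 + 2 from rfl, show X ^ 1 = X ^ (0 + 1) from rfl, hB1,
        show 1 + 3 = 2 + 2 from rfl, show X ^ (1 + 2) = X ^ (2 + 1) from rfl, hB2]
      simp only [sub_mul, smul_mul_assoc, mul_assoc]

end Lowering

namespace PrincipalRealization
variable {k H : Type*} [Field k] [Ring H] [HopfAlgebra k H] {q : k}
  (R : PrincipalRealization k H q) {l₂ : k} (hl : R.SerreParam 0 l₂)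

lemma mul_apply_groupLike {g : H} (hg : IsGroupLikeElem k g) (χ χ' : WithConv (H →ₐ[k] k)) :
    (χ * χ') g = χ g * χ' g := by
  rw [conv_apply', hitL, LinearMap.comp_apply, LinearMap.comp_apply, hg.comul_eq_tmul_self]
  simp

lemma pow_apply_groupLike {g : H} (hg : IsGroupLikeElem k g) (χ : WithConv (H →ₐ[k] k)) (n : ℕ) :
    (χ ^ n) g = χ g ^ n := by
  induction n with
  | zero =>
    have e : (1 : WithConv (H →ₐ[k] k)) g = counit (R := k) g := rfl
    rw [pow_zero, pow_zero, e, hg.counit_eq_one]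
  | succ n ih => rw [pow_succ, mul_apply_groupLike hg, ih, pow_succ]

lemma lower_pow_seven (hq : IsPrimitiveRoot q 7) :
    wshift (fun n : ℕ => n - 1) (fun n => 1 - q ^ (3 * n)) ^ 7 = (0 : Module.End k (ℕ →₀ k)) := by
  have key : ∀ m : ℕ, wshift (fun n : ℕ => n - 1) (fun n => 1 - q ^ (3 * n)) ^ m =
      wshift (fun n : ℕ => n - m) (fun n => ∏ i ∈ Finset.range m, (1 - q ^ (3 * (n - i)))) := by
    intro m
    induction m with
    | zero => exact end_ext fun p => by simp [wshift_single]
    | succ m ih =>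
      rw [pow_succ', ih, wshift_mul]
      refine end_ext fun p => ?_
      simp only [wshift_single, Function.comp_apply, Finset.prod_range_succ, Nat.sub_sub]
      rw [mul_comm (1 - _)]
  rw [key]
  refine end_ext fun n => ?_
  have h0 : ∏ i ∈ Finset.range 7, (1 - q ^ (3 * (n - i))) = 0 := by
    refine Finset.prod_eq_zero (i := n % 7) (Finset.mem_range.2 (Nat.mod_lt _ (by norm_num))) ?_
    have : 3 * (n - n % 7) = 7 * (3 * (n / 7)) := by omega
    rw [this, pow_mul, hq.pow_eq_one, one_pow, sub_self]
  simp [wshift_single, h0]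

lemma counit_smul_diagHom {ι : Type*} {σ : ι → WithConv (H →ₐ[k] k)} {p : ι} (hp : σ p = 1) (h : H)
    (a : k) :
    diagHom σ h (Finsupp.single p a) = counit (R := k) h • Finsupp.single p a := by
  have e : (1 : WithConv (H →ₐ[k] k)) h = counit (R := k) h := rfl
  rw [diagHom_apply, wshift_single, hp, e]
  simp

/-- For `l₁ = 0`, the case of a module in which the root vectors other than `y₂` are left multiples
of
a lowering operator `X`: they do not contribute on the kernel of `X`, and `y₂` does not contribute
because `ψ` vanishes on its image. The elements `relVec` are plain seventh powers here. -/
theorem exists_augmentation_of_lower {N : Type*} [AddCommGroup N] [Module k N]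
    (r : R.AAlg hl →ₐ[k] Module.End k N) {vac : N}
    {ψ : N →ₗ[k] k} (hv : ∀ h, r ((R.action hl).inr h) vac = counit (R := k) h • vac)
    (hψ : ∀ h n, ψ (r ((R.action hl).inr h) n) = counit (R := k) h * ψ n) (hvac : ψ vac = 1)
    {X : Module.End k N} (hX : X vac = 0)
    (hXG : ∀ i, X * r ((R.action hl).inr (R.g i)) = q ^ 3 • (r ((R.action hl).inr (R.g i)) * X))
    (hG : ∀ i j, r ((R.action hl).inr (R.g i)) * r (R.y hl j) =
      qMatrix q i j • (r (R.y hl j) * r ((R.action hl).inr (R.g i))))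
    (hroot : ∀ α, α ≠ .r2 → ∃ B, rootVec q (fun i => r (R.y hl i)) α = B * X)
    (hψy : ∀ n, ψ (r (R.y hl 1) n) = 0) :
    ∃ φ : R.AAlg hl →ₗ[k] k, R.IsAugmentation hl φ ∧
      ∀ α, R.cleave hl φ (relVec q 0 l₂ (R.y hl) α) = rootVec q R.x α ^ 7 := by
  set u : Fin 2 → Module.End k (N ⊗[k] R.HPre) := fun i => leftEnd (r (R.y hl i)) with hu
  have hvu : ∀ i j, R.gx hl r i * u j = qMatrix q i j • (u j * R.gx hl r i) :=
    fun i j => tensorEnd_mul_leftEnd (hG i j) _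
  have hXv : ∀ i, leftEnd X * R.gx hl r i = q ^ 3 • (R.gx hl r i * leftEnd X) :=
    fun i => leftEnd_mul_tensorEnd (hXG i) _
  let K : Submodule k (N ⊗[k] R.HPre) := LinearMap.ker (leftEnd X)
  have hvK : ∀ i, ∀ ζ ∈ K, R.gx hl r i ζ ∈ K := by
    intro i ζ hζ
    have := LinearMap.congr_fun (hXv i) ζ
    rw [Module.End.mul_apply, LinearMap.smul_apply, Module.End.mul_apply,
      (LinearMap.mem_ker.1 hζ : leftEnd X ζ = 0), map_zero, smul_zero] at this
    exact this
  have huK : ∀ α, α ≠ .r2 → ∀ ζ ∈ K, rootVec q u α ζ = 0 := by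
    intro α hα ζ hζ
    obtain ⟨B, hB⟩ := hroot α hα
    rw [hu, ← map_rootVec, hB, map_mul, Module.End.mul_apply,
      (LinearMap.mem_ker.1 hζ : leftEnd X ζ = 0), map_zero]
  refine R.exists_augmentation_of_module hl r hv hψ hvac fun α => ?_
  by_cases hα : α = .r2
  · subst hα
    have h1 : ∀ w, slice ψ (u 1 w) = (0 : R.HPre) := by
      intro w
      induction w using TensorProduct.induction_on with
      | zero => simp
      | add x y hx hy => rw [map_add, map_add, hx, hy, add_zero]
      | tmul n b =>
        change slice _ (leftEnd (r (R.y hl 1)) _) = _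
        rw [leftEnd_apply, tensorEnd_tmul, slice_tmul, hψy, zero_smul]
    have h2 : ∀ w, slice ψ (R.gx hl r 1 w) =
        R.x 1 * slice ψ w := by
      intro w
      induction w using TensorProduct.induction_on with
      | zero => simp
      | add x y hx hy => rw [map_add, map_add, hx, hy, map_add, mul_add]
      | tmul n b =>
        rw [gx, tensorEnd_tmul, slice_tmul, slice_tmul, hψ, (R.g_groupLike 1).counit_eq_one,
          one_mul, mul_smul_comm]
    -- `ψ` kills every term of `(y₂ ⊗ 1 + g₂ ⊗ x₂) ^ m` but the last one
    have h3 : ∀ m, slice ψ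
        (((u 1 + R.gx hl r 1) ^ m) (vac ⊗ₜ 1)) = R.x 1 ^ m := by
      intro m
      induction m with
      | zero => simp [slice_tmul, hvac]
      | succ m ih =>
        rw [pow_succ', Module.End.mul_apply, LinearMap.add_apply, map_add, h1, h2, ih, zero_add,
          pow_succ']
    exact h3 7
  · have e := rootVec_add_apply R.q_primitive hvu (R.gx_serre hl r) hvK huK hα 7
      (vac ⊗ₜ 1) (by
        rw [LinearMap.mem_ker, leftEnd_apply, tensorEnd_tmul, hX, TensorProduct.zero_tmul])
    rw [R.rootVec_gx_apply hl hv] at e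
    have e2 : relVec q 0 l₂ (fun i => u i + R.gx hl r i) α =
        rootVec q (fun i => u i + R.gx hl r i) α ^ 7 := by
      cases α <;> simp [relVec, rootVec]
    rw [e2, e, slice_tmul, hvac, one_smul, mul_one]

/-- The linear form for `l₁ = 0`. -/
theorem exists_augmentation_zero : ∃ φ : R.AAlg hl →ₗ[k] k, R.IsAugmentation hl φ ∧
      ∀ α, R.cleave hl φ (relVec q 0 l₂ (R.y hl) α) = rootVec q R.x α ^ 7 := by
  have h7 := R.q_pow
  -- polynomials in `d`, with `y₁ = κ X ^ 2` for a `q ^ 3`-derivative `X`; `κ` is determined by `l₂`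
  have hne : (1 - q ^ 3) * (1 - q ^ 6) ≠ 0 := by
    refine mul_ne_zero (sub_ne_zero.2 (Ne.symm ?_)) (sub_ne_zero.2 (Ne.symm ?_)) <;>
      exact R.q_primitive.pow_ne_one_of_pos_of_lt (by norm_num) (by norm_num)
  set κ := l₂ / ((1 - q ^ 3) * (1 - q ^ 6)) with hκ
  set d : Module.End k (ℕ →₀ k) := wshift (fun n => n + 1) (fun _ => 1) with hd
  set X : Module.End k (ℕ →₀ k) := wshift (fun n => n - 1) (fun n => 1 - q ^ (3 * n)) with hX
  have hXd : X * d = q ^ 3 • (d * X) + (1 - q ^ 3) • 1 := by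
    refine end_ext fun n => ?_
    cases n with
    | zero => simp [hX, hd, wshift_single]
    | succ n =>
      simp only [hX, hd, wshift_mul, LinearMap.add_apply, LinearMap.smul_apply, wshift_single,
        Function.comp_apply, Finsupp.smul_single, Module.End.one_apply, Nat.add_sub_cancel,
        ← Finsupp.single_add, smul_eq_mul]
      congr 1
      ring
  obtain ⟨s1, s2, s3⟩ := serre_sq_lower (A := Module.End k (ℕ →₀ k)) hXd
    (lower_pow_seven R.q_primitive) κ
  have hX2 : κ • X ^ 2 = wshift (fun n => n - 2)
      (fun n => κ * ((1 - q ^ (3 * (n - 1))) * (1 - q ^ (3 * n)))) := by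
    rw [pow_two, hX, wshift_mul]
    refine end_ext fun n => ?_
    simp only [LinearMap.smul_apply, wshift_single, Function.comp_apply, Finsupp.smul_single,
      smul_eq_mul, Nat.sub_sub, mul_one]
  let σ : ℕ → WithConv (H →ₐ[k] k) := fun n => R.χ 1 ^ n
  have hy : ∀ i h, diagHom σ h * ![κ • X ^ 2, d] i = ![κ • X ^ 2, d] i *
      diagHom σ (hitL (R.χ i) h) := by
    intro i
    fin_cases i
    · change ∀ h, diagHom σ h * (κ • X ^ 2) = (κ • X ^ 2) * diagHom σ (hitL (R.χ 0) h)
      rw [hX2]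
      refine diagHom_mul_wshift fun n hn => ?_
      have hκ0 : κ ≠ 0 := fun h => hn (by rw [h, zero_mul])
      have hl2 : l₂ ≠ 0 := fun h => hκ0 (by rw [hκ, h, zero_div])
      -- `y₁` lowers the weight by `χ₂ ^ 2`, which is `χ₁⁻¹` when it is needed
      have hχ : R.χ 0 * R.χ 1 ^ 2 = 1 := by
        by_contra hc
        exact hl2 (hl.2 (Or.inr (by simpa [χOf] using hc)))
      match n, hn with
      | 0, hn => simp at hn
      | 1, hn => simp at hn
      | n + 2, hn =>
        change R.χ 1 ^ n = R.χ 0 * R.χ 1 ^ (n + 2)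
        rw [add_comm, pow_add, ← mul_assoc, hχ, one_mul]
    · refine diagHom_mul_wshift fun n _ => ?_
      exact pow_succ' _ _
  have hk2 : algebraMap k (Module.End k (ℕ →₀ k)) (κ * (1 - q ^ 3) * (1 - q ^ 6)) =
      algebraMap k _ l₂ := by
    rw [mul_assoc, hκ, div_mul_cancel₀ _ hne]
  let r := R.rep hl σ ![κ • X ^ 2, d] (s1.trans (map_zero _).symm) (s2.trans hk2) hy
  have hrg : ∀ i, r ((R.action hl).inr (R.g i)) = wshift id (fun n => q ^ (3 * n)) := by
    intro i
    rw [rep_inr, diagHom_apply]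
    congr 1
    funext n
    have : R.χ 1 (R.g i) = q ^ 3 := by rw [R.χ_g]; fin_cases i <;> rfl
    rw [pow_apply_groupLike (R.g_groupLike i), this, pow_mul]
  have hGX : ∀ i, X * r ((R.action hl).inr (R.g i)) = q ^ 3 • (r ((R.action hl).inr (R.g i)) * X) :=
      by
    intro i
    rw [hrg]
    refine end_ext fun n => ?_
    cases n with
    | zero => simp [hX, wshift_single]
    | succ n =>
      simp only [hX, wshift_mul, LinearMap.smul_apply, wshift_single, Function.comp_apply, id,
        Finsupp.smul_single, Nat.add_sub_cancel, smul_eq_mul]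
      congr 1
      ring
  have hGd : ∀ i, r ((R.action hl).inr (R.g i)) * d = q ^ 3 • (d * r ((R.action hl).inr (R.g i))) :=
      by
    intro i
    rw [hrg]
    refine end_ext fun n => ?_
    simp only [hd, wshift_mul, LinearMap.smul_apply, wshift_single, Function.comp_apply, id,
        Finsupp.smul_single, smul_eq_mul]
    congr 1
    ring
  have hGX2 : ∀ i, r ((R.action hl).inr (R.g i)) * (κ • X ^ 2) =
      q • ((κ • X ^ 2) * r ((R.action hl).inr (R.g i))) := by
    intro i
    have hXG : r ((R.action hl).inr (R.g i)) * X = q ^ 4 • (X * r ((R.action hl).inr (R.g i))) := by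
      rw [hGX, smul_smul, ← pow_add, h7, one_smul]
    rw [mul_smul_comm, pow_two, ← mul_assoc, hXG, smul_mul_assoc, mul_assoc, hXG, mul_smul_comm,
      smul_mul_assoc, mul_assoc]
    match_scalars
    linear_combination (κ * q) * h7
  have hvac : ∀ h, r ((R.action hl).inr h) (Finsupp.single 0 1) =
      counit (R := k) h • Finsupp.single 0 1 := by
    intro h
    rw [rep_inr, counit_smul_diagHom (pow_zero _)]
  have hψ : ∀ h n, Finsupp.lapply (R := k) 0 (r ((R.action hl).inr h) n) =
      counit (R := k) h * Finsupp.lapply (R := k) (0 : ℕ) n := by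
    intro h n
    rw [rep_inr]
    induction n using Finsupp.induction_linear with
    | zero => simp
    | add f g hf hg => rw [map_add, map_add, hf, hg, map_add, mul_add]
    | single n a =>
      cases n with
      | zero => rw [counit_smul_diagHom (pow_zero _)]; simp
      | succ n => simp [diagHom_apply, wshift_single]
  refine R.exists_augmentation_of_lower hl r hvac hψ (by simp) (X := X) ?_ hGX ?_ ?_ ?_
  · simp [hX, wshift_single]
  · intro i j
    rw [rep_y]
    fin_cases j <;> fin_cases i <;> first | exact hGX2 _ | exact hGd _
  · intro α hα
    obtain ⟨B, hB⟩ := s3 α hα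
    refine ⟨B, ?_⟩
    rw [← hB]
    congr 1
    funext i
    exact R.rep_y hl _ _ _ _ _ i
  · intro n
    rw [rep_y]
    induction n using Finsupp.induction_linear with
    | zero => simp
    | add f g hf hg => rw [map_add, map_add, hf, hg, add_zero]
    | single n a => simp [hd, wshift_single]

end PrincipalRealization

/-! ### Scalar identities -/

section Coeff
variable {k : Type*} [Field k]

/-- The scalar `(1 - q⁻¹)(1 - q⁻²)(1 - q⁻³)(1 - q⁻⁴)`, reduced modulo `1 + q + ⋯ + q ^ 6`: the
parameter `l₁` of the pair `X, d ^ 4`. -/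
def serreCoeff₁ (q : k) : k := 3 + 2 * q + 4 * q ^ 2 + 2 * q ^ 3 + 3 * q ^ 4

/-- The scalar `(1 - q⁻¹)(1 - q⁻⁴)`, reduced modulo `1 + q + ⋯ + q ^ 6`: the parameter `l₂` of the
pair `X, d ^ 4` is this scalar times `d ^ 7`. -/
def serreCoeff₂ (q : k) : k := 2 + q + 2 * q ^ 2 + q ^ 4 + q ^ 5

/-! The values of the linear form on the vectors which cancel the constant terms of the seventh
powers of the root vectors of degrees `2α₁ + α₂`, `3α₁ + α₂`, `3α₁ + 2α₂`, without the powers of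
the parameters. -/

/-- The value for the degree `2α₁ + α₂`. -/
def form112 (q : k) : k := 33 - 7 * q + 35 * q ^ 2 + 14 * q ^ 3 + 28 * q ^ 4 + 28 * q ^ 5

/-- The value for the degree `3α₁ + α₂`. -/
def form1112 (q : k) : k := 31 - 70 * q ^ 2 - 126 * q ^ 3 - 126 * q ^ 4 - 70 * q ^ 5

/-- The value for the degree `3α₁ + 2α₂`. -/
def formBeta (q : k) : k := -34 + 49 * q ^ 2 + 98 * q ^ 3 + 98 * q ^ 4 + 49 * q ^ 5

lemma coeff_cube_mul_beta {q : k} (hΦ : ∑ i ∈ Finset.range 7, q ^ i = 0) :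
    listVal q [147, 98, 49, 0, 49, 147, 196] = (8 * q + 9 * q ^ 2 + 3 * q ^ 3 + 4 * q ^ 4 + 5 * q ^
        5 - q ^ 6) * serreCoeff₁ q ^ 2 := by
  simp only [Finset.sum_range_succ, Finset.sum_range_zero, zero_add, pow_zero, pow_one] at hΦ
  simp only [listVal, List.foldr, serreCoeff₁, serreCoeff₂, form112, form1112, formBeta]
  push_cast
  linear_combination ((147) * q ^ 0 + (-121) * q ^ 1 + (-154) * q ^ 2 + (-231) * q ^ 3 + (-140) * q
      ^ 4 + (-119) * q ^ 5 + (-35) * q ^ 6 + (-42) * q ^ 7 + (9) * q ^ 8) * hΦ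

lemma coeff_mul_beta_sq {q : k} (hΦ : ∑ i ∈ Finset.range 7, q ^ i = 0) :
    listVal q [245, 196, 98, 0, 0, 98, 196] = (5 * q + 8 * q ^ 2 + 9 * q ^ 3 + 8 * q ^ 4 + 5 * q ^
        5) * serreCoeff₁ q ^ 2 := by
  simp only [Finset.sum_range_succ, Finset.sum_range_zero, zero_add, pow_zero, pow_one] at hΦ
  simp only [listVal, List.foldr, serreCoeff₁, serreCoeff₂, form112, form1112, formBeta]
  push_cast
  linear_combination ((245) * q ^ 0 + (-94) * q ^ 1 + (-185) * q ^ 2 + (-283) * q ^ 3 + (-227) * q ^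
      4 + (-185) * q ^ 5 + (-87) * q ^ 6 + (-45) * q ^ 7) * hΦ

lemma coeff_sq_mul_sq {q : k} (hΦ : ∑ i ∈ Finset.range 7, q ^ i = 0) :
    listVal q [1715, 1029, 343, 0, 343, 1029, 1715] = -((7 * q ^ 3 * (1 + 2 * q + q ^ 2)) *
        serreCoeff₁ q ^ 3) := by
  simp only [Finset.sum_range_succ, Finset.sum_range_zero, zero_add, pow_zero, pow_one] at hΦ
  simp only [listVal, List.foldr, serreCoeff₁, serreCoeff₂, form112, form1112, formBeta]
  push_cast
  linear_combination ((1715) * q ^ 0 + (-686) * q ^ 1 + (-686) * q ^ 2 + (-154) * q ^ 3 + (910) * q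
      ^ 4 + (1883) * q ^ 5 + (2569) * q ^ 6 + (2471) * q ^ 7 + (1883) * q ^ 8 + (1197) * q ^ 9 +
      (567) * q ^ 10 + (189) * q ^ 11) * hΦ

lemma coeff_mul {q : k} (hΦ : ∑ i ∈ Finset.range 7, q ^ i = 0) :
    listVal q [343, 0, 1715, 3773, 4802, 4116, 2058] = (2 * q + 4 * q ^ 2 + 13 * q ^ 3 + 22 * q ^ 4
        + 17 * q ^ 5 + 5 * q ^ 6) * serreCoeff₂ q * serreCoeff₁ q ^ 3 := by
  simp only [Finset.sum_range_succ, Finset.sum_range_zero, zero_add, pow_zero, pow_one] at hΦ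
  simp only [listVal, List.foldr, serreCoeff₁, serreCoeff₂, form112, form1112, formBeta]
  push_cast
  linear_combination ((343) * q ^ 0 + (-451) * q ^ 1 + (1337) * q ^ 2 + (510) * q ^ 3 + (-2792) * q
      ^ 4 + (-8945) * q ^ 5 + (-15861) * q ^ 6 + (-22196) * q ^ 7 + (-25725) * q ^ 8 + (-25892) * q
      ^ 9 + (-23160) * q ^ 10 + (-18572) * q ^ 11 + (-13252) * q ^ 12 + (-8296) * q ^ 13 + (-4558) *
      q ^ 14 + (-2097) * q ^ 15 + (-729) * q ^ 16 + (-135) * q ^ 17) * hΦ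

lemma coeff_const12 {q : k} (hΦ : ∑ i ∈ Finset.range 7, q ^ i = 0) :
    listVal q [35, 14, 0, 28, 42, 70, 56] + listVal q [35, 56, 70, 42, 28, 0, 14] = 0 := by
  simp only [Finset.sum_range_succ, Finset.sum_range_zero, zero_add, pow_zero, pow_one] at hΦ
  simp only [listVal, List.foldr, serreCoeff₁, serreCoeff₂, form112, form1112, formBeta]
  push_cast
  linear_combination ((70) * q ^ 0) * hΦ

lemma coeff_const112 {q : k} (hΦ : ∑ i ∈ Finset.range 7, q ^ i = 0) :
    listVal q [32487, 28567, 15729, 2744, 0, 9212, 23422] + listVal q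
        [1323, 1078, 490, 0, 0, 490, 1078] * form112 q = 0 := by
  simp only [Finset.sum_range_succ, Finset.sum_range_zero, zero_add, pow_zero, pow_one] at hΦ
  simp only [listVal, List.foldr, serreCoeff₁, serreCoeff₂, form112, form1112, formBeta]
  push_cast
  linear_combination ((76146) * q ^ 0 + (-21266) * q ^ 1 + (15778) * q ^ 2 + (-15092) * q ^ 3 +
      (13720) * q ^ 4 + (30184) * q ^ 5) * hΦ

lemma coeff_const1112 {q : k} (hΦ : ∑ i ∈ Finset.range 7, q ^ i = 0) :
    listVal q [73059, 14406, 0, 40474, 105644, 146118, 131712] + listVal q [343, 686, 686, 0, 686] *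
        form1112 q = 0 := by
  simp only [Finset.sum_range_succ, Finset.sum_range_zero, zero_add, pow_zero, pow_one] at hΦ
  simp only [listVal, List.foldr, serreCoeff₁, serreCoeff₂, form112, form1112, formBeta]
  push_cast
  linear_combination ((83692) * q ^ 0 + (-48020) * q ^ 1 + (-38416) * q ^ 2 + (-48020) * q ^ 3) * hΦ

lemma coeff_beta_r2 {q : k} (hΦ : ∑ i ∈ Finset.range 7, q ^ i = 0) :
    listVal q [60025, 38416, 24010, 0, 0, 24010, 38416] * form1112 q + listVal q
        [0, 14406, 376957, 549829, 549829, 376957, 14406] = (833 * q + 1911 * q ^ 2 + 2352 * q ^ 3 +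
        1911 * q ^ 4 + 833 * q ^ 5) * serreCoeff₂ q * serreCoeff₁ q ^ 5 := by
  simp only [Finset.sum_range_succ, Finset.sum_range_zero, zero_add, pow_zero, pow_one] at hΦ
  simp only [listVal, List.foldr, serreCoeff₁, serreCoeff₂, form112, form1112, formBeta]
  push_cast
  linear_combination ((1860775) * q ^ 0 + (-1060311) * q ^ 1 + (-6361572) * q ^ 2 + (-14422366) * q
      ^ 3 + (-25002201) * q ^ 4 + (-46279226) * q ^ 5 + (-88744341) * q ^ 6 + (-161757575) * q ^ 7 +
      (-255232670) * q ^ 8 + (-356017291) * q ^ 9 + (-441898464) * q ^ 10 + (-497356370) * q ^ 11 +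
      (-508685562) * q ^ 12 + (-478677178) * q ^ 13 + (-413150752) * q ^ 14 + (-329713895) * q ^ 15
      + (-241301137) * q ^ 16 + (-162697052) * q ^ 17 + (-99606073) * q ^ 18 + (-55330996) * q ^ 19
      + (-27195735) * q ^ 20 + (-11667978) * q ^ 21 + (-4166127) * q ^ 22 + (-1139103) * q ^ 23 +
      (-202419) * q ^ 24) * hΦ

lemma coeff_beta_r12 {q : k} (hΦ : ∑ i ∈ Finset.range 7, q ^ i = 0) :
    listVal q [1029, 2058, 2058, 0, 2058] * form112 q + listVal q
        [9947, 0, 0, 3087, 16807, 19894, 19894] = (210 * q + 224 * q ^ 2 + 238 * q ^ 3 + 105 * q ^ 4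
        + 462 * q ^ 5 + 231 * q ^ 6) * serreCoeff₂ q ^ 2 * serreCoeff₁ q ^ 3 := by
  simp only [Finset.sum_range_succ, Finset.sum_range_zero, zero_add, pow_zero, pow_one] at hΦ
  simp only [listVal, List.foldr, serreCoeff₁, serreCoeff₂, form112, form1112, formBeta]
  push_cast
  linear_combination ((43904) * q ^ 0 + (-5873) * q ^ 1 + (-40740) * q ^ 2 + (-237804) * q ^ 3 +
      (-284144) * q ^ 4 + (-957229) * q ^ 5 + (-1186913) * q ^ 6 + (-2076739) * q ^ 7 + (-2415924) *
      q ^ 8 + (-3071425) * q ^ 9 + (-3200617) * q ^ 10 + (-3251997) * q ^ 11 + (-2986669) * q ^ 12 +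
      (-2557779) * q ^ 13 + (-2053352) * q ^ 14 + (-1485939) * q ^ 15 + (-1027502) * q ^ 16 +
      (-634704) * q ^ 17 + (-361368) * q ^ 18 + (-181020) * q ^ 19 + (-79758) * q ^ 20 + (-31185) *
      q ^ 21 + (-6237) * q ^ 22) * hΦ

lemma coeff_constBeta {q : k} (hΦ : ∑ i ∈ Finset.range 7, q ^ i = 0) :
    listVal q [0, 21609, 36015, 60025, 60025, 36015, 21609] * formBeta q - listVal q
        [0, 14406, 376957, 549829, 549829, 376957, 14406] + listVal q
        [9947, 0, 0, 3087, 16807, 19894, 19894] * listVal q [35, 56, 70, 42, 28, 0, 14] + listVal q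
        [0, 3022859, 9822491, 15272761, 15272761, 9822491, 3022859] = 0 := by
  simp only [Finset.sum_range_succ, Finset.sum_range_zero, zero_add, pow_zero, pow_one] at hΦ
  simp only [listVal, List.foldr, serreCoeff₁, serreCoeff₂, form112, form1112, formBeta]
  push_cast
  linear_combination ((348145) * q ^ 0 + (2482634) * q ^ 1 + (6086535) * q ^ 2 + (5349428) * q ^ 3 +
      (3337390) * q ^ 4 + (1058841) * q ^ 5 + (278516) * q ^ 6) * hΦ

lemma coeff_serreCoeff₁ {q : k} (hΦ : ∑ i ∈ Finset.range 7, q ^ i = 0) :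
    (1 - q ^ 24) * (1 - q ^ 18) * (1 - q ^ 12) * (1 - q ^ 6) = serreCoeff₁ q := by
  simp only [Finset.sum_range_succ, Finset.sum_range_zero, zero_add, pow_zero, pow_one] at hΦ
  simp only [listVal, List.foldr, serreCoeff₁, serreCoeff₂, form112, form1112, formBeta]
  linear_combination ((-2) * q ^ 0 + (-2) * q ^ 2 + (2) * q ^ 3 + (-1) * q ^ 4 + (3) * q ^ 5 + (-1)
      * q ^ 6 + (-1) * q ^ 7 + (-2) * q ^ 9 + (2) * q ^ 10 + (-1) * q ^ 11 + (2) * q ^ 12 + (-1) * q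
      ^ 14 + (-2) * q ^ 16 + (2) * q ^ 17 + (-1) * q ^ 18 + (2) * q ^ 19 + (-1) * q ^ 21 + (-2) * q
      ^ 23 + (2) * q ^ 24 + (-1) * q ^ 25 + (2) * q ^ 26 + (-1) * q ^ 28 + (-1) * q ^ 32 + (2) * q ^
      33 + (-1) * q ^ 35 + (-1) * q ^ 39 + (2) * q ^ 40 + (-1) * q ^ 42 + (-1) * q ^ 46 + (2) * q ^
      47 + (-1) * q ^ 48 + (-1) * q ^ 53 + (1) * q ^ 54) * hΦ

lemma coeff_serreCoeff₂ {q : k} (hΦ : ∑ i ∈ Finset.range 7, q ^ i = 0) :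
    (1 - q ^ 24) * (1 - q ^ 6) = serreCoeff₂ q := by
  simp only [Finset.sum_range_succ, Finset.sum_range_zero, zero_add, pow_zero, pow_one] at hΦ
  simp only [listVal, List.foldr, serreCoeff₁, serreCoeff₂, form112, form1112, formBeta]
  linear_combination ((-1) * q ^ 0 + (-1) * q ^ 2 + (2) * q ^ 3 + (-1) * q ^ 4 + (-1) * q ^ 9 + (2)
      * q ^ 10 + (-1) * q ^ 11 + (-1) * q ^ 16 + (2) * q ^ 17 + (-1) * q ^ 18 + (-1) * q ^ 23 + (1)
      * q ^ 24) * hΦ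

end Coeff

/-! ### Modules with lowering operators -/

section Models
variable {k N : Type*} [Field k] [AddCommGroup N] [Module k N] {q : k}

/-- The operators of the module used for `l₁ ≠ 0`: two lowering operators `X`, `X'` with their
raising operators `d`, `τ`, and a twist `g`; `G` is the action of `g₁` and of `g₂`. The generators
`y₁ = X + X'`, `y₂ = κ d ^ 4 + τ ^ 3 g` are sums of two pairs which commute up to the braiding
matrix. -/
structure LoweringData (q θ : k) (X d X' τ g G : Module.End k N) : Prop where
  X_d : X * d = q ^ 6 • (d * X) + (1 - q ^ 6) • 1
  X'_τ : X' * τ = q ^ 6 • (τ * X') + (1 - q ^ 6) • 1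
  X'_g : X' * g = q ^ 6 • (g * X')
  g_τ : g * τ = q ^ 6 • (τ * g)
  X'_d : X' * d = q ^ 6 • (d * X')
  X'_X : X' * X = q • (X * X')
  τg_d : (τ ^ 3 * g) * d = q ^ 6 • (d * (τ ^ 3 * g))
  τg_X : (τ ^ 3 * g) * X = q • (X * (τ ^ 3 * g))
  G_d : G * d = q ^ 6 • (d * G)
  G_X : G * X = q • (X * G)
  G_τ : G * τ = q ^ 6 • (τ * G)
  G_X' : G * X' = q • (X' * G)
  G_g : G * g = q ^ 6 • (g * G)
  d_pow : d ^ 7 = θ • 1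

lemma eq_smul_of_eq_smul {A : Type*} [Ring A] [Algebra k A] (h7 : q ^ 7 = 1) {x y : A} {a b : ℕ}
    (hab : a + b = 7) (h : x * y = q ^ a • (y * x)) : y * x = q ^ b • (x * y) := by
  rw [h, smul_smul, ← pow_add, add_comm, hab, h7, one_smul]

lemma mul_pow_mul_of_comm {A : Type*} [Ring A] [Algebra k A] {x a g : A} {c e : k}
    (h : x * a = c • (a * x)) (hg : x * g = e • (g * x)) (n : ℕ) :
    x * (a ^ n * g) = (c ^ n * e) • (a ^ n * g * x) := by
  induction n with
  | zero => simp [hg]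
  | succ n ih =>
    rw [pow_succ', mul_assoc, ← mul_assoc, h, smul_mul_assoc, mul_assoc, ih, mul_smul_comm,
      smul_smul]
    simp only [mul_assoc, pow_succ']

namespace LoweringData
variable {θ : k} {X d X' τ g G : Module.End k N}

lemma serre_scalar (D : LoweringData q θ X d X' τ g G) (hq : IsPrimitiveRoot q 7) (κ : k) :
    y11112 q ![X, d ^ 4 * (κ • 1)] = algebraMap k _ (κ * serreCoeff₁ q) ∧
    y122 q ![X, d ^ 4 * (κ • 1)] = algebraMap k _ (serreCoeff₂ q * κ ^ 2 * θ) := by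
  have hΦ : ∑ i ∈ Finset.range 7, q ^ i = 0 := hq.geom_sum_eq_zero (by norm_num)
  have h7 := hq.pow_eq_one
  obtain ⟨e1, -, e3⟩ := root_vectors_lower h7 D.X_d
    (show X * (κ • (1 : Module.End k N)) = q ^ 0 • ((κ • (1 : Module.End k N)) * X) by simp) 1
    (by linear_combination (q ^ 3 * (q ^ 14 + q ^ 7 + 1)) * h7)
  simp only [show 1 + 3 = 4 from rfl, show 1 + 2 = 3 from rfl, show 1 + 1 = 2 from rfl] at e1 e3
  constructor
  · rw [y11112, e3]
    simp only [brBracket, bichar_eq, Matrix.cons_val_zero, Matrix.cons_val_one, mul_smul_comm,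
      mul_one, smul_mul_assoc, pow_one, D.X_d]
    rw [← coeff_serreCoeff₁ hΦ, Algebra.algebraMap_eq_smul_one]
    norm_num
    module
  · rw [y122, e1]
    have e : d ^ 3 * d ^ 4 = θ • (1 : Module.End k N) := by rw [← pow_add, D.d_pow]
    have e' : d ^ 4 * d ^ 3 = θ • (1 : Module.End k N) := by rw [← pow_add, D.d_pow]
    simp only [brBracket, bichar_eq, Matrix.cons_val_zero, Matrix.cons_val_one, mul_smul_comm,
      mul_one, smul_mul_assoc, e, e']
    rw [← coeff_serreCoeff₂ hΦ, Algebra.algebraMap_eq_smul_one]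
    norm_num
    module

lemma serre_twist (D : LoweringData q θ X d X' τ g G) (hq : IsPrimitiveRoot q 7) :
    y11112 q ![X', τ ^ 3 * g] = 0 ∧ y122 q ![X', τ ^ 3 * g] = 0 := by
  have h7 := hq.pow_eq_one
  obtain ⟨e1, -, e3⟩ := root_vectors_lower h7 D.X'_τ D.X'_g 0
    (by linear_combination (q ^ 3 * (q ^ 14 + q ^ 7 + 1)) * h7)
  simp only [show 0 + 3 = 3 from rfl, show 0 + 2 = 2 from rfl, show 0 + 1 = 1 from rfl] at e1 e3
  constructor
  · rw [y11112, e3]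
    simp only [brBracket, bichar_eq, Matrix.cons_val_zero, Matrix.cons_val_one, mul_smul_comm,
      pow_zero, one_mul, smul_mul_assoc, D.X'_g]
    norm_num
    module
  · have p : ∀ i j, τ ^ i * g * (τ ^ j * g) = (q ^ 6) ^ j • (τ ^ (i + j) * (g * g)) := by
      intro i j
      rw [mul_assoc, ← mul_assoc g, mul_pow_of_comm D.g_τ, smul_mul_assoc, mul_smul_comm,
        pow_add]
      simp only [mul_assoc]
    rw [y122, e1]
    simp only [brBracket, bichar_eq, Matrix.cons_val_zero, Matrix.cons_val_one, mul_smul_comm,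
      smul_mul_assoc, p]
    norm_num
    rw [← pow_mul, ← pow_mul, smul_smul, smul_smul, smul_smul, ← sub_smul]
    rw [show (1 - q ^ 18) * q ^ (6 * 3) - q ^ 6 * (1 - q ^ 18) * q ^ (6 * 2) = 0 by ring, zero_smul]

lemma comm_base (D : LoweringData q θ X d X' τ g G) (hq : IsPrimitiveRoot q 7) (κ : k) (i j : Fin 2)
    :
    ![X', τ ^ 3 * g] i * ![X, d ^ 4 * (κ • 1)] j =
      qMatrix q i j • (![X, d ^ 4 * (κ • 1)] j * ![X', τ ^ 3 * g] i) := by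
  have h7 := hq.pow_eq_one
  have h : ∀ x : Module.End k N, x * d = q ^ 6 • (d * x) →
      x * (d ^ 4 * (κ • 1)) = q ^ 3 • (d ^ 4 * (κ • 1) * x) := by
    intro x hx
    rw [mul_pow_mul_of_comm hx (show x * (κ • 1) = (1 : k) • ((κ • 1) * x) by simp)]
    congr 1
    linear_combination (q ^ 3 * (q ^ 14 + q ^ 7 + 1)) * h7
  fin_cases i <;> fin_cases j
  · exact D.X'_X
  · exact h _ D.X'_d
  · exact D.τg_X
  · exact h _ D.τg_d

/-- The Serre relations of the sum of the two pairs. -/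
lemma serre_add (D : LoweringData q θ X d X' τ g G) (hq : IsPrimitiveRoot q 7) (κ : k) :
    y11112 q (fun i => ![X, d ^ 4 * (κ • 1)] i + ![X', τ ^ 3 * g] i) =
      algebraMap k _ (κ * serreCoeff₁ q) ∧
    y122 q (fun i => ![X, d ^ 4 * (κ • 1)] i + ![X', τ ^ 3 * g] i) =
      algebraMap k _ (serreCoeff₂ q * κ ^ 2 * θ) := by
  have h7 := hq.pow_eq_one
  rw [y11112_add h7 _ _ (D.comm_base hq κ), y122_add h7 _ _ (D.comm_base hq κ)]
  rw [(D.serre_twist hq).1, (D.serre_twist hq).2, add_zero, add_zero]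
  exact D.serre_scalar hq κ

variable {B : Type*} [Ring B] [Algebra k B] {b : Fin 2 → B}

lemma leftEnd_comm {S T : Module.End k N} {c : k} (h : S * T = c • (T * S)) :
    leftEnd (B := B) S * leftEnd T = c • (leftEnd T * leftEnd S) := by
  rw [← map_mul, h, map_smul, map_mul]

lemma leftEnd_lower {S T : Module.End k N} {c e : k} (h : S * T = c • (T * S) + e • 1) :
    leftEnd (B := B) S * leftEnd T = c • (leftEnd T * leftEnd S) + e • 1 := by
  rw [← map_mul, h, map_add, map_smul, map_smul, map_mul, map_one]

/-- Adding the pair `X', τ ^ 3 g` to the pair `g_i ⊗ x_i` is a reduction step with the twist `g`. -/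
lemma step_braided (hq : IsPrimitiveRoot q 7) {G : Fin 2 → Module.End k N}
    (D : ∀ i, LoweringData q θ X d X' τ g (G i))
    (hs : y11112 q (fun i => tensorEnd (G i ⊗ₜ[k] b i)) = 0 ∧
      y122 q (fun i => tensorEnd (G i ⊗ₜ[k] b i)) = 0) :
    Step q 0 6 (q ^ 6) (leftEnd (B := B) τ) (leftEnd X') (leftEnd g)
      (fun i => tensorEnd (G i ⊗ₜ[k] b i)) where
  lower_d := leftEnd_lower (D 0).X'_τ
  lower_g := leftEnd_comm (D 0).X'_g
  g_d := leftEnd_comm (D 0).g_τ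
  v_d i := tensorEnd_mul_leftEnd (D i).G_τ _
  v_g i := tensorEnd_mul_leftEnd (D i).G_g _
  v_lower i := tensorEnd_mul_leftEnd (D i).G_X' _
  lower_v i := leftEnd_mul_tensorEnd
    (eq_smul_of_eq_smul hq.pow_eq_one (a := 1) rfl (by rw [pow_one]; exact (D i).G_X')) _
  serre1 := hs.1
  serre2 := hs.2
  exponent := by linear_combination (q ^ 3 * (q ^ 14 + q ^ 7 + 1)) * hq.pow_eq_one

lemma comm_twist (hq : IsPrimitiveRoot q 7) {G : Fin 2 → Module.End k N}
    (D : ∀ i, LoweringData q θ X d X' τ g (G i)) (i j : Fin 2) :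
    tensorEnd (G i ⊗ₜ[k] b i) * leftEnd (![X', τ ^ 3 * g] j) =
      qMatrix q i j • (leftEnd (![X', τ ^ 3 * g] j) * tensorEnd (G i ⊗ₜ[k] b i)) := by
  have h : G i * (τ ^ 3 * g) = q ^ 3 • (τ ^ 3 * g * G i) := by
    rw [mul_pow_mul_of_comm (D i).G_τ (D i).G_g]
    congr 1
    linear_combination (q ^ 3 * (q ^ 14 + q ^ 7 + 1)) * hq.pow_eq_one
  refine tensorEnd_mul_leftEnd ?_ _
  fin_cases j
  · have := (D i).G_X'
    fin_cases i <;> exact this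
  · fin_cases i <;> exact h

/-- Adding the pair `X, κ d ^ 4` to the pair `y_i ⊗ 1 + g_i ⊗ x_i` with `y = (X', τ ^ 3 g)` is a
reduction step with the scalar twist `κ`. -/
lemma step_scalar (hq : IsPrimitiveRoot q 7) {G : Fin 2 → Module.End k N}
    (D : ∀ i, LoweringData q θ X d X' τ g (G i)) (κ : k)
    (hs : y11112 q (fun i => tensorEnd (G i ⊗ₜ[k] b i)) = 0 ∧
      y122 q (fun i => tensorEnd (G i ⊗ₜ[k] b i)) = 0) :
    Step q 1 0 1 (leftEnd (B := B) d) (leftEnd X) (κ • (1 : Module.End k (N ⊗[k] B)))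
      (fun i => leftEnd (![X', τ ^ 3 * g] i) + tensorEnd (G i ⊗ₜ[k] b i)) := by
  have h7 := hq.pow_eq_one
  have hd : ∀ i, ![X', τ ^ 3 * g] i * d = q ^ 6 • (d * ![X', τ ^ 3 * g] i) := by
    intro i; fin_cases i; exacts [(D 0).X'_d, (D 0).τg_d]
  have hX : ∀ i, ![X', τ ^ 3 * g] i * X = q • (X * ![X', τ ^ 3 * g] i) := by
    intro i; fin_cases i; exacts [(D 0).X'_X, (D 0).τg_X]
  have hd' : ∀ i, leftEnd (B := B) (![X', τ ^ 3 * g] i) * leftEnd d =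
      q ^ 6 • (leftEnd d * leftEnd (![X', τ ^ 3 * g] i)) := fun i => leftEnd_comm (hd i)
  have hX' : ∀ i, leftEnd (B := B) (![X', τ ^ 3 * g] i) * leftEnd X =
      q • (leftEnd X * leftEnd (![X', τ ^ 3 * g] i)) := fun i => leftEnd_comm (hX i)
  have hvX : ∀ i, (leftEnd (B := B) (![X', τ ^ 3 * g] i) + tensorEnd (G i ⊗ₜ[k] b i)) * leftEnd X =
      q • (leftEnd X * (leftEnd (![X', τ ^ 3 * g] i) + tensorEnd (G i ⊗ₜ[k] b i))) := fun i => by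
    rw [add_mul, mul_add, hX', tensorEnd_mul_leftEnd (D i).G_X, smul_add]
  refine
    { lower_d := leftEnd_lower (D 0).X_d
      lower_g := by simp
      g_d := by simp
      v_d := fun i => by
        rw [add_mul, mul_add, hd', tensorEnd_mul_leftEnd (D i).G_d, smul_add]
      v_g := fun i => by simp
      v_lower := hvX
      lower_v := fun i => eq_smul_of_eq_smul h7 (a := 1) rfl (by rw [pow_one]; exact hvX i)
      serre1 := ?_
      serre2 := ?_
      exponent := by linear_combination (q ^ 3 * (q ^ 14 + q ^ 7 + 1)) * h7 }
  · rw [y11112_add h7 _ _ (comm_twist hq D), ← map_y11112, ((D 0).serre_twist hq).1, hs.1]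
    simp
  · rw [y122_add h7 _ _ (comm_twist hq D), ← map_y122, ((D 0).serre_twist hq).2, hs.2]
    simp

end LoweringData

end Models

/-! ### The linear form from lowering operators -/

namespace PrincipalRealization
variable {k H : Type*} [Field k] [Ring H] [HopfAlgebra k H] {q : k}
  (R : PrincipalRealization k H q) {l₁ l₂ : k} (hl : R.SerreParam l₁ l₂)

set_option maxHeartbeats 2000000 in
/-- For `l₁ ≠ 0`, the linear form obtained from a module with lowering operators. The values of `ψ`
on the vectors `τ ^ a g ^ b vac` cancel the constant terms. -/
theorem exists_augmentation_of_loweringData {N : Type*} [AddCommGroup N] [Module k N]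
    (r : R.AAlg hl →ₐ[k] Module.End k N) {vac : N}
    {ψ : N →ₗ[k] k} (hv : ∀ h, r ((R.action hl).inr h) vac = counit (R := k) h • vac)
    (hψ : ∀ h n, ψ (r ((R.action hl).inr h) n) = counit (R := k) h * ψ n) (hvac : ψ vac = 1)
    {κ θ : k} {X d X' τ g : Module.End k N}
    (D : ∀ i, LoweringData q θ X d X' τ g (r ((R.action hl).inr (R.g i))))
    (hX : X vac = 0) (hX' : X' vac = 0)
    (hy : ∀ i, r (R.y hl i) = ![X, d ^ 4 * (κ • 1)] i + ![X', τ ^ 3 * g] i)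
    (h₁ : l₁ = κ * serreCoeff₁ q) (h₂ : l₂ = serreCoeff₂ q * κ ^ 2 * θ)
    (hψ₂ : ψ ((τ ^ 21 * g ^ 7) vac) = -(θ ^ 4 * κ ^ 7))
    (hψ₁₂ : ψ ((τ ^ 14 * g ^ 7) vac) = θ ^ 3 * κ ^ 7)
    (hψ₁₁₂ : ψ ((τ ^ 7 * g ^ 7) vac) = form112 q * (θ ^ 2 * κ ^ 7))
    (hψ₁₁₁₂ : ψ ((τ ^ 0 * g ^ 7) vac) = form1112 q * (θ * κ ^ 7))
    (hψβ : ψ ((τ ^ 21 * g ^ 14) vac) = formBeta q * (θ ^ 5 * κ ^ 14)) :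
    ∃ φ : R.AAlg hl →ₗ[k] k, R.IsAugmentation hl φ ∧
      ∀ α, R.cleave hl φ (relVec q l₁ l₂ (R.y hl) α) = rootVec q R.x α ^ 7 := by
  have hq := R.q_primitive
  have hΦ : ∑ i ∈ Finset.range 7, q ^ i = 0 := hq.geom_sum_eq_zero (by norm_num)
  have hs := R.gx_serre hl r
  have SB := LoweringData.step_braided (b := R.x) hq D hs
  have SA := LoweringData.step_scalar (b := R.x) hq D κ hs
  change Step q 0 6 (q ^ 6) (leftEnd τ) (leftEnd X') (leftEnd g) (R.gx hl r) at SB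
  change Step q 1 0 1 (leftEnd d) (leftEnd X) (κ • 1)
    (fun i => leftEnd (![X', τ ^ 3 * g] i) + R.gx hl r i) at SA
  set ξ : N ⊗[k] R.HPre := vac ⊗ₜ 1 with hξ
  set w : Fin 2 → Module.End k (N ⊗[k] R.HPre) := R.gx hl r with hw
  set v : Fin 2 → Module.End k (N ⊗[k] R.HPre) :=
    fun i => leftEnd (![X', τ ^ 3 * g] i) + w i with hvdef
  set Y : Fin 2 → Module.End k (N ⊗[k] R.HPre) :=
    fun i => leftEnd (r (R.y hl i)) + R.gx hl r i with hYdef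
  have hker : ∀ {T : Module.End k N} (z : R.HPre), T vac = 0 → leftEnd T (vac ⊗ₜ[k] z) = 0 := by
    intro T z hT
    rw [leftEnd_apply, tensorEnd_tmul, hT, TensorProduct.zero_tmul]
  have hYA : ∀ i, Y i = ![leftEnd X, leftEnd d ^ 4 * (κ • 1)] i + v i := by
    intro i
    simp only [hYdef, hvdef, hy, map_add, add_assoc]
    congr 1
    fin_cases i
    · rfl
    · simp
  have hvB : ∀ i, v i = ![leftEnd X', leftEnd τ ^ 3 * leftEnd g] i + w i := by
    intro i
    simp only [hvdef]
    congr 1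
    fin_cases i
    · rfl
    · simp
  -- `w = g ⊗ x`, `v = w + (X', τ ^ 3 g)`, `Y = v + (X, κ d ^ 4)`: reduce `Y` to `v`, `v` to `w`
  obtain ⟨a2, a12, a112, a1112, aβ⟩ := SA.powers_scalar hq rfl (ξ := ξ) (hker 1 hX) hYA
  obtain ⟨b2, b12, b112, b1112, bβ⟩ := SB.powers_braided hq (ξ := ξ) (hker 1 hX') hvB
  -- the values of the slice map
  have sroot : ∀ α, (rootVec q w α ^ 7) ξ = vac ⊗ₜ (rootVec q R.x α ^ 7) := by
    intro α
    rw [hw, hξ, R.rootVec_gx_apply hl hv, mul_one]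
  have sl : ∀ (T : Module.End k N) (z : R.HPre),
      slice ψ (leftEnd T (vac ⊗ₜ[k] z)) = ψ (T vac) • z := by
    intro T z
    rw [leftEnd_apply, tensorEnd_tmul, slice_tmul, one_mul]
  have sτ : ∀ a b, slice ψ ((leftEnd τ ^ a * leftEnd g ^ b : Module.End k (N ⊗[k] R.HPre)) ξ) =
      ψ ((τ ^ a * g ^ b) vac) • (1 : R.HPre) := by
    intro a b
    rw [← map_pow, ← map_pow, ← map_mul, hξ, sl]
  have sτw : ∀ a b α, slice ψ ((leftEnd τ ^ a * (leftEnd g ^ b * rootVec q w α ^ 7) :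
      Module.End k (N ⊗[k] R.HPre)) ξ) =
      ψ ((τ ^ a * g ^ b) vac) • rootVec q R.x α ^ 7 := by
    intro a b α
    rw [← mul_assoc, ← map_pow, ← map_pow, ← map_mul, Module.End.mul_apply, sroot, sl]
  have hd7 : (leftEnd d : Module.End k (N ⊗[k] R.HPre)) ^ 7 = θ • 1 := by
    rw [← map_pow, (D 0).d_pow, map_smul, map_one]
  have hdm : ∀ m, (leftEnd d : Module.End k (N ⊗[k] R.HPre)) ^ (7 * m) = θ ^ m • 1 := by
    intro m
    rw [pow_mul, hd7, smul_pow, one_pow]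
  have d7 := hdm 1
  have d14 := hdm 2
  have d21 := hdm 3
  have d28 := hdm 4
  have d35 := hdm 5
  simp only [Nat.reduceMul] at d7 d14 d21 d28 d35
  have r2 := sroot .r2
  have r12 := sroot .r12
  have r112 := sroot .r112
  have r1112 := sroot .r1112
  have rβ := sroot .rBeta
  have t2 := sτw 0 7 .r2
  have t12 := sτw 7 7 .r12
  simp only [rootVec] at r2 r12 r112 r1112 rβ t2 t12
  have hξ1 : slice ψ ξ = (1 : R.HPre) := by rw [hξ, slice_tmul, hvac, one_smul]
  have one1 : listVal q [1] = 1 := by simp [listVal]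
  -- the slices of the powers of the root vectors of `v`
  have v2 : slice ψ ((v 1 ^ 7) ξ) = R.x 1 ^ 7 - (θ ^ 4 * κ ^ 7) • (1 : R.HPre) := by
    rw [b2, map_add, map_smul, sτ, r2, slice_tmul, hvac, hψ₂, one1]
    module
  have v12 : slice ψ ((y12 q v ^ 7) ξ) = y12 q R.x ^ 7 +
      (listVal q [35, 56, 70, 42, 28, 0, 14] * (θ ^ 3 * κ ^ 7)) • (1 : R.HPre) := by
    rw [b12, map_add, map_smul, sτ, r12, slice_tmul, hvac, hψ₁₂]
    module
  refine R.exists_augmentation_of_module hl r hv hψ hvac fun α => ?_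
  change slice ψ ((relVec q l₁ l₂ Y α) ξ) = _
  -- for the roots `α₂`, `α₁ + α₂` the constants of the two reductions cancel
  have Y2 : slice ψ ((Y 1 ^ 7) ξ) = R.x 1 ^ 7 := by
    rw [a2, map_add, v2, d28, one1]
    simp only [smul_pow, one_pow, smul_mul_smul_comm, one_mul, LinearMap.smul_apply,
      Module.End.one_apply, map_smul, hξ1]
    module
  have Y12 : slice ψ ((y12 q Y ^ 7) ξ) = y12 q R.x ^ 7 := by
    rw [a12, map_add, v12, d21]
    simp only [smul_pow, one_pow, smul_mul_smul_comm, one_mul, LinearMap.smul_apply,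
      Module.End.one_apply, map_smul, hξ1]
    match_scalars
    · ring
    · linear_combination (θ ^ 3 * κ ^ 7) * coeff_const12 hΦ
  cases α with
  | r1 =>
    -- the operators `X` and `X'` kill `vac`
    have e : ∀ n, (Y 0 ^ n) ξ = (w 0 ^ n) ξ := by
      intro n
      induction n with
      | zero => rfl
      | succ n ih =>
        have := R.rootVec_gx_apply hl hv .r1 n 1
        rw [pow_succ', Module.End.mul_apply, ih, pow_succ', Module.End.mul_apply, hYA, hvB]
        simp only [rootVec] at this
        rw [hξ, hw, this]
        simp [hker _ hX, hker _ hX']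
    have := sroot .r1
    simp only [rootVec] at this
    simp only [relVec, rootVec]
    rw [e, this, slice_tmul, hvac, one_smul]
  | r2 =>
    simp only [relVec, rootVec]
    rw [Y2]
  | r12 =>
    simp only [relVec, rootVec]
    rw [Y12]
  | r1112 =>
    simp only [relVec, rootVec]
    rw [a1112, map_add, b1112, map_add, map_smul, sτ, r1112, slice_tmul, hvac, hψ₁₁₁₂, d7]
    simp only [smul_pow, one_pow, smul_mul_smul_comm, one_mul, LinearMap.smul_apply,
      Module.End.one_apply, map_smul, hξ1]
    match_scalars
    · ring
    · linear_combination (θ * κ ^ 7) * coeff_const1112 hΦ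
  | r112 =>
    -- the deforming terms are those which occur in the first reduction
    have e : relVec q l₁ l₂ Y .r112 = y112 q Y ^ 7 +
        (listVal q [147, 98, 49, 0, 49, 147, 196] •
          ((κ • 1) ^ 2 * (y12 q Y ^ 3 * yBeta q Y)) +
        (listVal q [245, 196, 98, 0, 0, 98, 196] • ((κ • 1) ^ 2 * (Y 1 * yBeta q Y ^ 2)) +
        (listVal q [1715, 1029, 343, 0, 343, 1029, 1715] •
          ((κ • 1) ^ 3 * (Y 1 ^ 2 * y12 q Y ^ 2)) +
        listVal q [343, 0, 1715, 3773, 4802, 4116, 2058] •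
          (leftEnd d ^ 7 * ((κ • 1) ^ 5 * (Y 1 * y12 q Y)))))) := by
      simp only [relVec, h₁, h₂]
      rw [d7]
      simp only [smul_pow, one_pow, smul_mul_assoc, one_mul, smul_smul,
        coeff_cube_mul_beta hΦ, coeff_mul_beta_sq hΦ, coeff_sq_mul_sq hΦ, coeff_mul hΦ]
      refine congrArg₂ _ rfl (congrArg₂ _ ?_ (congrArg₂ _ ?_ (congrArg₂ _ ?_ ?_)))
      all_goals
        refine congrArg (fun c : k => c • (_ : Module.End k (N ⊗[k] R.HPre))) ?_
        ring
    simp only [rootVec]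
    rw [e, a112, map_add, b112, map_add, map_smul, sτ, r112, slice_tmul, hvac, hψ₁₁₂, d14]
    simp only [smul_pow, one_pow, smul_mul_smul_comm, one_mul, LinearMap.smul_apply,
      Module.End.one_apply, map_smul, hξ1]
    match_scalars
    · ring
    · linear_combination (θ ^ 2 * κ ^ 7) * coeff_const112 hΦ
  | rBeta =>
    simp only [relVec, rootVec]
    -- the multiples of `y₁₂ ^ 7` and `y₂ ^ 7` are absorbed by the deforming terms
    rw [LinearMap.sub_apply, map_sub, LinearMap.add_apply, map_add, LinearMap.smul_apply,
      LinearMap.smul_apply, map_smul, map_smul, Y2, Y12, aβ, d7, d14, d35]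
    simp only [smul_pow, one_pow, smul_mul_assoc, one_mul,
      LinearMap.smul_apply, Module.End.one_apply, map_smul, map_add, hξ1, v2, v12]
    rw [bβ]
    simp only [map_add, map_smul, t2, t12, sτ, rβ, slice_tmul, hvac, hψ₁₁₁₂, hψ₁₁₂, hψβ, h₁, h₂]
    match_scalars
    · ring
    · linear_combination (θ * κ ^ 7) * coeff_beta_r2 hΦ
    · linear_combination (θ ^ 2 * κ ^ 7) * coeff_beta_r12 hΦ
    · linear_combination (θ ^ 5 * κ ^ 14) * coeff_constBeta hΦ

end PrincipalRealization

/-! ### A module with lowering operators -/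

section Weight
variable {k ι H : Type*} [Field k] [Ring H] [HopfAlgebra k H]

lemma hitL_hitL (χ χ' : WithConv (H →ₐ[k] k)) (h : H) :
    hitL χ' (hitL χ h) = hitL (χ * χ') h := by
  have e : (χ * χ').ofConv.toLinearMap = χ'.ofConv.toLinearMap ∘ₗ hitL χ :=
    LinearMap.ext fun x => PrincipalRealization.conv_apply' χ χ' x
  conv_lhs => rw [hitL, LinearMap.comp_apply, LinearMap.comp_apply, comul_hitL]
  conv_rhs => rw [hitL, e, LinearMap.rTensor_comp, LinearMap.comp_apply, LinearMap.comp_apply]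
  rfl

lemma hitL_one (h : H) : hitL (1 : WithConv (H →ₐ[k] k)) h = h := by
  have e : (1 : WithConv (H →ₐ[k] k)).ofConv.toLinearMap = counit := rfl
  rw [hitL, LinearMap.comp_apply, LinearMap.comp_apply, e, Coalgebra.rTensor_counit_comul]
  simp

/-- The operator `T` has weight `χ`. -/
def HasWeight (σ : ι → WithConv (H →ₐ[k] k)) (χ : WithConv (H →ₐ[k] k))
    (T : Module.End k (ι →₀ k)) : Prop :=
  ∀ h, diagHom σ h * T = T * diagHom σ (hitL χ h)

variable {σ : ι → WithConv (H →ₐ[k] k)} {χ χ' : WithConv (H →ₐ[k] k)}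
  {S T : Module.End k (ι →₀ k)}

lemma HasWeight.mul (hT : HasWeight σ χ T) (hS : HasWeight σ χ' S) :
    HasWeight σ (χ * χ') (T * S) := fun h => by
  rw [← mul_assoc, hT, mul_assoc, hS, ← mul_assoc, hitL_hitL]

lemma HasWeight.add (hT : HasWeight σ χ T) (hS : HasWeight σ χ S) : HasWeight σ χ (T + S) :=
  fun h => by rw [mul_add, hT, hS, add_mul]

lemma HasWeight.smul (hT : HasWeight σ χ T) (c : k) : HasWeight σ χ (c • T) :=
  fun h => by rw [mul_smul_comm, hT, smul_mul_assoc]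

lemma HasWeight.one : HasWeight σ 1 (1 : Module.End k (ι →₀ k)) := fun h => by
  rw [hitL_one, one_mul, mul_one]

lemma HasWeight.pow (hT : HasWeight σ χ T) (n : ℕ) : HasWeight σ (χ ^ n) (T ^ n) := by
  induction n with
  | zero => simpa only [pow_zero] using HasWeight.one
  | succ n ih => rw [pow_succ, pow_succ]; exact ih.mul hT

end Weight

namespace Model
variable {k : Type*} [Field k]

/-- The index set of the basis `e(n, i, j) = d ^ n τ ^ i g ^ j e(0, 0, 0)` of the module. -/
abbrev Index := Fin 7 × ℕ × ℕ

variable (q θ : k)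

/-- The raising operator with `d ^ 7 = θ`. -/
def d : Module.End k (Index →₀ k) :=
  wshift (fun p => (p.1 + 1, p.2)) fun p => if p.1 = 6 then θ else 1

/-- The lowering operator for `d`. -/
def X : Module.End k (Index →₀ k) :=
  wshift (fun p => (p.1 - 1, p.2)) fun p => 1 - (q ^ p.1.val) ^ 6

/-- The raising operator for `X'`. -/
def τ : Module.End k (Index →₀ k) :=
  wshift (fun p => (p.1, p.2.1 + 1, p.2.2)) fun p => q ^ p.1.val

/-- The lowering operator for `τ`; the truncated subtraction is harmless, as the coefficient is `0`
for `i = 0`. -/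
def X' : Module.End k (Index →₀ k) :=
  wshift (fun p => (p.1, p.2.1 - 1, p.2.2)) fun p => (q ^ p.1.val) ^ 6 * (1 - q ^ (6 * p.2.1))

/-- The twist of the second pair. -/
def g : Module.End k (Index →₀ k) :=
  wshift (fun p => (p.1, p.2.1, p.2.2 + 1)) fun p => (q ^ p.1.val) ^ 3 * q ^ (6 * p.2.1)

/-- The action of `g₁` and of `g₂`. -/
def G : Module.End k (Index →₀ k) :=
  wshift id fun p => (q ^ p.1.val) ^ 6 * (q ^ (6 * p.2.1) * q ^ (6 * p.2.2))

variable {q}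

lemma pow_val_add_one (h7 : q ^ 7 = 1) (n : Fin 7) : q ^ (n + 1).val = q * q ^ n.val := by
  fin_cases n <;> simp [← pow_succ', h7, ← pow_two]

lemma pow_val_sub_one (h7 : q ^ 7 = 1) (n : Fin 7) : q ^ (n - 1).val = q ^ 6 * q ^ n.val := by
  have := pow_val_add_one h7 (n - 1)
  rw [sub_add_cancel] at this
  rw [this, ← mul_assoc, ← pow_succ, h7, one_mul]

lemma τ_pow (m : ℕ) : τ q ^ m = wshift (fun p => (p.1, p.2.1 + m, p.2.2)) fun p =>
    (q ^ p.1.val) ^ m := by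
  induction m with
  | zero => exact end_ext fun p => by simp [wshift_single]
  | succ m ih =>
    rw [pow_succ', ih, τ, wshift_mul]
    exact end_ext fun p => by
      simp only [wshift_single, Function.comp_apply, add_assoc, pow_succ']

lemma g_pow_vac (b : ℕ) : (g q ^ b) (Finsupp.single ((0, 0, 0) : Index) 1) =
    Finsupp.single (0, 0, b) 1 := by
  induction b with
  | zero => simp
  | succ b ih => rw [pow_succ', Module.End.mul_apply, ih, g, wshift_single]; simp

lemma τ_pow_mul_g_pow_vac (a b : ℕ) :
    (τ q ^ a * g q ^ b) (Finsupp.single ((0, 0, 0) : Index) 1) = Finsupp.single (0, a, b) 1 := by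
  rw [Module.End.mul_apply, g_pow_vac, τ_pow, wshift_single]
  simp

lemma loweringData (h7 : q ^ 7 = 1) :
    LoweringData q θ (X q) (d θ) (X' q) (τ q) (g q) (G q) := by
  have ha : ∀ n : Fin 7, (q ^ n.val) ^ 7 = 1 := fun n => by rw [← pow_mul, mul_comm, pow_mul,
      h7, one_pow]
  have hp := pow_val_add_one h7
  have hm := pow_val_sub_one h7
  refine ⟨?_, ?_, ?_, ?_, ?_, ?_, ?_, ?_, ?_, ?_, ?_, ?_, ?_, ?_⟩
  · refine end_ext fun p => ?_
    obtain ⟨n, i, j⟩ := p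
    simp only [X, d, wshift_mul, LinearMap.add_apply, LinearMap.smul_apply, wshift_single,
      Function.comp_apply, Finsupp.smul_single, Module.End.one_apply, add_sub_cancel_right,
      sub_add_cancel, ← Finsupp.single_add, smul_eq_mul]
    congr 1
    fin_cases n <;> simp <;>
      first | ring1 | linear_combination (q ^ 35 + q ^ 28 + q ^ 21 + q ^ 14 + q ^ 7 + 1) * h7
  · refine end_ext fun p => ?_
    obtain ⟨n, i, j⟩ := p
    cases i with
    | zero =>
      simp only [X', τ, wshift_mul, LinearMap.add_apply, LinearMap.smul_apply, wshift_single,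
        Function.comp_apply, Finsupp.smul_single, Module.End.one_apply, smul_eq_mul]
      simp only [Nat.mul_zero, pow_zero, sub_self, mul_zero, zero_mul, Finsupp.single_zero,
        zero_add, mul_one, Nat.sub_self]
      refine congrArg (Finsupp.single _) ?_
      linear_combination (1 - q ^ 6) * ha n
    | succ i =>
      simp only [X', τ, wshift_mul, LinearMap.add_apply, LinearMap.smul_apply, wshift_single,
        Function.comp_apply, Finsupp.smul_single, Module.End.one_apply, smul_eq_mul,
        Nat.add_sub_cancel, ← Finsupp.single_add]
      refine congrArg (Finsupp.single _) ?_
      linear_combination (1 - q ^ 6) * ha n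
  · refine end_ext fun p => ?_
    obtain ⟨n, i, j⟩ := p
    cases i with
    | zero => simp [X', g, wshift_mul, wshift_single]
    | succ i =>
      simp only [X', g, wshift_mul, LinearMap.smul_apply, wshift_single,
        Function.comp_apply, Finsupp.smul_single, smul_eq_mul, id, hp, hm, τ_pow,
            Nat.add_sub_cancel]
      refine congrArg (Finsupp.single _) ?_
      ring
  · refine end_ext fun p => ?_
    obtain ⟨n, i, j⟩ := p
    simp only [g, τ, wshift_mul, LinearMap.smul_apply, wshift_single,
      Function.comp_apply, Finsupp.smul_single, smul_eq_mul, id, hp, hm, τ_pow, Nat.add_sub_cancel]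
    refine congrArg (Finsupp.single _) ?_
    ring
  · refine end_ext fun p => ?_
    obtain ⟨n, i, j⟩ := p
    simp only [X', d, wshift_mul, LinearMap.smul_apply, wshift_single,
      Function.comp_apply, Finsupp.smul_single, smul_eq_mul, id, hp, hm, τ_pow, Nat.add_sub_cancel]
    refine congrArg (Finsupp.single _) ?_
    ring
  · refine end_ext fun p => ?_
    obtain ⟨n, i, j⟩ := p
    simp only [X', X, wshift_mul, LinearMap.smul_apply, wshift_single,
      Function.comp_apply, Finsupp.smul_single, smul_eq_mul, id, hp, hm, τ_pow, Nat.add_sub_cancel]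
    refine congrArg (Finsupp.single _) ?_
    linear_combination ((1 - (q ^ n.val) ^ 6) * (q ^ n.val) ^ 6 * (1 - q ^ (6 * i)) * (q ^ 29 + q ^
        22 + q ^ 15 + q ^ 8 + q)) * h7
  · refine end_ext fun p => ?_
    obtain ⟨n, i, j⟩ := p
    simp only [g, d, wshift_mul, LinearMap.smul_apply, wshift_single,
      Function.comp_apply, Finsupp.smul_single, smul_eq_mul, id, hp, hm, τ_pow, Nat.add_sub_cancel]
    refine congrArg (Finsupp.single _) ?_
    ring
  · refine end_ext fun p => ?_
    obtain ⟨n, i, j⟩ := p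
    simp only [g, X, wshift_mul, LinearMap.smul_apply, wshift_single,
      Function.comp_apply, Finsupp.smul_single, smul_eq_mul, id, hp, hm, τ_pow, Nat.add_sub_cancel]
    refine congrArg (Finsupp.single _) ?_
    linear_combination ((1 - (q ^ n.val) ^ 6) * (q ^ n.val) ^ 6 * q ^ (6 * i) *
      (q ^ 29 + q ^ 22 + q ^ 15 + q ^ 8 + q)) * h7
  · refine end_ext fun p => ?_
    obtain ⟨n, i, j⟩ := p
    simp only [G, d, wshift_mul, LinearMap.smul_apply, wshift_single,
      Function.comp_apply, Finsupp.smul_single, smul_eq_mul, id, hp, hm, τ_pow, Nat.add_sub_cancel]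
    refine congrArg (Finsupp.single _) ?_
    ring
  · refine end_ext fun p => ?_
    obtain ⟨n, i, j⟩ := p
    simp only [G, X, wshift_mul, LinearMap.smul_apply, wshift_single,
      Function.comp_apply, Finsupp.smul_single, smul_eq_mul, id, hp, hm, τ_pow, Nat.add_sub_cancel]
    refine congrArg (Finsupp.single _) ?_
    linear_combination ((1 - (q ^ n.val) ^ 6) * (q ^ n.val) ^ 6 * q ^ (6 * i) * q ^ (6 * j) *
      (q ^ 29 + q ^ 22 + q ^ 15 + q ^ 8 + q)) * h7
  · refine end_ext fun p => ?_
    obtain ⟨n, i, j⟩ := p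
    simp only [G, τ, wshift_mul, LinearMap.smul_apply, wshift_single,
      Function.comp_apply, Finsupp.smul_single, smul_eq_mul, id, hp, hm, τ_pow, Nat.add_sub_cancel]
    refine congrArg (Finsupp.single _) ?_
    ring
  · refine end_ext fun p => ?_
    obtain ⟨n, i, j⟩ := p
    cases i with
    | zero => simp [G, X', wshift_mul, wshift_single]
    | succ i =>
      simp only [G, X', wshift_mul, LinearMap.smul_apply, wshift_single,
        Function.comp_apply, Finsupp.smul_single, smul_eq_mul, id, hp, hm, τ_pow,
            Nat.add_sub_cancel]
      refine congrArg (Finsupp.single _) ?_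
      linear_combination (-((q ^ n.val) ^ 12 * q ^ (6 * j) * (q ^ (6 * i) - q ^ 6 * (q ^ (6 * i)) ^
          2))) * h7
  · refine end_ext fun p => ?_
    obtain ⟨n, i, j⟩ := p
    simp only [G, g, wshift_mul, LinearMap.smul_apply, wshift_single,
      Function.comp_apply, Finsupp.smul_single, smul_eq_mul, id, hp, hm, τ_pow, Nat.add_sub_cancel]
    refine congrArg (Finsupp.single _) ?_
    ring
  · have h : ∀ n i j, (d θ ^ 7) (Finsupp.single ((n, i, j) : Index) 1) = Finsupp.single (n, i, j) θ
      := by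
      intro n i j
      simp only [pow_succ, pow_zero, one_mul, Module.End.mul_apply, d, wshift_single]
      fin_cases n <;> simp
    refine end_ext fun p => ?_
    rw [h p.1 p.2.1 p.2.2]
    simp

end Model

/-! ### The linear form for `l₁ ≠ 0` -/

namespace PrincipalRealization
variable {k H : Type*} [Field k] [Ring H] [HopfAlgebra k H] {q : k}
  (R : PrincipalRealization k H q) {l₁ l₂ : k} (hl : R.SerreParam l₁ l₂)

/-- The weight of the basis vector `e(n, i, j)`: each of `d`, `τ`, `g` has the weight `χ₁ ^ 3 χ₂`,
the inverse of `χ₁` when `χ₁ ^ 4 χ₂` is trivial. -/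
def modelWeight (p : Model.Index) : WithConv (H →ₐ[k] k) :=
  R.χOf ![3, 1] ^ (p.1.val + (p.2.1 + p.2.2))

/-- The values of the linear form on the basis vectors. -/
def modelForm (q θ κ : k) (p : Model.Index) : k :=
  if p = (0, 0, 0) then 1 else if p = (0, 21, 7) then -(θ ^ 4 * κ ^ 7) else
  if p = (0, 14, 7) then θ ^ 3 * κ ^ 7 else if p = (0, 7, 7) then form112 q * (θ ^ 2 * κ ^ 7) else
  if p = (0, 0, 7) then form1112 q * (θ * κ ^ 7) else
  if p = (0, 21, 14) then formBeta q * (θ ^ 5 * κ ^ 14) else 0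

lemma modelWeight_eq_one {θ κ : k} (hθ : θ ≠ 0 → R.χOf ![3, 1] ^ 7 = 1) {p : Model.Index}
    (hp : modelForm q θ κ p ≠ 0) : R.modelWeight p = 1 := by
  have key : ∀ m, θ ≠ 0 → R.χOf ![3, 1] ^ (7 * m) = 1 := fun m h => by
    rw [pow_mul, hθ h, one_pow]
  unfold modelForm at hp
  split_ifs at hp with h h h h h h
  · rw [h]; exact pow_zero _
  · rw [h]; exact key 4 fun h0 => hp (by simp [h0])
  · rw [h]; exact key 3 fun h0 => hp (by simp [h0])
  · rw [h]; exact key 2 fun h0 => hp (by simp [h0])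
  · rw [h]; exact key 1 fun h0 => hp (by simp [h0])
  · rw [h]; exact key 5 fun h0 => hp (by simp [h0])
  · exact absurd rfl hp

lemma χOf_pow (a : Fin 2 → ℕ) (n : ℕ) : R.χOf a ^ n = R.χOf (n • a) := by
  induction n with
  | zero => simp [χOf]
  | succ n ih => rw [pow_succ, ih, χOf_mul, succ_nsmul]

/-- For `l₁ ≠ 0` the weight `χ₁ ^ 3 χ₂` is the inverse of `χ₁`, its fourth power is `χ₂`, and for
`l₂ ≠ 0` its seventh power is trivial. -/
lemma χOf_three_one (h : R.χOf ![4, 1] = 1) :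
    R.χ 0 * R.χOf ![3, 1] = 1 ∧ R.χOf ![3, 1] ^ 4 = R.χ 1 ∧
      (R.χOf ![1, 2] = 1 → R.χOf ![3, 1] ^ 7 = 1) := by
  refine ⟨?_, ?_, fun h' => ?_⟩
  · rw [R.χOf_zero_one.1, χOf_mul, ← h]
    congr 1
    ext i; fin_cases i <;> rfl
  · have e : R.χOf ![3, 1] ^ 4 = R.χOf ![4, 1] ^ 3 * R.χOf ![0, 1] := by
      rw [χOf_pow, χOf_pow, χOf_mul]
      congr 1
      ext i; fin_cases i <;> rfl
    rw [e, h, one_pow, one_mul, R.χOf_zero_one.2]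
  · have e : R.χOf ![3, 1] ^ 7 = R.χOf ![4, 1] ^ 5 * R.χOf ![1, 2] := by
      rw [χOf_pow, χOf_pow, χOf_mul]
      congr 1
      ext i; fin_cases i <;> rfl
    rw [e, h, h', one_pow, one_mul]

lemma hasWeight_model {θ : k} (hχ : R.χ 0 * R.χOf ![3, 1] = 1)
    (hθ : θ ≠ 0 → R.χOf ![3, 1] ^ 7 = 1) :
    HasWeight R.modelWeight (R.χ 0) (Model.X q) ∧ HasWeight R.modelWeight (R.χ 0) (Model.X' q) ∧
    HasWeight R.modelWeight (R.χOf ![3, 1]) (Model.d θ) ∧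
    HasWeight R.modelWeight (R.χOf ![3, 1]) (Model.τ q) ∧
    HasWeight R.modelWeight (R.χOf ![3, 1]) (Model.g q) := by
  have hχ' : ∀ m, R.χ 0 * R.χOf ![3, 1] ^ (m + 1) = R.χOf ![3, 1] ^ m := fun m => by
    rw [pow_succ', ← mul_assoc, hχ, one_mul]
  refine ⟨diagHom_mul_wshift ?_, diagHom_mul_wshift ?_, diagHom_mul_wshift ?_,
    diagHom_mul_wshift ?_, diagHom_mul_wshift ?_⟩
  · rintro ⟨n, i, j⟩ hp
    have hn : n ≠ 0 := fun h => hp (by simp [h])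
    simp only [modelWeight]
    have : n.val = (n - 1).val + 1 := by fin_cases n <;> first | exact absurd rfl hn | rfl
    rw [this, add_right_comm, hχ']
  · rintro ⟨n, i, j⟩ hp
    cases i with
    | zero => exact absurd (by simp) hp
    | succ i =>
      simp only [modelWeight, Nat.add_sub_cancel]
      rw [show n.val + (i + 1 + j) = n.val + (i + j) + 1 by omega, hχ']
  · rintro ⟨n, i, j⟩ hp
    simp only [modelWeight]
    by_cases hn : n = 6
    · subst hn
      have h7 := hθ (by simpa using hp)
      rw [← pow_succ', show (6 : Fin 7).val + (i + j) + 1 = 7 + (i + j) by simp; omega, pow_add _ 7,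
        h7, one_mul]
      simp
    · have : (n + 1).val = n.val + 1 := by fin_cases n <;> first | exact absurd rfl hn | rfl
      rw [this, ← pow_succ', add_right_comm]
  · rintro ⟨n, i, j⟩ -
    simp only [modelWeight]
    rw [← pow_succ']
    congr 1
    ring
  · rintro ⟨n, i, j⟩ -
    simp only [modelWeight]
    rw [← pow_succ']
    congr 1

lemma diagHom_modelWeight_g (i : Fin 2) : diagHom R.modelWeight (R.g i) = Model.G q := by
  have h6 : R.χOf ![3, 1] (R.g i) = q ^ 6 := by
    rw [χOf, mul_apply_groupLike (R.g_groupLike i), pow_apply_groupLike (R.g_groupLike i),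
      pow_apply_groupLike (R.g_groupLike i), R.χ_g, R.χ_g]
    fin_cases i <;> simp [qMatrix] <;> ring
  rw [diagHom_apply, Model.G]
  congr 1
  funext p
  rw [modelWeight, pow_apply_groupLike (R.g_groupLike i), h6]
  ring

/-- The linear form for `l₁ ≠ 0`. -/
theorem exists_augmentation_ne_zero (h₁ : l₁ ≠ 0) :
    ∃ φ : R.AAlg hl →ₗ[k] k, R.IsAugmentation hl φ ∧
      ∀ α, R.cleave hl φ (relVec q l₁ l₂ (R.y hl) α) = rootVec q R.x α ^ 7 := by
  have hq := R.q_primitive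
  have hΦ : ∑ i ∈ Finset.range 7, q ^ i = 0 := hq.geom_sum_eq_zero (by norm_num)
  have hne : ∀ n, ¬ 7 ∣ n → 1 - q ^ n ≠ 0 := fun n hn =>
    sub_ne_zero.2 (Ne.symm fun h => hn ((hq.pow_eq_one_iff_dvd n).1 h))
  have hA : serreCoeff₁ q ≠ 0 := by
    rw [← coeff_serreCoeff₁ hΦ]
    refine mul_ne_zero (mul_ne_zero (mul_ne_zero ?_ ?_) ?_) ?_ <;> exact hne _ (by norm_num)
  have hB : serreCoeff₂ q ≠ 0 := by
    rw [← coeff_serreCoeff₂ hΦ]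
    refine mul_ne_zero ?_ ?_ <;> exact hne _ (by norm_num)
  set κ := l₁ / serreCoeff₁ q with hκ
  have hκ0 : κ ≠ 0 := div_ne_zero h₁ hA
  set θ := l₂ / (serreCoeff₂ q * κ ^ 2) with hθ
  have e₁ : l₁ = κ * serreCoeff₁ q := (div_mul_cancel₀ _ hA).symm
  have e₂ : l₂ = serreCoeff₂ q * κ ^ 2 * θ :=
    (mul_div_cancel₀ _ (mul_ne_zero hB (pow_ne_zero 2 hκ0))).symm
  have hχ4 : R.χOf ![4, 1] = 1 := by
    by_contra h
    exact h₁ (hl.1 (Or.inr h))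
  obtain ⟨w1, w2, w3⟩ := R.χOf_three_one hχ4
  have hθ7 : θ ≠ 0 → R.χOf ![3, 1] ^ 7 = 1 := fun h => w3 (by
    by_contra h'
    exact h (by rw [hθ, hl.2 (Or.inr h'), zero_div]))
  have D := Model.loweringData θ R.q_pow
  obtain ⟨hX, hX', hd, hτ, hg⟩ := R.hasWeight_model w1 hθ7
  obtain ⟨s1, s2⟩ := D.serre_add hq κ
  have hw : ∀ i, HasWeight R.modelWeight (R.χ i)
      (![Model.X q, Model.d θ ^ 4 * (κ • 1)] i + ![Model.X' q, Model.τ q ^ 3 * Model.g q] i) := by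
    intro i
    fin_cases i
    · exact hX.add hX'
    · have e1 := (hd.pow 4).mul (HasWeight.one.smul κ)
      have e2 := (hτ.pow 3).mul hg
      rw [← pow_succ, w2] at e2
      rw [mul_one, w2] at e1
      exact e1.add e2
  let r := R.rep hl R.modelWeight _ (s1.trans (by rw [e₁])) (s2.trans (by rw [e₂])) hw
  have hr : ∀ h, r ((R.action hl).inr h) = diagHom R.modelWeight h := fun h =>
    R.rep_inr hl _ _ _ _ hw h
  have hv : ∀ h, r ((R.action hl).inr h) (Finsupp.single (0, 0, 0) 1) =
      counit (R := k) h • Finsupp.single (0, 0, 0) 1 := by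
    intro h
    rw [hr, counit_smul_diagHom (by rw [modelWeight]; exact pow_zero _)]
  have hψ : ∀ h n, Finsupp.linearCombination k (modelForm q θ κ) (r ((R.action hl).inr h) n) =
      counit (R := k) h * Finsupp.linearCombination k (modelForm q θ κ) n := by
    intro h n
    rw [hr]
    induction n using Finsupp.induction_linear with
    | zero => simp
    | add f g hf hg => rw [map_add, map_add, hf, hg, map_add, mul_add]
    | single p a =>
      by_cases hp : modelForm q θ κ p = 0
      · rw [diagHom_apply, wshift_single, Finsupp.linearCombination_single,
          Finsupp.linearCombination_single, id, hp, smul_zero, smul_zero, mul_zero]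
      · rw [counit_smul_diagHom (R.modelWeight_eq_one hθ7 hp), map_smul, smul_eq_mul]
  refine R.exists_augmentation_of_loweringData hl r hv hψ (by simp [modelForm]) (κ := κ) (θ := θ)
    (X := Model.X q) (d := Model.d θ) (X' := Model.X' q) (τ := Model.τ q) (g := Model.g q)
    (fun i => ?_) ?_ ?_ (fun i => R.rep_y hl _ _ _ _ _ i) e₁ e₂ ?_ ?_ ?_ ?_ ?_
  · rw [hr, diagHom_modelWeight_g]
    exact D
  · simp [Model.X, wshift_single]
  · simp [Model.X', wshift_single]
  all_goals
    rw [Model.τ_pow_mul_g_pow_vac, Finsupp.linearCombination_single, one_smul]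
    simp [modelForm]

/-- The linear form on `𝓐(λ)` whose colinear map sends the elements `relVec` to the seventh powers
of the root vectors of `𝓗'`. -/
theorem exists_augmentation :
    ∃ φ : R.AAlg hl →ₗ[k] k, R.IsAugmentation hl φ ∧
      ∀ α, R.cleave hl φ (relVec q l₁ l₂ (R.y hl) α) = rootVec q R.x α ^ 7 := by
  by_cases h : l₁ = 0
  · subst h
    exact R.exists_augmentation_zero hl
  · exact R.exists_augmentation_ne_zero hl h

end PrincipalRealization

/-! ### The filtration by degree and the Rees algebra -/

section Filtration
variable {k A B : Type*} [Field k] [Ring A] [Algebra k A] [Ring B] [Algebra k B]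

/-- The elements of degree at most `m` in the generators `y 0`, `y 1`. -/
def filt (y : Fin 2 → A) (m : ℕ) : Submodule k A := Submodule.span k (insert 1 (Set.range y)) ^ m

/-- The elements of degree less than `m` in the generators `y 0`, `y 1`. -/
def filtLT (y : Fin 2 → A) : ℕ → Submodule k A
  | 0 => ⊥
  | m + 1 => filt y m

variable (y : Fin 2 → A)

lemma map_filt (f : A →ₐ[k] B) (m : ℕ) :
    (filt (k := k) y m).map f.toLinearMap = filt (fun i => f (y i)) m := by
  rw [filt, Submodule.map_pow, Submodule.map_span]
  congr 2
  rw [Set.image_insert_eq, ← Set.range_comp]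
  simp [Function.comp_def]

lemma map_filtLT (f : A →ₐ[k] B) (m : ℕ) :
    (filtLT (k := k) y m).map f.toLinearMap = filtLT (fun i => f (y i)) m := by
  cases m with
  | zero => exact Submodule.map_bot _
  | succ m => exact map_filt y f m

lemma one_mem_span : (1 : A) ∈ Submodule.span k (insert 1 (Set.range y)) :=
  Submodule.subset_span (Set.mem_insert _ _)

lemma filt_mono {m n : ℕ} (h : m ≤ n) : filt (k := k) y m ≤ filt y n :=
  pow_le_pow_right₀ (Submodule.one_le.2 (one_mem_span y)) h

lemma one_mem_filt (m : ℕ) : (1 : A) ∈ filt (k := k) y m :=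
  Submodule.one_le.1 (one_le_pow₀ (Submodule.one_le.2 (one_mem_span y)))

lemma algebraMap_mem_filt (r : k) (m : ℕ) : algebraMap k A r ∈ filt (k := k) y m := by
  rw [Algebra.algebraMap_eq_smul_one]
  exact Submodule.smul_mem _ _ (one_mem_filt y m)

lemma filtLT_le (m : ℕ) : filtLT (k := k) y m ≤ filt y m := by
  cases m with
  | zero => exact bot_le
  | succ m => exact filt_mono y m.le_succ

lemma filtLT_mono {m n : ℕ} (h : m ≤ n) : filtLT (k := k) y m ≤ filtLT y n := by
  cases m with
  | zero => exact bot_le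
  | succ m =>
    cases n with
    | zero => omega
    | succ n => exact filt_mono y (by omega)

lemma mul_mem_filt {m n : ℕ} {a b : A} (ha : a ∈ filt (k := k) y m) (hb : b ∈ filt (k := k) y n) :
    a * b ∈ filt (k := k) y (m + n) := by
  rw [filt, pow_add]
  exact Submodule.mul_mem_mul ha hb

lemma mul_mem_filtLT {m n : ℕ} {a b : A} (ha : a ∈ filt (k := k) y m)
    (hb : b ∈ filtLT (k := k) y n) : a * b ∈ filtLT (k := k) y (m + n) := by
  cases n with
  | zero => rw [(Submodule.mem_bot k).1 hb, mul_zero]; exact zero_mem _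
  | succ n => exact mul_mem_filt y ha hb

lemma filtLT_mul_mem {m n : ℕ} {a b : A} (ha : a ∈ filtLT (k := k) y m)
    (hb : b ∈ filt (k := k) y n) : a * b ∈ filtLT (k := k) y (m + n) := by
  cases m with
  | zero => rw [(Submodule.mem_bot k).1 ha, zero_mul]; exact zero_mem _
  | succ m => rw [Nat.succ_add]; exact mul_mem_filt y ha hb

lemma gen_mem_filt (i : Fin 2) : y i ∈ filt (k := k) y 1 := by
  rw [filt, pow_one]
  exact Submodule.subset_span (Set.mem_insert_of_mem _ ⟨i, rfl⟩)

lemma filt_succ_le {m : ℕ} {P : Submodule k A} (h : filt y m ≤ P)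
    (h' : ∀ i, ∀ a ∈ filt (k := k) y m, y i * a ∈ P) : filt y (m + 1) ≤ P := by
  rw [filt, pow_succ', Submodule.mul_le]
  intro u hu a ha
  induction hu using Submodule.span_induction with
  | mem u hu =>
    rcases hu with rfl | ⟨i, rfl⟩
    · rw [one_mul]; exact h ha
    · exact h' i a ha
  | zero => rw [zero_mul]; exact zero_mem _
  | add u v _ _ hu hv => rw [add_mul]; exact add_mem hu hv
  | smul r u _ hu => rw [smul_mul_assoc]; exact Submodule.smul_mem _ _ hu

lemma exists_mem_filt (hy : Algebra.adjoin k (Set.range y) = ⊤) (a : A) :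
    ∃ m, a ∈ filt (k := k) y m := by
  have ha : a ∈ Algebra.adjoin k (Set.range y) := hy ▸ Algebra.mem_top
  induction ha using Algebra.adjoin_induction with
  | mem x hx => obtain ⟨i, rfl⟩ := hx; exact ⟨1, gen_mem_filt y i⟩
  | algebraMap r => exact ⟨0, algebraMap_mem_filt y r 0⟩
  | add a b _ _ ha hb =>
    obtain ⟨m, ha⟩ := ha
    obtain ⟨n, hb⟩ := hb
    exact ⟨m + n, add_mem (filt_mono y (by omega) ha) (filt_mono y (by omega) hb)⟩
  | mul a b _ _ ha hb =>
    obtain ⟨m, ha⟩ := ha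
    obtain ⟨n, hb⟩ := hb
    exact ⟨m + n, mul_mem_filt y ha hb⟩

end Filtration

section Rees
variable {k A : Type*} [Field k] [Ring A] [Algebra k A] (y : Fin 2 → A)
open Polynomial

/-- The map of the free algebra to the Rees algebra: `x_i ↦ y_i T`. -/
def rees : FreeAlgebra k (Fin 2) →ₐ[k] A[X] := FreeAlgebra.lift k fun i => monomial 1 (y i)

lemma coeff_rees_mem (t : FreeAlgebra k (Fin 2)) (m : ℕ) :
    (rees y t).coeff m ∈ filt (k := k) y m := by
  induction t using FreeAlgebra.induction generalizing m with
  | grade0 r =>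
    rw [AlgHom.commutes, Polynomial.algebraMap_apply, coeff_C]
    split_ifs
    · exact algebraMap_mem_filt y r m
    · exact zero_mem _
  | grade1 i =>
    rw [rees, FreeAlgebra.lift_ι_apply, coeff_monomial]
    split_ifs with h
    · rw [← h]; exact gen_mem_filt y i
    · exact zero_mem _
  | mul a b ha hb =>
    rw [map_mul, Polynomial.coeff_mul]
    refine sum_mem fun p hp => ?_
    rw [← Finset.HasAntidiagonal.mem_antidiagonal.1 hp]
    exact mul_mem_filt y (ha _) (hb _)
  | add a b ha hb => rw [map_add, coeff_add]; exact add_mem (ha m) (hb m)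

lemma coeff_rees_eq_zero {m : ℕ} {t : FreeAlgebra k (Fin 2)}
    (ht : t ∈ filt (k := k) (FreeAlgebra.ι k) m) {j : ℕ} (hj : m < j) :
    (rees y t).coeff j = 0 := by
  suffices h : filt (k := k) (FreeAlgebra.ι k) m ≤
      ((degreeLE A m).restrictScalars k).comap (rees y).toLinearMap by
    have := h ht
    exact coeff_eq_zero_of_degree_lt (lt_of_le_of_lt (mem_degreeLE.1 this) (by exact_mod_cast hj))
  clear hj ht
  induction m with
  | zero =>
    rw [filt, pow_zero, Submodule.one_le]
    change rees y 1 ∈ degreeLE A _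
    rw [map_one, mem_degreeLE]
    exact degree_one_le
  | succ m ih =>
    refine filt_succ_le _ (fun a ha => ?_) fun i a ha => ?_
    · exact degreeLE_mono (by exact_mod_cast m.le_succ) (ih ha)
    · have h1 : degree (rees y a) ≤ m := mem_degreeLE.1 (ih ha)
      change rees y (FreeAlgebra.ι k i * a) ∈ degreeLE A _
      rw [mem_degreeLE, map_mul, rees, FreeAlgebra.lift_ι_apply]
      refine (degree_mul_le _ _).trans ?_
      refine (add_le_add (degree_monomial_le _ _) h1).trans ?_
      push_cast
      rw [add_comm]

lemma sum_coeff_rees {m : ℕ} {t : FreeAlgebra k (Fin 2)}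
    (ht : t ∈ filt (k := k) (FreeAlgebra.ι k) m) :
    ∑ j ∈ Finset.range (m + 1), (rees y t).coeff j = FreeAlgebra.lift k y t := by
  let ev : A[X] →ₐ[k] A :=
    { eval₂RingHom' (RingHom.id A) 1 fun a => Commute.one_right a with
      commutes' := fun r => by simp [Polynomial.algebraMap_apply] }
  have e : ev.comp (rees y) = FreeAlgebra.lift k y := by
    ext i
    simp [rees, ev]
  rw [← e, AlgHom.comp_apply]
  change _ = eval₂ (RingHom.id A) 1 (rees y t)
  rw [eval₂_eq_sum_range' (n := m + 1)]
  · simp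
  · refine Nat.lt_succ_of_le (natDegree_le_iff_coeff_eq_zero.2 fun j hj => ?_)
    exact coeff_rees_eq_zero y ht hj

lemma brBracket_monomial (q : k) (a b : Fin 2 → ℕ) (m n : ℕ) (u v : A) :
    brBracket q a b (monomial m u) (monomial n v) = monomial (m + n) (brBracket q a b u v) := by
  rw [brBracket, monomial_mul_monomial, monomial_mul_monomial, add_comm n m, brBracket, map_sub,
    smul_monomial]

lemma rees_serre (q : k) :
    rees y (y11112 q (FreeAlgebra.ι k)) = monomial 5 (y11112 q y) ∧
      rees y (y122 q (FreeAlgebra.ι k)) = monomial 3 (y122 q y) := by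
  have h : (fun i => rees (k := k) y (FreeAlgebra.ι k i)) = fun i => monomial 1 (y i) := by
    funext i; simp [rees]
  rw [map_y11112, map_y122, h]
  simp only [y11112, y1112, y112, y12, y122, brBracket_monomial]
  constructor <;> norm_num

/-- The ideal of the free algebra which consists of the elements with lower order components in
the Rees algebra. -/
def reesIdeal : TwoSidedIdeal (FreeAlgebra k (Fin 2)) :=
  .mk' {t | ∀ m, (rees y t).coeff m ∈ filtLT (k := k) y m}
    (fun m => by rw [map_zero, coeff_zero]; exact zero_mem _)
    (fun ha hb m => by rw [map_add, coeff_add]; exact add_mem (ha m) (hb m))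
    (fun ha m => by rw [map_neg, coeff_neg]; exact neg_mem (ha m))
    (fun {a b} hb m => by
      rw [map_mul, Polynomial.coeff_mul]
      refine sum_mem fun p hp => ?_
      rw [← Finset.HasAntidiagonal.mem_antidiagonal.1 hp]
      exact mul_mem_filtLT y (coeff_rees_mem y a _) (hb _))
    (fun {a b} ha m => by
      rw [map_mul, Polynomial.coeff_mul]
      refine sum_mem fun p hp => ?_
      rw [← Finset.HasAntidiagonal.mem_antidiagonal.1 hp]
      exact filtLT_mul_mem y (ha _) (coeff_rees_mem y b _))

lemma mem_reesIdeal {t : FreeAlgebra k (Fin 2)} :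
    t ∈ reesIdeal (k := k) y ↔ ∀ m, (rees y t).coeff m ∈ filtLT (k := k) y m :=
  TwoSidedIdeal.mem_mk' ..

variable {y} {q l₁ l₂ : k}

/-- The ideal contains the kernel of the map to `𝓔(0, 0)`, as the values of the Serre elements in
the
Rees algebra are scalars times `T ^ 5`, `T ^ 3`, and thus of lower degree. -/
lemma mem_reesIdeal_of_serre
    (h1 : y11112 q y = algebraMap k A l₁) (h2 : y122 q y = algebraMap k A l₂)
    {t : FreeAlgebra k (Fin 2)} (ht : RingQuot.mkAlgHom k (SerreRel q 0 0) t = 0) :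
    t ∈ reesIdeal (k := k) y := by
  have mem : ∀ (n : ℕ) (l : k) (m : ℕ),
      (monomial (n + 1) (algebraMap k A l)).coeff m ∈ filtLT (k := k) y m := by
    intro n l m
    rw [coeff_monomial]
    split_ifs with h
    · rw [← h]; exact algebraMap_mem_filt y l n
    · exact zero_mem _
  let c := (reesIdeal (k := k) y).ringCon
  let p : FreeAlgebra k (Fin 2) →ₐ[k] c.Quotient := RingCon.mkₐ k c
  have hp : ∀ t, p t = 0 ↔ t ∈ reesIdeal (k := k) y := by
    intro t
    rw [TwoSidedIdeal.mem_iff, ← map_zero p]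
    exact RingCon.eq c
  let f : EAlg q (0 : k) 0 →ₐ[k] c.Quotient := EAlg.lift (fun i => p (FreeAlgebra.ι k i))
    (by
      rw [← map_y11112, map_zero (algebraMap k _), hp, mem_reesIdeal, (rees_serre y q).1, h1]
      exact mem 4 l₁)
    (by
      rw [← map_y122, map_zero (algebraMap k _), hp, mem_reesIdeal, (rees_serre y q).2, h2]
      exact mem 2 l₂)
  have hf : f.comp (RingQuot.mkAlgHom k (SerreRel q 0 0)) = p := by
    ext i
    exact EAlg.lift_gen _ _ _ i
  rw [← hp, ← hf, AlgHom.comp_apply, ht, map_zero]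

/-- If a polynomial of degree at most `m` vanishes in `𝓔(0, 0)`, then its value in `𝓔(l₁, l₂)` has
degree less than `m`. -/
lemma mkAlgHom_mem_filtLT {m : ℕ} {t : FreeAlgebra k (Fin 2)}
    (hm : t ∈ filt (k := k) (FreeAlgebra.ι k) m)
    (ht : RingQuot.mkAlgHom k (SerreRel q 0 0) t = 0) :
    RingQuot.mkAlgHom k (SerreRel q l₁ l₂) t ∈ filtLT (k := k) (gen q l₁ l₂) m := by
  have h := (mem_reesIdeal _).1 (mem_reesIdeal_of_serre (gen_serre1 q l₁ l₂) (gen_serre2 q l₁ l₂)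
      ht)
  have e : FreeAlgebra.lift k (gen q l₁ l₂) = RingQuot.mkAlgHom k (SerreRel q l₁ l₂) := by
    ext i
    simp [gen]
  rw [← e, ← sum_coeff_rees _ hm]
  exact sum_mem fun j hj => filtLT_mono _ (by have := Finset.mem_range.1 hj; omega) (h j)

/-- A linear map `𝓔(l₁, l₂) → 𝓔(0, 0)` which is the identity up to terms of lower degree is
bijective. -/
theorem bijective_of_unipotent (Φ : EAlg q l₁ l₂ →ₗ[k] EAlg q (0 : k) 0)
    (h : ∀ m, ∀ t ∈ filt (k := k) (FreeAlgebra.ι k) m,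
      Φ (RingQuot.mkAlgHom k (SerreRel q l₁ l₂) t) - RingQuot.mkAlgHom k (SerreRel q 0 0) t ∈
        filtLT (k := k) (gen q 0 0) m) : Function.Bijective Φ := by
  have hf : ∀ (l l' : k) m, filt (k := k) (gen q l l') m =
      (filt (k := k) (FreeAlgebra.ι k) m).map (RingQuot.mkAlgHom k (SerreRel q l l')).toLinearMap :=
    fun l l' m => (map_filt _ _ m).symm
  have hlt : ∀ (l l' : k) m, filtLT (k := k) (gen q l l') m =
      (filtLT (k := k) (FreeAlgebra.ι k) m).map
        (RingQuot.mkAlgHom k (SerreRel q l l')).toLinearMap :=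
    fun l l' m => (map_filtLT _ _ m).symm
  constructor
  · rw [injective_iff_map_eq_zero]
    suffices H : ∀ m, ∀ e ∈ filtLT (k := k) (gen q l₁ l₂) m, Φ e = 0 → e = 0 by
      intro e he
      obtain ⟨m, hm⟩ := exists_mem_filt _ (adjoin_gen q l₁ l₂) e
      exact H (m + 1) e hm he
    intro m
    induction m with
    | zero => exact fun e he _ => (Submodule.mem_bot k).1 he
    | succ m ih =>
      intro e he h0
      refine ih e ?_ h0
      change e ∈ filt _ m at he
      rw [hf] at he
      obtain ⟨t, ht, rfl⟩ := he
      have h1 := h m t ht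
      rw [AlgHom.toLinearMap_apply] at h0 ⊢
      rw [h0, zero_sub, neg_mem_iff, hlt] at h1
      obtain ⟨t', ht', h2⟩ := h1
      have h3 := mkAlgHom_mem_filtLT (q := q) (l₁ := l₁) (l₂ := l₂)
        (sub_mem ht (filtLT_le _ _ ht'))
        (by rw [map_sub, sub_eq_zero]; exact h2.symm)
      have h4 := add_mem h3 ((hlt l₁ l₂ m).symm ▸ Submodule.mem_map_of_mem ht')
      rwa [map_sub, AlgHom.toLinearMap_apply, sub_add_cancel] at h4
  · suffices H : ∀ m, filtLT (k := k) (gen q 0 0) m ≤ LinearMap.range Φ by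
      intro e
      obtain ⟨m, hm⟩ := exists_mem_filt _ (adjoin_gen q 0 0) e
      exact H (m + 1) hm
    intro m
    induction m with
    | zero => exact bot_le
    | succ m ih =>
      intro e he
      change e ∈ filt _ m at he
      rw [hf] at he
      obtain ⟨t, ht, rfl⟩ := he
      have h1 := sub_mem (LinearMap.mem_range_self Φ
        (RingQuot.mkAlgHom k (SerreRel q l₁ l₂) t)) (ih (h m t ht))
      rwa [sub_sub_cancel] at h1

end Rees

/-! ### Bijectivity of the colinear map -/

namespace HModuleAlgebra
variable {k H E : Type*} [Field k] [Ring H] [HopfAlgebra k H] [Ring E] [Algebra k E]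
  (S : HModuleAlgebra k H E)

/-- The projection `a # h ↦ ε(h) a`. -/
def counitRight : S.Smash →ₗ[k] E :=
  (TensorProduct.rid k E).toLinearMap ∘ₗ LinearMap.lTensor E (counit (R := k) (A := H))

lemma counitRight_inl (a : E) : S.counitRight (S.inl a) = a := by
  change TensorProduct.rid k E (LinearMap.lTensor E counit (a ⊗ₜ[k] (1 : H))) = a
  simp

lemma inl_injective : Function.Injective S.inl :=
  Function.LeftInverse.injective S.counitRight_inl

end HModuleAlgebra

namespace PrincipalRealization
variable {k H : Type*} [Field k] [Ring H] [HopfAlgebra k H] {q : k}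
  (R : PrincipalRealization k H q) {l₁ l₂ : k} (hl : R.SerreParam l₁ l₂)

lemma slice_mul {A B : Type*} [Ring A] [Algebra k A] [Ring B] [Algebra k B] (f : A →ₗ[k] k)
    (a : A) (b : B) (z : A ⊗[k] B) :
    slice f ((a ⊗ₜ b) * z) = b * slice (f ∘ₗ LinearMap.mulLeft k a) z := by
  induction z using TensorProduct.induction_on with
  | zero => simp
  | add z z' hz hz' => simp only [mul_add, map_add, hz, hz']
  | tmul c d => simp [slice_tmul]

lemma slice_coaction_y_mul (f : R.AAlg hl →ₗ[k] k) (i : Fin 2) (a : R.AAlg hl) :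
    slice f (R.coaction hl (R.y hl i * a)) =
      slice (f ∘ₗ LinearMap.mulLeft k (R.y hl i)) (R.coaction hl a) +
        R.x i * slice (f ∘ₗ LinearMap.mulLeft k ((R.action hl).inr (R.g i))) (R.coaction hl a) := by
  rw [map_mul, coaction_y, add_mul, map_add, slice_mul, slice_mul, one_mul]

lemma slice_coaction_mem (m : ℕ) {a : R.AAlg hl} (ha : a ∈ filt (k := k) (R.y hl) m)
    (f : R.AAlg hl →ₗ[k] k) : slice f (R.coaction hl a) ∈ filt (k := k) R.x m := by
  induction m generalizing a f with
  | zero =>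
    rw [filt, pow_zero] at ha ⊢
    obtain ⟨r, rfl⟩ := Submodule.mem_one.1 ha
    rw [Algebra.algebraMap_eq_smul_one, map_smul, map_smul, map_one,
      Algebra.TensorProduct.one_def, slice_tmul]
    exact Submodule.smul_mem _ _ (Submodule.smul_mem _ _ (Submodule.one_le.1 le_rfl))
  | succ m ih =>
    refine filt_succ_le (R.y hl)
      (P := (filt (k := k) R.x (m + 1)).comap (slice f ∘ₗ (R.coaction hl).toLinearMap))
      (fun b hb => ?_) (fun i b hb => ?_) ha
    · exact filt_mono _ m.le_succ (ih hb f)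
    · change slice f (R.coaction hl (R.y hl i * b)) ∈ filt (k := k) R.x (m + 1)
      rw [slice_coaction_y_mul]
      refine add_mem (filt_mono _ m.le_succ (ih hb _)) ?_
      rw [add_comm m]
      exact mul_mem_filt _ (gen_mem_filt _ i) (ih hb _)

/-- The map `𝓔(λ) → 𝓔(0)` induced by a linear form on `𝓐(λ)`. -/
def cleaveE (φ : R.AAlg hl →ₗ[k] k) : EAlg q l₁ l₂ →ₗ[k] EAlg q (0 : k) 0 :=
  (R.action R.serreParam_zero).counitRight ∘ₗ R.cleave hl φ ∘ₗ (R.action hl).inl.toLinearMap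

lemma cleave_inl (φ : R.AAlg hl →ₗ[k] k) (e : EAlg q l₁ l₂) :
    R.cleave hl φ ((R.action hl).inl e) =
      (R.action R.serreParam_zero).inl (R.cleaveE hl φ e) := by
  obtain ⟨m, hm⟩ := exists_mem_filt _ (adjoin_gen q l₁ l₂) e
  have h1 : (R.action hl).inl e ∈ filt (k := k) (R.y hl) m := by
    have := Submodule.mem_map_of_mem (f := (R.action hl).inl.toLinearMap) hm
    rwa [map_filt] at this
  have h2 := R.slice_coaction_mem hl m h1 φ
  have h3 : filt (k := k) R.x m = (filt (k := k) (gen q 0 0) m).map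
    (R.action R.serreParam_zero).inl.toLinearMap := (map_filt _ _ _).symm
  rw [h3] at h2
  obtain ⟨e', -, he'⟩ := h2
  have h4 : R.cleave hl φ ((R.action hl).inl e) = (R.action R.serreParam_zero).inl e' := he'.symm
  have h5 : R.cleaveE hl φ e = e' := by
    change (R.action R.serreParam_zero).counitRight (R.cleave hl φ ((R.action hl).inl e)) = e'
    rw [h4, HModuleAlgebra.counitRight_inl]
  rw [h4, h5]

variable {R hl} {φ : R.AAlg hl →ₗ[k] k}

lemma IsAugmentation.cleave_y_mul (hφ : R.IsAugmentation hl φ) (i : Fin 2) (a : R.AAlg hl) :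
    R.cleave hl φ (R.y hl i * a) =
      slice (φ ∘ₗ LinearMap.mulLeft k (R.y hl i)) (R.coaction hl a) + R.x i * R.cleave hl φ a := by
  have e : φ ∘ₗ LinearMap.mulLeft k ((R.action hl).inr (R.g i)) = φ := by
    ext b
    simp [hφ.inr_mul, (R.g_groupLike i).counit_eq_one]
  have := R.slice_coaction_y_mul hl φ i a
  rw [e] at this
  exact this

lemma IsAugmentation.cleave_one (hφ : R.IsAugmentation hl φ) :
    R.cleave hl φ 1 = 1 := by
  simp [cleave, Algebra.TensorProduct.one_def, slice_tmul, hφ.map_one]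

/-- The colinear map preserves the leading term of a polynomial in the generators. -/
lemma IsAugmentation.cleave_sub_mem (hφ : R.IsAugmentation hl φ) (m : ℕ)
    {t : FreeAlgebra k (Fin 2)}
    (ht : t ∈ filt (k := k) (FreeAlgebra.ι k) m) :
    R.cleave hl φ (FreeAlgebra.lift k (R.y hl) t) - FreeAlgebra.lift k R.x t ∈
      filtLT (k := k) R.x m := by
  suffices H : filt (k := k) (FreeAlgebra.ι k) m ≤ (filtLT (k := k) R.x m).comap
      (R.cleave hl φ ∘ₗ (FreeAlgebra.lift k (R.y hl)).toLinearMap -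
        (FreeAlgebra.lift k R.x).toLinearMap) from H ht
  clear ht t
  induction m with
  | zero =>
    rw [filt, pow_zero, Submodule.one_le]
    change R.cleave hl φ (FreeAlgebra.lift k (R.y hl) 1) - FreeAlgebra.lift k R.x 1 ∈
      filtLT (k := k) R.x 0
    rw [_root_.map_one (FreeAlgebra.lift k (R.y hl)), _root_.map_one (FreeAlgebra.lift k R.x),
      hφ.cleave_one, sub_self]
    exact zero_mem _
  | succ m ih =>
    refine filt_succ_le _ (fun t ht => filtLT_mono _ m.le_succ (ih ht)) fun i t ht => ?_
    change R.cleave hl φ (FreeAlgebra.lift k (R.y hl) (FreeAlgebra.ι k i * t)) -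
      FreeAlgebra.lift k R.x (FreeAlgebra.ι k i * t) ∈ filtLT (k := k) R.x (m + 1)
    rw [map_mul (FreeAlgebra.lift k (R.y hl)), map_mul (FreeAlgebra.lift k R.x),
      FreeAlgebra.lift_ι_apply, FreeAlgebra.lift_ι_apply, hφ.cleave_y_mul, add_sub_assoc, ← mul_sub]
    refine add_mem ?_ ?_
    · refine R.slice_coaction_mem hl m ?_ _
      have := Submodule.mem_map_of_mem (f := (FreeAlgebra.lift k (R.y hl)).toLinearMap) ht
      rw [map_filt] at this
      simpa using this
    · rw [add_comm m]
      exact mul_mem_filtLT _ (gen_mem_filt _ i) (ih ht)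

lemma IsAugmentation.cleaveE_bijective (hφ : R.IsAugmentation hl φ) :
    Function.Bijective (R.cleaveE hl φ) := by
  refine bijective_of_unipotent _ fun m t ht => ?_
  have h := hφ.cleave_sub_mem m ht
  have e1 : FreeAlgebra.lift k (R.y hl) =
      (R.action hl).inl.comp (RingQuot.mkAlgHom k (SerreRel q l₁ l₂)) := by
    ext i; simp [y, gen]
  have e2 : FreeAlgebra.lift k R.x =
      (R.action R.serreParam_zero).inl.comp (RingQuot.mkAlgHom k (SerreRel q 0 0)) := by
    ext i; simp [x, y, gen]
  have e3 : filtLT (k := k) R.x m = (filtLT (k := k) (gen q 0 0) m).map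
    (R.action R.serreParam_zero).inl.toLinearMap := (map_filtLT _ _ _).symm
  rw [e1, e2, AlgHom.comp_apply, AlgHom.comp_apply, cleave_inl, ← map_sub, e3] at h
  obtain ⟨a, ha, h⟩ := h
  rwa [← HModuleAlgebra.inl_injective _ h]

/-- Slicing by an augmentation is right `H`-linear. -/
lemma IsAugmentation.slice_mul_inr (hφ : R.IsAugmentation hl φ) (w : R.AAlg hl ⊗[k] R.HPre)
    (h : H) : slice φ (w * R.coaction hl ((R.action hl).inr h)) =
      slice φ w * (R.action R.serreParam_zero).inr h := by
  have e : ∀ z : H ⊗[k] H, slice φ (w * TensorProduct.map (R.action hl).inr.toLinearMap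
      (R.action R.serreParam_zero).inr.toLinearMap z) = slice φ w *
        (R.action R.serreParam_zero).inr (TensorProduct.lid k H (LinearMap.rTensor H counit z)) :=
            by
    intro z
    induction w using TensorProduct.induction_on with
    | zero => simp
    | add w w' hw hw' => simp only [add_mul, map_add, hw, hw']
    | tmul c d =>
      induction z using TensorProduct.induction_on with
      | zero => simp
      | add z z' hz hz' => simp only [mul_add, map_add, hz, hz']
      | tmul a b =>
        rw [TensorProduct.map_tmul, Algebra.TensorProduct.tmul_mul_tmul, slice_tmul, slice_tmul,
          AlgHom.toLinearMap_apply, hφ.mul_inr]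
        simp [smul_smul, mul_comm]
  rw [coaction_inr, e, Coalgebra.rTensor_counit_comul]
  simp

/-- Slicing by an augmentation is left `H`-linear. -/
lemma IsAugmentation.slice_inr_mul (hφ : R.IsAugmentation hl φ) (w : R.AAlg hl ⊗[k] R.HPre)
    (h : H) : slice φ (R.coaction hl ((R.action hl).inr h) * w) =
      (R.action R.serreParam_zero).inr h * slice φ w := by
  have e : ∀ z : H ⊗[k] H, slice φ (TensorProduct.map (R.action hl).inr.toLinearMap
      (R.action R.serreParam_zero).inr.toLinearMap z * w) = (R.action R.serreParam_zero).inr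
        (TensorProduct.lid k H (LinearMap.rTensor H counit z)) * slice φ w := by
    intro z
    induction w using TensorProduct.induction_on with
    | zero => simp
    | add w w' hw hw' => simp only [mul_add, map_add, hw, hw']
    | tmul c d =>
      induction z using TensorProduct.induction_on with
      | zero => simp
      | add z z' hz hz' => simp only [add_mul, map_add, hz, hz']
      | tmul a b =>
        rw [TensorProduct.map_tmul, Algebra.TensorProduct.tmul_mul_tmul, slice_tmul, slice_tmul,
          AlgHom.toLinearMap_apply, hφ.inr_mul]
        simp [smul_smul, mul_comm]
  rw [coaction_inr, e, Coalgebra.rTensor_counit_comul]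
  simp

lemma IsAugmentation.cleave_mul_inr (hφ : R.IsAugmentation hl φ) (a : R.AAlg hl) (h : H) :
    R.cleave hl φ (a * (R.action hl).inr h) =
      R.cleave hl φ a * (R.action R.serreParam_zero).inr h := by
  simp only [cleave, LinearMap.comp_apply, AlgHom.toLinearMap_apply, map_mul, hφ.slice_mul_inr]

lemma IsAugmentation.cleave_inr_mul (hφ : R.IsAugmentation hl φ) (a : R.AAlg hl) (h : H) :
    R.cleave hl φ ((R.action hl).inr h * a) =
      (R.action R.serreParam_zero).inr h * R.cleave hl φ a := by
  simp only [cleave, LinearMap.comp_apply, AlgHom.toLinearMap_apply, map_mul, hφ.slice_inr_mul]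

lemma IsAugmentation.cleave_bijective (hφ : R.IsAugmentation hl φ) :
    Function.Bijective (R.cleave hl φ) := by
  let e : EAlg q l₁ l₂ ≃ₗ[k] EAlg q (0 : k) 0 := LinearEquiv.ofBijective _ hφ.cleaveE_bijective
  have h : ∀ z : EAlg q l₁ l₂ ⊗[k] H, R.cleave hl φ z = LinearEquiv.rTensor H e z := by
    intro z
    induction z using TensorProduct.induction_on with
    | zero => rw [map_zero]; exact map_zero (R.cleave hl φ)
    | add z z' hz hz' =>
      rw [map_add, ← hz, ← hz']
      exact map_add (R.cleave hl φ) _ _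
    | tmul a b =>
      have h1 := hφ.cleave_mul_inr ((R.action hl).inl a) b
      rw [← HModuleAlgebra.tm_eq, cleave_inl, ← HModuleAlgebra.tm_eq] at h1
      exact h1
  have h' : (R.cleave hl φ : R.AAlg hl → R.HPre) = LinearEquiv.rTensor H e := funext h
  rw [h']
  exact (LinearEquiv.rTensor H e).bijective

end PrincipalRealization

/-! ### The coalgebra structure of `𝓗'` and colinearity -/

section Ext
variable {k H E B : Type*} [Field k] [Ring H] [HopfAlgebra k H] [Ring E] [Algebra k E]
  [Ring B] [Algebra k B]

lemma HModuleAlgebra.smash_induction (S : HModuleAlgebra k H E) {P : S.Smash → Prop}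
    (zero : P 0) (add : ∀ a b, P a → P b → P (a + b)) (tm : ∀ a h, P (S.inl a * S.inr h))
    (z : S.Smash) : P z :=
  TensorProduct.induction_on (motive := P) z zero (fun a h => by
    have h' := tm a h
    rw [← S.tm_eq] at h'
    exact h') add

lemma HModuleAlgebra.smash_hom_ext (S : HModuleAlgebra k H E) {f g : S.Smash →ₐ[k] B}
    (hl : f.comp S.inl = g.comp S.inl) (hr : f.comp S.inr = g.comp S.inr) : f = g := by
  ext z
  induction z using S.smash_induction with
  | zero => rw [map_zero, map_zero]
  | add a b ha hb => rw [map_add, map_add, ha, hb]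
  | tm a h =>
    have h1 := DFunLike.congr_fun hl a
    have h2 := DFunLike.congr_fun hr h
    simp only [AlgHom.comp_apply] at h1 h2
    rw [map_mul, map_mul, h1, h2]

lemma HModuleAlgebra.lift_inl (S : HModuleAlgebra k H E) (f : E →ₐ[k] B) (g : H →ₐ[k] B)
    (hfg : ∀ a, S.Compat f g a) (a : E) : S.lift f g hfg (S.inl a) = f a := by
  change HModuleAlgebra.pairLin f g (a ⊗ₜ[k] (1 : H)) = _
  simp [HModuleAlgebra.pairLin]

lemma HModuleAlgebra.lift_inr (S : HModuleAlgebra k H E) (f : E →ₐ[k] B) (g : H →ₐ[k] B)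
    (hfg : ∀ a, S.Compat f g a) (h : H) : S.lift f g hfg (S.inr h) = g h := by
  change HModuleAlgebra.pairLin f g ((1 : E) ⊗ₜ[k] h) = _
  simp [HModuleAlgebra.pairLin]

lemma EAlg.hom_ext {q l₁ l₂ : k} {f g : EAlg q l₁ l₂ →ₐ[k] B}
    (h : ∀ i, f (gen q l₁ l₂ i) = g (gen q l₁ l₂ i)) : f = g :=
  RingQuot.ringQuot_ext' k _ _ (FreeAlgebra.hom_ext (funext h))

variable {A : Type*} [AddCommGroup A] [Module k A]

lemma apply_slice (φ : A →ₗ[k] k) (Δ : B →ₗ[k] B ⊗[k] B) (w : A ⊗[k] B) :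
    Δ (slice φ w) = slice φ (TensorProduct.map LinearMap.id Δ w) := by
  induction w using TensorProduct.induction_on with
  | zero => simp
  | add z z' hz hz' => simp only [map_add, hz, hz']
  | tmul c d => simp [slice_tmul]

lemma map_slice (φ : A →ₗ[k] k) (ρ : A →ₗ[k] A ⊗[k] B) (w : A ⊗[k] B) :
    TensorProduct.map (slice φ ∘ₗ ρ) LinearMap.id w =
      slice φ (TensorProduct.assoc k A B B (TensorProduct.map ρ LinearMap.id w)) := by
  induction w using TensorProduct.induction_on with
  | zero => simp
  | add z z' hz hz' => simp only [map_add, hz, hz']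
  | tmul c d =>
    simp only [TensorProduct.map_tmul, LinearMap.comp_apply, LinearMap.id_apply]
    induction ρ c using TensorProduct.induction_on with
    | zero => simp
    | add z z' hz hz' => simp only [map_add, TensorProduct.add_tmul, hz, hz']
    | tmul c' d' => simp [slice_tmul, TensorProduct.smul_tmul']

end Ext

namespace PrincipalRealization
variable {k H : Type*} [Field k] [Ring H] [HopfAlgebra k H] {q : k}
  (R : PrincipalRealization k H q) {l₁ l₂ : k} (hl : R.SerreParam l₁ l₂)

lemma hom_ext {B : Type*} [Ring B] [Algebra k B] {f g : R.AAlg hl →ₐ[k] B}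
    (hy : ∀ i, f (R.y hl i) = g (R.y hl i))
    (hr : ∀ h, f ((R.action hl).inr h) = g ((R.action hl).inr h)) : f = g :=
  HModuleAlgebra.smash_hom_ext _ (EAlg.hom_ext hy) (AlgHom.ext hr)

lemma preComul_x (i : Fin 2) : R.preComul (R.x i) =
    R.x i ⊗ₜ 1 + (R.action R.serreParam_zero).inr (R.g i) ⊗ₜ R.x i :=
  R.coaction_y R.serreParam_zero i

lemma preComul_inr (h : H) : R.preComul ((R.action R.serreParam_zero).inr h) =
    TensorProduct.map (R.action R.serreParam_zero).inr.toLinearMap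
      (R.action R.serreParam_zero).inr.toLinearMap (comul h) :=
  R.coaction_inr R.serreParam_zero h

lemma preCounit_x (i : Fin 2) : R.preCounit (R.x i) = 0 := by
  refine (HModuleAlgebra.lift_inl _ _ _ _ _).trans ?_
  exact EAlg.lift_gen _ _ _ i

lemma preCounit_inr (h : H) :
    R.preCounit ((R.action R.serreParam_zero).inr h) = counit (R := k) h :=
  HModuleAlgebra.lift_inr _ _ _ _ _

lemma coaction_coassoc : (Algebra.TensorProduct.assoc k k k (R.AAlg hl) R.HPre R.HPre).toAlgHom.comp
    ((Algebra.TensorProduct.map (R.coaction hl) (AlgHom.id k R.HPre)).comp (R.coaction hl)) =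
    (Algebra.TensorProduct.map (AlgHom.id k (R.AAlg hl)) R.preComul).comp (R.coaction hl) := by
  refine R.hom_ext hl (fun i => ?_) fun h => ?_
  · simp only [AlgHom.comp_apply, coaction_y, map_add, Algebra.TensorProduct.map_tmul,
      coaction_inr, (R.g_groupLike i).comul_eq_tmul_self, preComul_x, TensorProduct.map_tmul,
      TensorProduct.add_tmul, TensorProduct.tmul_add, map_one]
    simp [Algebra.TensorProduct.one_def, add_assoc]
  · simp only [AlgHom.comp_apply, coaction_inr]
    have key := congrArg (TensorProduct.map (R.action hl).inr.toLinearMap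
      (TensorProduct.map (R.action R.serreParam_zero).inr.toLinearMap
        (R.action R.serreParam_zero).inr.toLinearMap)) (Coalgebra.coassoc_apply (R := k) h)
    refine Eq.trans ?_ (key.trans ?_)
    · induction comul (R := k) h using TensorProduct.induction_on with
      | zero => simp
      | add z z' hz hz' => simp only [map_add, hz, hz']
      | tmul a b =>
        simp only [TensorProduct.map_tmul, Algebra.TensorProduct.map_tmul, LinearMap.rTensor_tmul,
          AlgHom.toLinearMap_apply, coaction_inr]
        induction comul (R := k) a using TensorProduct.induction_on with
        | zero => simp
        | add z z' hz hz' => simp only [map_add, TensorProduct.add_tmul, hz, hz']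
        | tmul c d => simp
    · induction comul (R := k) h using TensorProduct.induction_on with
      | zero => simp
      | add z z' hz hz' => simp only [map_add, hz, hz']
      | tmul a b => simp [preComul_inr]

lemma coaction_coassoc_apply (a : R.AAlg hl) :
    TensorProduct.assoc k _ _ _ (TensorProduct.map (R.coaction hl).toLinearMap LinearMap.id
      (R.coaction hl a)) =
      TensorProduct.map LinearMap.id R.preComul.toLinearMap (R.coaction hl a) :=
  DFunLike.congr_fun (R.coaction_coassoc hl) a

lemma preCounit_comul_left : (Algebra.TensorProduct.lid k R.HPre).toAlgHom.comp
    ((Algebra.TensorProduct.map R.preCounit (AlgHom.id k R.HPre)).comp R.preComul) =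
    AlgHom.id k R.HPre := by
  refine R.hom_ext R.serreParam_zero (fun i => ?_) fun h => ?_
  · change _ = R.x i
    simp only [AlgHom.comp_apply]
    erw [R.preComul_x i]
    simp [preCounit_x, preCounit_inr, (R.g_groupLike i).counit_eq_one]
  · simp only [AlgHom.comp_apply, preComul_inr]
    have key := congrArg (fun z => (R.action R.serreParam_zero).inr (TensorProduct.lid k H z))
      (Coalgebra.rTensor_counit_comul (R := k) h)
    simp only [TensorProduct.lid_tmul, one_smul] at key
    refine Eq.trans ?_ key
    induction comul (R := k) h using TensorProduct.induction_on with
    | zero => simp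
    | add z z' hz hz' => simp only [map_add, hz, hz']
    | tmul a b => simp [preCounit_inr]

lemma preCounit_comul_right : (Algebra.TensorProduct.rid k k R.HPre).toAlgHom.comp
    ((Algebra.TensorProduct.map (AlgHom.id k R.HPre) R.preCounit).comp R.preComul) =
    AlgHom.id k R.HPre := by
  refine R.hom_ext R.serreParam_zero (fun i => ?_) fun h => ?_
  · change _ = R.x i
    simp only [AlgHom.comp_apply]
    erw [R.preComul_x i]
    simp [preCounit_x]
  · simp only [AlgHom.comp_apply, preComul_inr]
    have key := congrArg (fun z => (R.action R.serreParam_zero).inr (TensorProduct.rid k H z))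
      (Coalgebra.lTensor_counit_comul (R := k) h)
    simp only [TensorProduct.rid_tmul, one_smul] at key
    refine Eq.trans ?_ key
    induction comul (R := k) h using TensorProduct.induction_on with
    | zero => simp
    | add z z' hz hz' => simp only [map_add, hz, hz']
    | tmul a b => simp [preCounit_inr]

/-- The coalgebra structure of the Hopf algebra `𝓗'`. -/
instance preCoalgebra : Coalgebra k R.HPre where
  comul := R.preComul.toLinearMap
  counit := R.preCounit.toLinearMap
  coassoc := LinearMap.ext fun a => R.coaction_coassoc_apply R.serreParam_zero a
  rTensor_counit_comp_comul := LinearMap.ext fun a => by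
    have := DFunLike.congr_fun R.preCounit_comul_left a
    apply (TensorProduct.lid k R.HPre).injective
    exact this.trans (by simp)
  lTensor_counit_comp_comul := LinearMap.ext fun a => by
    have := DFunLike.congr_fun R.preCounit_comul_right a
    apply (TensorProduct.rid k R.HPre).injective
    exact this.trans (by simp)

/-- The map `a ↦ φ(a₍₀₎) a₍₁₎` is colinear. -/
lemma preComul_cleave (φ : R.AAlg hl →ₗ[k] k) (a : R.AAlg hl) :
    R.preComul (R.cleave hl φ a) =
      TensorProduct.map (R.cleave hl φ) LinearMap.id (R.coaction hl a) := by
  have e := map_slice φ (R.coaction hl).toLinearMap (R.coaction hl a)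
  rw [coaction_coassoc_apply, ← apply_slice] at e
  exact e.symm

end PrincipalRealization

/-! ### Convolution invertibility -/

namespace PrincipalRealization
variable {k H : Type*} [Field k] [Ring H] [HopfAlgebra k H] {q : k}
  (R : PrincipalRealization k H q) {A : Type*} [Ring A] [Algebra k A]

lemma conv_apply_eq (f F : WithConv (R.HPre →ₗ[k] A)) (z : R.HPre) :
    (f * F).ofConv z = LinearMap.mul' k A (TensorProduct.map f.ofConv F.ofConv (R.preComul z)) :=
  rfl

/-- The convolution product on `x_i z`. -/
lemma conv_x_mul (f F : WithConv (R.HPre →ₗ[k] A)) (i : Fin 2) (z : R.HPre) :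
    (f * F).ofConv (R.x i * z) =
      (WithConv.toConv (f.ofConv ∘ₗ LinearMap.mulLeft k (R.x i)) * F).ofConv z +
      (WithConv.toConv (f.ofConv ∘ₗ LinearMap.mulLeft k ((R.action R.serreParam_zero).inr (R.g i)))
          *
        WithConv.toConv (F.ofConv ∘ₗ LinearMap.mulLeft k (R.x i))).ofConv z := by
  simp only [conv_apply_eq, map_mul, preComul_x, add_mul, map_add]
  congr 1
  all_goals
    induction R.preComul z using TensorProduct.induction_on with
    | zero => simp
    | add z z' hz hz' => simp only [map_add, mul_add, hz, hz']
    | tmul c d => simp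

/-- The linear map vanishes on the elements `e # h` of `𝓗'` with `e` of degree less than `m`. -/
def VanishLT (F : R.HPre →ₗ[k] A) (m : ℕ) : Prop :=
  ∀ e ∈ filtLT (k := k) R.x m, ∀ h, F (e * (R.action R.serreParam_zero).inr h) = 0

variable {R}

lemma vanishLT_succ_of {F : R.HPre →ₗ[k] A} {m : ℕ} (h : R.VanishLT F (m + 1))
    (h' : ∀ i, R.VanishLT (F ∘ₗ LinearMap.mulLeft k (R.x i)) (m + 1)) :
    R.VanishLT F (m + 2) := by
  intro e he a
  refine filt_succ_le R.x (P := LinearMap.ker (F ∘ₗ LinearMap.mulRight k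
    ((R.action R.serreParam_zero).inr a))) (fun e he => h e he a) (fun i e he => ?_) he
  have := h' i e he a
  rw [LinearMap.mem_ker]
  simpa [mul_assoc] using this

lemma vanishLT_one {F : R.HPre →ₗ[k] A} (h : ∀ a, F ((R.action R.serreParam_zero).inr a) = 0) :
    R.VanishLT F 1 := by
  intro e he a
  change e ∈ filt R.x 0 at he
  rw [filt, pow_zero] at he
  obtain ⟨r, rfl⟩ := Submodule.mem_one.1 he
  rw [← Algebra.smul_def, map_smul, h, smul_zero]

lemma VanishLT.mono {F : R.HPre →ₗ[k] A} {m n : ℕ} (h : R.VanishLT F n) (hmn : m ≤ n) :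
    R.VanishLT F m := fun e he => h e (filtLT_mono _ hmn he)

lemma VanishLT.inr {F : R.HPre →ₗ[k] A} {m : ℕ} (h : R.VanishLT F (m + 1)) (a : H) :
    F ((R.action R.serreParam_zero).inr a) = 0 := by
  have := h 1 (one_mem_filt _ m) a
  rwa [one_mul] at this

lemma VanishLT.x_mul {F : R.HPre →ₗ[k] A} {m : ℕ} (h : R.VanishLT F (m + 1)) (i : Fin 2) :
    R.VanishLT (F ∘ₗ LinearMap.mulLeft k (R.x i)) m := by
  intro e he a
  have h1 : R.x i * e ∈ filtLT (k := k) R.x (m + 1) := by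
    rw [add_comm]
    exact mul_mem_filtLT _ (gen_mem_filt _ i) he
  simpa [mul_assoc] using h _ h1 a

lemma VanishLT.inr_mul {F : R.HPre →ₗ[k] A} (h : R.VanishLT F 1) (a : H) :
    R.VanishLT (F ∘ₗ LinearMap.mulLeft k ((R.action R.serreParam_zero).inr a)) 1 :=
  vanishLT_one fun b => by
    have := h.inr (m := 0) (a * b)
    rwa [map_mul] at this

lemma conv_inr (f F : WithConv (R.HPre →ₗ[k] A)) (a : H) :
    (f * F).ofConv ((R.action R.serreParam_zero).inr a) = LinearMap.mul' k A
      (TensorProduct.map (f.ofConv ∘ₗ (R.action R.serreParam_zero).inr.toLinearMap)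
        (F.ofConv ∘ₗ (R.action R.serreParam_zero).inr.toLinearMap) (comul a)) := by
  rw [conv_apply_eq, preComul_inr, TensorProduct.map_comp]
  rfl

lemma VanishLT.conv_right {F : WithConv (R.HPre →ₗ[k] A)} {m : ℕ} (hF : R.VanishLT F.ofConv m)
    (f : WithConv (R.HPre →ₗ[k] A)) : R.VanishLT (f * F).ofConv m := by
  induction m generalizing f F with
  | zero =>
    intro e he a
    rw [(Submodule.mem_bot k).1 he, zero_mul, map_zero]
  | succ m ih =>
    cases m with
    | zero =>
      refine vanishLT_one fun a => ?_
      have h0 : F.ofConv ∘ₗ (R.action R.serreParam_zero).inr.toLinearMap = 0 :=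
        LinearMap.ext fun a => hF.inr a
      rw [conv_inr, h0, TensorProduct.map_zero_right]
      simp
    | succ m =>
      refine vanishLT_succ_of (ih (hF.mono (by omega)) f) fun i e he a => ?_
      have h1 := ih (hF.mono (by omega))
        (WithConv.toConv (f.ofConv ∘ₗ LinearMap.mulLeft k (R.x i))) e he a
      have h2 := ih (F := WithConv.toConv (F.ofConv ∘ₗ LinearMap.mulLeft k (R.x i))) (hF.x_mul i)
        (WithConv.toConv
          (f.ofConv ∘ₗ LinearMap.mulLeft k ((R.action R.serreParam_zero).inr (R.g i)))) e he a
      rw [LinearMap.comp_apply, LinearMap.mulLeft_apply, conv_x_mul, h1, h2, add_zero]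

lemma VanishLT.conv {f F : WithConv (R.HPre →ₗ[k] A)} {m : ℕ} (hf : R.VanishLT f.ofConv 1)
    (hF : R.VanishLT F.ofConv m) : R.VanishLT (f * F).ofConv (m + 1) := by
  induction m generalizing f F with
  | zero =>
    refine vanishLT_one fun a => ?_
    have h0 : f.ofConv ∘ₗ (R.action R.serreParam_zero).inr.toLinearMap = 0 :=
      LinearMap.ext fun a => hf.inr a
    rw [conv_inr, h0, TensorProduct.map_zero_left]
    simp
  | succ m ih =>
    refine vanishLT_succ_of (ih hf (hF.mono (by omega))) fun i e he a => ?_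
    have h1 := hF.conv_right
      (WithConv.toConv (f.ofConv ∘ₗ LinearMap.mulLeft k (R.x i))) e he a
    have h2 := ih (f := WithConv.toConv
        (f.ofConv ∘ₗ LinearMap.mulLeft k ((R.action R.serreParam_zero).inr (R.g i))))
      (F := WithConv.toConv (F.ofConv ∘ₗ LinearMap.mulLeft k (R.x i)))
      (hf.inr_mul _) (hF.x_mul i) e he a
    rw [LinearMap.comp_apply, LinearMap.mulLeft_apply, conv_x_mul, h1, h2, add_zero]

lemma eventually_eq_zero {F : ℕ → R.HPre →ₗ[k] A} (hF : ∀ n, R.VanishLT (F n) n) (z : R.HPre) :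
    ∃ N, ∀ n, N ≤ n → F n z = 0 := by
  induction z using HModuleAlgebra.smash_induction with
  | zero => exact ⟨0, fun n _ => map_zero _⟩
  | add a b ha hb =>
    obtain ⟨N, hN⟩ := ha
    obtain ⟨M, hM⟩ := hb
    exact ⟨N + M, fun n hn => by rw [map_add, hN n (by omega), hM n (by omega), add_zero]⟩
  | tm e a =>
    obtain ⟨m, hm⟩ := exists_mem_filt _ (adjoin_gen q 0 0) e
    refine ⟨m + 1, fun n hn => ((hF n).mono hn) _ ?_ a⟩
    have := Submodule.mem_map_of_mem (f := (R.action R.serreParam_zero).inl.toLinearMap) hm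
    rwa [map_filt] at this

/-- The sum of a locally finite sequence of linear maps. -/
lemma exists_locally_finite_sum {F : ℕ → R.HPre →ₗ[k] A} (hF : ∀ n, R.VanishLT (F n) n) :
    ∃ s : R.HPre →ₗ[k] A, ∀ z, ∃ N, ∀ n, N ≤ n → s z = ∑ j ∈ Finset.range n, F j z := by
  have key : ∀ z, ∃ N, ∀ n, N ≤ n → ∑ᶠ j, F j z = ∑ j ∈ Finset.range n, F j z := by
    intro z
    obtain ⟨N, hN⟩ := eventually_eq_zero hF z
    refine ⟨N, fun n hn => finsum_eq_sum_of_support_subset _ fun j hj => ?_⟩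
    by_contra h
    exact hj (hN j (by simp at h; omega))
  refine ⟨{ toFun := fun z => ∑ᶠ j, F j z
            map_add' := fun a b => ?_
            map_smul' := fun r a => ?_ }, key⟩
  · obtain ⟨N, hN⟩ := key a
    obtain ⟨M, hM⟩ := key b
    obtain ⟨K, hK⟩ := key (a + b)
    rw [hN (N + M + K) (by omega), hM (N + M + K) (by omega), hK (N + M + K) (by omega)]
    simp [Finset.sum_add_distrib]
  · obtain ⟨N, hN⟩ := key a
    obtain ⟨K, hK⟩ := key (r • a)
    rw [hN (N + K) (by omega), hK (N + K) (by omega)]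
    simp [Finset.smul_sum]

/-- A map `u` which is the counit on `H` has a right inverse for convolution, the geometric series
`∑ (1 - u) ^ n`: it is finite on every element, as `(1 - u) ^ n` vanishes on the elements of degree
less than `n`. -/
lemma exists_right_inverse {u : WithConv (R.HPre →ₗ[k] A)}
    (hu : ∀ a, u.ofConv ((R.action R.serreParam_zero).inr a) =
      algebraMap k A (counit (R := k) a)) :
    ∃ s : WithConv (R.HPre →ₗ[k] A), u * s = 1 ∧ ∀ a,
      s.ofConv ((R.action R.serreParam_zero).inr a) = algebraMap k A (counit (R := k) a) := by
  have hone : ∀ a, (1 : WithConv (R.HPre →ₗ[k] A)).ofConv ((R.action R.serreParam_zero).inr a) =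
      algebraMap k A (counit (R := k) a) := fun a => by
    rw [← R.preCounit_inr]
    rfl
  have hf : R.VanishLT (1 - u).ofConv 1 := vanishLT_one fun a => by
    rw [WithConv.ofConv_sub, LinearMap.sub_apply, hone, hu, sub_self]
  have hP : ∀ n, R.VanishLT ((1 - u) ^ n).ofConv n := by
    intro n
    induction n with
    | zero =>
      intro e he a
      rw [(Submodule.mem_bot k).1 he, zero_mul, map_zero]
    | succ n ih =>
      rw [pow_succ']
      exact hf.conv ih
  obtain ⟨s, hs⟩ := exists_locally_finite_sum hP
  refine ⟨WithConv.toConv s, ?_, fun a => ?_⟩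
  · apply WithConv.ext
    refine LinearMap.ext fun z => ?_
    have h1 : ∀ w : R.HPre ⊗[k] R.HPre, ∃ N, ∀ n, N ≤ n →
        LinearMap.mul' k A (TensorProduct.map u.ofConv s w) = LinearMap.mul' k A
          (TensorProduct.map u.ofConv (∑ j ∈ Finset.range n, (1 - u) ^ j).ofConv w) := by
      intro w
      induction w using TensorProduct.induction_on with
      | zero => exact ⟨0, fun n _ => by simp⟩
      | add w w' hw hw' =>
        obtain ⟨N, hN⟩ := hw
        obtain ⟨M, hM⟩ := hw'
        refine ⟨N + M, fun n hn => ?_⟩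
        simp only [map_add]
        rw [hN n (by omega), hM n (by omega)]
      | tmul c d =>
        obtain ⟨N, hN⟩ := hs d
        refine ⟨N, fun n hn => ?_⟩
        simp [hN n hn]
    obtain ⟨N, hN⟩ := h1 (R.preComul z)
    obtain ⟨M, hM⟩ := eventually_eq_zero hP z
    rw [conv_apply_eq]
    refine (hN (N + M) (by omega)).trans ?_
    rw [← conv_apply_eq]
    have h2 := mul_neg_geom_sum (1 - u) (N + M)
    rw [sub_sub_cancel] at h2
    rw [h2, WithConv.ofConv_sub, LinearMap.sub_apply, hM _ (by omega), sub_zero]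
  · obtain ⟨N, hN⟩ := hs ((R.action R.serreParam_zero).inr a)
    rw [hN (N + 1) (by omega), Finset.sum_range_succ', Finset.sum_eq_zero, pow_zero, zero_add, hone]
    exact fun j _ => (hP (j + 1)).inr a

/-- A linear map on `𝓗'` which is the counit on `H` is invertible for convolution. -/
lemma isUnit_of_inr {u : WithConv (R.HPre →ₗ[k] A)}
    (hu : ∀ a, u.ofConv ((R.action R.serreParam_zero).inr a) =
      algebraMap k A (counit (R := k) a)) : IsUnit u := by
  obtain ⟨s, hs, h⟩ := exists_right_inverse hu
  obtain ⟨t, ht, -⟩ := exists_right_inverse h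
  have e : u = t := by rw [← mul_one u, ← ht, ← mul_assoc, hs, one_mul]
  exact ⟨⟨u, s, hs, e ▸ ht⟩, rfl⟩

/-- A linear map `γ` on `𝓗'` whose restriction `j` to `H` is an algebra map is invertible for
convolution: `γ * η` and `η * γ` are the counit on `H`, where `η` is `j ∘ S` after the projection
`𝓗' → H`. -/
theorem isUnit_of_inr_algHom {γ : WithConv (R.HPre →ₗ[k] A)} (j : H →ₐ[k] A)
    (hγ : ∀ a, γ.ofConv ((R.action R.serreParam_zero).inr a) = j a) : IsUnit γ := by
  let π : R.HPre →ₗ[k] H := (TensorProduct.lid k H).toLinearMap ∘ₗ LinearMap.rTensor H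
    (EAlg.lift (q := q) (B := k) (fun _ => 0) (by simp [y11112, brBracket])
      (by simp [y122, brBracket])).toLinearMap
  have hπ : ∀ a, π ((R.action R.serreParam_zero).inr a) = a := by
    intro a
    change TensorProduct.lid k H (LinearMap.rTensor H _ ((1 : EAlg q (0 : k) 0) ⊗ₜ[k] a)) = a
    simp
  let η : WithConv (R.HPre →ₗ[k] A) := WithConv.toConv (j.toLinearMap ∘ₗ
    HopfAlgebra.antipode k ∘ₗ π)
  have e1 : γ.ofConv ∘ₗ (R.action R.serreParam_zero).inr.toLinearMap = j.toLinearMap :=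
    LinearMap.ext hγ
  have e2 : η.ofConv ∘ₗ (R.action R.serreParam_zero).inr.toLinearMap =
      j.toLinearMap ∘ₗ HopfAlgebra.antipode k := LinearMap.ext fun a => by
    simp [η, hπ]
  have hj : ∀ w : H ⊗[k] H, LinearMap.mul' k A (TensorProduct.map j.toLinearMap j.toLinearMap w) =
      j (LinearMap.mul' k H w) := by
    intro w
    induction w using TensorProduct.induction_on with
    | zero => simp
    | add z z' hz hz' => simp only [map_add, hz, hz']
    | tmul c d => simp
  have h1 : IsUnit (γ * η) := isUnit_of_inr fun a => by
    rw [conv_inr, e1, e2, ← LinearMap.comp_id j.toLinearMap, LinearMap.comp_assoc,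
      TensorProduct.map_comp, LinearMap.comp_apply, hj, LinearMap.id_comp]
    have := HopfAlgebra.mul_antipode_lTensor_comul_apply (R := k) a
    rw [LinearMap.lTensor] at this
    rw [this, AlgHom.commutes]
  have h2 : IsUnit (η * γ) := isUnit_of_inr fun a => by
    rw [conv_inr, e1, e2]
    nth_rewrite 2 [← LinearMap.comp_id j.toLinearMap]
    rw [TensorProduct.map_comp, LinearMap.comp_apply, hj]
    have := HopfAlgebra.mul_antipode_rTensor_comul_apply (R := k) a
    rw [LinearMap.rTensor] at this
    rw [this, AlgHom.commutes]
  obtain ⟨s, hs⟩ := h1.exists_right_inv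
  obtain ⟨t, ht⟩ := h2.exists_left_inv
  rw [mul_assoc] at hs
  rw [← mul_assoc] at ht
  exact ⟨⟨γ, η * s, hs, left_inv_eq_right_inv ht hs ▸ ht⟩, rfl⟩

end PrincipalRealization

/-! ### The section -/

namespace PrincipalRealization
variable {k H : Type*} [Field k] [Ring H] [HopfAlgebra k H] {q : k}
  (R : PrincipalRealization k H q) {l₁ l₂ : k} (hl : R.SerreParam l₁ l₂)

/-- The inverse of a bijective colinear map `a ↦ φ(a₍₀₎) a₍₁₎` is a section, for a suitable linear
form `φ`. -/
theorem exists_section : ∃ γ : R.HPre →ₗ[k] R.AAlg hl, R.IsSection hl γ ∧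
    ∀ α, γ (rootVec q R.x α ^ 7) = (R.action hl).inl (relVec q l₁ l₂ (gen q l₁ l₂) α) := by
  obtain ⟨φ, hφ, hrel⟩ := R.exists_augmentation hl
  let Φ : R.AAlg hl ≃ₗ[k] R.HPre := LinearEquiv.ofBijective _ hφ.cleave_bijective
  have hΦ : ∀ a, Φ a = R.cleave hl φ a := fun a => rfl
  have hγ : ∀ α, Φ.symm (rootVec q R.x α ^ 7) =
      (R.action hl).inl (relVec q l₁ l₂ (gen q l₁ l₂) α) := fun α => by
    rw [LinearEquiv.symm_apply_eq, hΦ, map_relVec, ← hrel α]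
    rfl
  have h1 : Φ.symm 1 = 1 := by rw [LinearEquiv.symm_apply_eq, hΦ, hφ.cleave_one]
  have hr : ∀ z h, Φ.symm (z * (R.action R.serreParam_zero).inr h) =
      Φ.symm z * (R.action hl).inr h := fun z h => by
    rw [LinearEquiv.symm_apply_eq, hΦ, hφ.cleave_mul_inr, ← hΦ, LinearEquiv.apply_symm_apply]
  have hu : IsUnit (WithConv.toConv (Φ.symm : R.HPre →ₗ[k] R.AAlg hl)) :=
    isUnit_of_inr_algHom (R.action hl).inr fun a => by
      have := hr 1 a
      rw [one_mul, h1, one_mul] at this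
      exact this
  refine ⟨Φ.symm, ⟨h1, fun h z => ?_, hr, ?_, ?_, fun α => ⟨_, (hγ α).symm⟩⟩, hγ⟩
  · change Φ.symm _ = _ * Φ.symm z
    rw [LinearEquiv.symm_apply_eq, hΦ, hφ.cleave_inr_mul, ← hΦ, LinearEquiv.apply_symm_apply]
  · refine LinearMap.ext fun z => ?_
    obtain ⟨a, rfl⟩ := Φ.surjective z
    simp only [LinearMap.comp_apply, LinearEquiv.coe_coe, LinearEquiv.symm_apply_apply,
      AlgHom.toLinearMap_apply]
    rw [hΦ, preComul_cleave, ← LinearMap.comp_apply, ← TensorProduct.map_comp, LinearMap.id_comp]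
    have e : (Φ.symm : R.HPre →ₗ[k] R.AAlg hl) ∘ₗ R.cleave hl φ = LinearMap.id :=
      LinearMap.ext fun a => Φ.symm_apply_apply a
    rw [e, TensorProduct.map_id, LinearMap.id_apply]
  · obtain ⟨s, hs⟩ := hu.exists_right_inv
    obtain ⟨t, ht⟩ := hu.exists_left_inv
    have e := left_inv_eq_right_inv ht hs
    rw [e] at ht
    exact ⟨s.ofConv, congrArg WithConv.ofConv hs, congrArg WithConv.ofConv ht⟩

end PrincipalRealization

/-! ### The algebras `𝓔(λ, μ)` and `𝓐(λ, μ)` -/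

section Equivariant
variable {k H E E' : Type*} [Field k] [Ring H] [HopfAlgebra k H] [Ring E] [Algebra k E]
  [Ring E'] [Algebra k E']

lemma HModuleAlgebra.map_act (S : HModuleAlgebra k H E) (S' : HModuleAlgebra k H E')
    (f : E →ₐ[k] E') {y : Fin 2 → E} (hy : Algebra.adjoin k (Set.range y) = ⊤)
    (h : ∀ a i, S'.act a (f (y i)) = f (S.act a (y i))) (a : H) (e : E) :
    S'.act a (f e) = f (S.act a e) := by
  have he : e ∈ Algebra.adjoin k (Set.range y) := hy ▸ Algebra.mem_top
  induction he using Algebra.adjoin_induction generalizing a with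
  | mem x hx => obtain ⟨i, rfl⟩ := hx; exact h a i
  | algebraMap r =>
    rw [AlgHom.commutes, Algebra.algebraMap_eq_smul_one, Algebra.algebraMap_eq_smul_one, map_smul,
      map_smul, map_smul, S.act_one, S'.act_one, AlgHom.commutes]
  | add b c _ _ hb hc => rw [map_add, map_add, map_add, map_add, hb, hc]
  | mul b c _ _ hb hc =>
    rw [map_mul, S.act_mul, S'.act_mul]
    induction comul (R := k) a using TensorProduct.induction_on with
    | zero => simp
    | add z z' hz hz' => simp only [map_add, hz, hz']
    | tmul u v => simp [hb, hc]

end Equivariant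

section Relations
variable {k A : Type*} [Field k] [Ring A] [Algebra k A]

lemma relVec_r112_iff {q l₁ l₂ m : k} {y : Fin 2 → A} :
    relVec q l₁ l₂ y .r112 = algebraMap k A m ↔ y112 q y ^ 7 = algebraMap k A m
        - ((8 * q + 9 * q ^ 2 + 3 * q ^ 3 + 4 * q ^ 4 + 5 * q ^ 5 - q ^ 6) * l₁ ^ 2) •
          (y12 q y ^ 3 * yBeta q y)
        - ((5 * q + 8 * q ^ 2 + 9 * q ^ 3 + 8 * q ^ 4 + 5 * q ^ 5) * l₁ ^ 2) •
          (y 1 * yBeta q y ^ 2)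
        + (7 * q ^ 3 * (1 + 2 * q + q ^ 2) * l₁ ^ 3) • (y 1 ^ 2 * y12 q y ^ 2)
        - ((2 * q + 4 * q ^ 2 + 13 * q ^ 3 + 22 * q ^ 4 + 17 * q ^ 5 + 5 * q ^ 6) * l₂ * l₁ ^ 3) •
          (y 1 * y12 q y) := by
  simp only [relVec]
  rw [neg_smul]
  constructor
  · intro h
    rw [← h]
    abel
  · intro h
    rw [h]
    abel

lemma relVec_rBeta_iff {q l₁ l₂ m : k} {y : Fin 2 → A} :
    relVec q l₁ l₂ y .rBeta = algebraMap k A m ↔ yBeta q y ^ 7 = algebraMap k A m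
        + ((210 * q + 224 * q ^ 2 + 238 * q ^ 3 + 105 * q ^ 4 + 462 * q ^ 5 + 231 * q ^ 6) *
            l₂ ^ 2 * l₁ ^ 3) • y12 q y ^ 7
        + ((833 * q + 1911 * q ^ 2 + 2352 * q ^ 3 + 1911 * q ^ 4 + 833 * q ^ 5) * l₂ * l₁ ^ 5) •
          y 1 ^ 7 := by
  simp only [relVec]
  rw [sub_eq_iff_eq_add, ← add_assoc (algebraMap k A m)]

end Relations

namespace PrincipalRealization
variable {k H : Type*} [Field k] [Ring H] [HopfAlgebra k H] {q : k}
  (R : PrincipalRealization k H q) {l₁ l₂ : k} (hl : R.SerreParam l₁ l₂)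

lemma wt_pow {E : Type*} [Ring E] [Algebra k E] (a : Fin 2 → ℕ) (u : E) (n : ℕ) :
    wt (R.χOf a) u ^ n = wt (R.χOf (n • a)) (u ^ n) := by
  induction n with
  | zero =>
    have e : R.χOf (0 • a) = 1 := by simp [χOf]
    rw [pow_zero, pow_zero, e, ← map_one (algebraMap k E), wt_one_algebraMap, map_one]
  | succ n ih => rw [pow_succ, ih, wt_mul, χOf_mul, pow_succ, succ_nsmul]

lemma rootVec_wt {E : Type*} [Ring E] [Algebra k E] (y : Fin 2 → E) (α : PosRoot) :
    rootVec q (fun i => wt (R.χ i) (y i)) α = wt (R.χOf α.deg) (rootVec q y α) := by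
  cases α <;> simp only [rootVec, yBeta, y1112, y112, y12, PosRoot.deg]
  · rw [R.χOf_zero_one.1]
  · rw [R.χOf_zero_one.1, R.χOf_zero_one.2, R.bracket_wt (e := ![1, 1]) _ _ _ _ _ _ (by simp),
      R.bracket_wt (e := ![2, 1]) _ _ _ _ _ _ (by simp),
      R.bracket_wt (e := ![3, 1]) _ _ _ _ _ _ (by simp)]
  · rw [R.χOf_zero_one.1, R.χOf_zero_one.2, R.bracket_wt (e := ![1, 1]) _ _ _ _ _ _ (by simp),
      R.bracket_wt (e := ![2, 1]) _ _ _ _ _ _ (by simp)]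
  · rw [R.χOf_zero_one.1, R.χOf_zero_one.2, R.bracket_wt (e := ![1, 1]) _ _ _ _ _ _ (by simp),
      R.bracket_wt (e := ![2, 1]) _ _ _ _ _ _ (by simp),
      R.bracket_wt (e := ![3, 2]) _ _ _ _ _ _ (by simp)]
  · rw [R.χOf_zero_one.1, R.χOf_zero_one.2, R.bracket_wt (e := ![1, 1]) _ _ _ _ _ _ (by simp)]
  · rw [R.χOf_zero_one.2]

lemma smul_wt {E : Type*} [Ring E] [Algebra k E] {χ ψ : WithConv (H →ₐ[k] k)} {c : k}
    (h : c ≠ 0 → χ = ψ) (u : E) : c • wt χ u = wt ψ (c • u) := by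
  by_cases hc : c = 0
  · rw [hc, zero_smul, zero_smul]
    apply WithConv.ext
    ext a
    simp [wt_apply]
  · rw [h hc, wt_smul]

lemma wt_add {E : Type*} [Ring E] [Algebra k E] (χ : WithConv (H →ₐ[k] k)) (u v : E) :
    wt χ (u + v) = wt χ u + wt χ v := by
  apply WithConv.ext
  ext a
  simp [wt_apply]

/-- The characters of the deforming terms agree when the parameters are nonzero. -/
lemma χOf_eq_of_param (hl : R.SerreParam l₁ l₂) {a b : Fin 2 → ℕ} (m n : ℕ) (hb : b = a + (m •
    ![4, 1] + n • ![1, 2]))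
    {c : k} (h : c ≠ 0 → (m ≠ 0 → l₁ ≠ 0) ∧ (n ≠ 0 → l₂ ≠ 0)) (hc : c ≠ 0) :
    R.χOf a = R.χOf b := by
  have e1 : R.χOf (m • ![4, 1]) = 1 := by
    by_cases hm : m = 0
    · simp [hm, χOf]
    · have : R.χOf ![4, 1] = 1 := by
        by_contra h'
        exact (h hc).1 hm (hl.1 (Or.inr h'))
      rw [← χOf_pow, this, one_pow]
  have e2 : R.χOf (n • ![1, 2]) = 1 := by
    by_cases hn : n = 0
    · simp [hn, χOf]
    · have : R.χOf ![1, 2] = 1 := by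
        by_contra h'
        exact (h hc).2 hn (hl.2 (Or.inr h'))
      rw [← χOf_pow, this, one_pow]
  rw [hb, ← χOf_mul, ← χOf_mul, e1, e2, mul_one, mul_one]

/-- The element `relVec` has the weight `χ_α ^ 7`. -/
lemma relVec_wt (hl : R.SerreParam l₁ l₂) {E : Type*} [Ring E] [Algebra k E] (y : Fin 2 → E) (α :
    PosRoot) :
    relVec q l₁ l₂ (fun i => wt (R.χ i) (y i)) α =
      wt (R.χOf α.deg ^ 7) (relVec q l₁ l₂ y α) := by
  have h1 := R.rootVec_wt y .r1
  have h2 := R.rootVec_wt y .r2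
  have h12 := R.rootVec_wt y .r12
  have h112 := R.rootVec_wt y .r112
  have h1112 := R.rootVec_wt y .r1112
  have hb := R.rootVec_wt y .rBeta
  simp only [rootVec, PosRoot.deg] at h1 h2 h12 h112 h1112 hb
  cases α <;> simp only [relVec, h1, h2, h12, h112, h1112, hb, wt_pow, χOf_pow, PosRoot.deg]
  · simp only [wt_mul, χOf_mul, wt_add]
    congr 1
    congr 1
    · exact smul_wt (R.χOf_eq_of_param hl 2 0 (by ext i; fin_cases i <;> rfl)
        (fun h => ⟨fun _ h' => h (by simp [h']), fun h' => absurd rfl h'⟩)) _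
    congr 1
    · exact smul_wt (R.χOf_eq_of_param hl 2 0 (by ext i; fin_cases i <;> rfl)
        (fun h => ⟨fun _ h' => h (by simp [h']), fun h' => absurd rfl h'⟩)) _
    congr 1
    · exact smul_wt (R.χOf_eq_of_param hl 3 0 (by ext i; fin_cases i <;> rfl)
        (fun h => ⟨fun _ h' => h (by simp [h']), fun h' => absurd rfl h'⟩)) _
    · exact smul_wt (R.χOf_eq_of_param hl 3 1 (by ext i; fin_cases i <;> rfl)
        (fun h => ⟨fun _ h' => h (by simp [h']), fun _ h' => h (by simp [h'])⟩)) _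
  · simp only [wt_sub, wt_add]
    congr 1
    congr 1
    · exact smul_wt (R.χOf_eq_of_param hl 3 2 (by ext i; fin_cases i <;> rfl)
        (fun h => ⟨fun _ h' => h (by simp [h']), fun _ h' => h (by simp [h'])⟩)) _
    · exact smul_wt (R.χOf_eq_of_param hl 5 1 (by ext i; fin_cases i <;> rfl)
        (fun h => ⟨fun _ h' => h (by simp [h']), fun _ h' => h (by simp [h'])⟩)) _

variable {γ : R.HPre →ₗ[k] R.AAlg hl}
  (hγ : ∀ α, γ (rootVec q R.x α ^ 7) = (R.action hl).inl (relVec q l₁ l₂ (gen q l₁ l₂) α))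
  (μ : PosRoot → k)

/-- The generators of `𝓔(λ, μ)`. -/
def genPow (γ : R.HPre →ₗ[k] R.AAlg hl) (μ : PosRoot → k) (i : Fin 2) : R.EPow hl γ μ :=
  RingQuot.mkAlgHom k (R.PowerRel hl γ μ) (gen q l₁ l₂ i)

lemma adjoin_genPow : Algebra.adjoin k (Set.range (R.genPow hl γ μ)) = ⊤ := by
  have : Set.range (R.genPow hl γ μ) =
      (RingQuot.mkAlgHom k (R.PowerRel hl γ μ)) '' Set.range (gen q l₁ l₂) := by
    rw [← Set.range_comp]; rfl
  rw [this, ← AlgHom.map_adjoin, adjoin_gen, Algebra.map_top, AlgHom.range_eq_top]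
  exact RingQuot.mkAlgHom_surjective k _

lemma genPow_serre1 : y11112 q (R.genPow hl γ μ) = algebraMap k _ l₁ := by
  have := congrArg (RingQuot.mkAlgHom k (R.PowerRel hl γ μ)) (gen_serre1 q l₁ l₂)
  exact (map_y11112 (A := EAlg q l₁ l₂) (B := R.EPow hl γ μ)
    (RingQuot.mkAlgHom k (R.PowerRel hl γ μ)) q _).symm.trans
    (this.trans (AlgHom.commutes _ _))

lemma genPow_serre2 : y122 q (R.genPow hl γ μ) = algebraMap k _ l₂ := by
  have := congrArg (RingQuot.mkAlgHom k (R.PowerRel hl γ μ)) (gen_serre2 q l₁ l₂)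
  exact (map_y122 (A := EAlg q l₁ l₂) (B := R.EPow hl γ μ)
    (RingQuot.mkAlgHom k (R.PowerRel hl γ μ)) q _).symm.trans
    (this.trans (AlgHom.commutes _ _))

variable {R hl}

lemma relVec_genPow
    (hγ : ∀ α, γ (rootVec q R.x α ^ 7) = (R.action hl).inl (relVec q l₁ l₂ (gen q l₁ l₂) α))
    (α : PosRoot) :
    relVec q l₁ l₂ (R.genPow hl γ μ) α = algebraMap k _ (μ α) := by
  have := RingQuot.mkAlgHom_rel k (PowerRel.power (μ := μ) α _ (hγ α).symm)
  exact (map_relVec (A := EAlg q l₁ l₂) (B := R.EPow hl γ μ)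
    (RingQuot.mkAlgHom k (R.PowerRel hl γ μ)) q _ _ _ _).symm.trans
    (this.trans (AlgHom.commutes _ _))

/-- Algebra maps out of `𝓔(λ, μ)`. -/
def liftPow {B : Type*} [Ring B] [Algebra k B]
    (hγ : ∀ α, γ (rootVec q R.x α ^ 7) = (R.action hl).inl (relVec q l₁ l₂ (gen q l₁ l₂) α))
    (y : Fin 2 → B)
    (h1 : y11112 q y = algebraMap k B l₁) (h2 : y122 q y = algebraMap k B l₂)
    (h3 : ∀ α, relVec q l₁ l₂ y α = algebraMap k B (μ α)) : R.EPow hl γ μ →ₐ[k] B :=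
  RingQuot.liftAlgHom k ⟨EAlg.lift y h1 h2, fun a b hab => by
    obtain ⟨α, a, ha⟩ := hab
    rw [hγ] at ha
    rw [HModuleAlgebra.inl_injective _ ha, AlgHom.commutes, ← h3, map_relVec]
    simp only [EAlg.lift_gen]⟩

lemma liftPow_gen {B : Type*} [Ring B] [Algebra k B] (y : Fin 2 → B)
    (h1 : y11112 q y = algebraMap k B l₁) (h2 : y122 q y = algebraMap k B l₂)
    (h3 : ∀ α, relVec q l₁ l₂ y α = algebraMap k B (μ α)) (i : Fin 2) :
    liftPow μ hγ y h1 h2 h3 (R.genPow hl γ μ i) = y i := by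
  rw [liftPow, genPow, RingQuot.liftAlgHom_mkAlgHom_apply, EAlg.lift_gen]

variable {μ} (hμ : R.PowerParam μ)

/-- The `H`-action on `𝓔(λ, μ)`. -/
def actionPow
    (hγ : ∀ α, γ (rootVec q R.x α ^ 7) = (R.action hl).inl (relVec q l₁ l₂ (gen q l₁ l₂) α))
    (hμ : R.PowerParam μ) : HModuleAlgebra k H (R.EPow hl γ μ) :=
  HModuleAlgebra.ofWeights R.χ (R.genPow hl γ μ) (R.adjoin_genPow hl μ)
    (liftPow μ hγ (fun i => wt (R.χ i) (R.genPow hl γ μ i))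
      (by rw [R.y11112_wt, genPow_serre1]; exact wt_param fun h => hl.1 (Or.inr h))
      (by rw [R.y122_wt, genPow_serre2]; exact wt_param fun h => hl.2 (Or.inr h))
      (fun α => by
        rw [R.relVec_wt hl, relVec_genPow μ hγ]
        exact wt_param fun h => hμ α (Or.inr h)))
    (fun i => liftPow_gen hγ μ _ _ _ _ i)

lemma actionPow_gen (h : H) (i : Fin 2) :
    (actionPow hγ hμ).act h (R.genPow hl γ μ i) = R.χ i h • R.genPow hl γ μ i :=
  HModuleAlgebra.ofWeights_act _ _ _ _ _ _ _

lemma actionPow_mkAlgHom (h : H) (a : EAlg q l₁ l₂) :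
    (actionPow hγ hμ).act h (RingQuot.mkAlgHom k (R.PowerRel hl γ μ) a) =
      RingQuot.mkAlgHom k (R.PowerRel hl γ μ) ((R.action hl).act h a) := by
  refine HModuleAlgebra.map_act _ _ _ (adjoin_gen q l₁ l₂) (fun h i => ?_) h a
  rw [action_gen, map_smul]
  exact actionPow_gen hγ hμ h i

end PrincipalRealization

/-! ### The presentation by generators and relations -/

lemma relations_map {k A B : Type*} [Field k] [Ring A] [Algebra k A] [Ring B] [Algebra k B]
    (f : A →ₐ[k] B) {q l₁ l₂ : k} {μ : PosRoot → k} {y : Fin 2 → A}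
    (h1 : y11112 q y = algebraMap k A l₁) (h2 : y122 q y = algebraMap k A l₂)
    (h3 : ∀ α, relVec q l₁ l₂ y α = algebraMap k A (μ α)) :
    y11112 q (fun i => f (y i)) = algebraMap k B l₁ ∧
      y122 q (fun i => f (y i)) = algebraMap k B l₂ ∧
      ∀ α, relVec q l₁ l₂ (fun i => f (y i)) α = algebraMap k B (μ α) := by
  rw [← map_y11112, ← map_y122, h1, h2]
  refine ⟨AlgHom.commutes _ _, AlgHom.commutes _ _, fun α => ?_⟩
  rw [← map_relVec, h3, AlgHom.commutes]

namespace PrincipalRealization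
variable {k H : Type*} [Field k] [Ring H] [HopfAlgebra k H] {q : k}
  (R : PrincipalRealization k H q) {l₁ l₂ : k} {hl : R.SerreParam l₁ l₂}
  {γ : R.HPre →ₗ[k] R.AAlg hl} {μ : PosRoot → k}

/-- The quotient of `T(V) # H` by the explicit relations. -/
abbrev Presented (l₁ l₂ : k) (μ : PosRoot → k) : Type _ := RingQuot (R.CleftRel l₁ l₂ μ)

/-- The generators `y_1`, `y_2` of the presented algebra. -/
def genPresented (l₁ l₂ : k) (μ : PosRoot → k) (i : Fin 2) : R.Presented l₁ l₂ μ :=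
  RingQuot.mkAlgHom k (R.CleftRel l₁ l₂ μ) (R.yT i)

/-- The map of `H` to the presented algebra. -/
def inrPresented (l₁ l₂ : k) (μ : PosRoot → k) : H →ₐ[k] R.Presented l₁ l₂ μ :=
  (RingQuot.mkAlgHom k (R.CleftRel l₁ l₂ μ)).comp R.tensorAction.inr

lemma tensorAction_ι (h : H) (i : Fin 2) :
    R.tensorAction.act h (FreeAlgebra.ι k i) = R.χ i h • FreeAlgebra.ι k i :=
  HModuleAlgebra.ofWeights_act _ _ _ _ _ _ _

/-- An algebra map out of `T(V) # H` factors through the presented algebra if and only if it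
satisfies the Serre relations and the relations `relVec = μ`. -/
lemma cleftRel_iff {B : Type*} [Ring B] [Algebra k B] (f : R.TH →ₐ[k] B) :
    (∀ a b, R.CleftRel l₁ l₂ μ a b → f a = f b) ↔
      y11112 q (fun i => f (R.yT i)) = algebraMap k B l₁ ∧
      y122 q (fun i => f (R.yT i)) = algebraMap k B l₂ ∧
      ∀ α, relVec q l₁ l₂ (fun i => f (R.yT i)) α = algebraMap k B (μ α) := by
  have h12 := map_rootVec f q R.yT .r12
  have h112 := map_rootVec f q R.yT .r112
  have h1112 := map_rootVec f q R.yT .r1112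
  have hb := map_rootVec f q R.yT .rBeta
  simp only [rootVec] at h12 h112 h1112 hb
  constructor
  · intro h
    refine ⟨?_, ?_, fun α => ?_⟩
    · have := h _ _ .serre1
      rwa [map_y11112, AlgHom.commutes] at this
    · have := h _ _ .serre2
      rwa [map_y122, AlgHom.commutes] at this
    · cases α with
      | r1 => have := h _ _ .pow1; rwa [map_pow, AlgHom.commutes] at this
      | r2 => have := h _ _ .pow2; rwa [map_pow, AlgHom.commutes] at this
      | r12 => have := h _ _ .pow12; rwa [map_pow, h12, AlgHom.commutes] at this
      | r1112 => have := h _ _ .pow1112; rwa [map_pow, h1112, AlgHom.commutes] at this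
      | r112 =>
        have := h _ _ .pow112
        simp only [map_pow, map_add, map_sub, map_smul, map_mul, AlgHom.commutes, h12, h112,
          hb] at this
        rw [relVec_r112_iff, this]
      | rBeta =>
        have := h _ _ .powBeta
        simp only [map_pow, map_add, map_smul, AlgHom.commutes, h12, hb] at this
        rw [relVec_rBeta_iff, this]
  · rintro ⟨h1, h2, h3⟩ a b hab
    cases hab with
    | serre1 => rw [map_y11112, AlgHom.commutes, h1]
    | serre2 => rw [map_y122, AlgHom.commutes, h2]
    | pow1 => rw [map_pow, AlgHom.commutes]; exact h3 .r1
    | pow2 => rw [map_pow, AlgHom.commutes]; exact h3 .r2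
    | pow12 => rw [map_pow, h12, AlgHom.commutes]; exact h3 .r12
    | pow1112 => rw [map_pow, h1112, AlgHom.commutes]; exact h3 .r1112
    | pow112 =>
      simp only [map_pow, map_add, map_sub, map_smul, map_mul, AlgHom.commutes, h12, h112, hb]
      exact relVec_r112_iff.1 (h3 .r112)
    | powBeta =>
      simp only [map_pow, map_add, map_smul, AlgHom.commutes, h12, hb]
      exact relVec_rBeta_iff.1 (h3 .rBeta)

variable {R}

/-- A smash product whose first factor satisfies the relations is the presented algebra, as soon as
its first factor maps to the presented algebra. -/
theorem exists_smash_equiv_presented {E : Type*} [Ring E] [Algebra k E] (S : HModuleAlgebra k H E)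
    {y : Fin 2 → E} (hy : Algebra.adjoin k (Set.range y) = ⊤)
    (hS : ∀ h i, S.act h (y i) = R.χ i h • y i)
    (h1 : y11112 q y = algebraMap k E l₁) (h2 : y122 q y = algebraMap k E l₂)
    (h3 : ∀ α, relVec q l₁ l₂ y α = algebraMap k E (μ α))
    (F : E →ₐ[k] R.Presented l₁ l₂ μ) (hF : ∀ i, F (y i) = R.genPresented l₁ l₂ μ i) :
    ∃ e : S.Smash ≃ₐ[k] R.Presented l₁ l₂ μ, (∀ i, e (S.inl (y i)) = R.genPresented l₁ l₂ μ i) ∧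
      ∀ h, e (S.inr h) = R.inrPresented l₁ l₂ μ h := by
  let f : S.Smash →ₐ[k] R.Presented l₁ l₂ μ := S.lift F (R.inrPresented l₁ l₂ μ)
    (HModuleAlgebra.compat_of_gen _ _ _ _ hy fun i => by
      rw [HModuleAlgebra.compat_iff _ _ _ (fun h => hS h i)]
      intro h
      have := congrArg (RingQuot.mkAlgHom k (R.CleftRel l₁ l₂ μ))
        (HModuleAlgebra.inr_mul_inl_of_weight _ (fun h => R.tensorAction_ι h i) h)
      rw [map_mul, map_mul] at this
      rw [hF]
      exact this)
  have f_y : ∀ i, f (S.inl (y i)) = R.genPresented l₁ l₂ μ i :=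
    fun i => (HModuleAlgebra.lift_inl _ _ _ _ _).trans (hF i)
  have f_h : ∀ h, f (S.inr h) = R.inrPresented l₁ l₂ μ h :=
    fun h => HModuleAlgebra.lift_inr _ _ _ _ _
  let g₀ : R.TH →ₐ[k] S.Smash := R.tensorAction.lift (FreeAlgebra.lift k fun i => S.inl (y i)) S.inr
    (HModuleAlgebra.compat_of_gen _ _ _ _ (FreeAlgebra.adjoin_range_ι _ _) fun i => by
      rw [HModuleAlgebra.compat_iff _ _ _ (fun h => R.tensorAction_ι h i)]
      intro h
      rw [FreeAlgebra.lift_ι_apply]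
      exact HModuleAlgebra.inr_mul_inl_of_weight _ (fun h => hS h i) h)
  have g₀_y : ∀ i, g₀ (R.yT i) = S.inl (y i) :=
    fun i => (HModuleAlgebra.lift_inl _ _ _ _ _).trans (FreeAlgebra.lift_ι_apply _ _)
  have g₀_h : ∀ h, g₀ (R.tensorAction.inr h) = S.inr h :=
    fun h => HModuleAlgebra.lift_inr _ _ _ _ _
  have hg₀ : ∀ a b, R.CleftRel l₁ l₂ μ a b → g₀ a = g₀ b := by
    rw [cleftRel_iff, funext g₀_y]
    exact relations_map S.inl h1 h2 h3
  let g : R.Presented l₁ l₂ μ →ₐ[k] S.Smash :=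
    RingQuot.liftAlgHom k ⟨g₀, fun a b hab => hg₀ a b hab⟩
  have g_y : ∀ i, g (R.genPresented l₁ l₂ μ i) = S.inl (y i) :=
    fun i => (RingQuot.liftAlgHom_mkAlgHom_apply _ _ _ _).trans (g₀_y i)
  have g_h : ∀ h, g (R.inrPresented l₁ l₂ μ h) = S.inr h :=
    fun h => (RingQuot.liftAlgHom_mkAlgHom_apply _ _ _ _).trans (g₀_h h)
  have fg : f.comp g = AlgHom.id k _ := by
    refine RingQuot.ringQuot_ext' k _ _ ?_
    refine HModuleAlgebra.smash_hom_ext _ (FreeAlgebra.hom_ext (funext fun i => ?_))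
      (AlgHom.ext fun h => ?_)
    · change f (g (R.genPresented l₁ l₂ μ i)) = R.genPresented l₁ l₂ μ i
      rw [g_y, f_y]
    · change f (g (R.inrPresented l₁ l₂ μ h)) = R.inrPresented l₁ l₂ μ h
      rw [g_h, f_h]
  have gf : g.comp f = AlgHom.id k _ := by
    refine HModuleAlgebra.smash_hom_ext _ (AlgHom.ext_of_adjoin_eq_top hy ?_)
      (AlgHom.ext fun h => ?_)
    · rintro _ ⟨i, rfl⟩
      change g (f (S.inl (y i))) = S.inl (y i)
      rw [f_y, g_y]
    · change g (f (S.inr h)) = S.inr h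
      rw [f_h, g_h]
  exact ⟨AlgEquiv.ofAlgHom f g fg gf, f_y, f_h⟩

/-- The cleft object `𝓐(λ, μ) = 𝓔(λ, μ) # H` has the presentation by the explicit relations. -/
theorem exists_equiv_presented
    (hγ : ∀ α, γ (rootVec q R.x α ^ 7) = (R.action hl).inl (relVec q l₁ l₂ (gen q l₁ l₂) α))
    (hμ : R.PowerParam μ) : ∃ e : (actionPow hγ hμ).Smash ≃ₐ[k] R.Presented l₁ l₂ μ,
      (∀ i, e ((actionPow hγ hμ).inl (R.genPow hl γ μ i)) = R.genPresented l₁ l₂ μ i) ∧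
      ∀ h, e ((actionPow hγ hμ).inr h) = R.inrPresented l₁ l₂ μ h := by
  obtain ⟨s1, s2, s3⟩ : y11112 q (R.genPresented l₁ l₂ μ) = algebraMap k _ l₁ ∧
      y122 q (R.genPresented l₁ l₂ μ) = algebraMap k _ l₂ ∧
      ∀ α, relVec q l₁ l₂ (R.genPresented l₁ l₂ μ) α = algebraMap k _ (μ α) :=
    (R.cleftRel_iff (RingQuot.mkAlgHom k (R.CleftRel l₁ l₂ μ))).1
      fun a b hab => RingQuot.mkAlgHom_rel k hab
  exact exists_smash_equiv_presented _ (R.adjoin_genPow hl μ) (actionPow_gen hγ hμ)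
    (R.genPow_serre1 hl μ) (R.genPow_serre2 hl μ) (relVec_genPow μ hγ)
    (liftPow μ hγ (R.genPresented l₁ l₂ μ) s1 s2 s3) (liftPow_gen hγ μ _ s1 s2 s3)

end PrincipalRealization

end CleftG2
end

theorem mainTheorem7 {k : Type*} [Field k] [IsAlgClosed k] [CharZero k]
    {H : Type*} [Ring H] [HopfAlgebra k H] (hH : CleftG2.IsCosemisimple k H)
    {q : k} (R : CleftG2.PrincipalRealization k H q)
    {l₁ l₂ : k} (hl : R.SerreParam l₁ l₂) :
    ∃ γ : R.HPre →ₗ[k] R.AAlg hl, R.IsSection hl γ ∧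
      ∀ μ : CleftG2.PosRoot → k, R.PowerParam μ →
        ∃ S : CleftG2.HModuleAlgebra k H (R.EPow hl γ μ),
          (∀ (h : H) (a : CleftG2.EAlg q l₁ l₂),
            S.act h (RingQuot.mkAlgHom k (R.PowerRel hl γ μ) a) =
              RingQuot.mkAlgHom k (R.PowerRel hl γ μ) ((R.action hl).act h a)) ∧
          ∃ e : S.Smash ≃ₐ[k] RingQuot (R.CleftRel l₁ l₂ μ),
            (∀ i : Fin 2,
              e (S.inl (RingQuot.mkAlgHom k (R.PowerRel hl γ μ) (CleftG2.gen q l₁ l₂ i))) =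
                RingQuot.mkAlgHom k (R.CleftRel l₁ l₂ μ) (R.yT i)) ∧
            (∀ h : H,
              e (S.inr h) = RingQuot.mkAlgHom k (R.CleftRel l₁ l₂ μ) (R.tensorAction.inr h)) := by
  obtain ⟨γ, hγ, hrel⟩ := R.exists_section hl
  refine ⟨γ, hγ, fun μ hμ => ⟨CleftG2.PrincipalRealization.actionPow hrel hμ,
    CleftG2.PrincipalRealization.actionPow_mkAlgHom hrel hμ, ?_⟩⟩
  exact CleftG2.PrincipalRealization.exists_equiv_presented hrel hμ
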